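/- **Setting.** Let $M$ be a smooth 4-manifold with a smooth pseudo-Riemannian metric $g$, and let $\mathcal G_2$ be a 2-dimensional Abelian Lie algebra of Killing vector fields of $g$ (not necessarily all Killing fields of $g$). Let $\Xi$ be the distribution spanned by $\mathcal G_2$ and $\Xi^\perp$ its orthogonal distribution. The *Killing leaves* are the integral manifolds of $\Xi$; they are assumed to be surfaces, and *non-null* means that $g$ restricted to $\Xi$ is nondegenerate at every point. *Adapted coordinates* are local coordinates $(t_1,t_2,z_1,z_2)$ in which $\partial_{z_1},\partial_{z_2}$ form a basis of $\mathcal G_2$; there $g=b_{ij}\,dt_i\,dt_j+2f_{ik}\,dt_i\,dz_k+h_{kl}\,dz_k\,dz_l$ with components depending only on $(t_1,t_2)$, and the *orbit metric* is $\tilde g=\tilde g_{ij}\,dt_i\,dt_j$, where $\tilde g_{ij}=b_{ij}-f_{ik}f_{jl}h^{kl}$ and $(h^{kl})=(h_{kl})^{-1}$. Intrinsically, $\tilde g$ is the metric induced on the orbit space by the restriction of $g$ to $\Xi^\perp$. The *curvature vector* $\mathcal C$ is, up to a sign depending on the orientation, the $\Xi$-component of $[Y_1,Y_2]$ divided by $\sqrt{|\det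 g(Y_i,Y_j)|}$, for any local frame $Y_1,Y_2$ of $\Xi^\perp$. The leaves are *orthogonally intransitive* if $\mathcal C\neq 0$ everywhere. A smooth vector field $X$ and a constant $\Lambda\in\mathbb R$ make $(M,g)$ a *Ricci soliton* if $\mathrm{Ric}(g)+\tfrac12 L_Xg=\Lambda g$; it is expanding, steady or shrinking if $\Lambda<0$, $\Lambda=0$ or $\Lambda>0$. **Hypotheses (Case I).** $(M,g,X,\Lambda)$ is a Ricci soliton with $\mathcal G_2$ as above, with non-null and orthogonally intransitive Killing leaves, the orbit metric is nowhere negative definite, and 1. $g(\mathcal C,\mathcal C)=0$ everywhere; 2. $\mathcal G_2$ contains a nonzero field $\xi_{(2)}$ that is null everywhere; 3. $X$ is tangent to the Killing leaves and is a symmetry of $\Xi^\perp$ (the bracket of $X$ with any local section of $\Xi^\perp$ is a section of $\Xi^\perp$); 4. for some choice of $\xi_{(2)}$ as in 2, $\mathcal C$ is at no point a multiple of $\xi_{(2)}$. (In adapted coordinates with $\partial_{z_2}=\xi_{(2)}$ and $\Xi^\perp$ spanned by $\partial_{t_1}-f_1^1\partial_{z_1}-f_1^2\partial_{z_2}$ and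 $\partial_{t_2}$, this is the condition $f^1_{1,t_2}\neq0$.) **Theorem.** (a) Every point of $M$ has a neighbourhood with adapted coordinates $(t_1,t_2,z_1,z_2)$ in which, for some $\varepsilon_0=\pm1$, some constants $c,a_1,a_2\in\mathbb R$, some smooth $P=P(t_1,t_2)$ and some smooth antiderivative $F=\int e^{-2P}dt_2$ (that is, $F=F(t_1,t_2)$ with $F_{,t_2}=e^{-2P}$), $$g=e^{-2P}(dt_1^2+\varepsilon_0\,dt_2^2)-2F\,(c\,dt_1dz_1-dt_1dz_2)-2c\,dz_1^2+2\,dz_1dz_2,$$ $$X=\Big(\tfrac{\varepsilon_0c}{2}z_1-\tfrac{\varepsilon_0}{2}z_2+a_1\Big)\partial_{z_1}+\Big(\big(\tfrac{\varepsilon_0c^2}{2}-2\Lambda c\big)z_1+\big(2\Lambda-\tfrac{\varepsilon_0c}{2}\big)z_2+a_2\Big)\partial_{z_2},$$ $$P_{,t_1t_1}+\varepsilon_0P_{,t_2t_2}=\Lambda e^{-2P}.$$ In these coordinates the orbit metric is $\tilde g=e^{-2P}(dt_1^2+\varepsilon_0\,dt_2^2)$, and it has constant Gauss curvature $\Lambda$.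 (b) Conversely, the data are arbitrary: for all $\Lambda,c,a_1,a_2\in\mathbb R$ and $\varepsilon_0=\pm1$, every nonempty open $U\subseteq\mathbb R^4$, and all smooth $P,F$ on the projection of $U$ to the $(t_1,t_2)$-plane that satisfy the Liouville equation and $F_{,t_2}=e^{-2P}$, the formulas in (a) define on $U$ a Ricci soliton with constant $\Lambda$ that satisfies all hypotheses of Case I, with $\mathcal G_2=\langle\partial_{z_1},\partial_{z_2}\rangle$. (c) For every $\Lambda\in\mathbb R$ and each sign $\varepsilon_0=\pm1$ there is a Ricci soliton with constant $\Lambda$ on a nonempty open subset of $\mathbb R^4$ that satisfies the hypotheses of Case I and is in the normal form of (a) with that $\varepsilon_0$. In particular, such solitons can be expanding, steady or shrinking. -/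

import Mathlib

open scoped Manifold ContDiff

noncomputable section

/-! ## Tensor calculus in coordinates -/

namespace Coord

variable {n : ℕ}

/-- The partial derivative of `f` in the direction of the `i`-th coordinate. -/
def pd (i : Fin n) (f : EuclideanSpace ℝ (Fin n) → ℝ) (x : EuclideanSpace ℝ (Fin n)) : ℝ :=
  fderiv ℝ f x (EuclideanSpace.single i 1)

/-- The Christoffel symbol `Γ^k_{ij}` of the metric with component matrix `G`. -/
def christoffel (G : EuclideanSpace ℝ (Fin n) → Matrix (Fin n) (Fin n) ℝ) (k i j : Fin n)
    (x : EuclideanSpace ℝ (Fin n)) : ℝ :=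
  (1 / 2) * ∑ l, (G x)⁻¹ k l *
    (pd i (fun y => G y j l) x + pd j (fun y => G y i l) x - pd l (fun y => G y i j) x)

/-- The component `R^l_{kij}` of the curvature tensor, `R(∂_i, ∂_j) ∂_k = R^l_{kij} ∂_l`. -/
def riemann (G : EuclideanSpace ℝ (Fin n) → Matrix (Fin n) (Fin n) ℝ) (l k i j : Fin n)
    (x : EuclideanSpace ℝ (Fin n)) : ℝ :=
  pd i (christoffel G l j k) x - pd j (christoffel G l i k) x
    + ∑ m, (christoffel G l i m x * christoffel G m j k x
      - christoffel G l j m x * christoffel G m i k x)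

/-- The component `Ric_{kj} = R^i_{kij}` of the Ricci tensor. -/
def ricci (G : EuclideanSpace ℝ (Fin n) → Matrix (Fin n) (Fin n) ℝ) (k j : Fin n)
    (x : EuclideanSpace ℝ (Fin n)) : ℝ :=
  ∑ i, riemann G i k i j x

/-- The component `(L_X g)_{ij} = X^k ∂_k g_{ij} + g_{kj} ∂_i X^k + g_{ik} ∂_j X^k`. -/
def lieDerivMetric (G : EuclideanSpace ℝ (Fin n) → Matrix (Fin n) (Fin n) ℝ)
    (X : EuclideanSpace ℝ (Fin n) → EuclideanSpace ℝ (Fin n)) (i j : Fin n)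
    (x : EuclideanSpace ℝ (Fin n)) : ℝ :=
  ∑ k, (X x k * pd k (fun y => G y i j) x + G x k j * pd i (fun y => X y k) x
    + G x i k * pd j (fun y => X y k) x)

/-- The Gauss curvature `g(R(∂_1, ∂_2) ∂_2, ∂_1) / det g` of a metric in two dimensions. -/
def gaussCurvature (G : EuclideanSpace ℝ (Fin 2) → Matrix (Fin 2) (Fin 2) ℝ)
    (x : EuclideanSpace ℝ (Fin 2)) : ℝ :=
  (∑ l, G x 0 l * riemann G l 1 0 1 x) / (G x).det

end Coord

/-! ## Pseudo-Riemannian 4-manifolds and Ricci solitons -/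

/-- The model space of 4-manifolds. -/
abbrev E4 : Type := EuclideanSpace ℝ (Fin 4)

/-- The space of the parameters `(t₁, t₂)`. -/
abbrev E2 : Type := EuclideanSpace ℝ (Fin 2)

namespace Soliton

variable {M : Type*} [TopologicalSpace M] [ChartedSpace E4 M]

/-- (Not necessarily continuous) vector fields on `M`. -/
abbrev VField (M : Type*) [TopologicalSpace M] [ChartedSpace E4 M] : Type _ :=
  ∀ p : M, TangentSpace (𝓡 4) p

/-- The matrix of components, in the chart `φ`, of a field `g` of bilinear forms. -/
def formInChart (g : ∀ p : M, LinearMap.BilinForm ℝ (TangentSpace (𝓡 4) p))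
    (φ : OpenPartialHomeomorph M E4) (y : E4) : Matrix (Fin 4) (Fin 4) ℝ :=
  Matrix.of fun i j => g (φ.symm y)
    (mfderiv (𝓡 4) (𝓡 4) φ.symm y (EuclideanSpace.single i (1 : ℝ) : E4))
    (mfderiv (𝓡 4) (𝓡 4) φ.symm y (EuclideanSpace.single j (1 : ℝ) : E4))

/-- The components, in the chart `φ`, of the vector field `X`. -/
def fieldInChart (X : VField M) (φ : OpenPartialHomeomorph M E4) (y : E4) : E4 :=
  (mfderiv (𝓡 4) (𝓡 4) φ (φ.symm y) (X (φ.symm y)) : E4)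

variable (M) in
/-- A smooth pseudo-Riemannian metric, of any signature, on the 4-manifold `M`. -/
structure PseudoMetric where
  form : ∀ p : M, LinearMap.BilinForm ℝ (TangentSpace (𝓡 4) p)
  symm : ∀ p v w, form p v w = form p w v
  nondegenerate : ∀ p v, (∀ w, form p v w = 0) → v = 0
  smooth : ∀ φ ∈ atlas E4 M, ∀ i j, ContDiffOn ℝ ∞ (fun y => formInChart form φ y i j) φ.target

/-- The matrix of components of the metric `g` in the chart `φ`. -/
def PseudoMetric.inChart (g : PseudoMetric M) (φ : OpenPartialHomeomorph M E4) :
    E4 → Matrix (Fin 4) (Fin 4) ℝ :=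
  formInChart g.form φ

variable [IsManifold (𝓡 4) ∞ M]

/-- `Y` is smooth on the set `V`. -/
def SmoothOn (Y : VField M) (V : Set M) : Prop :=
  ContMDiffOn (𝓡 4) (𝓡 4).tangent ∞ (fun q => (⟨q, Y q⟩ : TangentBundle (𝓡 4) M)) V

/-- `ξ` is a (smooth) Killing field: `L_ξ g = 0`, an identity between tensors, which is written
out in the charts of the atlas. -/
def IsKilling (g : PseudoMetric M) (ξ : VField M) : Prop :=
  SmoothOn ξ Set.univ ∧ ∀ φ ∈ atlas E4 M, ∀ y ∈ φ.target, ∀ i j,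
    Coord.lieDerivMetric (g.inChart φ) (fieldInChart ξ φ) i j y = 0

/-- The Ricci soliton equation `Ric(g) + ½ L_X g = Λ g`, for a smooth vector field `X`; the
identity between tensors is written out in the charts of the atlas. -/
def IsRicciSoliton (g : PseudoMetric M) (X : VField M) (Λ : ℝ) : Prop :=
  SmoothOn X Set.univ ∧ ∀ φ ∈ atlas E4 M, ∀ y ∈ φ.target, ∀ i j,
    Coord.ricci (g.inChart φ) i j y
      + (1 / 2) * Coord.lieDerivMetric (g.inChart φ) (fieldInChart X φ) i j y
      = Λ * g.inChart φ y i j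

/-! ## Two-dimensional Abelian Killing algebras -/

/-- `𝒢` is a two-dimensional Abelian Lie algebra of Killing fields of `g`. -/
structure IsAbelianKillingAlgebra (g : PseudoMetric M) (𝒢 : Submodule ℝ (VField M)) : Prop where
  finrank_eq : Module.finrank ℝ 𝒢 = 2
  killing : ∀ ξ ∈ 𝒢, IsKilling g ξ
  abelian : ∀ ξ ∈ 𝒢, ∀ η ∈ 𝒢, ∀ p, VectorField.mlieBracket (𝓡 4) ξ η p = 0

/-- The distribution `Ξ` spanned by the fields in `𝒢`, at the point `p`. -/
def leafSpace (𝒢 : Submodule ℝ (VField M)) (p : M) : Submodule ℝ (TangentSpace (𝓡 4) p) :=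
  𝒢.map (LinearMap.proj p)

/-- The distribution `Ξ^⊥` at the point `p`. -/
def horizontalSpace (g : PseudoMetric M) (𝒢 : Submodule ℝ (VField M)) (p : M) :
    Submodule ℝ (TangentSpace (𝓡 4) p) :=
  (g.form p).orthogonal (leafSpace 𝒢 p)

/-- The Killing leaves are surfaces on which the metric is nondegenerate (for a basis
`ξ₁, ξ₂` of `𝒢`: the determinant of `h_{kl} = g(ξ_k, ξ_l)` vanishes nowhere). -/
def NonNullLeaves (g : PseudoMetric M) (𝒢 : Submodule ℝ (VField M)) : Prop :=
  ∀ p, Module.finrank ℝ (leafSpace 𝒢 p) = 2 ∧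
    ∀ v ∈ leafSpace 𝒢 p, (∀ w ∈ leafSpace 𝒢 p, g.form p v w = 0) → v = 0

/-- `Y` is a section of `Ξ^⊥` over `V`. -/
def IsHorizontalOn (g : PseudoMetric M) (𝒢 : Submodule ℝ (VField M)) (Y : VField M)
    (V : Set M) : Prop :=
  ∀ q ∈ V, Y q ∈ horizontalSpace g 𝒢 q

/-- `C` is the value at `p` (which is determined up to the sign that depends on the orientation)
of the curvature vector field of the submersion defined by `𝒢`: for a local frame `Y₁, Y₂` of
`Ξ^⊥`, it is the `Ξ`-component of `[Y₁, Y₂]` divided by `√|det g(Y_i, Y_j)|`. For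
`Y_j = e_j = ∂_{t_j} - f_j^k ∂_{z_k}` in adapted coordinates one has
`[e₁, e₂] = (∂_{t₂} f_1^k - ∂_{t₁} f_2^k) ∂_{z_k}` and `g(e_i, e_j) = g̃_{ij}`. -/
def IsCurvatureVector (g : PseudoMetric M) (𝒢 : Submodule ℝ (VField M)) (p : M)
    (C : TangentSpace (𝓡 4) p) : Prop :=
  ∃ (V : Set M) (Y₁ Y₂ : VField M) (w : TangentSpace (𝓡 4) p),
    IsOpen V ∧ p ∈ V ∧ SmoothOn Y₁ V ∧ SmoothOn Y₂ V ∧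
    IsHorizontalOn g 𝒢 Y₁ V ∧ IsHorizontalOn g 𝒢 Y₂ V ∧
    (∀ q ∈ V, LinearIndependent ℝ ![Y₁ q, Y₂ q]) ∧
    w ∈ leafSpace 𝒢 p ∧
    VectorField.mlieBracket (𝓡 4) Y₁ Y₂ p - w ∈ horizontalSpace g 𝒢 p ∧
    C = (√|g.form p (Y₁ p) (Y₁ p) * g.form p (Y₂ p) (Y₂ p)
          - g.form p (Y₁ p) (Y₂ p) * g.form p (Y₂ p) (Y₁ p)|)⁻¹ • w

/-- Orthogonal intransitivity: the curvature vector field vanishes nowhere. -/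
def OrthogonallyIntransitive (g : PseudoMetric M) (𝒢 : Submodule ℝ (VField M)) : Prop :=
  ∀ p C, IsCurvatureVector g 𝒢 p C → C ≠ 0

/-- The curvature vector field is a null vector field. -/
def NullCurvatureVector (g : PseudoMetric M) (𝒢 : Submodule ℝ (VField M)) : Prop :=
  ∀ p C, IsCurvatureVector g 𝒢 p C → g.form p C C = 0

/-- `η` is a nonzero element of `𝒢` that is null everywhere. -/
def IsNullElement (g : PseudoMetric M) (𝒢 : Submodule ℝ (VField M)) (η : VField M) : Prop :=
  η ∈ 𝒢 ∧ η ≠ 0 ∧ ∀ p, g.form p (η p) (η p) = 0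

/-- `X` is tangent to the Killing leaves. -/
def TangentToLeaves (𝒢 : Submodule ℝ (VField M)) (X : VField M) : Prop :=
  ∀ p, X p ∈ leafSpace 𝒢 p

/-- `X` is a symmetry of `Ξ^⊥`: the bracket of `X` with every local section of `Ξ^⊥` is again
a section of `Ξ^⊥`. -/
def IsSymmetryOfHorizontal (g : PseudoMetric M) (𝒢 : Submodule ℝ (VField M))
    (X : VField M) : Prop :=
  ∀ (V : Set M) (Y : VField M), IsOpen V → SmoothOn Y V → IsHorizontalOn g 𝒢 Y V →
    IsHorizontalOn g 𝒢 (VectorField.mlieBracket (𝓡 4) X Y) V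

/-- The metric that `g` induces on the orbit space (that is, on `Ξ^⊥`) is nowhere negative
definite. -/
def OrbitMetricNotNegDef (g : PseudoMetric M) (𝒢 : Submodule ℝ (VField M)) : Prop :=
  ∀ p, ∃ v ∈ horizontalSpace g 𝒢 p, 0 < g.form p v v

/-- The Ricci solitons of the first case.

The last field is the condition `f^1_{1,t₂} ≠ 0`. Indeed, in adapted coordinates with
`∂_{z₂} = η` and `f_2^1 = f_2^2 = 0`, the curvature vector is
`(f^1_{1,t₂} ∂_{z₁} + f^2_{1,t₂} ∂_{z₂}) / √|det g̃|`, and the condition says that its component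
along `∂_{z₁}` does not vanish, i.e. that it is not a multiple of `η`. -/
structure IsCaseI (g : PseudoMetric M) (𝒢 : Submodule ℝ (VField M)) (X : VField M)
    (Λ : ℝ) : Prop where
  soliton : IsRicciSoliton g X Λ
  killingAlgebra : IsAbelianKillingAlgebra g 𝒢
  nonNull : NonNullLeaves g 𝒢
  intransitive : OrthogonallyIntransitive g 𝒢
  orbitMetric : OrbitMetricNotNegDef g 𝒢
  nullCurvature : NullCurvatureVector g 𝒢
  tangent : TangentToLeaves 𝒢 X
  symmetry : IsSymmetryOfHorizontal g 𝒢 X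
  nullElement : ∃ η, IsNullElement g 𝒢 η ∧
    ∀ p C, IsCurvatureVector g 𝒢 p C → C ∉ Submodule.span ℝ {η p}

/-! ## The normal form

Coordinates on `E4` are `(t₁, t₂, z₁, z₂)`, in this order. -/

/-- The projection `(t₁, t₂, z₁, z₂) ↦ (t₁, t₂)`. -/
def projT (y : E4) : E2 := !₂[y 0, y 1]

/-- The positions of `t₁, t₂`. -/
def tIdx : Fin 2 → Fin 4 := ![0, 1]

/-- The positions of `z₁, z₂`. -/
def zIdx : Fin 2 → Fin 4 := ![2, 3]

/-- The components `g̃_{ij} = b_{ij} - f_{ik} h^{kl} f_{jl}` of the orbit metric, for a metric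
with components `A = (b, f; fᵀ, h)` in adapted coordinates. -/
def orbitMetric (A : Matrix (Fin 4) (Fin 4) ℝ) : Matrix (Fin 2) (Fin 2) ℝ :=
  A.submatrix tIdx tIdx
    - A.submatrix tIdx zIdx * (A.submatrix zIdx zIdx)⁻¹ * A.submatrix zIdx tIdx

/-- The components of `e^{-2P} (dt₁² + ε dt₂²)`. -/
def conformalMetric (ε : ℝ) (P : E2 → ℝ) (t : E2) : Matrix (Fin 2) (Fin 2) ℝ :=
  !![Real.exp (-2 * P t), 0; 0, ε * Real.exp (-2 * P t)]

/-- The components of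
`e^{-2P} (dt₁² + ε dt₂²) - 2 F (c dt₁dz₁ - dt₁dz₂) - 2c dz₁² + 2 dz₁dz₂`. -/
def normalMetric (ε c : ℝ) (P F : E2 → ℝ) (y : E4) : Matrix (Fin 4) (Fin 4) ℝ :=
  !![Real.exp (-2 * P (projT y)), 0, -c * F (projT y), F (projT y);
     0, ε * Real.exp (-2 * P (projT y)), 0, 0;
     -c * F (projT y), 0, -2 * c, 1;
     F (projT y), 0, 1, 0]

/-- The soliton field, in terms of its components along `∂_{t₁}, ∂_{t₂}, ∂_{z₁}, ∂_{z₂}`. -/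
def normalField (Λ ε c a₁ a₂ : ℝ) (y : E4) : E4 :=
  !₂[0, 0,
    ε * c / 2 * y 2 - ε / 2 * y 3 + a₁,
    (ε * c ^ 2 / 2 - 2 * Λ * c) * y 2 + (2 * Λ - ε * c / 2) * y 3 + a₂]

/-- On the open set `D` of the plane, `P` is a smooth solution of the Liouville equation
`P_{t₁t₁} + ε P_{t₂t₂} = Λ e^{-2P}`, and `F` is smooth and an antiderivative `∫ e^{-2P} dt₂`. -/
structure IsLiouvillePair (Λ ε : ℝ) (D : Set E2) (P F : E2 → ℝ) : Prop where
  smooth_P : ContDiffOn ℝ ∞ P D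
  smooth_F : ContDiffOn ℝ ∞ F D
  antiderivative : ∀ t ∈ D, Coord.pd 1 F t = Real.exp (-2 * P t)
  liouville : ∀ t ∈ D, Coord.pd 0 (Coord.pd 0 P) t + ε * Coord.pd 1 (Coord.pd 1 P) t
    = Λ * Real.exp (-2 * P t)

/-- The chart `φ` gives adapted coordinates for `𝒢`: a basis of `𝒢` is `∂_{z₁}, ∂_{z₂}` in the
domain of `φ`. -/
def IsAdaptedChart (𝒢 : Submodule ℝ (VField M)) (φ : OpenPartialHomeomorph M E4) : Prop :=
  ∃ ξ₁ ξ₂ : VField M, 𝒢 = Submodule.span ℝ {ξ₁, ξ₂} ∧ ∀ y ∈ φ.target,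
    fieldInChart ξ₁ φ y = EuclideanSpace.single 2 1 ∧
    fieldInChart ξ₂ φ y = EuclideanSpace.single 3 1

/-- In the adapted coordinates given by `φ`, the metric and the soliton field have the normal
form with the constants `Λ, ε, c, a₁, a₂` and the functions `P, F`, and the orbit metric is
`e^{-2P} (dt₁² + ε dt₂²)` and has constant Gauss curvature `Λ`. -/
structure HasNormalForm (g : PseudoMetric M) (𝒢 : Submodule ℝ (VField M)) (X : VField M)
    (φ : OpenPartialHomeomorph M E4) (Λ ε c a₁ a₂ : ℝ) (P F : E2 → ℝ) : Prop where
  adapted : IsAdaptedChart 𝒢 φ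
  functions : IsLiouvillePair Λ ε (projT '' φ.target) P F
  metric : ∀ y ∈ φ.target, g.inChart φ y = normalMetric ε c P F y
  field : ∀ y ∈ φ.target, fieldInChart X φ y = normalField Λ ε c a₁ a₂ y
  orbit : ∀ y ∈ φ.target, orbitMetric (g.inChart φ y) = conformalMetric ε P (projT y)
  curvature : ∀ t ∈ projT '' φ.target, Coord.gaussCurvature (conformalMetric ε P) t = Λ

end Soliton

end

open scoped Manifold ContDiff Topology
open Set Filter

noncomputable section

namespace SmoothFlow

universe u

/-! ## The inverse function theorem -/

/-! Choose adapted coordinates in which `∂_{z₂}` is the null Killing field. The leaves then carry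
the null pair `E₂ = ∂_{z₁} - f ∂_{z₂}`, `E₃ = h⁻¹ ∂_{z₂}` with `g(E₂, E₃) = 1`, and `Ξ^⊥` has a
frame `E₀, E₁` invariant under `𝒢` and orthonormal up to the sign `ε`. The vertical part of `[E₀,
E₁]` is a null vector that is not a multiple of `E₃`, so `[E₀, E₁] = r₁ E₀ + r₂ E₁ + l E₂` with `l ≠
0`. This is the structure `IsNullFrameOn`; `IsCaseI.exists_nullFrame` produces it.

Since `X` is tangent to the leaves and a symmetry of `Ξ^⊥`, its components are constant along `E₀`
and `E₁`, hence along `[E₀, E₁]`, hence along `E₂`. So `L_X g` has entries only at the index pairs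
`(2,3)` and `(3,3)`, and the soliton equation can be read off entry by entry
(`IsNullFrameOn.soliton`). The entries `(0,2)`, `(1,2)` say that `f` is constant, and `(0,3)`,
`(1,3)` that `h² l` is. The entry `(3,3)` expresses a derivative of `X` by `h l²`; this derivative
is invariant, so `h l²` is constant too, and therefore so are `h` and `l`. The entry `(0,0)` says
that the orbit surface has curvature `Λ`, and `(2,3)`, `(3,3)` fix the linear part of `X`.

It remains to find coordinates. On a surface of curvature `Λ` take a solution `y` of `Hess y = -Λ y
g̃`. Its gradient and the rotated gradient commute, because the latter is a Killing field preserving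
`y`; they give conformal coordinates `t₁, t₂` with factor `|∇y|²`. The horizontal lifts of these two
fields do not commute: their bracket is a multiple of `E₂`. Adding to the first lift a multiple of
`E₂` that is linear in `t₂` repairs this, and that multiple is the antiderivative `F` of the normal
form. Instead of solving the overdetermined system for `y`, the values of `y`, of its two
derivatives and of `t₂` are made coordinates of a larger space; the curvature condition is then what
makes two vector fields there commute (`IsNullFrameOn.fderiv_prolongedField_comm`).
`IsNullFrameOn.exists_isothermal` and `IsNullFrameOn.exists_normal_param` draw the conclusions.

For the converse, the normal form has a null frame with `h = l = 1` and `f = -c`: the condition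
`F_{,t₂} = e^{-2P}` gives `l = 1`, and the Liouville equation is the curvature condition. The
entrywise computation is then read backwards (`IsNullFrameOn.soliton_of_eq`). Solutions for every
`Λ` come from `P = log (e^{t₁} + (Λ/4) e^{-t₁})`.

Two tools support this. Smooth local flows come from the inverse function theorem in a Banach space
of curves. The Ricci tensor is computed in an arbitrary moving frame from its connection
coefficients; a pushed-forward coordinate frame is a special case, which shows that the Ricci tensor
is a tensor and carries the soliton equation from the atlas to adapted charts. -/

/-- The inverse function theorem for smooth maps, with an inverse that is smooth on an open set. -/
theorem exists_smooth_local_inverse {E F : Type*} [NormedAddCommGroup E] [NormedSpace ℝ E]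
    [CompleteSpace E] [NormedAddCommGroup F] [NormedSpace ℝ F] {f : E → F} {U : Set E} {a : E}
    (hU : IsOpen U) (ha : a ∈ U) (hf : ContDiffOn ℝ ∞ f U) (f' : E ≃L[ℝ] F)
    (hf' : HasFDerivAt f (f' : E →L[ℝ] F) a) :
    ∃ e : OpenPartialHomeomorph E F, a ∈ e.source ∧ e.source ⊆ U ∧ (∀ x, e x = f x) ∧
      ContDiffOn ℝ ∞ e e.source ∧ ContDiffOn ℝ ∞ e.symm e.target := by
  have hfa : ContDiffAt ℝ ∞ f a := hf.contDiffAt (hU.mem_nhds ha)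
  set e₀ := hfa.toOpenPartialHomeomorph f hf' (by simp) with he₀
  -- Invertibility of the derivative is an open condition. Cutting the source down to the points
  -- where it holds makes the inverse smooth on its whole domain, not only at the image of `a`.
  have hR : IsOpen (range ((↑) : (E ≃L[ℝ] F) → E →L[ℝ] F)) := ContinuousLinearEquiv.isOpen
  have hcont : ContinuousOn (fderiv ℝ f) U := hf.continuousOn_fderiv_of_isOpen hU (by simp)
  have hV : IsOpen (U ∩ fderiv ℝ f ⁻¹' range ((↑) : (E ≃L[ℝ] F) → E →L[ℝ] F)) :=
    hcont.isOpen_inter_preimage hU hR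
  set V := U ∩ fderiv ℝ f ⁻¹' range ((↑) : (E ≃L[ℝ] F) → E →L[ℝ] F)
  have haV : a ∈ V := ⟨ha, f', hf'.fderiv.symm⟩
  have hs : ∀ x ∈ (e₀.restrOpen V hV).source, x ∈ V := fun x hx => by
    rw [OpenPartialHomeomorph.restrOpen_source] at hx; exact hx.2
  refine ⟨e₀.restrOpen V hV, ?_, fun x hx => (hs x hx).1, fun x => rfl, ?_, ?_⟩
  · rw [OpenPartialHomeomorph.restrOpen_source]
    exact ⟨hfa.mem_toOpenPartialHomeomorph_source hf' (by simp), haV⟩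
  · exact hf.mono fun x hx => (hs x hx).1
  · intro y hy
    have hx := (e₀.restrOpen V hV).map_target hy
    obtain ⟨hxU, g, hg⟩ := hs _ hx
    have hfx : ContDiffAt ℝ ∞ f _ := hf.contDiffAt (hU.mem_nhds hxU)
    refine ((e₀.restrOpen V hV).contDiffAt_symm (f₀' := g) hy ?_ hfx).contDiffWithinAt
    rw [hg]
    exact (hfx.differentiableAt (by simp)).hasFDerivAt

/-! ## Composition operators on spaces of continuous functions -/

section Composition

variable {K : Type*} [TopologicalSpace K] [CompactSpace K]

/-- Pointwise application of a bounded bilinear map. -/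
def applyCLM (K : Type*) [TopologicalSpace K] [CompactSpace K] {G E F : Type*}
    [NormedAddCommGroup G] [NormedSpace ℝ G]
    [NormedAddCommGroup E] [NormedSpace ℝ E] [NormedAddCommGroup F] [NormedSpace ℝ F]
    (B : G →L[ℝ] E →L[ℝ] F) : C(K, G) →L[ℝ] C(K, E) →L[ℝ] C(K, F) :=
  LinearMap.mkContinuous₂
    (LinearMap.mk₂ ℝ (fun (A : C(K, G)) (v : C(K, E)) =>
        (⟨fun k => B (A k) (v k), by fun_prop⟩ : C(K, F)))
      (fun A B v => by ext; simp) (fun c A v => by ext; simp)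
      (fun A v w => by ext; simp) (fun c A v => by ext; simp)) ‖B‖
    (fun A v => by
      refine (ContinuousMap.norm_le _ (by positivity)).2 fun k => ?_
      refine (B.le_opNorm₂ (A k) (v k)).trans ?_
      have h1 := A.norm_coe_le_norm k
      have h2 := v.norm_coe_le_norm k
      gcongr)

theorem lipschitz_of_hasCompactSupport {E F : Type*} [NormedAddCommGroup E] [NormedSpace ℝ E]
    [NormedAddCommGroup F] [NormedSpace ℝ F] {f : E → F} (hf : ContDiff ℝ 1 f)
    (hs : HasCompactSupport f) :
    ∃ C : ℝ, 0 ≤ C ∧ ∀ x y, ‖f y - f x‖ ≤ C * ‖y - x‖ := by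
  obtain ⟨K, hK⟩ := hf.lipschitzWith_of_hasCompactSupport hs (by simp)
  exact ⟨K, K.2, fun x y => by simpa [dist_eq_norm] using hK.dist_le_mul y x⟩

/-- The derivative is Lipschitz because it has compact support, and the mean value inequality bounds
the Taylor remainder. One constant serves all base points, which is what estimates in the sup norm
need. -/
theorem exists_bound_quadratic {E F : Type*} [NormedAddCommGroup E] [NormedSpace ℝ E]
    [NormedAddCommGroup F] [NormedSpace ℝ F] {f : E → F} (hf : ContDiff ℝ ∞ f)
    (hs : HasCompactSupport f) :
    ∃ C : ℝ, 0 ≤ C ∧ ∀ x y, ‖f y - f x - fderiv ℝ f x (y - x)‖ ≤ C * ‖y - x‖ ^ 2 := by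
  have hf1 : ContDiff ℝ ∞ (fderiv ℝ f) := hf.fderiv_right (by simp)
  have hs1 : HasCompactSupport (fderiv ℝ f) := hs.fderiv ℝ
  obtain ⟨C, hC0, hC⟩ := lipschitz_of_hasCompactSupport (f := fderiv ℝ f) (hf1.of_le (by simp)) hs1
  refine ⟨C, hC0, fun x y => ?_⟩
  have hd : Differentiable ℝ f := hf.differentiable (by simp)
  have hb : ∀ z ∈ Metric.closedBall x ‖y - x‖, ‖fderiv ℝ f z - fderiv ℝ f x‖ ≤ C * ‖y - x‖ :=
    fun z hz => (hC x z).trans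
      (mul_le_mul_of_nonneg_left (by rwa [← dist_eq_norm]) hC0)
  have h1 : x ∈ Metric.closedBall x ‖y - x‖ := Metric.mem_closedBall_self (norm_nonneg _)
  have h2 : y ∈ Metric.closedBall x ‖y - x‖ := by rw [Metric.mem_closedBall, dist_eq_norm]
  have := (convex_closedBall x ‖y - x‖).norm_image_sub_le_of_norm_fderiv_le' (𝕜 := ℝ)
    (fun w _ => hd w) hb h1 h2
  rwa [mul_assoc, ← sq] at this

/-- The uniform Taylor remainder of `f`, applied at every point of `K`, is a quadratic remainder in
the sup norm. -/
theorem hasFDerivAt_postcomp {G E F : Type*} [NormedAddCommGroup G] [NormedSpace ℝ G]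
    [NormedAddCommGroup E] [NormedSpace ℝ E] [NormedAddCommGroup F] [NormedSpace ℝ F]
    (B : G →L[ℝ] E →L[ℝ] F) (f : C(E, F)) (hf : ContDiff ℝ ∞ f)
    (hs : HasCompactSupport f) (f' : C(E, G)) (hf' : ∀ x, B (f' x) = fderiv ℝ f x)
    (γ : C(K, E)) :
    HasFDerivAt (fun γ : C(K, E) => f.comp γ) (applyCLM K B (f'.comp γ)) γ := by
  obtain ⟨C, hC0, hC⟩ := exists_bound_quadratic hf hs
  have key : HasFDerivAt (fun η : C(K, E) => f.comp η - f.comp γ - applyCLM K B (f'.comp γ) (η - γ))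
      (0 : C(K, E) →L[ℝ] C(K, F)) γ := by
    refine Asymptotics.IsBigO.hasFDerivAt (n := 2) ?_ (by norm_num)
    refine Asymptotics.IsBigO.of_bound C (Eventually.of_forall fun η => ?_)
    rw [ContinuousMap.norm_le _ (by positivity)]
    intro k
    have h1 : ‖(η - γ) k‖ ≤ ‖η - γ‖ := (η - γ).norm_coe_le_norm k
    calc _ = ‖f (η k) - f (γ k) - fderiv ℝ f (γ k) (η k - γ k)‖ := by rw [← hf']; rfl
      _ ≤ C * ‖η k - γ k‖ ^ 2 := hC _ _
      _ ≤ C * ‖‖η - γ‖ ^ 2‖ := by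
        rw [norm_pow, norm_norm]
        gcongr
        exact h1
  have h2 : HasFDerivAt (fun η : C(K, E) => f.comp γ + applyCLM K B (f'.comp γ) (η - γ))
      (applyCLM K B (f'.comp γ)) γ :=
    (((applyCLM K B (f'.comp γ)).hasFDerivAt).comp γ (hasFDerivAt_sub_const γ)).const_add _
  have h3 := key.add h2
  rw [zero_add] at h3
  refine h3.congr_of_eventuallyEq (Eventually.of_forall fun η => ?_)
  simp

theorem contDiff_postcomp_succ {G E F : Type*} [NormedAddCommGroup G] [NormedSpace ℝ G]
    [NormedAddCommGroup E] [NormedSpace ℝ E] [NormedAddCommGroup F] [NormedSpace ℝ F]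
    (B : G →L[ℝ] E →L[ℝ] F) (f : C(E, F)) (hf : ContDiff ℝ ∞ f)
    (hs : HasCompactSupport f) (f' : C(E, G)) (hf' : ∀ x, B (f' x) = fderiv ℝ f x) (n : ℕ)
    (h : ContDiff ℝ n (fun γ : C(K, E) => f'.comp γ)) :
    ContDiff ℝ (n + 1 : ℕ) (fun γ : C(K, E) => f.comp γ) := by
  rw [Nat.cast_succ, contDiff_succ_iff_hasFDerivAt]
  exact ⟨fun γ => applyCLM K B (f'.comp γ), (applyCLM K B).contDiff.comp h,
    fun γ => hasFDerivAt_postcomp B f hf hs f' hf' γ⟩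

/-- The derivative of postcomposition with `f` is given by postcomposition with `fderiv ℝ f`, which
is again smooth with compact support. The induction runs over all target spaces in one universe,
since `F` is replaced by `E →L[ℝ] F`. -/
theorem contDiff_postcomp_nat {E : Type u} [NormedAddCommGroup E] [NormedSpace ℝ E] (n : ℕ) :
    ∀ {F : Type u} [NormedAddCommGroup F] [NormedSpace ℝ F] (f : C(E, F)), ContDiff ℝ ∞ f →
      HasCompactSupport f → ContDiff ℝ n (fun γ : C(K, E) => f.comp γ) := by
  induction n with
  | zero =>
    intro F _ _ f _ _
    exact contDiff_zero.2 (ContinuousMap.continuous_postcomp f)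
  | succ n ih =>
    intro F _ _ f hf hs
    have hf1 : ContDiff ℝ ∞ (fderiv ℝ f) := hf.fderiv_right (by simp)
    exact contDiff_postcomp_succ (ContinuousLinearMap.id ℝ (E →L[ℝ] F)) f hf hs
      ⟨fderiv ℝ f, hf1.continuous⟩ (fun _ => rfl) n (ih _ hf1 (hs.fderiv ℝ))

theorem contDiff_postcomp {E : Type u} [NormedAddCommGroup E] [NormedSpace ℝ E]
    {F : Type u} [NormedAddCommGroup F] [NormedSpace ℝ F] (f : C(E, F)) (hf : ContDiff ℝ ∞ f)
    (hs : HasCompactSupport f) : ContDiff ℝ ∞ (fun γ : C(K, E) => f.comp γ) :=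
  contDiff_infty.2 fun n => contDiff_postcomp_nat n f hf hs

end Composition

/-! ## The flow of a vector field -/

section Flow

variable {E : Type u} [NormedAddCommGroup E] [NormedSpace ℝ E] [CompleteSpace E]

/-- The curves on the unit interval. -/
abbrev Curve (E : Type*) [TopologicalSpace E] := C(Icc (0 : ℝ) 1, E)

/-- A curve, extended by constants. -/
def extend (γ : Curve E) (σ : ℝ) : E := γ (projIcc 0 1 zero_le_one σ)

omit [NormedSpace ℝ E] [CompleteSpace E] in
theorem continuous_extend (γ : Curve E) : Continuous (extend γ) :=
  γ.continuous.comp continuous_projIcc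

omit [NormedSpace ℝ E] [CompleteSpace E] in
theorem extend_of_mem (γ : Curve E) {σ : ℝ} (h : σ ∈ Icc (0 : ℝ) 1) : extend γ σ = γ ⟨σ, h⟩ := by
  rw [extend, projIcc_of_mem _ h]

/-- The constant curves. -/
def constCurve (E : Type*) [NormedAddCommGroup E] [NormedSpace ℝ E] : E →L[ℝ] Curve E :=
  ContinuousLinearMap.const ℝ (Icc (0 : ℝ) 1)

omit [CompleteSpace E] in
@[simp] theorem constCurve_apply (x : E) (σ : Icc (0 : ℝ) 1) : constCurve E x σ = x := rfl

/-- Integration from `0`. -/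
def primitive (E : Type*) [NormedAddCommGroup E] [NormedSpace ℝ E] [CompleteSpace E] :
    Curve E →L[ℝ] Curve E :=
  LinearMap.mkContinuous
    { toFun := fun γ => ⟨fun τ => ∫ σ in (0 : ℝ)..τ, extend γ σ,
        (intervalIntegral.continuous_primitive
          (fun _ _ => (continuous_extend γ).intervalIntegrable _ _) 0).comp continuous_subtype_val⟩
      map_add' := fun γ η => by
        ext τ
        exact intervalIntegral.integral_add ((continuous_extend γ).intervalIntegrable _ _)
          ((continuous_extend η).intervalIntegrable _ _)
      map_smul' := fun c γ => by
        ext τ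
        exact intervalIntegral.integral_smul c _ } 1
    (fun γ => by
      rw [one_mul, ContinuousMap.norm_le _ (norm_nonneg _)]
      rintro ⟨τ, h0, h1⟩
      refine (intervalIntegral.norm_integral_le_of_norm_le_const
        (fun σ _ => γ.norm_coe_le_norm _)).trans ?_
      rw [sub_zero, abs_of_nonneg h0]
      exact mul_le_of_le_one_right (norm_nonneg _) h1)

theorem primitive_apply (γ : Curve E) (τ : Icc (0 : ℝ) 1) :
    primitive E γ τ = ∫ σ in (0 : ℝ)..τ, extend γ σ := rfl

/-- The map whose zeros are the rescaled integral curves. -/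
def integralEquation (f : C(E, E)) (z : (ℝ × E) × Curve E) : (ℝ × E) × Curve E :=
  (z.1, z.2 - constCurve E z.1.2 - z.1.1 • primitive E (f.comp z.2))

/-- The second component vanishes when `γ τ = x + t ∫₀^τ f (γ σ) dσ`, so `γ` is an integral curve of
`f` run over `[0, 1]` at speed `t`. With the interval fixed, time is a parameter just like the
initial point, and one application of the inverse function theorem gives smoothness in both. -/
theorem contDiff_integralEquation {f : C(E, E)} (hf : ContDiff ℝ ∞ f) (hs : HasCompactSupport f) :
    ContDiff ℝ ∞ (integralEquation f) := by
  refine contDiff_fst.prodMk ((contDiff_snd.sub ?_).sub ((contDiff_fst.comp contDiff_fst).smul ?_))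
  · exact (constCurve E).contDiff.comp
      (contDiff_snd.comp contDiff_fst)
  · exact (primitive E).contDiff.comp ((contDiff_postcomp f hf hs).comp contDiff_snd)

/-- The derivative of `integralEquation` at time zero. -/
def integralEquationDeriv (v : Curve E) : ((ℝ × E) × Curve E) ≃L[ℝ] ((ℝ × E) × Curve E) :=
  ContinuousLinearEquiv.equivOfInverse
    ((ContinuousLinearMap.fst ℝ (ℝ × E) (Curve E)).prod
      (ContinuousLinearMap.snd ℝ (ℝ × E) (Curve E)
        - (constCurve E).comp
          ((ContinuousLinearMap.snd ℝ ℝ E).comp (ContinuousLinearMap.fst ℝ (ℝ × E) (Curve E)))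
        - ((ContinuousLinearMap.fst ℝ ℝ E).comp
          (ContinuousLinearMap.fst ℝ (ℝ × E) (Curve E))).smulRight v))
    ((ContinuousLinearMap.fst ℝ (ℝ × E) (Curve E)).prod
      (ContinuousLinearMap.snd ℝ (ℝ × E) (Curve E)
        + (constCurve E).comp
          ((ContinuousLinearMap.snd ℝ ℝ E).comp (ContinuousLinearMap.fst ℝ (ℝ × E) (Curve E)))
        + ((ContinuousLinearMap.fst ℝ ℝ E).comp
          (ContinuousLinearMap.fst ℝ (ℝ × E) (Curve E))).smulRight v))
    (fun z => by
      ext <;> simp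
      abel)
    (fun z => by
      ext <;> simp
      abel)

/-- At time zero the nonlinear term carries the factor `t = 0`, so only the variation of `t` sees
it. The derivative is triangular with the identity on curves, and is invertible without any
smallness condition. -/
theorem hasFDerivAt_integralEquation {f : C(E, E)} (hf : ContDiff ℝ ∞ f)
    (hs : HasCompactSupport f) (x : E) (γ : Curve E) :
    HasFDerivAt (integralEquation f)
      (integralEquationDeriv (primitive E (f.comp γ)) :
        ((ℝ × E) × Curve E) →L[ℝ] ((ℝ × E) × Curve E)) ((0, x), γ) := by
  have h1 : HasFDerivAt (fun z : (ℝ × E) × Curve E => primitive E (f.comp z.2)) _ ((0, x), γ) :=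
    (((primitive E).contDiff.comp ((contDiff_postcomp f hf hs).comp contDiff_snd)).differentiable
      (n := ∞) (by simp)).differentiableAt.hasFDerivAt
  have h2 := (((ContinuousLinearMap.fst ℝ ℝ E).comp
    (ContinuousLinearMap.fst ℝ (ℝ × E) (Curve E))).hasFDerivAt (x := ((0, x), γ))).smul h1
  have h3 := (ContinuousLinearMap.fst ℝ (ℝ × E) (Curve E)).hasFDerivAt (x := ((0, x), γ))
  have h4 := ((ContinuousLinearMap.snd ℝ (ℝ × E) (Curve E)).hasFDerivAt (x := ((0, x), γ))).sub
    (((constCurve E).comp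
          ((ContinuousLinearMap.snd ℝ ℝ E).comp
            (ContinuousLinearMap.fst ℝ (ℝ × E) (Curve E)))).hasFDerivAt (x := ((0, x), γ)))
  refine (h3.prodMk (h4.sub h2)).congr_fderiv ?_
  apply ContinuousLinearMap.ext
  intro z
  ext <;> simp [integralEquationDeriv]

/-- A curve run through at a slower pace. -/
def slow (τ : Icc (0 : ℝ) 1) (γ : Curve E) : Curve E :=
  ⟨fun σ => γ ⟨τ * σ, mul_nonneg τ.2.1 σ.2.1, mul_le_one₀ τ.2.2 σ.2.1 σ.2.2⟩, by fun_prop⟩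

/-- The initial piece of a solution, stretched back to `[0, 1]`, solves the equation for the shorter
time; this is the substitution `u = τ σ` in the integral. -/
theorem integralEquation_slow {f : C(E, E)} {t : ℝ} {x : E} {γ : Curve E}
    (h : integralEquation f ((t, x), γ) = ((t, x), 0)) (τ : Icc (0 : ℝ) 1) :
    integralEquation f ((t * τ, x), slow τ γ) = ((t * τ, x), 0) := by
  have h' : ∀ σ, γ σ = x + t • ∫ u in (0 : ℝ)..σ, extend (f.comp γ) u := fun σ => by
    have := congrArg (fun z => z.2 σ) h
    simp only [integralEquation, ContinuousMap.sub_apply, ContinuousMap.smul_apply,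
      primitive_apply, ContinuousMap.zero_apply, constCurve_apply] at this
    rw [sub_sub, sub_eq_zero] at this
    exact this
  refine Prod.ext rfl ?_
  ext σ
  simp only [integralEquation, ContinuousMap.sub_apply, ContinuousMap.smul_apply,
      primitive_apply, ContinuousMap.zero_apply, constCurve_apply]
  rw [sub_sub, sub_eq_zero]
  have h3 : slow τ γ σ = γ ⟨τ * σ, mul_nonneg τ.2.1 σ.2.1, mul_le_one₀ τ.2.2 σ.2.1 σ.2.2⟩ := rfl
  rw [h3, h', mul_smul]
  congr 2
  have h4 := intervalIntegral.smul_integral_comp_mul_left (a := 0) (b := σ)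
    (extend (f.comp γ)) (τ : ℝ)
  rw [mul_zero] at h4
  rw [← h4]
  congr 1
  refine intervalIntegral.integral_congr fun u hu => ?_
  rw [uIcc_of_le σ.2.1] at hu
  have hu1 : u ∈ Icc (0 : ℝ) 1 := ⟨hu.1, hu.2.trans σ.2.2⟩
  rw [extend_of_mem _ hu1,
    extend_of_mem _ ⟨mul_nonneg τ.2.1 hu1.1, mul_le_one₀ τ.2.2 hu1.1 hu1.2⟩]
  rfl

/-- A compactly supported smooth vector field has a smooth local flow. -/
theorem exists_flow_of_hasCompactSupport {f : E → E} (hf : ContDiff ℝ ∞ f)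
    (hs : HasCompactSupport f) (p : E) :
    ∃ δ > 0, ∃ α : ℝ × E → E, ContDiffOn ℝ ∞ α (Metric.ball (0, p) δ) ∧
      (∀ x, (0, x) ∈ Metric.ball ((0, p) : ℝ × E) δ → α (0, x) = x) ∧
      ∀ t x, (t, x) ∈ Metric.ball ((0, p) : ℝ × E) δ →
        HasDerivAt (fun s => α (s, x)) (f (α (t, x))) t := by
  let fc : C(E, E) := ⟨f, hf.continuous⟩
  let γp : Curve E := constCurve E p
  obtain ⟨e, hae, -, he, -, hsymm⟩ := exists_smooth_local_inverse isOpen_univ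
    (mem_univ ((0, p), γp)) (contDiff_integralEquation (f := fc) hf hs).contDiffOn
    (integralEquationDeriv (primitive E (fc.comp γp)))
    (hasFDerivAt_integralEquation (f := fc) hf hs p γp)
  have hep : e ((0, p), γp) = ((0, p), 0) := by
    rw [he]
    simp [integralEquation, γp]
  -- a ball in the source, and a ball of parameters that is mapped to it
  obtain ⟨r, hr, hball⟩ := Metric.isOpen_iff.1 e.open_source _ hae
  let j : ℝ × E → (ℝ × E) × Curve E := fun z => (z, 0)
  have hj : ContDiff ℝ ∞ j := contDiff_id.prodMk contDiff_const
  have hj0 : j (0, p) = e ((0, p), γp) := hep.symm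
  have hopen : IsOpen (e.target ∩ e.symm ⁻¹' Metric.ball ((0, p), γp) r) :=
    e.symm.isOpen_inter_preimage Metric.isOpen_ball
  have hmem : j (0, p) ∈ e.target ∩ e.symm ⁻¹' Metric.ball ((0, p), γp) r := by
    rw [hj0]
    refine ⟨e.map_source hae, ?_⟩
    rw [mem_preimage, e.left_inv hae]
    exact Metric.mem_ball_self hr
  obtain ⟨δ, hδ, hδball⟩ := Metric.isOpen_iff.1 (hopen.preimage hj.continuous) (0, p) hmem
  let Γ : ℝ × E → Curve E := fun z => (e.symm (j z)).2
  have hone : (1 : ℝ) ∈ Icc (0 : ℝ) 1 := ⟨zero_le_one, le_rfl⟩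
  let ev : Curve E →L[ℝ] E := ContinuousMap.evalCLM ℝ (⟨1, hone⟩ : Icc (0 : ℝ) 1)
  let α : ℝ × E → E := fun z => ev (Γ z)
  -- The flow at time `t` is the endpoint of the rescaled integral curve.
  have hα : ContDiffOn ℝ ∞ α (Metric.ball (0, p) δ) :=
    ev.contDiff.comp_contDiffOn (contDiff_snd.comp_contDiffOn
      (hsymm.comp hj.contDiffOn fun z hz => (hδball hz).1))
  have hΓ : ∀ z ∈ Metric.ball (0, p) δ, e.symm (j z) = (z, Γ z) ∧
      integralEquation fc (z, Γ z) = (z, 0) := fun z hz => by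
    have h1 : e (e.symm (j z)) = j z := e.right_inv (hδball hz).1
    have h2 : integralEquation fc (e.symm (j z)) = (z, 0) := by rw [← he, h1]
    have h3 : (e.symm (j z)).1 = z := congrArg Prod.fst h2
    have h4 : e.symm (j z) = (z, Γ z) := Prod.ext h3 rfl
    exact ⟨h4, h4 ▸ h2⟩
  have hint : ∀ t x, (t, x) ∈ Metric.ball ((0, p) : ℝ × E) δ → ∀ σ : Icc (0 : ℝ) 1,
      Γ (t, x) σ = x + t • ∫ u in (0 : ℝ)..σ, extend (fc.comp (Γ (t, x))) u := by
    intro t x hz σ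
    have := congrArg (fun z => z.2 σ) (hΓ _ hz).2
    simp only [integralEquation, ContinuousMap.sub_apply, ContinuousMap.smul_apply,
      primitive_apply, ContinuousMap.zero_apply, constCurve_apply] at this
    rw [sub_sub, sub_eq_zero] at this
    exact this
  have hshrink : ∀ t x, (t, x) ∈ Metric.ball ((0, p) : ℝ × E) δ → ∀ τ : Icc (0 : ℝ) 1,
      ((t * τ, x) : ℝ × E) ∈ Metric.ball ((0, p) : ℝ × E) δ := by
    intro t x hz τ
    rw [Metric.mem_ball, Prod.dist_eq, max_lt_iff] at hz ⊢
    refine ⟨lt_of_le_of_lt ?_ hz.1, hz.2⟩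
    simp only [dist_zero_right, norm_mul, Real.norm_eq_abs, abs_of_nonneg τ.2.1]
    exact mul_le_of_le_one_right (abs_nonneg _) τ.2.2
  -- the curves for different times are reparametrizations of each other
  have hscale : ∀ t x, (t, x) ∈ Metric.ball ((0, p) : ℝ × E) δ → ∀ τ : Icc (0 : ℝ) 1,
      Γ (t, x) τ = α (t * τ, x) := by
    intro t x hz τ
    have hz' := hshrink t x hz τ
    have h1 := integralEquation_slow (hΓ _ hz).2 τ
    have hb : ((t, x), Γ (t, x)) ∈ Metric.ball ((0, p), γp) r := by
      rw [← (hΓ _ hz).1]; exact (hδball hz).2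
    have hb' : ((t * τ, x), Γ (t * τ, x)) ∈ Metric.ball ((0, p), γp) r := by
      rw [← (hΓ _ hz').1]; exact (hδball hz').2
    -- The slowed curve takes only values of `Γ (t, x)`, so it is no farther from the constant
    -- curve. It therefore lies in the ball on which `e` is injective, and agrees with the solution
    -- for time `t * τ`.
    have hb2 : ((t * τ, x), slow τ (Γ (t, x))) ∈ Metric.ball ((0, p), γp) r := by
      rw [Metric.mem_ball, Prod.dist_eq, max_lt_iff] at hb hb' ⊢
      refine ⟨hb'.1, lt_of_le_of_lt ?_ hb.2⟩
      rw [ContinuousMap.dist_le dist_nonneg]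
      intro σ
      exact ContinuousMap.dist_apply_le_dist (f := Γ (t, x)) (g := γp) _
    have h2 := e.injOn (hball hb2) (hball hb') (by rw [he, he, h1, (hΓ _ hz').2])
    have h3 : slow τ (Γ (t, x)) = Γ (t * τ, x) := congrArg Prod.snd h2
    have h4 : slow τ (Γ (t, x)) ⟨1, hone⟩ = Γ (t, x) τ :=
      congrArg (Γ (t, x)) (Subtype.ext (mul_one _))
    rw [← h4, h3]
    rfl
  have hαdiff : ∀ z ∈ Metric.ball ((0, p) : ℝ × E) δ, HasFDerivAt α (fderiv ℝ α z) z := fun z hz =>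
    ((hα.differentiableOn (by simp)).differentiableAt
      (Metric.isOpen_ball.mem_nhds hz)).hasFDerivAt
  have hline : ∀ t x, (t, x) ∈ Metric.ball ((0, p) : ℝ × E) δ →
      HasDerivAt (fun s => α (s, x)) (fderiv ℝ α (t, x) (1, 0)) t := fun t x hz =>
    HasFDerivAt.comp_hasDerivAt (f := fun s : ℝ => ((s, x) : ℝ × E)) t (hαdiff _ hz)
      ((hasDerivAt_id t).prodMk (hasDerivAt_const t x))
  have hne : ∀ t x, (t, x) ∈ Metric.ball ((0, p) : ℝ × E) δ → t ≠ 0 →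
      fderiv ℝ α (t, x) (1, 0) = f (α (t, x)) := by
    intro t x hz ht
    -- The derivative of `τ ↦ α (t * τ, x)` at `τ = 1` is computed by the chain rule and by the
    -- integral equation; comparing the results allows division by `t`. It is one-sided because the
    -- curves live on `[0, 1]`.
    have h1 : HasDerivWithinAt (fun τ : ℝ => α (t * τ, x)) (t • fderiv ℝ α (t, x) (1, 0))
        (Icc 0 1) 1 := by
      have h2 : HasDerivAt (fun τ : ℝ => t * τ) t 1 := by
        simpa using (hasDerivAt_id (1 : ℝ)).const_mul t
      have h3 : HasDerivAt (fun s => α (s, x)) (fderiv ℝ α (t, x) (1, 0)) (t * 1) := by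
        rw [mul_one]; exact hline t x hz
      exact (h3.scomp 1 h2).hasDerivWithinAt
    have h4 : HasDerivWithinAt (fun τ : ℝ => α (t * τ, x)) (t • f (α (t, x))) (Icc 0 1) 1 := by
      have hc := continuous_extend (fc.comp (Γ (t, x)))
      have h5 : HasDerivAt (fun τ : ℝ => x + t • ∫ u in (0 : ℝ)..τ, extend (fc.comp (Γ (t, x))) u)
          (t • extend (fc.comp (Γ (t, x))) 1) 1 :=
        ((intervalIntegral.integral_hasDerivAt_right (hc.intervalIntegrable _ _)
          (hc.stronglyMeasurableAtFilter _ _) hc.continuousAt).const_smul t).const_add x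
      have h6 : extend (fc.comp (Γ (t, x))) 1 = f (α (t, x)) := by
        rw [extend_of_mem _ hone]; rfl
      rw [h6] at h5
      refine h5.hasDerivWithinAt.congr (fun τ hτ => ?_) ?_
      · rw [← hscale t x hz ⟨τ, hτ⟩, hint t x hz]
      · rw [← hscale t x hz ⟨1, hone⟩, hint t x hz]
    have h7 := (uniqueDiffOn_Icc zero_lt_one 1 hone).eq_deriv _ h1 h4
    exact smul_right_injective E ht h7
  refine ⟨δ, hδ, α, hα, fun x hz => ?_, fun t x hz => ?_⟩
  · have := hint 0 x hz ⟨1, hone⟩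
    rw [zero_smul, add_zero] at this
    exact this
  · by_cases ht : t = 0
    -- At time zero there is nothing to divide by; the identity extends from nonzero times by
    -- continuity.
    · subst ht
      have hev : ∀ᶠ s in 𝓝[≠] (0 : ℝ), fderiv ℝ α (s, x) (1, 0) = f (α (s, x)) := by
        have : ∀ᶠ s in 𝓝 (0 : ℝ), ((s, x) : ℝ × E) ∈ Metric.ball ((0, p) : ℝ × E) δ :=
          (by fun_prop : Continuous fun s : ℝ => ((s, x) : ℝ × E)).continuousAt.preimage_mem_nhds
            (Metric.isOpen_ball.mem_nhds hz)
        filter_upwards [this.filter_mono nhdsWithin_le_nhds, self_mem_nhdsWithin] with s h1 h2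
        exact hne s x h1 h2
      have hcpair : ContinuousAt (fun s : ℝ => ((s, x) : ℝ × E)) 0 := by fun_prop
      have hc1 : ContinuousAt (fun s : ℝ => fderiv ℝ α (s, x) (1, 0)) 0 := by
        have h8 : ContinuousAt (fderiv ℝ α) (0, x) :=
          (hα.continuousOn_fderiv_of_isOpen Metric.isOpen_ball (by simp)).continuousAt
            (Metric.isOpen_ball.mem_nhds hz)
        exact (ContinuousAt.comp (f := fun s : ℝ => ((s, x) : ℝ × E)) h8 hcpair).clm_apply
          continuousAt_const
      have hc2 : ContinuousAt (fun s : ℝ => f (α (s, x))) 0 :=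
        hf.continuous.continuousAt.comp (ContinuousAt.comp (f := fun s : ℝ => ((s, x) : ℝ × E))
          (hαdiff _ hz).continuousAt hcpair)
      have := tendsto_nhds_unique_of_eventuallyEq
        (hc1.tendsto.mono_left nhdsWithin_le_nhds) (hc2.tendsto.mono_left nhdsWithin_le_nhds) hev
      rw [← this]
      exact hline 0 x hz
    · rw [← hne t x hz ht]
      exact hline t x hz

end Flow

end SmoothFlow

/-! ### Local flows on open sets, and commuting vector fields. -/

namespace SmoothFlow

universe u

variable {E : Type u} [NormedAddCommGroup E] [NormedSpace ℝ E] [FiniteDimensional ℝ E]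

/-- A vector field that is smooth on an open set has a smooth local flow. -/
theorem exists_local_flow {f : E → E} {U : Set E} (hU : IsOpen U) (hf : ContDiffOn ℝ ∞ f U)
    {p : E} (hp : p ∈ U) :
    ∃ δ > 0, ∃ α : ℝ × E → E, ContDiffOn ℝ ∞ α (Metric.ball (0, p) δ) ∧
      (∀ z ∈ Metric.ball ((0, p) : ℝ × E) δ, α z ∈ U) ∧
      (∀ x, (0, x) ∈ Metric.ball ((0, p) : ℝ × E) δ → α (0, x) = x) ∧
      ∀ t x, (t, x) ∈ Metric.ball ((0, p) : ℝ × E) δ →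
        HasDerivAt (fun s => α (s, x)) (f (α (t, x))) t := by
  have : CompleteSpace E := FiniteDimensional.complete ℝ E
  obtain ⟨r, hr, hrU⟩ := Metric.isOpen_iff.1 hU p hp
  -- The cut-off equals one on the ball of radius `r / 3`. Times and initial points are restricted
  -- so that the flow stays there, where it cannot see the cut-off.
  let χ : ContDiffBump p := ⟨r / 3, r / 2, by positivity, by linarith⟩
  have hχU : tsupport χ ⊆ U := by
    rw [χ.tsupport_eq]
    exact (Metric.closedBall_subset_ball (by simp [χ]; linarith)).trans hrU
  have hsm : ContDiff ℝ ∞ (fun x => χ x • f x) := by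
    rw [contDiff_iff_contDiffAt]
    intro x
    by_cases hx : x ∈ tsupport χ
    · exact χ.contDiff.contDiffAt.smul (hf.contDiffAt (hU.mem_nhds (hχU hx)))
    · refine (contDiffAt_const (c := (0 : E))).congr_of_eventuallyEq ?_
      filter_upwards [(isClosed_tsupport χ).isOpen_compl.mem_nhds hx] with y hy
      rw [image_eq_zero_of_notMem_tsupport hy, zero_smul]
  have hcs : HasCompactSupport (fun x => χ x • f x) := χ.hasCompactSupport.smul_right
  obtain ⟨δ, hδ, α, hα, h0, hd⟩ := exists_flow_of_hasCompactSupport hsm hcs p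
  have hc : ContinuousAt α (0, p) :=
    hα.continuousOn.continuousAt (Metric.ball_mem_nhds _ hδ)
  have hp0 : α (0, p) = p := h0 p (Metric.mem_ball_self hδ)
  have hmem : α ⁻¹' Metric.ball p (r / 3) ∈ 𝓝 ((0, p) : ℝ × E) := by
    apply hc
    rw [hp0]
    exact Metric.ball_mem_nhds _ (by positivity)
  obtain ⟨δ', hδ', hδ'b⟩ := Metric.mem_nhds_iff.1 hmem
  have hsub1 : Metric.ball ((0, p) : ℝ × E) (min δ δ') ⊆ Metric.ball (0, p) δ :=
    Metric.ball_subset_ball (min_le_left _ _)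
  have hsub2 : Metric.ball ((0, p) : ℝ × E) (min δ δ') ⊆ Metric.ball (0, p) δ' :=
    Metric.ball_subset_ball (min_le_right _ _)
  refine ⟨min δ δ', lt_min hδ hδ', α, hα.mono hsub1, fun z hz => ?_, fun x hx => h0 x (hsub1 hx),
    fun t x hz => ?_⟩
  · exact hrU (Metric.ball_subset_ball (by linarith) (hδ'b (hsub2 hz)))
  · have h1 := hd t x (hsub1 hz)
    have h2 : χ (α (t, x)) = 1 :=
      χ.one_of_mem_closedBall (Metric.ball_subset_closedBall (hδ'b (hsub2 hz)))
    simpa only [h2, one_smul] using h1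

omit [FiniteDimensional ℝ E] in
/-- The flow of `X` maps a vector field that commutes with `X` to itself. -/
theorem fderiv_flow_apply_of_commute {X Y : E → E} {U : Set E} (hU : IsOpen U)
    (hX : ContDiffOn ℝ ∞ X U) (hY : ContDiffOn ℝ ∞ Y U)
    (hXY : ∀ x ∈ U, fderiv ℝ Y x (X x) = fderiv ℝ X x (Y x)) {p : E} {δ : ℝ}
    {α : ℝ × E → E} (hα : ContDiffOn ℝ ∞ α (Metric.ball (0, p) δ))
    (hαU : ∀ z ∈ Metric.ball ((0, p) : ℝ × E) δ, α z ∈ U)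
    (h0 : ∀ x, (0, x) ∈ Metric.ball ((0, p) : ℝ × E) δ → α (0, x) = x)
    (hd : ∀ t x, (t, x) ∈ Metric.ball ((0, p) : ℝ × E) δ →
        HasDerivAt (fun s => α (s, x)) (X (α (t, x))) t) {t : ℝ} {x : E}
    (hz : (t, x) ∈ Metric.ball ((0, p) : ℝ × E) δ) :
    fderiv ℝ α (t, x) (0, Y x) = Y (α (t, x)) := by
  have hopen : IsOpen (Metric.ball ((0, p) : ℝ × E) δ) := Metric.isOpen_ball
  have hmem : ∀ s : ℝ, (s, x) ∈ Metric.ball ((0, p) : ℝ × E) δ ↔ |s| < δ := by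
    intro s
    rw [Metric.mem_ball, Prod.dist_eq, max_lt_iff] at hz ⊢
    simp only [Real.dist_eq, sub_zero]
    exact ⟨fun h => h.1, fun h => ⟨h, hz.2⟩⟩
  have ht : |t| < δ := (hmem t).1 hz
  obtain ⟨b, hb1, hb2⟩ := exists_between ht
  have hb0 : 0 < b := (abs_nonneg t).trans_lt hb1
  have hI : ∀ s ∈ Icc (-b) b, (s, x) ∈ Metric.ball ((0, p) : ℝ × E) δ := fun s hs =>
    (hmem s).2 ((abs_le.2 hs).trans_lt hb2)
  have hα1 : ∀ z ∈ Metric.ball ((0, p) : ℝ × E) δ, HasFDerivAt α (fderiv ℝ α z) z := fun z hz =>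
    ((hα.differentiableOn (by simp)).differentiableAt (hopen.mem_nhds hz)).hasFDerivAt
  have hα2 : ContDiffOn ℝ ∞ (fderiv ℝ α) (Metric.ball (0, p) δ) :=
    hα.fderiv_of_isOpen hopen (by simp)
  have hα3 : ∀ z ∈ Metric.ball ((0, p) : ℝ × E) δ,
      HasFDerivAt (fderiv ℝ α) (fderiv ℝ (fderiv ℝ α) z) z := fun z hz =>
    ((hα2.differentiableOn (by simp)).differentiableAt (hopen.mem_nhds hz)).hasFDerivAt
  have hX1 : ∀ y ∈ U, HasFDerivAt X (fderiv ℝ X y) y := fun y hy =>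
    ((hX.differentiableOn (by simp)).differentiableAt (hU.mem_nhds hy)).hasFDerivAt
  have hY1 : ∀ y ∈ U, HasFDerivAt Y (fderiv ℝ Y y) y := fun y hy =>
    ((hY.differentiableOn (by simp)).differentiableAt (hU.mem_nhds hy)).hasFDerivAt
  have hline : ∀ s : ℝ, HasDerivAt (fun s : ℝ => ((s, x) : ℝ × E)) (1, 0) s := fun s =>
    (hasDerivAt_id s).prodMk (hasDerivAt_const s x)
  have htime : ∀ z ∈ Metric.ball ((0, p) : ℝ × E) δ, fderiv ℝ α z (1, 0) = X (α z) := by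
    rintro ⟨s, y⟩ hz
    exact (HasFDerivAt.comp_hasDerivAt (f := fun s : ℝ => ((s, y) : ℝ × E)) s (hα1 _ hz)
      ((hasDerivAt_id s).prodMk (hasDerivAt_const s y))).unique (hd s y hz)
  -- Both the transported vector `dα_s (Y x)` and the field along the orbit, `Y (α (s, x))`, solve
  -- the linear equation `u' = A s u`: the former by symmetry of second derivatives, the latter by
  -- commutation. They agree at `s = 0`.
  let A : ℝ → E →L[ℝ] E := fun s => fderiv ℝ X (α (s, x))
  have hder1 : ∀ s ∈ Icc (-b) b, HasDerivAt (fun s => fderiv ℝ α (s, x) (0, Y x))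
      (A s (fderiv ℝ α (s, x) (0, Y x))) s := by
    intro s hs
    have hzs := hI s hs
    have h1 : HasDerivAt (fun s => fderiv ℝ α (s, x)) (fderiv ℝ (fderiv ℝ α) (s, x) (1, 0)) s :=
      HasFDerivAt.comp_hasDerivAt (f := fun s : ℝ => ((s, x) : ℝ × E)) s (hα3 _ hzs) (hline s)
    have h2 := h1.clm_apply (hasDerivAt_const s ((0, Y x) : ℝ × E))
    rw [map_zero, add_zero] at h2
    have hsymm : fderiv ℝ (fderiv ℝ α) (s, x) (1, 0) (0, Y x)
        = fderiv ℝ (fderiv ℝ α) (s, x) (0, Y x) (1, 0) :=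
      second_derivative_symmetric_of_eventually
        (by filter_upwards [hopen.mem_nhds hzs] with z hz using hα1 z hz) (hα3 _ hzs) _ _
    have h3 : HasFDerivAt (fun z => fderiv ℝ α z (1, 0))
        ((fderiv ℝ (fderiv ℝ α) (s, x)).flip (1, 0)) (s, x) := by
      have := (hα3 _ hzs).clm_apply (hasFDerivAt_const ((1, 0) : ℝ × E) ((s, x) : ℝ × E))
      refine this.congr_fderiv ?_
      ext v <;> simp
    have h4 : HasFDerivAt (fun z => fderiv ℝ α z (1, 0))
        ((fderiv ℝ X (α (s, x))).comp (fderiv ℝ α (s, x))) (s, x) :=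
      ((hX1 _ (hαU _ hzs)).comp (s, x) (hα1 _ hzs)).congr_of_eventuallyEq
        (by filter_upwards [hopen.mem_nhds hzs] with z hz using htime z hz)
    have h5 := congrArg (fun L => L (0, Y x)) (h3.unique h4)
    simp only [ContinuousLinearMap.flip_apply, ContinuousLinearMap.comp_apply] at h5
    rw [hsymm, h5] at h2
    exact h2
  have hder2 : ∀ s ∈ Icc (-b) b, HasDerivAt (fun s => Y (α (s, x))) (A s (Y (α (s, x)))) s := by
    intro s hs
    have h1 := (hY1 _ (hαU _ (hI s hs))).comp_hasDerivAt s (hd s x (hI s hs))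
    rw [hXY _ (hαU _ (hI s hs))] at h1
    exact h1
  have hA : ContinuousOn A (Icc (-b) b) := by
    refine (hX.continuousOn_fderiv_of_isOpen hU (by simp)).comp
      (hα.continuousOn.comp (by fun_prop) hI) fun s hs => hαU _ (hI s hs)
  obtain ⟨C, hC⟩ := isCompact_Icc.exists_bound_of_continuousOn hA
  have hlip : ∀ s ∈ Ioo (-b) b, LipschitzOnWith C.toNNReal (A s) univ := fun s hs => by
    refine ((A s).lipschitz.weaken ?_).lipschitzOnWith
    rw [← NNReal.coe_le_coe, coe_nnnorm]
    exact (hC s (Ioo_subset_Icc_self hs)).trans (Real.le_coe_toNNReal C)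
  refine ODE_solution_unique_of_mem_Ioo (v := fun s => A s) (s := fun _ => univ) hlip
    (t₀ := 0) ⟨by linarith, hb0⟩
    (fun s hs => ⟨hder1 s (Ioo_subset_Icc_self hs), mem_univ _⟩)
    (fun s hs => ⟨hder2 s (Ioo_subset_Icc_self hs), mem_univ _⟩) ?_ (abs_lt.1 hb1)
  have hz0 : (0, x) ∈ Metric.ball ((0, p) : ℝ × E) δ := hI 0 ⟨by linarith, hb0.le⟩
  have h6 : HasFDerivAt (fun y : E => α (0, y))
      ((fderiv ℝ α (0, x)).comp (ContinuousLinearMap.inr ℝ ℝ E)) x :=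
    HasFDerivAt.comp (f := fun y : E => ((0, y) : ℝ × E)) x (hα1 _ hz0)
      ((ContinuousLinearMap.inr ℝ ℝ E).hasFDerivAt)
  have h7 : HasFDerivAt (fun y : E => α (0, y)) (ContinuousLinearMap.id ℝ E) x := by
    refine (hasFDerivAt_id x).congr_of_eventuallyEq ?_
    have hc : ContinuousAt (fun y : E => ((0, y) : ℝ × E)) x := by fun_prop
    filter_upwards [hc.preimage_mem_nhds (hopen.mem_nhds hz0)] with y hy using h0 y hy
  have h8 := congrArg (fun L => L (Y x)) (h6.unique h7)
  simp only [ContinuousLinearMap.comp_apply, ContinuousLinearMap.inr_apply,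
    ContinuousLinearMap.id_apply] at h8
  rw [h8, h0 x hz0]

/-- Two commuting vector fields generate a local action of the plane. -/
theorem exists_commuting_flow {X Y : E → E} {U : Set E} (hU : IsOpen U)
    (hX : ContDiffOn ℝ ∞ X U) (hY : ContDiffOn ℝ ∞ Y U)
    (hXY : ∀ x ∈ U, fderiv ℝ Y x (X x) = fderiv ℝ X x (Y x)) {p : E} (hp : p ∈ U) :
    ∃ δ > 0, ∃ Ψ : (ℝ × ℝ) × E → E, ContDiffOn ℝ ∞ Ψ (Metric.ball (0, p) δ) ∧
      (∀ z ∈ Metric.ball ((0, p) : (ℝ × ℝ) × E) δ, Ψ z ∈ U) ∧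
      (∀ x, (0, x) ∈ Metric.ball ((0, p) : (ℝ × ℝ) × E) δ → Ψ (0, x) = x) ∧
      ∀ z ∈ Metric.ball ((0, p) : (ℝ × ℝ) × E) δ,
        fderiv ℝ Ψ z ((1, 0), 0) = X (Ψ z) ∧ fderiv ℝ Ψ z ((0, 1), 0) = Y (Ψ z) := by
  obtain ⟨δ₁, hδ₁, α, hα, hαU, hα0, hαd⟩ := exists_local_flow hU hX hp
  obtain ⟨δ₂, hδ₂, β, hβ, hβU, hβ0, hβd⟩ := exists_local_flow hU hY hp
  -- The action is `Ψ ((s, t), x) = α (s, β (t, x))`. Its `s`-derivative is `X` by construction; its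
  -- `t`-derivative is `Y` transported by the flow of `X`, which is `Y` itself.
  let b : (ℝ × ℝ) × E → ℝ × E := fun z => (z.1.2, z.2)
  have hb : ContDiff ℝ ∞ b := (contDiff_snd.comp contDiff_fst).prodMk contDiff_snd
  let a : (ℝ × ℝ) × E → ℝ × E := fun z => (z.1.1, β (b z))
  have hbc : b ⁻¹' Metric.ball (0, p) δ₂ ∈ 𝓝 ((0, p) : (ℝ × ℝ) × E) :=
    hb.continuous.continuousAt.preimage_mem_nhds (Metric.ball_mem_nhds _ hδ₂)
  have ha : ContDiffOn ℝ ∞ a (b ⁻¹' Metric.ball (0, p) δ₂) :=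
    (contDiff_fst.comp contDiff_fst).contDiffOn.prodMk
      (hβ.comp hb.contDiffOn (mapsTo_preimage _ _))
  have hap : a (0, p) = (0, p) := by
    have : β (b (0, p)) = p := hβ0 p (Metric.mem_ball_self hδ₂)
    simp only [a, this]
    rfl
  have hac : a ⁻¹' Metric.ball (0, p) δ₁ ∈ 𝓝 ((0, p) : (ℝ × ℝ) × E) := by
    have h1 : ContinuousAt a (0, p) := ha.continuousOn.continuousAt hbc
    apply h1
    rw [hap]
    exact Metric.ball_mem_nhds _ hδ₁
  obtain ⟨δ, hδ, hball⟩ := Metric.mem_nhds_iff.1 (inter_mem hbc hac)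
  refine ⟨δ, hδ, fun z => α (a z), ?_, fun z hz => hαU _ (hball hz).2, fun x hx => ?_,
    fun z hz => ?_⟩
  · exact hα.comp (ha.mono fun z hz => (hball hz).1) fun z hz => (hball hz).2
  · have h1 : β (0, x) = x := hβ0 x (hball hx).1
    have h2 : a (0, x) = (0, x) := by
      change ((0 : ℝ), β (0, x)) = (0, x)
      rw [h1]
    simp only [h2]
    exact hα0 x (h2 ▸ (hball hx).2)
  · obtain ⟨hz1, hz2⟩ := hball hz
    obtain ⟨⟨s, t⟩, x⟩ := z
    have hz1' : ((t, x) : ℝ × E) ∈ Metric.ball ((0, p) : ℝ × E) δ₂ := hz1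
    have hz2' : ((s, β (t, x)) : ℝ × E) ∈ Metric.ball ((0, p) : ℝ × E) δ₁ := hz2
    have hΨ : HasFDerivAt (fun z => α (a z)) (fderiv ℝ (fun z => α (a z)) ((s, t), x)) ((s, t), x) :=
      (((hα.comp (ha.mono fun z hz => (hball hz).1) fun z hz => (hball hz).2).differentiableOn
        (by simp)).differentiableAt (Metric.isOpen_ball.mem_nhds hz)).hasFDerivAt
    constructor
    · have h1 : HasDerivAt (fun s : ℝ => (((s, t), x) : (ℝ × ℝ) × E)) ((1, 0), 0) s :=
        ((hasDerivAt_id s).prodMk (hasDerivAt_const s t)).prodMk (hasDerivAt_const s x)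
      exact (HasFDerivAt.comp_hasDerivAt (f := fun s : ℝ => (((s, t), x) : (ℝ × ℝ) × E)) s
        hΨ h1).unique (hαd s _ hz2')
    · have h1 : HasDerivAt (fun t : ℝ => (((s, t), x) : (ℝ × ℝ) × E)) ((0, 1), 0) t :=
        ((hasDerivAt_const t s).prodMk (hasDerivAt_id t)).prodMk (hasDerivAt_const t x)
      have h2 := HasFDerivAt.comp_hasDerivAt (f := fun t : ℝ => (((s, t), x) : (ℝ × ℝ) × E)) t
        hΨ h1
      have h3 : HasFDerivAt α (fderiv ℝ α (s, β (t, x))) (s, β (t, x)) :=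
        ((hα.differentiableOn (by simp)).differentiableAt
          (Metric.isOpen_ball.mem_nhds hz2')).hasFDerivAt
      have h4 := HasFDerivAt.comp_hasDerivAt (f := fun t : ℝ => ((s, β (t, x)) : ℝ × E)) t h3
        ((hasDerivAt_const t s).prodMk (hβd t x hz1'))
      have h5 := h2.unique h4
      rw [h5]
      exact fderiv_flow_apply_of_commute hU hX hY hXY hα hαU hα0 hαd hz2'

end SmoothFlow

namespace Coord

variable {n : ℕ}

/-! ## Bilinear forms and Christoffel symbols as multilinear maps -/

/-- The bilinear form with matrix `A`. -/
def bilin (A : Matrix (Fin n) (Fin n) ℝ) :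
    EuclideanSpace ℝ (Fin n) →L[ℝ] EuclideanSpace ℝ (Fin n) →L[ℝ] ℝ :=
  ∑ q : Fin n × Fin n, A q.1 q.2 •
    (EuclideanSpace.proj q.1 : EuclideanSpace ℝ (Fin n) →L[ℝ] ℝ).smulRight
      (EuclideanSpace.proj q.2 : EuclideanSpace ℝ (Fin n) →L[ℝ] ℝ)

theorem bilin_apply (A : Matrix (Fin n) (Fin n) ℝ) (u v : EuclideanSpace ℝ (Fin n)) :
    bilin A u v = ∑ i, ∑ j, A i j * (u i * v j) := by
  simp [bilin, Fintype.sum_prod_type]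

theorem bilin_single (A : Matrix (Fin n) (Fin n) ℝ) (i j : Fin n) :
    bilin A (EuclideanSpace.single i 1) (EuclideanSpace.single j 1) = A i j := by
  simp [bilin_apply]

theorem bilin_symm {A : Matrix (Fin n) (Fin n) ℝ} (hA : ∀ i j, A i j = A j i)
    (u v : EuclideanSpace ℝ (Fin n)) : bilin A u v = bilin A v u := by
  rw [bilin_apply, bilin_apply, Finset.sum_comm]
  refine Finset.sum_congr rfl fun i _ => Finset.sum_congr rfl fun j _ => ?_
  rw [hA, mul_comm (u j)]

theorem bilin_nondegenerate {A : Matrix (Fin n) (Fin n) ℝ} (hA : IsUnit A.det)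
    {u : EuclideanSpace ℝ (Fin n)} (h : ∀ v, bilin A u v = 0) : u = 0 := by
  have h1 : Matrix.vecMul u.ofLp A = 0 := by
    ext j
    have := h (EuclideanSpace.single j 1)
    simpa [bilin_apply, Pi.single_apply, Matrix.vecMul, dotProduct, mul_comm] using this
  have h2 := congrArg (fun w => Matrix.vecMul w A⁻¹) h1
  simp only [Matrix.vecMul_vecMul, Matrix.mul_nonsing_inv A hA, Matrix.vecMul_one,
    Matrix.zero_vecMul] at h2
  exact PiLp.ext fun i => congrFun h2 i

theorem bilin_ext {A B : EuclideanSpace ℝ (Fin n) →L[ℝ] EuclideanSpace ℝ (Fin n) →L[ℝ] ℝ}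
    {e : Fin n → EuclideanSpace ℝ (Fin n)} (he : LinearIndependent ℝ e)
    (h : ∀ i j, A (e i) (e j) = B (e i) (e j)) : A = B := by
  rcases isEmpty_or_nonempty (Fin n) with hn | hn
  · exact ContinuousLinearMap.ext fun u => by
      rw [show u = 0 from PiLp.ext fun i => isEmptyElim i, map_zero, map_zero]
  let b := basisOfLinearIndependentOfCardEqFinrank he (by simp)
  have hb : ∀ i, b i = e i := fun i => by simp [b]
  refine ContinuousLinearMap.coe_injective (b.ext fun i => ?_)
  refine ContinuousLinearMap.coe_injective (b.ext fun j => ?_)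
  rw [hb, hb]
  exact h i j

theorem linearIndependent_single :
    LinearIndependent ℝ fun i : Fin n => (EuclideanSpace.single i 1 : EuclideanSpace ℝ (Fin n)) := by
  have h := (EuclideanSpace.basisFun (Fin n) ℝ).toBasis.linearIndependent
  have h2 : ⇑(EuclideanSpace.basisFun (Fin n) ℝ).toBasis =
      fun i : Fin n => (EuclideanSpace.single i 1 : EuclideanSpace ℝ (Fin n)) := by
    ext i : 1
    simp
  rwa [h2] at h

/-- The vector-valued bilinear map with components `T k i j`. -/
def vecBilin (T : Fin n → Fin n → Fin n → ℝ) : EuclideanSpace ℝ (Fin n) →L[ℝ]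
    EuclideanSpace ℝ (Fin n) →L[ℝ] EuclideanSpace ℝ (Fin n) :=
  ∑ q : Fin n × Fin n × Fin n, T q.1 q.2.1 q.2.2 •
    (EuclideanSpace.proj q.2.1 : EuclideanSpace ℝ (Fin n) →L[ℝ] ℝ).smulRight
      ((EuclideanSpace.proj q.2.2 : EuclideanSpace ℝ (Fin n) →L[ℝ] ℝ).smulRight
        (EuclideanSpace.single q.1 (1 : ℝ)))

theorem vecBilin_apply (T : Fin n → Fin n → Fin n → ℝ) (u v : EuclideanSpace ℝ (Fin n))
    (k : Fin n) : vecBilin T u v k = ∑ i, ∑ j, T k i j * (u i * v j) := by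
  simp [vecBilin, Fintype.sum_prod_type, Pi.single_apply]

theorem vecBilin_single (T : Fin n → Fin n → Fin n → ℝ) (i j k : Fin n) :
    vecBilin T (EuclideanSpace.single i 1) (EuclideanSpace.single j 1) k = T k i j := by
  simp [vecBilin_apply]

theorem fderiv_sum_smul_const {ι E F : Type*} [Fintype ι] [NormedAddCommGroup E]
    [NormedSpace ℝ E] [NormedAddCommGroup F] [NormedSpace ℝ F] {c : ι → E → ℝ} (B : ι → F) {y : E}
    (hc : ∀ i, DifferentiableAt ℝ (c i) y) :
    DifferentiableAt ℝ (fun x => ∑ i, c i x • B i) y ∧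
      ∀ w, fderiv ℝ (fun x => ∑ i, c i x • B i) y w = ∑ i, fderiv ℝ (c i) y w • B i := by
  have h : HasFDerivAt (fun x => ∑ i, c i x • B i) (∑ i, (fderiv ℝ (c i) y).smulRight (B i)) y :=
    HasFDerivAt.fun_sum fun i _ => (hc i).hasFDerivAt.smul_const _
  exact ⟨h.differentiableAt, fun w => by simp [h.fderiv]⟩

theorem fderiv_bilin {G : EuclideanSpace ℝ (Fin n) → Matrix (Fin n) (Fin n) ℝ}
    {y : EuclideanSpace ℝ (Fin n)} (hG : ∀ i j, DifferentiableAt ℝ (fun x => G x i j) y) :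
    DifferentiableAt ℝ (fun x => bilin (G x)) y ∧ ∀ w, fderiv ℝ (fun x => bilin (G x)) y w
      = bilin (Matrix.of fun i j => fderiv ℝ (fun x => G x i j) y w) :=
  fderiv_sum_smul_const
    (F := EuclideanSpace ℝ (Fin n) →L[ℝ] EuclideanSpace ℝ (Fin n) →L[ℝ] ℝ)
    (c := fun (q : Fin n × Fin n) x => G x q.1 q.2) _ fun q => hG q.1 q.2

theorem fderiv_vecBilin {T : Fin n → Fin n → Fin n → EuclideanSpace ℝ (Fin n) → ℝ}
    {y : EuclideanSpace ℝ (Fin n)} (hT : ∀ k i j, DifferentiableAt ℝ (T k i j) y) :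
    DifferentiableAt ℝ (fun x => vecBilin fun k i j => T k i j x) y ∧
      ∀ w, fderiv ℝ (fun x => vecBilin fun k i j => T k i j x) y w
        = vecBilin fun k i j => fderiv ℝ (T k i j) y w :=
  fderiv_sum_smul_const (F := EuclideanSpace ℝ (Fin n) →L[ℝ] EuclideanSpace ℝ (Fin n) →L[ℝ]
      EuclideanSpace ℝ (Fin n))
    (c := fun (q : Fin n × Fin n × Fin n) x => T q.1 q.2.1 q.2.2 x) _
    fun q => hT q.1 q.2.1 q.2.2

/-! ## Smooth metrics on open sets -/

/-- `G` is a smooth pseudo-Riemannian metric on `U`. -/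
structure IsMetricOn (G : EuclideanSpace ℝ (Fin n) → Matrix (Fin n) (Fin n) ℝ)
    (U : Set (EuclideanSpace ℝ (Fin n))) : Prop where
  smooth : ∀ i j, ContDiffOn ℝ ∞ (fun x => G x i j) U
  symm : ∀ x ∈ U, ∀ i j, G x i j = G x j i
  det : ∀ x ∈ U, IsUnit (G x).det

theorem IsMetricOn.mono {G : EuclideanSpace ℝ (Fin n) → Matrix (Fin n) (Fin n) ℝ}
    {U V : Set (EuclideanSpace ℝ (Fin n))} (h : IsMetricOn G U) (hV : V ⊆ U) : IsMetricOn G V :=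
  ⟨fun i j => (h.smooth i j).mono hV, fun x hx => h.symm x (hV hx), fun x hx => h.det x (hV hx)⟩

theorem contDiffOn_det {m : ℕ} {E : Type*} [NormedAddCommGroup E] [NormedSpace ℝ E]
    {G : E → Matrix (Fin m) (Fin m) ℝ} {U : Set E}
    (h : ∀ i j, ContDiffOn ℝ ∞ (fun x => G x i j) U) :
    ContDiffOn ℝ ∞ (fun x => (G x).det) U := by
  simp only [Matrix.det_apply]
  refine ContDiffOn.sum fun σ _ => ContDiffOn.const_smul _ ?_
  exact contDiffOn_prod fun i _ => h _ _

theorem contDiffOn_inv {E : Type*} [NormedAddCommGroup E] [NormedSpace ℝ E]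
    {G : E → Matrix (Fin n) (Fin n) ℝ} {U : Set E}
    (h : ∀ i j, ContDiffOn ℝ ∞ (fun x => G x i j) U) (hd : ∀ x ∈ U, IsUnit (G x).det)
    (i j : Fin n) : ContDiffOn ℝ ∞ (fun x => (G x)⁻¹ i j) U := by
  have h1 : ContDiffOn ℝ ∞ (fun x => (G x).det⁻¹ * (G x).adjugate i j) U := by
    refine ((contDiffOn_det h).inv fun x hx => (hd x hx).ne_zero).mul ?_
    simp only [Matrix.adjugate_apply]
    refine contDiffOn_det fun k l => ?_
    by_cases hk : k = j
    · simp only [hk, Matrix.updateRow_self]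
      exact contDiffOn_const
    · simp only [Matrix.updateRow_ne hk]
      exact h k l
  refine h1.congr fun x _ => ?_
  rw [Matrix.inv_def, Matrix.smul_apply, Ring.inverse_eq_inv', smul_eq_mul]

theorem contDiffOn_pd {U : Set (EuclideanSpace ℝ (Fin n))} (hU : IsOpen U)
    {f : EuclideanSpace ℝ (Fin n) → ℝ} (hf : ContDiffOn ℝ ∞ f U) (i : Fin n) :
    ContDiffOn ℝ ∞ (pd i f) U :=
  (hf.fderiv_of_isOpen hU (by simp)).clm_apply contDiffOn_const

theorem IsMetricOn.contDiffOn_christoffel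
    {G : EuclideanSpace ℝ (Fin n) → Matrix (Fin n) (Fin n) ℝ}
    {U : Set (EuclideanSpace ℝ (Fin n))} (h : IsMetricOn G U) (hU : IsOpen U) (k i j : Fin n) :
    ContDiffOn ℝ ∞ (christoffel G k i j) U := by
  refine ContDiffOn.mul contDiffOn_const (ContDiffOn.sum fun l _ => ?_)
  exact (contDiffOn_inv h.smooth h.det k l).mul
    (((contDiffOn_pd hU (h.smooth j l) i).add (contDiffOn_pd hU (h.smooth i l) j)).sub
      (contDiffOn_pd hU (h.smooth i j) l))

theorem IsMetricOn.differentiableAt {G : EuclideanSpace ℝ (Fin n) → Matrix (Fin n) (Fin n) ℝ}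
    {U : Set (EuclideanSpace ℝ (Fin n))} (h : IsMetricOn G U) (hU : IsOpen U)
    {y : EuclideanSpace ℝ (Fin n)} (hy : y ∈ U) (i j : Fin n) :
    DifferentiableAt ℝ (fun x => G x i j) y :=
  ((h.smooth i j).differentiableOn (by simp)).differentiableAt (hU.mem_nhds hy)

theorem IsMetricOn.pd_symm {G : EuclideanSpace ℝ (Fin n) → Matrix (Fin n) (Fin n) ℝ}
    {U : Set (EuclideanSpace ℝ (Fin n))} (h : IsMetricOn G U) (hU : IsOpen U)
    {y : EuclideanSpace ℝ (Fin n)} (hy : y ∈ U) (i j l : Fin n) :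
    pd l (fun x => G x i j) y = pd l (fun x => G x j i) y := by
  unfold pd
  rw [Filter.EventuallyEq.fderiv_eq (f₁ := fun x => G x i j) (f := fun x => G x j i)]
  filter_upwards [hU.mem_nhds hy] with x hx using h.symm x hx i j

theorem IsMetricOn.christoffel_symm {G : EuclideanSpace ℝ (Fin n) → Matrix (Fin n) (Fin n) ℝ}
    {U : Set (EuclideanSpace ℝ (Fin n))} (h : IsMetricOn G U) (hU : IsOpen U)
    {y : EuclideanSpace ℝ (Fin n)} (hy : y ∈ U) (k i j : Fin n) :
    christoffel G k i j y = christoffel G k j i y := by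
  unfold christoffel
  congr 1
  refine Finset.sum_congr rfl fun l _ => ?_
  rw [h.pd_symm hU hy i j l, add_comm (pd i _ y)]

theorem IsMetricOn.sum_mul_christoffel
    {G : EuclideanSpace ℝ (Fin n) → Matrix (Fin n) (Fin n) ℝ}
    {U : Set (EuclideanSpace ℝ (Fin n))} (h : IsMetricOn G U)
    {y : EuclideanSpace ℝ (Fin n)} (hy : y ∈ U) (a i j : Fin n) :
    ∑ k, G y a k * christoffel G k i j y = (1 / 2) * (pd i (fun y => G y j a) y
      + pd j (fun y => G y i a) y - pd a (fun y => G y i j) y) := by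
  have h1 : ∀ l, ∑ k, G y a k * (G y)⁻¹ k l = (1 : Matrix (Fin n) (Fin n) ℝ) a l := fun l => by
    rw [← Matrix.mul_nonsing_inv (G y) (h.det y hy), Matrix.mul_apply]
  calc ∑ k, G y a k * christoffel G k i j y
      = ∑ l, (1 / 2) * ((∑ k, G y a k * (G y)⁻¹ k l) * (pd i (fun y => G y j l) y
        + pd j (fun y => G y i l) y - pd l (fun y => G y i j) y)) := by
        unfold christoffel
        simp only [Finset.mul_sum, Finset.sum_mul]
        rw [Finset.sum_comm]
        refine Finset.sum_congr rfl fun l _ => Finset.sum_congr rfl fun k _ => ?_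
        ring
    _ = _ := by
      simp only [h1, Matrix.one_apply]
      simp

theorem IsMetricOn.pd_eq {G : EuclideanSpace ℝ (Fin n) → Matrix (Fin n) (Fin n) ℝ}
    {U : Set (EuclideanSpace ℝ (Fin n))} (h : IsMetricOn G U) (hU : IsOpen U)
    {y : EuclideanSpace ℝ (Fin n)} (hy : y ∈ U) (l i j : Fin n) :
    pd l (fun x => G x i j) y = ∑ m, christoffel G m l i y * G y m j
      + ∑ m, christoffel G m l j y * G y i m := by
  have h1 := h.sum_mul_christoffel hy j l i
  have h2 := h.sum_mul_christoffel hy i l j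
  have h3 : ∑ m, christoffel G m l i y * G y m j = ∑ k, G y j k * christoffel G k l i y :=
    Finset.sum_congr rfl fun k _ => by rw [h.symm y hy k j, mul_comm]
  have h4 : ∑ m, christoffel G m l j y * G y i m = ∑ k, G y i k * christoffel G k l j y :=
    Finset.sum_congr rfl fun k _ => by rw [mul_comm]
  rw [h3, h4, h1, h2, h.pd_symm hU hy j i l]
  ring

/-! ## The Levi-Civita connection -/

/-- The Christoffel symbols as a bilinear map. -/
def gam (G : EuclideanSpace ℝ (Fin n) → Matrix (Fin n) (Fin n) ℝ)
    (x : EuclideanSpace ℝ (Fin n)) := vecBilin fun k i j => christoffel G k i j x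

theorem IsMetricOn.gam_symm {G : EuclideanSpace ℝ (Fin n) → Matrix (Fin n) (Fin n) ℝ}
    {U : Set (EuclideanSpace ℝ (Fin n))} (h : IsMetricOn G U) (hU : IsOpen U)
    {y : EuclideanSpace ℝ (Fin n)} (hy : y ∈ U) (u v : EuclideanSpace ℝ (Fin n)) :
    gam G y u v = gam G y v u := by
  refine PiLp.ext fun k => ?_
  simp only [gam, vecBilin_apply]
  rw [Finset.sum_comm]
  refine Finset.sum_congr rfl fun i _ => Finset.sum_congr rfl fun j _ => ?_
  rw [h.christoffel_symm hU hy, mul_comm (u j)]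

theorem fderiv_apply_eq_sum_pd (f : EuclideanSpace ℝ (Fin n) → ℝ)
    (y w : EuclideanSpace ℝ (Fin n)) : fderiv ℝ f y w = ∑ l, w l * pd l f y := by
  have h1 : w = ∑ l, w l • (EuclideanSpace.single l 1 : EuclideanSpace ℝ (Fin n)) := by
    refine PiLp.ext fun k => ?_
    simp [Pi.single_apply]
  conv_lhs => rw [h1]
  simp only [map_sum, map_smul, smul_eq_mul]
  rfl

/-- The Levi-Civita connection preserves the metric; expanding the coordinate identity `pd_eq`
multilinearly makes it available for arbitrary vectors. -/
theorem IsMetricOn.compat {G : EuclideanSpace ℝ (Fin n) → Matrix (Fin n) (Fin n) ℝ}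
    {U : Set (EuclideanSpace ℝ (Fin n))} (h : IsMetricOn G U) (hU : IsOpen U)
    {y : EuclideanSpace ℝ (Fin n)} (hy : y ∈ U) (w u v : EuclideanSpace ℝ (Fin n)) :
    bilin (Matrix.of fun i j => fderiv ℝ (fun x => G x i j) y w) u v =
      bilin (G y) (gam G y w u) v + bilin (G y) u (gam G y w v) := by
  have key : ∀ l, bilin (Matrix.of fun i j => pd l (fun x => G x i j) y) =
      (bilin (G y)).comp (gam G y (EuclideanSpace.single l 1))
        + ((bilin (G y)).flip.comp (gam G y (EuclideanSpace.single l 1))).flip := by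
    intro l
    refine bilin_ext linearIndependent_single fun i j => ?_
    simp only [_root_.add_apply, ContinuousLinearMap.comp_apply,
      ContinuousLinearMap.flip_apply]
    rw [bilin_single, Matrix.of_apply, h.pd_eq hU hy]
    congr 1
    · simp [bilin_apply, gam, vecBilin_single, mul_comm]
    · simp [bilin_apply, gam, vecBilin_single, mul_comm]
  have h1 : w = ∑ l, w l • (EuclideanSpace.single l 1 : EuclideanSpace ℝ (Fin n)) := by
    refine PiLp.ext fun k => ?_
    simp [Pi.single_apply]
  have h2 : bilin (Matrix.of fun i j => fderiv ℝ (fun x => G x i j) y w) =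
      ∑ l, w l • bilin (Matrix.of fun i j => pd l (fun x => G x i j) y) := by
    refine bilin_ext linearIndependent_single fun i j => ?_
    rw [bilin_single, Matrix.of_apply, fderiv_apply_eq_sum_pd]
    simp only [_root_.sum_apply, _root_.smul_apply, bilin_single,
      smul_eq_mul, Matrix.of_apply]
  rw [h2]
  conv_rhs => rw [h1]
  simp only [key, map_sum, map_smul, _root_.sum_apply,
    _root_.smul_apply, _root_.add_apply, ContinuousLinearMap.comp_apply,
    ContinuousLinearMap.flip_apply, smul_add, Finset.sum_add_distrib]

/-- The covariant derivative. -/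
def cov (G : EuclideanSpace ℝ (Fin n) → Matrix (Fin n) (Fin n) ℝ)
    (V W : EuclideanSpace ℝ (Fin n) → EuclideanSpace ℝ (Fin n)) (x : EuclideanSpace ℝ (Fin n)) :
    EuclideanSpace ℝ (Fin n) :=
  fderiv ℝ W x (V x) + gam G x (V x) (W x)

theorem fderiv_bilin_apply {G : EuclideanSpace ℝ (Fin n) → Matrix (Fin n) (Fin n) ℝ}
    {V W : EuclideanSpace ℝ (Fin n) → EuclideanSpace ℝ (Fin n)} {y : EuclideanSpace ℝ (Fin n)}
    (hG : ∀ i j, DifferentiableAt ℝ (fun x => G x i j) y)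
    (hV : DifferentiableAt ℝ V y) (hW : DifferentiableAt ℝ W y) (w : EuclideanSpace ℝ (Fin n)) :
    fderiv ℝ (fun x => bilin (G x) (V x) (W x)) y w =
      bilin (Matrix.of fun i j => fderiv ℝ (fun x => G x i j) y w) (V y) (W y)
        + bilin (G y) (fderiv ℝ V y w) (W y) + bilin (G y) (V y) (fderiv ℝ W y w) := by
  obtain ⟨hL, hLw⟩ := fderiv_bilin hG
  have := ((hL.hasFDerivAt.clm_apply hV.hasFDerivAt).clm_apply hW.hasFDerivAt).fderiv
  rw [this, ← hLw]
  simp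
  ring

theorem IsMetricOn.fderiv_bilin {G : EuclideanSpace ℝ (Fin n) → Matrix (Fin n) (Fin n) ℝ}
    {U : Set (EuclideanSpace ℝ (Fin n))} (h : IsMetricOn G U) (hU : IsOpen U)
    {V W Z : EuclideanSpace ℝ (Fin n) → EuclideanSpace ℝ (Fin n)} {y : EuclideanSpace ℝ (Fin n)}
    (hy : y ∈ U) (hV : DifferentiableAt ℝ V y) (hW : DifferentiableAt ℝ W y) :
    fderiv ℝ (fun x => bilin (G x) (V x) (W x)) y (Z y) =
      bilin (G y) (cov G Z V y) (W y) + bilin (G y) (V y) (cov G Z W y) := by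
  rw [fderiv_bilin_apply (h.differentiableAt hU hy) hV hW, h.compat hU hy]
  simp only [cov, map_add, _root_.add_apply]
  ring

/-- The curvature tensor as a trilinear map. -/
def curv (G : EuclideanSpace ℝ (Fin n) → Matrix (Fin n) (Fin n) ℝ)
    (x u v w : EuclideanSpace ℝ (Fin n)) : EuclideanSpace ℝ (Fin n) :=
  fderiv ℝ (gam G) x u v w - fderiv ℝ (gam G) x v u w
    + gam G x u (gam G x v w) - gam G x v (gam G x u w)

theorem IsMetricOn.hasFDerivAt_gam {G : EuclideanSpace ℝ (Fin n) → Matrix (Fin n) (Fin n) ℝ}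
    {U : Set (EuclideanSpace ℝ (Fin n))} (h : IsMetricOn G U) (hU : IsOpen U)
    {y : EuclideanSpace ℝ (Fin n)} (hy : y ∈ U) : HasFDerivAt (gam G) (fderiv ℝ (gam G) y) y ∧
      ∀ w, fderiv ℝ (gam G) y w = vecBilin fun k i j => fderiv ℝ (christoffel G k i j) y w := by
  obtain ⟨hL, hLw⟩ := fderiv_vecBilin (T := fun k i j => christoffel G k i j) (y := y)
    fun k i j => ((h.contDiffOn_christoffel hU k i j).differentiableOn
      (by simp)).differentiableAt (hU.mem_nhds hy)
  exact ⟨hL.hasFDerivAt, hLw⟩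

theorem IsMetricOn.curv_single {G : EuclideanSpace ℝ (Fin n) → Matrix (Fin n) (Fin n) ℝ}
    {U : Set (EuclideanSpace ℝ (Fin n))} (h : IsMetricOn G U) (hU : IsOpen U)
    {y : EuclideanSpace ℝ (Fin n)} (hy : y ∈ U) (i j k l : Fin n) :
    curv G y (EuclideanSpace.single i 1) (EuclideanSpace.single j 1) (EuclideanSpace.single k 1) l
      = riemann G l k i j y := by
  have h1 : ∀ a b c, gam G y (EuclideanSpace.single a 1) (gam G y (EuclideanSpace.single b 1)
      (EuclideanSpace.single c 1)) l = ∑ m, christoffel G l a m y * christoffel G m b c y := by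
    intro a b c
    conv_lhs => rw [gam, vecBilin_apply]
    simp [vecBilin_single]
  simp only [curv, riemann, PiLp.add_apply, PiLp.sub_apply, h1, (h.hasFDerivAt_gam hU hy).2,
    vecBilin_single, Finset.sum_sub_distrib]
  unfold pd
  ring

/-- The curvature tensor is the commutator of covariant derivatives. -/
theorem IsMetricOn.curv_eq {G : EuclideanSpace ℝ (Fin n) → Matrix (Fin n) (Fin n) ℝ}
    {U : Set (EuclideanSpace ℝ (Fin n))} (h : IsMetricOn G U) (hU : IsOpen U)
    {V W Z : EuclideanSpace ℝ (Fin n) → EuclideanSpace ℝ (Fin n)}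
    (hV : ContDiffOn ℝ ∞ V U) (hW : ContDiffOn ℝ ∞ W U) (hZ : ContDiffOn ℝ ∞ Z U)
    {y : EuclideanSpace ℝ (Fin n)} (hy : y ∈ U) :
    curv G y (V y) (W y) (Z y) = cov G V (cov G W Z) y - cov G W (cov G V Z) y
      - cov G (VectorField.lieBracket ℝ V W) Z y := by
  have d : ∀ {X : EuclideanSpace ℝ (Fin n) → EuclideanSpace ℝ (Fin n)}, ContDiffOn ℝ ∞ X U →
      HasFDerivAt X (fderiv ℝ X y) y := fun hX =>
    ((hX.differentiableOn (by simp)).differentiableAt (hU.mem_nhds hy)).hasFDerivAt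
  have hdZ : HasFDerivAt (fderiv ℝ Z) (fderiv ℝ (fderiv ℝ Z) y) y :=
    (((hZ.fderiv_of_isOpen hU (m := ∞) (by simp)).differentiableOn
      (by simp)).differentiableAt (hU.mem_nhds hy)).hasFDerivAt
  have hsymm : ∀ u v, fderiv ℝ (fderiv ℝ Z) y u v = fderiv ℝ (fderiv ℝ Z) y v u := fun u v =>
    second_derivative_symmetric_of_eventually (f := Z) (f' := fderiv ℝ Z)
      (by filter_upwards [hU.mem_nhds hy] with z hz using
        ((hZ.differentiableOn (by simp)).differentiableAt (hU.mem_nhds hz)).hasFDerivAt) hdZ _ _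
  have hΓ := (h.hasFDerivAt_gam hU hy).1
  -- In the commutator, the second derivatives of `Z` cancel by symmetry and the first derivatives
  -- of the two fields combine to their bracket.
  have key : ∀ {X Y : EuclideanSpace ℝ (Fin n) → EuclideanSpace ℝ (Fin n)},
      ContDiffOn ℝ ∞ Y U →
      cov G X (cov G Y Z) y = fderiv ℝ (fderiv ℝ Z) y (X y) (Y y)
        + fderiv ℝ Z y (fderiv ℝ Y y (X y)) + fderiv ℝ (gam G) y (X y) (Y y) (Z y)
        + gam G y (fderiv ℝ Y y (X y)) (Z y) + gam G y (Y y) (fderiv ℝ Z y (X y))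
        + gam G y (X y) (fderiv ℝ Z y (Y y)) + gam G y (X y) (gam G y (Y y) (Z y)) := by
    intro X Y hY
    have h1 : HasFDerivAt (cov G Y Z) _ y :=
      (hdZ.clm_apply (d hY)).add ((hΓ.clm_apply (d hY)).clm_apply (d hZ))
    conv_lhs => rw [cov]
    rw [h1.fderiv]
    simp only [cov, _root_.add_apply, ContinuousLinearMap.comp_apply,
      ContinuousLinearMap.flip_apply, map_add]
    abel
  rw [key hW, key hV, hsymm (W y) (V y)]
  simp only [cov, curv, VectorField.lieBracket, map_sub, _root_.sub_apply]
  abel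

end Coord

namespace Coord

variable {n : ℕ}

/-! ## The Ricci tensor in a moving frame -/

theorem eq_zero_of_bilin_frame {A : Matrix (Fin n) (Fin n) ℝ} (hA : IsUnit A.det)
    {e : Fin n → EuclideanSpace ℝ (Fin n)} (he : LinearIndependent ℝ e)
    {u : EuclideanSpace ℝ (Fin n)} (h : ∀ a, bilin A u (e a) = 0) : u = 0 := by
  rcases isEmpty_or_nonempty (Fin n) with hn | hn
  · exact PiLp.ext fun i => isEmptyElim i
  let b := basisOfLinearIndependentOfCardEqFinrank he (by simp)
  have hb : ∀ i, b i = e i := fun i => by simp [b]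
  refine bilin_nondegenerate hA fun v => ?_
  have : (bilin A u : EuclideanSpace ℝ (Fin n) →ₗ[ℝ] ℝ) = 0 := b.ext fun i => by
    rw [hb]; exact h i
  exact LinearMap.congr_fun this v

/-- Both sides are the trace of `L`. This turns the contraction that defines the Ricci tensor into a
sum over a frame. -/
theorem sum_apply_single_eq_sum_of_frame {e : Fin n → EuclideanSpace ℝ (Fin n)}
    (he : LinearIndependent ℝ e)
    (L : EuclideanSpace ℝ (Fin n) →ₗ[ℝ] EuclideanSpace ℝ (Fin n)) {m : Fin n → Fin n → ℝ}
    (hL : ∀ a, L (e a) = ∑ d, m a d • e d) :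
    ∑ i, L (EuclideanSpace.single i 1) i = ∑ a, m a a := by
  rcases isEmpty_or_nonempty (Fin n) with hn | hn
  · simp
  let b := basisOfLinearIndependentOfCardEqFinrank he (by simp)
  have hb : ∀ i, b i = e i := fun i => by simp [b]
  have h1 := LinearMap.trace_eq_matrix_trace ℝ b L
  have h2 := LinearMap.trace_eq_matrix_trace ℝ (EuclideanSpace.basisFun (Fin n) ℝ).toBasis L
  rw [h1] at h2
  simp only [Matrix.trace, Matrix.diag_apply, LinearMap.toMatrix_apply] at h2
  have h3 : ∀ a, b.repr (L (b a)) a = m a a := fun a => by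
    rw [hb, hL]
    simp only [← hb, map_sum, map_smul, Finsupp.coe_finsetSum, Finset.sum_apply,
      Finsupp.smul_apply, Module.Basis.repr_self, Finsupp.single_apply, smul_eq_mul, mul_ite,
      mul_one, mul_zero, Finset.sum_ite_eq', Finset.mem_univ, if_true]
  simp only [h3] at h2
  rw [h2]
  refine Finset.sum_congr rfl fun i _ => ?_
  simp

/-- A smooth frame on `U` with connection coefficients `κ a b c`, the coefficient of `e c` in
`∇_{e a} (e b)`. -/
structure IsFrameOn (G : EuclideanSpace ℝ (Fin n) → Matrix (Fin n) (Fin n) ℝ)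
    (e : Fin n → EuclideanSpace ℝ (Fin n) → EuclideanSpace ℝ (Fin n))
    (κ : Fin n → Fin n → Fin n → EuclideanSpace ℝ (Fin n) → ℝ)
    (U : Set (EuclideanSpace ℝ (Fin n))) : Prop where
  smooth : ∀ a, ContDiffOn ℝ ∞ (e a) U
  indep : ∀ y ∈ U, LinearIndependent ℝ fun a => e a y
  smooth_coeff : ∀ a b c, ContDiffOn ℝ ∞ (κ a b c) U
  torsion : ∀ y ∈ U, ∀ a b, VectorField.lieBracket ℝ (e a) (e b) y
    = ∑ c, (κ a b c y - κ b a c y) • e c y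
  metric : ∀ y ∈ U, ∀ a b c, fderiv ℝ (fun x => bilin (G x) (e a x) (e b x)) y (e c y)
    = ∑ d, κ c a d y * bilin (G y) (e d y) (e b y) + ∑ d, κ c b d y * bilin (G y) (e a y) (e d y)

variable {G : EuclideanSpace ℝ (Fin n) → Matrix (Fin n) (Fin n) ℝ}
  {e : Fin n → EuclideanSpace ℝ (Fin n) → EuclideanSpace ℝ (Fin n)}
  {κ : Fin n → Fin n → Fin n → EuclideanSpace ℝ (Fin n) → ℝ}
  {U : Set (EuclideanSpace ℝ (Fin n))}

theorem IsFrameOn.differentiableAt (f : IsFrameOn G e κ U) (hU : IsOpen U)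
    {y : EuclideanSpace ℝ (Fin n)} (hy : y ∈ U) (a : Fin n) : DifferentiableAt ℝ (e a) y :=
  ((f.smooth a).differentiableOn (by simp)).differentiableAt (hU.mem_nhds hy)

/-- Uniqueness of the Levi-Civita connection: the defect `S`, paired with the frame, is symmetric in
its first two indices by the torsion equations and skew in its last two by metric compatibility. A
three-index array with both symmetries vanishes. Hence a proposed table of connection coefficients
only has to be checked against `torsion` and `metric`. -/
theorem IsFrameOn.cov_eq (f : IsFrameOn G e κ U) (h : IsMetricOn G U) (hU : IsOpen U)
    {y : EuclideanSpace ℝ (Fin n)} (hy : y ∈ U) (a b : Fin n) :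
    cov G (e a) (e b) y = ∑ c, κ a b c y • e c y := by
  let S : Fin n → Fin n → EuclideanSpace ℝ (Fin n) := fun a b =>
    cov G (e a) (e b) y - ∑ c, κ a b c y • e c y
  have hS1 : ∀ a b, S a b = S b a := by
    intro a b
    have h1 := f.torsion y hy a b
    simp only [sub_smul, Finset.sum_sub_distrib, VectorField.lieBracket] at h1
    simp only [S, cov]
    rw [h.gam_symm hU hy (e b y)]
    have : fderiv ℝ (e b) y (e a y) = fderiv ℝ (e a) y (e b y)
        + (∑ c, κ a b c y • e c y - ∑ c, κ b a c y • e c y) := by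
      rw [← h1]; abel
    rw [this]
    abel
  have hS2 : ∀ c a b, bilin (G y) (S c a) (e b y) = - bilin (G y) (S c b) (e a y) := by
    intro c a b
    have h1 := h.fderiv_bilin hU (Z := e c) hy (f.differentiableAt hU hy a)
      (f.differentiableAt hU hy b)
    rw [f.metric y hy a b c] at h1
    simp only [S, map_sub, map_sum, map_smul, _root_.sub_apply, _root_.sum_apply,
      _root_.smul_apply, smul_eq_mul]
    have h2 : ∀ u, bilin (G y) u (e a y) = bilin (G y) (e a y) u := fun u =>
      bilin_symm (h.symm y hy) _ _
    simp only [h2]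
    linarith
  have hS : ∀ a b c, bilin (G y) (S a b) (e c y) = 0 := by
    intro a b c
    have e1 := hS2 a b c
    have e2 := hS2 c a b
    have e3 := hS2 b c a
    rw [hS1 c a] at e2
    rw [hS1 b c] at e3
    rw [hS1 b a] at e3
    linarith
  exact sub_eq_zero.1 (eq_zero_of_bilin_frame (h.det y hy) (f.indep y hy) (hS a b))

theorem IsFrameOn.curv_eq (f : IsFrameOn G e κ U) (h : IsMetricOn G U) (hU : IsOpen U)
    {y : EuclideanSpace ℝ (Fin n)} (hy : y ∈ U) (a b c : Fin n) :
    curv G y (e a y) (e b y) (e c y) = ∑ d, (fderiv ℝ (κ b c d) y (e a y)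
      - fderiv ℝ (κ a c d) y (e b y) + ∑ k, (κ b c k y * κ a k d y - κ a c k y * κ b k d y
        - (κ a b k y - κ b a k y) * κ k c d y)) • e d y := by
  have key : ∀ a b c, cov G (e a) (cov G (e b) (e c)) y =
      ∑ d, (fderiv ℝ (κ b c d) y (e a y) + ∑ k, κ b c k y * κ a k d y) • e d y := by
    intro a b c
    have hκ : ∀ d, HasFDerivAt (κ b c d) (fderiv ℝ (κ b c d) y) y := fun d =>
      (((f.smooth_coeff b c d).differentiableOn (by simp)).differentiableAt
        (hU.mem_nhds hy)).hasFDerivAt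
    have h1 : HasFDerivAt (cov G (e b) (e c)) _ y :=
      (HasFDerivAt.fun_sum (u := Finset.univ) fun d _ =>
        (hκ d).smul (f.differentiableAt hU hy d).hasFDerivAt).congr_of_eventuallyEq
        (by filter_upwards [hU.mem_nhds hy] with x hx using f.cov_eq h hU hx b c)
    have h2 : ∀ k, cov G (e a) (e k) y = ∑ d, κ a k d y • e d y := fun k => f.cov_eq h hU hy a k
    calc cov G (e a) (cov G (e b) (e c)) y
        = ∑ k, (fderiv ℝ (κ b c k) y (e a y) • e k y + κ b c k y • cov G (e a) (e k) y) := by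
          conv_lhs => rw [cov, h1.fderiv, f.cov_eq h hU hy b c]
          simp only [cov, _root_.sum_apply, _root_.add_apply, _root_.smul_apply,
            ContinuousLinearMap.smulRight_apply, map_sum, map_smul, smul_add,
            Finset.sum_add_distrib]
          abel
      _ = _ := by
          simp only [h2, add_smul, Finset.sum_add_distrib, Finset.smul_sum, smul_smul,
            Finset.sum_smul]
          congr 1
          rw [Finset.sum_comm]
  have hbr : cov G (VectorField.lieBracket ℝ (e a) (e b)) (e c) y
      = ∑ d, (∑ k, (κ a b k y - κ b a k y) * κ k c d y) • e d y := by
    have h2 : ∀ k, cov G (e k) (e c) y = ∑ d, κ k c d y • e d y := fun k => f.cov_eq h hU hy k c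
    calc cov G (VectorField.lieBracket ℝ (e a) (e b)) (e c) y
        = ∑ k, (κ a b k y - κ b a k y) • cov G (e k) (e c) y := by
          conv_lhs => rw [cov, f.torsion y hy a b]
          simp only [cov, map_sum, map_smul, _root_.sum_apply, _root_.smul_apply, smul_add,
            Finset.sum_add_distrib]
      _ = _ := by
          simp only [h2, Finset.smul_sum, smul_smul, Finset.sum_smul]
          rw [Finset.sum_comm]
  rw [h.curv_eq hU (f.smooth a) (f.smooth b) (f.smooth c) hy, key, key, hbr]
  simp only [← Finset.sum_sub_distrib, ← sub_smul]
  refine Finset.sum_congr rfl fun d _ => ?_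
  congr 1
  simp only [Finset.sum_sub_distrib]
  ring

/-- The curvature as a linear map in its first argument. -/
def curvLin (G : EuclideanSpace ℝ (Fin n) → Matrix (Fin n) (Fin n) ℝ)
    (y v w : EuclideanSpace ℝ (Fin n)) :
    EuclideanSpace ℝ (Fin n) →ₗ[ℝ] EuclideanSpace ℝ (Fin n) where
  toFun u := curv G y u v w
  map_add' u u' := by
    simp only [curv, map_add, _root_.add_apply]
    abel
  map_smul' c u := by
    simp only [curv, map_smul, _root_.smul_apply, RingHom.id_apply, smul_sub, smul_add]

theorem IsMetricOn.bilin_ricci (h : IsMetricOn G U) (hU : IsOpen U)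
    {y : EuclideanSpace ℝ (Fin n)} (hy : y ∈ U) (w v : EuclideanSpace ℝ (Fin n)) :
    bilin (Matrix.of fun k j => ricci G k j y) w v
      = ∑ i, curv G y (EuclideanSpace.single i 1) v w i := by
  have h1 : ∀ (z : EuclideanSpace ℝ (Fin n)),
      z = ∑ l, z l • (EuclideanSpace.single l 1 : EuclideanSpace ℝ (Fin n)) := by
    intro z
    refine PiLp.ext fun k => ?_
    simp [Pi.single_apply]
  have h2 : ∀ i, curv G y (EuclideanSpace.single i 1) v w i
      = ∑ k, ∑ j, riemann G i k i j y * (w k * v j) := by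
    intro i
    have h3 : curv G y (EuclideanSpace.single i 1) v w
        = ∑ k, ∑ j, (w k * v j) • curv G y (EuclideanSpace.single i 1)
            (EuclideanSpace.single j 1) (EuclideanSpace.single k 1) := by
      conv_lhs => rw [h1 v, h1 w]
      simp only [curv, map_sum, map_smul, _root_.sum_apply, _root_.smul_apply, smul_sub,
        smul_add, Finset.smul_sum, smul_smul, Finset.sum_sub_distrib, Finset.sum_add_distrib]
    have h4 := congrArg (EuclideanSpace.proj i : EuclideanSpace ℝ (Fin n) →L[ℝ] ℝ) h3
    simp only [map_sum, map_smul, PiLp.proj_apply, h.curv_single hU hy, smul_eq_mul] at h4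
    rw [h4]
    simp only [mul_comm]
  rw [bilin_apply]
  simp only [h2, Matrix.of_apply, ricci, Finset.sum_mul]
  rw [Finset.sum_comm (f := fun i k => ∑ j, riemann G i k i j y * (w k * v j))]
  exact Finset.sum_congr rfl fun k _ => Finset.sum_comm

/-- The Ricci tensor in terms of the connection coefficients of a frame. -/
theorem IsFrameOn.ricci_eq (f : IsFrameOn G e κ U) (h : IsMetricOn G U) (hU : IsOpen U)
    {y : EuclideanSpace ℝ (Fin n)} (hy : y ∈ U) (c b : Fin n) :
    bilin (Matrix.of fun k j => ricci G k j y) (e c y) (e b y)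
      = ∑ a, (fderiv ℝ (κ b c a) y (e a y) - fderiv ℝ (κ a c a) y (e b y)
        + ∑ k, (κ b c k y * κ a k a y - κ a c k y * κ b k a y
          - (κ a b k y - κ b a k y) * κ k c a y)) := by
  rw [h.bilin_ricci hU hy]
  exact sum_apply_single_eq_sum_of_frame (f.indep y hy) (curvLin G y (e b y) (e c y))
    (fun a => f.curv_eq h hU hy a b c)

/-! ## The Lie derivative of the metric -/

/-- In a frame with constant inner products the first term drops out, and the Lie derivative of the
metric is determined by brackets alone. -/
theorem bilin_lieDerivMetric {X V W : EuclideanSpace ℝ (Fin n) → EuclideanSpace ℝ (Fin n)}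
    {y : EuclideanSpace ℝ (Fin n)} (hG : ∀ i j, DifferentiableAt ℝ (fun x => G x i j) y)
    (hX : DifferentiableAt ℝ X y) (hV : DifferentiableAt ℝ V y) (hW : DifferentiableAt ℝ W y) :
    bilin (Matrix.of fun i j => lieDerivMetric G X i j y) (V y) (W y)
      = fderiv ℝ (fun x => bilin (G x) (V x) (W x)) y (X y)
        - bilin (G y) (VectorField.lieBracket ℝ X V y) (W y)
        - bilin (G y) (V y) (VectorField.lieBracket ℝ X W y) := by
  have hXk : ∀ i k, pd i (fun x => X x k) y = fderiv ℝ X y (EuclideanSpace.single i 1) k := by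
    intro i k
    have : HasFDerivAt (fun x => X x k)
        ((EuclideanSpace.proj k : EuclideanSpace ℝ (Fin n) →L[ℝ] ℝ).comp (fderiv ℝ X y)) y :=
      (EuclideanSpace.proj k : EuclideanSpace ℝ (Fin n) →L[ℝ] ℝ).hasFDerivAt.comp y hX.hasFDerivAt
    rw [pd, this.fderiv]
    rfl
  have key : bilin (Matrix.of fun i j => lieDerivMetric G X i j y) =
      bilin (Matrix.of fun i j => fderiv ℝ (fun x => G x i j) y (X y))
        + (bilin (G y)).comp (fderiv ℝ X y) + ((bilin (G y)).flip.comp (fderiv ℝ X y)).flip := by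
    refine bilin_ext linearIndependent_single fun i j => ?_
    simp only [_root_.add_apply, ContinuousLinearMap.comp_apply,
      ContinuousLinearMap.flip_apply]
    rw [bilin_single, bilin_single, Matrix.of_apply, Matrix.of_apply, fderiv_apply_eq_sum_pd]
    simp only [lieDerivMetric, Finset.sum_add_distrib, hXk]
    congr 1
    · congr 1
      simp [bilin_apply]
    · simp [bilin_apply]
  rw [key, fderiv_bilin_apply hG hV hW]
  simp only [_root_.add_apply, ContinuousLinearMap.comp_apply, ContinuousLinearMap.flip_apply,
    VectorField.lieBracket, map_sub, _root_.sub_apply]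
  ring

end Coord

namespace Coord

variable {n : ℕ}

/-! ## Changes of coordinates -/

/-- `χ` is a smooth change of coordinates, and `G'` is the pull-back of the metric `G`. -/
structure IsChange (χ : OpenPartialHomeomorph (EuclideanSpace ℝ (Fin n)) (EuclideanSpace ℝ (Fin n)))
    (G' G : EuclideanSpace ℝ (Fin n) → Matrix (Fin n) (Fin n) ℝ) : Prop where
  smooth : ContDiffOn ℝ ∞ χ χ.source
  smooth_symm : ContDiffOn ℝ ∞ χ.symm χ.target
  pull : ∀ x ∈ χ.source, ∀ i j, G' x i j = bilin (G (χ x))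
    (fderiv ℝ χ x (EuclideanSpace.single i 1)) (fderiv ℝ χ x (EuclideanSpace.single j 1))

variable {χ : OpenPartialHomeomorph (EuclideanSpace ℝ (Fin n)) (EuclideanSpace ℝ (Fin n))}
  {G' G : EuclideanSpace ℝ (Fin n) → Matrix (Fin n) (Fin n) ℝ}

/-- The pull-back of a bilinear form by a linear map. -/
def pullBilin (B : EuclideanSpace ℝ (Fin n) →L[ℝ] EuclideanSpace ℝ (Fin n) →L[ℝ] ℝ)
    (L : EuclideanSpace ℝ (Fin n) →L[ℝ] EuclideanSpace ℝ (Fin n)) :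
    EuclideanSpace ℝ (Fin n) →L[ℝ] EuclideanSpace ℝ (Fin n) →L[ℝ] ℝ :=
  ((B.comp L).flip.comp L).flip

theorem hasFDerivAt_change (hχ : ContDiffOn ℝ ∞ χ χ.source) {x : EuclideanSpace ℝ (Fin n)}
    (hx : x ∈ χ.source) : HasFDerivAt χ (fderiv ℝ χ x) x :=
  ((hχ.differentiableOn (by simp)).differentiableAt (χ.open_source.mem_nhds hx)).hasFDerivAt

theorem fderiv_symm_comp_fderiv (hχ : ContDiffOn ℝ ∞ χ χ.source)
    (hχ' : ContDiffOn ℝ ∞ χ.symm χ.target) {x : EuclideanSpace ℝ (Fin n)}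
    (hx : x ∈ χ.source) (v : EuclideanSpace ℝ (Fin n)) :
    fderiv ℝ χ.symm (χ x) (fderiv ℝ χ x v) = v := by
  have h1 := (hasFDerivAt_change (χ := χ.symm) hχ' (χ.map_source hx)).comp x
    (hasFDerivAt_change hχ hx)
  have h2 : HasFDerivAt (χ.symm ∘ χ) (ContinuousLinearMap.id ℝ _) x := by
    refine (hasFDerivAt_id x).congr_of_eventuallyEq ?_
    filter_upwards [χ.open_source.mem_nhds hx] with z hz using χ.left_inv hz
  exact congrArg (fun L => L v) (h1.unique h2)

theorem fderiv_comp_fderiv_symm (hχ : ContDiffOn ℝ ∞ χ χ.source)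
    (hχ' : ContDiffOn ℝ ∞ χ.symm χ.target) {x : EuclideanSpace ℝ (Fin n)}
    (hx : x ∈ χ.source) (v : EuclideanSpace ℝ (Fin n)) :
    fderiv ℝ χ x (fderiv ℝ χ.symm (χ x) v) = v := by
  have := fderiv_symm_comp_fderiv (χ := χ.symm) hχ' hχ (χ.map_source hx) v
  rwa [χ.left_inv hx] at this

theorem linearIndependent_fderiv_change (hχ : ContDiffOn ℝ ∞ χ χ.source)
    (hχ' : ContDiffOn ℝ ∞ χ.symm χ.target) {x : EuclideanSpace ℝ (Fin n)}
    (hx : x ∈ χ.source) :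
    LinearIndependent ℝ fun i : Fin n => fderiv ℝ χ x (EuclideanSpace.single i 1) :=
  LinearIndependent.map' linearIndependent_single
    (fderiv ℝ χ x : EuclideanSpace ℝ (Fin n) →ₗ[ℝ] EuclideanSpace ℝ (Fin n))
    (LinearMap.ker_eq_bot_of_injective
      (Function.LeftInverse.injective (g := fderiv ℝ χ.symm (χ x))
        (fderiv_symm_comp_fderiv hχ hχ' hx)))

theorem fderiv_comp_symm_apply {F : Type*} [NormedAddCommGroup F] [NormedSpace ℝ F]
    {f : EuclideanSpace ℝ (Fin n) → F} (hχ : ContDiffOn ℝ ∞ χ χ.source)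
    (hχ' : ContDiffOn ℝ ∞ χ.symm χ.target) {x : EuclideanSpace ℝ (Fin n)}
    (hx : x ∈ χ.source) (hf : DifferentiableAt ℝ f x) (v : EuclideanSpace ℝ (Fin n)) :
    fderiv ℝ (fun y => f (χ.symm y)) (χ x) (fderiv ℝ χ x v) = fderiv ℝ f x v := by
  have hf' : HasFDerivAt f (fderiv ℝ f x) (χ.symm (χ x)) := by
    rw [χ.left_inv hx]; exact hf.hasFDerivAt
  have h1 := hf'.comp (χ x) (hasFDerivAt_change (χ := χ.symm) hχ' (χ.map_source hx))
  have h2 : fderiv ℝ (fun y => f (χ.symm y)) (χ x) = _ := h1.fderiv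
  rw [h2, ContinuousLinearMap.comp_apply, fderiv_symm_comp_fderiv hχ hχ' hx]

theorem IsChange.bilin_pull (c : IsChange χ G' G) {x : EuclideanSpace ℝ (Fin n)}
    (hx : x ∈ χ.source) (u v : EuclideanSpace ℝ (Fin n)) :
    bilin (G' x) u v = bilin (G (χ x)) (fderiv ℝ χ x u) (fderiv ℝ χ x v) := by
  have : bilin (G' x) = pullBilin (bilin (G (χ x))) (fderiv ℝ χ x) := by
    refine bilin_ext linearIndependent_single fun i j => ?_
    rw [bilin_single, c.pull x hx]
    rfl
  rw [this]
  rfl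

theorem contDiffOn_fderiv_change (hχ : ContDiffOn ℝ ∞ χ χ.source)
    (v : EuclideanSpace ℝ (Fin n)) : ContDiffOn ℝ ∞ (fun x => fderiv ℝ χ x v) χ.source :=
  (hχ.fderiv_of_isOpen χ.open_source (by simp)).clm_apply contDiffOn_const

theorem contDiffOn_bilin {G : EuclideanSpace ℝ (Fin n) → Matrix (Fin n) (Fin n) ℝ}
    {V W : EuclideanSpace ℝ (Fin n) → EuclideanSpace ℝ (Fin n)} {U : Set (EuclideanSpace ℝ (Fin n))}
    (hG : ∀ i j, ContDiffOn ℝ ∞ (fun x => G x i j) U) (hV : ContDiffOn ℝ ∞ V U)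
    (hW : ContDiffOn ℝ ∞ W U) : ContDiffOn ℝ ∞ (fun x => bilin (G x) (V x) (W x)) U := by
  simp only [bilin_apply]
  have hp : ∀ {X : EuclideanSpace ℝ (Fin n) → EuclideanSpace ℝ (Fin n)}, ContDiffOn ℝ ∞ X U →
      ∀ i, ContDiffOn ℝ ∞ (fun x => X x i) U := fun hX i =>
    (EuclideanSpace.proj i : EuclideanSpace ℝ (Fin n) →L[ℝ] ℝ).contDiff.comp_contDiffOn hX
  exact ContDiffOn.sum fun i _ => ContDiffOn.sum fun j _ => (hG i j).mul ((hp hV i).mul (hp hW j))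

theorem IsChange.isMetricOn (c : IsChange χ G' G) (h : IsMetricOn G χ.target) :
    IsMetricOn G' χ.source where
  smooth i j := by
    refine ContDiffOn.congr ?_ fun x hx => c.pull x hx i j
    exact contDiffOn_bilin (G := fun x => G (χ x))
      (fun i j => (h.smooth i j).comp c.smooth χ.mapsTo)
      (contDiffOn_fderiv_change c.smooth _) (contDiffOn_fderiv_change c.smooth _)
  symm x hx i j := by
    rw [c.pull x hx, c.pull x hx, bilin_symm (h.symm _ (χ.map_source hx))]
  det x hx := by
    rw [isUnit_iff_ne_zero]
    intro h0
    obtain ⟨w, hw0, hw⟩ := Matrix.exists_vecMul_eq_zero_iff.2 h0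
    apply hw0
    have h1 : ∀ v, bilin (G' x) (WithLp.toLp 2 w) v = 0 := fun v => by
      rw [bilin_apply]
      calc _ = ∑ j, (∑ i, w i * G' x i j) * v j := by
            rw [Finset.sum_comm]
            refine Finset.sum_congr rfl fun j _ => ?_
            rw [Finset.sum_mul]
            exact Finset.sum_congr rfl fun i _ => by ring
        _ = 0 := Finset.sum_eq_zero fun j _ => by
            have := congrFun hw j
            simp only [Matrix.vecMul, dotProduct, Pi.zero_apply] at this
            rw [this, zero_mul]
    have h2 : fderiv ℝ χ x (WithLp.toLp 2 w) = 0 :=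
      bilin_nondegenerate (h.det _ (χ.map_source hx)) fun v => by
        have := h1 (fderiv ℝ χ.symm (χ x) v)
        rwa [c.bilin_pull hx, fderiv_comp_fderiv_symm c.smooth c.smooth_symm hx] at this
    have h3 := fderiv_symm_comp_fderiv c.smooth c.smooth_symm hx (WithLp.toLp 2 w)
    rw [h2, map_zero] at h3
    exact congrArg WithLp.ofLp h3.symm

/-- The coordinate fields, pushed forward by `χ`. -/
def push (χ : OpenPartialHomeomorph (EuclideanSpace ℝ (Fin n)) (EuclideanSpace ℝ (Fin n)))
    (a : Fin n) (y : EuclideanSpace ℝ (Fin n)) : EuclideanSpace ℝ (Fin n) :=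
  fderiv ℝ χ (χ.symm y) (EuclideanSpace.single a 1)

theorem push_apply {x : EuclideanSpace ℝ (Fin n)} (hx : x ∈ χ.source) (a : Fin n) :
    push χ a (χ x) = fderiv ℝ χ x (EuclideanSpace.single a 1) := by
  rw [push, χ.left_inv hx]

theorem contDiffOn_push (hχ : ContDiffOn ℝ ∞ χ χ.source)
    (hχ' : ContDiffOn ℝ ∞ χ.symm χ.target) (a : Fin n) : ContDiffOn ℝ ∞ (push χ a) χ.target :=
  (contDiffOn_fderiv_change hχ _).comp hχ' χ.symm.mapsTo

theorem fderiv_push (hχ : ContDiffOn ℝ ∞ χ χ.source)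
    (hχ' : ContDiffOn ℝ ∞ χ.symm χ.target) {x : EuclideanSpace ℝ (Fin n)} (hx : x ∈ χ.source)
    (a : Fin n) (v : EuclideanSpace ℝ (Fin n)) : fderiv ℝ (push χ a) (χ x) (fderiv ℝ χ x v)
      = fderiv ℝ (fderiv ℝ χ) x v (EuclideanSpace.single a 1) := by
  have h1 : DifferentiableAt ℝ (fderiv ℝ χ) x :=
    ((hχ.fderiv_of_isOpen χ.open_source (m := ∞) (by simp)).differentiableOn
      (by simp)).differentiableAt (χ.open_source.mem_nhds hx)
  have h2 := h1.hasFDerivAt.clm_apply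
    (hasFDerivAt_const (EuclideanSpace.single a 1 : EuclideanSpace ℝ (Fin n)) x)
  have h3 := fderiv_comp_symm_apply hχ hχ' hx h2.differentiableAt v
  unfold push
  rw [h3, h2.fderiv]
  simp

theorem second_fderiv_symm (hχ : ContDiffOn ℝ ∞ χ χ.source) {x : EuclideanSpace ℝ (Fin n)}
    (hx : x ∈ χ.source) (u v : EuclideanSpace ℝ (Fin n)) :
    fderiv ℝ (fderiv ℝ χ) x u v = fderiv ℝ (fderiv ℝ χ) x v u :=
  second_derivative_symmetric_of_eventually (f := χ) (f' := fderiv ℝ χ)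
    (by filter_upwards [χ.open_source.mem_nhds hx] with z hz using hasFDerivAt_change hχ hz)
    (((hχ.fderiv_of_isOpen χ.open_source (m := ∞) (by simp)).differentiableOn
      (by simp)).differentiableAt (χ.open_source.mem_nhds hx)).hasFDerivAt _ _

/-- The pushed coordinate fields commute, and their inner products are the components of `G'`; hence
the Christoffel symbols of `G'` satisfy the two frame equations. This takes the place of the
transformation law of Christoffel symbols. -/
theorem IsChange.isFrameOn (c : IsChange χ G' G) (h : IsMetricOn G χ.target) :
    IsFrameOn G (push χ) (fun a b k y => christoffel G' k a b (χ.symm y)) χ.target := by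
  have h' := c.isMetricOn h
  have hrep : ∀ y ∈ χ.target, ∃ x ∈ χ.source, χ x = y := fun y hy =>
    ⟨χ.symm y, χ.map_target hy, χ.right_inv hy⟩
  refine ⟨contDiffOn_push c.smooth c.smooth_symm, ?_, fun a b k =>
    (h'.contDiffOn_christoffel χ.open_source k a b).comp c.smooth_symm χ.symm.mapsTo, ?_, ?_⟩
  · intro y hy
    obtain ⟨x, hx, rfl⟩ := hrep y hy
    simp only [push_apply hx]
    exact linearIndependent_fderiv_change c.smooth c.smooth_symm hx
  · intro y hy a b
    obtain ⟨x, hx, rfl⟩ := hrep y hy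
    simp only [χ.left_inv hx, h'.christoffel_symm χ.open_source hx _ a b, sub_self, zero_smul,
      Finset.sum_const_zero, VectorField.lieBracket]
    rw [push_apply hx, push_apply hx, fderiv_push c.smooth c.smooth_symm hx,
      fderiv_push c.smooth c.smooth_symm hx, second_fderiv_symm c.smooth hx, sub_self]
  · intro y hy a b k
    obtain ⟨x, hx, rfl⟩ := hrep y hy
    have h1 : fderiv ℝ (fun z => bilin (G z) (push χ a z) (push χ b z)) (χ x) =
        fderiv ℝ (fun z => G' (χ.symm z) a b) (χ x) := by
      refine Filter.EventuallyEq.fderiv_eq ?_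
      filter_upwards [χ.open_target.mem_nhds hy] with z hz
      rw [c.pull _ (χ.map_target hz), χ.right_inv hz]
      rfl
    have h2 : ∀ i j, bilin (G (χ x)) (push χ i (χ x)) (push χ j (χ x)) = G' x i j := fun i j => by
      rw [push_apply hx, push_apply hx, c.pull x hx]
    rw [h1, push_apply hx, fderiv_comp_symm_apply (f := fun z => G' z a b) c.smooth c.smooth_symm hx
      (h'.differentiableAt χ.open_source hx a b)]
    simp only [χ.left_inv hx, h2]
    exact h'.pd_eq χ.open_source hx k a b

/-- The Ricci tensor is a tensor. -/
theorem IsChange.bilin_ricci (c : IsChange χ G' G) (h : IsMetricOn G χ.target)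
    {x : EuclideanSpace ℝ (Fin n)} (hx : x ∈ χ.source) (u v : EuclideanSpace ℝ (Fin n)) :
    bilin (Matrix.of fun i j => ricci G' i j x) u v =
      bilin (Matrix.of fun i j => ricci G i j (χ x)) (fderiv ℝ χ x u) (fderiv ℝ χ x v) := by
  have h' := c.isMetricOn h
  have : bilin (Matrix.of fun i j => ricci G' i j x) =
      pullBilin (bilin (Matrix.of fun i j => ricci G i j (χ x))) (fderiv ℝ χ x) := by
    refine bilin_ext linearIndependent_single fun k b => ?_
    -- In the pushed coordinate frame the frame formula becomes the coordinate formula for `G'`; the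
    -- bracket term disappears by the symmetry of the Christoffel symbols.
    have h1 := (c.isFrameOn h).ricci_eq h χ.open_target (χ.map_source hx) k b
    simp only [push_apply hx] at h1
    rw [bilin_single]
    refine Eq.trans ?_ h1.symm
    simp only [Matrix.of_apply, ricci, riemann, χ.left_inv hx]
    refine Finset.sum_congr rfl fun a _ => ?_
    have hd : ∀ i j l, DifferentiableAt ℝ (christoffel G' i j l) x := fun i j l =>
      ((h'.contDiffOn_christoffel χ.open_source i j l).differentiableOn
        (by simp)).differentiableAt (χ.open_source.mem_nhds hx)
    rw [fderiv_comp_symm_apply c.smooth c.smooth_symm hx (hd _ _ _),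
      fderiv_comp_symm_apply c.smooth c.smooth_symm hx (hd _ _ _)]
    unfold pd
    congr 1
    refine Finset.sum_congr rfl fun k _ => ?_
    rw [h'.christoffel_symm χ.open_source hx k a b]
    ring
  rw [this]
  rfl

/-- The Lie derivative of the metric is a tensor. -/
theorem IsChange.bilin_lieDerivMetric (c : IsChange χ G' G) (h : IsMetricOn G χ.target)
    {X' X : EuclideanSpace ℝ (Fin n) → EuclideanSpace ℝ (Fin n)}
    (hX' : ContDiffOn ℝ ∞ X' χ.source) (hX : ContDiffOn ℝ ∞ X χ.target)
    (hXX : ∀ x ∈ χ.source, X (χ x) = fderiv ℝ χ x (X' x))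
    {x : EuclideanSpace ℝ (Fin n)} (hx : x ∈ χ.source) (u v : EuclideanSpace ℝ (Fin n)) :
    bilin (Matrix.of fun i j => lieDerivMetric G' X' i j x) u v =
      bilin (Matrix.of fun i j => lieDerivMetric G X i j (χ x)) (fderiv ℝ χ x u)
        (fderiv ℝ χ x v) := by
  have h' := c.isMetricOn h
  have hy := χ.map_source hx
  have dX' : DifferentiableAt ℝ X' x :=
    (hX'.differentiableOn (by simp)).differentiableAt (χ.open_source.mem_nhds hx)
  have dX : DifferentiableAt ℝ X (χ x) :=
    (hX.differentiableOn (by simp)).differentiableAt (χ.open_target.mem_nhds hy)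
  have dp : ∀ a, DifferentiableAt ℝ (push χ a) (χ x) := fun a =>
    ((contDiffOn_push c.smooth c.smooth_symm a).differentiableOn
      (by simp)).differentiableAt (χ.open_target.mem_nhds hy)
  -- Obtained by differentiating `X (χ z) = fderiv ℝ χ z (X' z)` in two ways.
  have hDX : ∀ w, fderiv ℝ X (χ x) (fderiv ℝ χ x w) =
      fderiv ℝ (fderiv ℝ χ) x w (X' x) + fderiv ℝ χ x (fderiv ℝ X' x w) := by
    intro w
    have h1 : HasFDerivAt (fun z => X (χ z)) _ x :=
      dX.hasFDerivAt.comp x (hasFDerivAt_change c.smooth hx)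
    have h2 : HasFDerivAt (fderiv ℝ χ) (fderiv ℝ (fderiv ℝ χ) x) x :=
      (((c.smooth.fderiv_of_isOpen χ.open_source (m := ∞) (by simp)).differentiableOn
        (by simp)).differentiableAt (χ.open_source.mem_nhds hx)).hasFDerivAt
    have h3 : HasFDerivAt (fun z => X (χ z)) _ x :=
      (h2.clm_apply dX'.hasFDerivAt).congr_of_eventuallyEq
        (by filter_upwards [χ.open_source.mem_nhds hx] with z hz using hXX z hz)
    have h4 := congrArg (fun L => L w) (h1.unique h3)
    simpa [add_comm] using h4
  -- Naturality of the bracket: the second derivatives of `χ` cancel by symmetry.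
  have hbr : ∀ a, VectorField.lieBracket ℝ X (push χ a) (χ x) =
      fderiv ℝ χ x (VectorField.lieBracket ℝ X' (fun _ => EuclideanSpace.single a 1) x) := by
    intro a
    simp only [VectorField.lieBracket, fderiv_fun_const, Pi.zero_apply, zero_sub, map_neg,
      _root_.zero_apply]
    rw [hXX x hx, fderiv_push c.smooth c.smooth_symm hx, push_apply hx, hDX,
      second_fderiv_symm c.smooth hx]
    abel
  have : bilin (Matrix.of fun i j => lieDerivMetric G' X' i j x) =
      pullBilin (bilin (Matrix.of fun i j => lieDerivMetric G X i j (χ x))) (fderiv ℝ χ x) := by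
    refine bilin_ext linearIndependent_single fun a b => ?_
    have h1 := Coord.bilin_lieDerivMetric (h.differentiableAt χ.open_target hy) dX (dp a) (dp b)
    have h2 := Coord.bilin_lieDerivMetric (h'.differentiableAt χ.open_source hx) dX'
      (V := fun _ => EuclideanSpace.single a 1) (W := fun _ => EuclideanSpace.single b 1)
      (differentiableAt_const _) (differentiableAt_const _)
    have h3 : fderiv ℝ (fun z => bilin (G z) (push χ a z) (push χ b z)) (χ x) =
        fderiv ℝ (fun z => G' (χ.symm z) a b) (χ x) := by
      refine Filter.EventuallyEq.fderiv_eq ?_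
      filter_upwards [χ.open_target.mem_nhds hy] with z hz
      rw [c.pull _ (χ.map_target hz), χ.right_inv hz]
      rfl
    rw [h2]
    refine Eq.trans ?_ (Eq.trans h1.symm ?_)
    · rw [hbr, hbr, h3, hXX x hx, fderiv_comp_symm_apply (f := fun z => G' z a b) c.smooth
        c.smooth_symm hx (h'.differentiableAt χ.open_source hx a b), push_apply hx, push_apply hx]
      simp only [← c.bilin_pull hx, bilin_single]
    · rw [push_apply hx, push_apply hx]
      rfl
  rw [this]
  rfl

end Coord

namespace Soliton

variable {M : Type*} [TopologicalSpace M] [ChartedSpace E4 M]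

/-! ## Charts -/

/-- The tangent vector with components `v` in the chart `φ`, at the point with coordinates `y`. -/
def vecOf (φ : OpenPartialHomeomorph M E4) (y : E4) : E4 →L[ℝ] TangentSpace (𝓡 4) (φ.symm y) :=
  mfderiv (𝓡 4) (𝓡 4) φ.symm y

/-- The components of a tangent vector in the chart `φ`. -/
def comps (φ : OpenPartialHomeomorph M E4) (q : M) : TangentSpace (𝓡 4) q →L[ℝ] E4 :=
  mfderiv (𝓡 4) (𝓡 4) φ q

theorem fieldInChart_eq (X : VField M) (φ : OpenPartialHomeomorph M E4) (y : E4) :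
    fieldInChart X φ y = comps φ (φ.symm y) (X (φ.symm y)) := rfl

theorem bilin_formInChart (g : ∀ p : M, LinearMap.BilinForm ℝ (TangentSpace (𝓡 4) p))
    (φ : OpenPartialHomeomorph M E4) (y u v : E4) :
    Coord.bilin (formInChart g φ y) u v = g (φ.symm y) (vecOf φ y u) (vecOf φ y v) := by
  have h : ∀ w : E4, vecOf φ y w = ∑ i, w i • vecOf φ y (EuclideanSpace.single i 1) := fun w => by
    have h1 : w = ∑ l, w l • (EuclideanSpace.single l 1 : E4) := by
      refine PiLp.ext fun k => ?_
      simp [Pi.single_apply]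
    conv_lhs => rw [h1]
    rw [map_sum]
    exact Finset.sum_congr rfl fun i _ => map_smul _ _ _
  rw [h u, h v, Coord.bilin_apply]
  simp only [map_sum, LinearMap.sum_apply, map_smul, LinearMap.smul_apply, smul_eq_mul,
    Finset.mul_sum]
  rw [Finset.sum_comm]
  refine Finset.sum_congr rfl fun i _ => Finset.sum_congr rfl fun j _ => ?_
  change g (φ.symm y) (vecOf φ y (EuclideanSpace.single j 1))
    (vecOf φ y (EuclideanSpace.single i 1)) * _ = _
  ring

variable {φ ψ : OpenPartialHomeomorph M E4}

theorem mdifferentiable_of_mem_maximalAtlas (hφ : φ ∈ IsManifold.maximalAtlas (𝓡 4) ∞ M) :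
    φ.MDifferentiable (𝓡 4) (𝓡 4) :=
  ⟨(contMDiffOn_of_mem_maximalAtlas hφ).mdifferentiableOn (by simp),
    (contMDiffOn_symm_of_mem_maximalAtlas hφ).mdifferentiableOn (by simp)⟩

theorem comps_vecOf (hφ : φ ∈ IsManifold.maximalAtlas (𝓡 4) ∞ M) {y : E4} (hy : y ∈ φ.target)
    (v : E4) : comps φ (φ.symm y) (vecOf φ y v) = v :=
  congrArg (fun L => L v) ((mdifferentiable_of_mem_maximalAtlas hφ).comp_symm_deriv hy)

theorem vecOf_comps (hφ : φ ∈ IsManifold.maximalAtlas (𝓡 4) ∞ M) {y : E4} (hy : y ∈ φ.target)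
    (w : TangentSpace (𝓡 4) (φ.symm y)) : vecOf φ y (comps φ (φ.symm y) w) = w := by
  have h := (mdifferentiable_of_mem_maximalAtlas hφ).symm_comp_deriv (φ.map_target hy)
  rw [φ.right_inv hy] at h
  exact congrArg (fun L => L w) h

theorem vecOf_fieldInChart (hφ : φ ∈ IsManifold.maximalAtlas (𝓡 4) ∞ M) {y : E4}
    (hy : y ∈ φ.target) (X : VField M) : vecOf φ y (fieldInChart X φ y) = X (φ.symm y) :=
  vecOf_comps hφ hy _

theorem comps_injective (hφ : φ ∈ IsManifold.maximalAtlas (𝓡 4) ∞ M) {q : M}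
    (hq : q ∈ φ.source) : Function.Injective (comps φ q) :=
  (mdifferentiable_of_mem_maximalAtlas hφ).mfderiv_injective hq

theorem contDiffOn_transition (hφ : φ ∈ IsManifold.maximalAtlas (𝓡 4) ∞ M)
    (hψ : ψ ∈ IsManifold.maximalAtlas (𝓡 4) ∞ M) :
    ContDiffOn ℝ ∞ (φ.symm.trans ψ) (φ.symm.trans ψ).source := by
  rw [← contMDiffOn_iff_contDiffOn]
  refine (contMDiffOn_of_mem_maximalAtlas hψ).comp
    ((contMDiffOn_symm_of_mem_maximalAtlas hφ).mono ?_) ?_ <;>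
  · intro y hy
    simp only [mfld_simps] at hy
    simp [hy]

theorem comps_eq_fderiv_transition (hφ : φ ∈ IsManifold.maximalAtlas (𝓡 4) ∞ M)
    (hψ : ψ ∈ IsManifold.maximalAtlas (𝓡 4) ∞ M) {y : E4} (hy : y ∈ (φ.symm.trans ψ).source)
    (v : E4) : comps ψ (φ.symm y) (vecOf φ y v) = fderiv ℝ (φ.symm.trans ψ) y v := by
  simp only [mfld_simps] at hy
  have h := mfderiv_comp y
    ((mdifferentiable_of_mem_maximalAtlas hψ).mdifferentiableAt hy.2)
    ((mdifferentiable_of_mem_maximalAtlas hφ).mdifferentiableAt_symm hy.1)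
  rw [mfderiv_eq_fderiv] at h
  exact (congrArg (fun L => L v) h).symm

theorem vecOf_fderiv_transition (hφ : φ ∈ IsManifold.maximalAtlas (𝓡 4) ∞ M)
    (hψ : ψ ∈ IsManifold.maximalAtlas (𝓡 4) ∞ M) {y : E4} (hy : y ∈ (φ.symm.trans ψ).source)
    (v : E4) : (vecOf ψ (φ.symm.trans ψ y) (fderiv ℝ (φ.symm.trans ψ) y v) : E4)
      = (vecOf φ y v : E4) := by
  rw [← comps_eq_fderiv_transition hφ hψ hy]
  simp only [mfld_simps] at hy
  have h := (mdifferentiable_of_mem_maximalAtlas hψ).symm_comp_deriv hy.2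
  exact congrArg (fun L => L (vecOf φ y v)) h

/-- All tangent spaces are the same vector space `E4`, so vectors at points that are only
propositionally equal can be compared in `E4`. -/
theorem form_congr (g : ∀ p : M, LinearMap.BilinForm ℝ (TangentSpace (𝓡 4) p)) {p q : M}
    (h : p = q) {u v : TangentSpace (𝓡 4) p} {u' v' : TangentSpace (𝓡 4) q}
    (hu : (u : E4) = (u' : E4)) (hv : (v : E4) = (v' : E4)) : g p u v = g q u' v' := by
  subst h
  exact congrArg₂ (fun a b => g p a b) hu hv

theorem isChange_transition (g : ∀ p : M, LinearMap.BilinForm ℝ (TangentSpace (𝓡 4) p))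
    (hφ : φ ∈ IsManifold.maximalAtlas (𝓡 4) ∞ M) (hψ : ψ ∈ IsManifold.maximalAtlas (𝓡 4) ∞ M) :
    Coord.IsChange (φ.symm.trans ψ) (formInChart g φ) (formInChart g ψ) where
  smooth := contDiffOn_transition hφ hψ
  smooth_symm := by
    have h := contDiffOn_transition hψ hφ
    have h2 : (φ.symm.trans ψ).symm = ψ.symm.trans φ := by
      rw [OpenPartialHomeomorph.trans_symm_eq_symm_trans_symm, OpenPartialHomeomorph.symm_symm]
    rw [← OpenPartialHomeomorph.symm_source, h2]
    exact h
  pull y hy i j := by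
    rw [← Coord.bilin_single (formInChart g φ y), bilin_formInChart, bilin_formInChart]
    refine form_congr g ?_ (vecOf_fderiv_transition hφ hψ hy _).symm
      (vecOf_fderiv_transition hφ hψ hy _).symm
    simp only [mfld_simps] at hy
    simp [hy]

theorem fieldInChart_transition (X : VField M) (hφ : φ ∈ IsManifold.maximalAtlas (𝓡 4) ∞ M)
    (hψ : ψ ∈ IsManifold.maximalAtlas (𝓡 4) ∞ M) {y : E4} (hy : y ∈ (φ.symm.trans ψ).source) :
    fieldInChart X ψ (φ.symm.trans ψ y) = fderiv ℝ (φ.symm.trans ψ) y (fieldInChart X φ y) := by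
  rw [← comps_eq_fderiv_transition hφ hψ hy]
  simp only [mfld_simps] at hy
  rw [vecOf_fieldInChart hφ hy.1, fieldInChart_eq]
  simp only [mfld_simps]
  rw [ψ.left_inv hy.2]
  rfl

theorem exists_atlas_transition [IsManifold (𝓡 4) ∞ M] {y : E4}
    (hy : y ∈ φ.target) : ∃ ψ ∈ atlas E4 M, ψ ∈ IsManifold.maximalAtlas (𝓡 4) ∞ M ∧
      y ∈ (φ.symm.trans ψ).source :=
  ⟨chartAt E4 (φ.symm y), chart_mem_atlas _ _, IsManifold.chart_mem_maximalAtlas _, by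
    simp only [mfld_simps]; exact hy⟩

/-- Symmetry and nondegeneracy are pointwise and hold in every chart. Smoothness is given for the
charts of the atlas only and is brought to `φ` by a transition map. -/
theorem PseudoMetric.isMetricOn [IsManifold (𝓡 4) ∞ M] (g : PseudoMetric M)
    (hφ : φ ∈ IsManifold.maximalAtlas (𝓡 4) ∞ M) : Coord.IsMetricOn (g.inChart φ) φ.target := by
  have pointwise : ∀ ψ ∈ IsManifold.maximalAtlas (𝓡 4) ∞ M, ∀ y ∈ ψ.target,
      (∀ i j, g.inChart ψ y i j = g.inChart ψ y j i) ∧ IsUnit (g.inChart ψ y).det := by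
    intro ψ hψ y hy
    refine ⟨fun i j => g.symm _ _ _, ?_⟩
    rw [isUnit_iff_ne_zero]
    intro h0
    obtain ⟨w, hw0, hw⟩ := Matrix.exists_vecMul_eq_zero_iff.2 h0
    apply hw0
    have h1 : ∀ v, Coord.bilin (g.inChart ψ y) (WithLp.toLp 2 w) v = 0 := fun v => by
      rw [Coord.bilin_apply, Finset.sum_comm]
      refine Finset.sum_eq_zero fun j _ => ?_
      have h2 := congrFun hw j
      simp only [Matrix.vecMul, dotProduct, Pi.zero_apply] at h2
      simp only [← mul_assoc, ← Finset.sum_mul]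
      simp only [mul_comm (g.inChart ψ y _ j)]
      rw [h2, zero_mul]
    have h2 : vecOf ψ y (WithLp.toLp 2 w) = 0 := by
      refine g.nondegenerate _ _ fun u => ?_
      have h3 := h1 (comps ψ (ψ.symm y) u)
      rw [PseudoMetric.inChart, bilin_formInChart, vecOf_comps hψ hy] at h3
      exact h3
    have h3 := comps_vecOf hψ hy (WithLp.toLp 2 w)
    rw [h2, map_zero] at h3
    exact congrArg WithLp.ofLp h3.symm
  refine ⟨fun i j y hy => ?_, fun y hy => (pointwise φ hφ y hy).1,
    fun y hy => (pointwise φ hφ y hy).2⟩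
  obtain ⟨ψ, hψa, hψ, hyψ⟩ := exists_atlas_transition hy
  have hm : Coord.IsMetricOn (g.inChart ψ) ψ.target :=
    ⟨fun i j => g.smooth ψ hψa i j, fun y hy => (pointwise ψ hψ y hy).1,
      fun y hy => (pointwise ψ hψ y hy).2⟩
  have h1 := (isChange_transition g.form hφ hψ).isMetricOn (hm.mono (by simp [mfld_simps]))
  exact ((h1.smooth i j).contDiffAt
    ((φ.symm.trans ψ).open_source.mem_nhds hyψ)).contDiffWithinAt

/-! ## Vector fields in charts -/

/-- Identifies the component function of a field with its pull-back by the inverse chart, so that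
the general facts on smoothness and brackets of pull-backs apply to components. -/
theorem mpullback_symm_eq (hφ : φ ∈ IsManifold.maximalAtlas (𝓡 4) ∞ M) (X : VField M) {y : E4}
    (hy : y ∈ φ.target) :
    (mfderiv (𝓡 4) (𝓡 4) φ.symm y).IsInvertible ∧
      VectorField.mpullback (𝓡 4) (𝓡 4) φ.symm X y = fieldInChart X φ y := by
  have h1 : (mfderiv (𝓡 4) (𝓡 4) φ (φ.symm y)) ∘L (mfderiv (𝓡 4) (𝓡 4) φ.symm y) = .id ℝ _ :=
    (mdifferentiable_of_mem_maximalAtlas hφ).comp_symm_deriv hy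
  have h2 : (mfderiv (𝓡 4) (𝓡 4) φ.symm y) ∘L (mfderiv (𝓡 4) (𝓡 4) φ (φ.symm y)) = .id ℝ _ :=
    ContinuousLinearMap.ext fun w => vecOf_comps hφ hy w
  refine ⟨.of_inverse h2 h1, ?_⟩
  rw [VectorField.mpullback_apply]
  exact congrArg (fun L => L (X (φ.symm y))) (ContinuousLinearMap.inverse_eq h2 h1)

variable [IsManifold (𝓡 4) ∞ M]

theorem SmoothOn.fieldInChart {X : VField M} {V : Set M} (hX : SmoothOn X V) (hV : IsOpen V)
    (hφ : φ ∈ IsManifold.maximalAtlas (𝓡 4) ∞ M) :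
    ContDiffOn ℝ ∞ (fieldInChart X φ) (φ.target ∩ φ.symm ⁻¹' V) := by
  intro y hy
  have hU : φ.target ∩ φ.symm ⁻¹' V ∈ 𝓝 y := (φ.isOpen_inter_preimage_symm hV).mem_nhds hy
  have h1 : ContMDiffAt (𝓡 4) (𝓡 4).tangent ∞
      (fun q => (⟨q, X q⟩ : TangentBundle (𝓡 4) M)) (φ.symm y) :=
    (hX _ hy.2).contMDiffAt (hV.mem_nhds hy.2)
  have h2 := h1.mpullback_vectorField_preimage (n := ∞)
    (contMDiffAt_symm_of_mem_maximalAtlas hφ hy.1) (mpullback_symm_eq hφ X hy.1).1 (by simp)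
  have h3 := contMDiffAt_vectorSpace_iff_contDiffAt.1 h2
  refine (h3.congr_of_eventuallyEq ?_).contDiffWithinAt
  filter_upwards [hU] with z hz using (mpullback_symm_eq hφ X hz.1).2.symm

theorem SmoothOn.mdifferentiableAt {X : VField M} {V : Set M} (hX : SmoothOn X V) (hV : IsOpen V)
    {p : M} (hp : p ∈ V) : MDifferentiableAt (𝓡 4) (𝓡 4).tangent
      (fun q => (⟨q, X q⟩ : TangentBundle (𝓡 4) M)) p :=
  ((hX _ hp).contMDiffAt (hV.mem_nhds hp)).mdifferentiableAt (by simp)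

theorem mlieBracket_eq_lieBracket (V W : ∀ y : E4, TangentSpace (𝓡 4) y) (y : E4) :
    VectorField.mlieBracket (𝓡 4) V W y =
      VectorField.lieBracket ℝ (V : E4 → E4) (W : E4 → E4) y := by
  rw [← VectorField.mlieBracketWithin_univ, VectorField.mlieBracketWithin_eq_lieBracketWithin]
  exact congrFun VectorField.lieBracketWithin_univ y

theorem fieldInChart_mlieBracket {X Y : VField M} {V : Set M} (hX : SmoothOn X V)
    (hY : SmoothOn Y V) (hV : IsOpen V) (hφ : φ ∈ IsManifold.maximalAtlas (𝓡 4) ∞ M)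
    {y : E4} (hy : y ∈ φ.target) (hyV : φ.symm y ∈ V) :
    fieldInChart (VectorField.mlieBracket (𝓡 4) X Y) φ y =
      VectorField.lieBracket ℝ (fieldInChart X φ) (fieldInChart Y φ) y := by
  have h2 : minSmoothness ℝ 2 ≤ ∞ := by
    rw [minSmoothness_of_isRCLikeNormedField]; exact ENat.LEInfty.out
  have : IsManifold (𝓡 4) (minSmoothness ℝ 2) M := .of_le h2
  rw [← (mpullback_symm_eq hφ _ hy).2, VectorField.mpullback_mlieBracket (n := ∞)
    (hX.mdifferentiableAt hV hyV) (hY.mdifferentiableAt hV hyV)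
    (contMDiffAt_symm_of_mem_maximalAtlas hφ hy) h2,
    mlieBracket_eq_lieBracket]
  have h : ∀ Z : VField M, VectorField.mpullback (𝓡 4) (𝓡 4) φ.symm Z =ᶠ[𝓝 y]
      Soliton.fieldInChart Z φ := fun Z => by
    filter_upwards [φ.open_target.mem_nhds hy] with z hz using (mpullback_symm_eq hφ Z hz).2
  exact (h X).lieBracket_vectorField_eq (h Y)

variable (φ) in
/-- The vector field on `M` with components `Y` in the chart `φ`. -/
def fieldOf (Y : E4 → E4) : VField M := fun q =>
  (mfderiv (𝓡 4) (𝓡 4) φ.symm (φ q) (Y (φ q)) : E4)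

omit [IsManifold (𝓡 4) ∞ M] in
theorem fieldOf_eq (Y : E4 → E4) {y : E4} (hy : y ∈ φ.target) :
    fieldOf φ Y (φ.symm y) = vecOf φ y (Y y) := by
  unfold fieldOf vecOf
  rw [φ.right_inv hy]
  rfl

omit [IsManifold (𝓡 4) ∞ M] in
theorem fieldInChart_fieldOf (hφ : φ ∈ IsManifold.maximalAtlas (𝓡 4) ∞ M) (Y : E4 → E4) {y : E4}
    (hy : y ∈ φ.target) : fieldInChart (fieldOf φ Y) φ y = Y y := by
  rw [fieldInChart_eq, fieldOf_eq Y hy, comps_vecOf hφ hy]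

theorem smoothOn_fieldOf (hφ : φ ∈ IsManifold.maximalAtlas (𝓡 4) ∞ M) {Y : E4 → E4} {U : Set E4}
    (hU : IsOpen U) (hY : ContDiffOn ℝ ∞ Y U) :
    SmoothOn (fieldOf φ Y) (φ.source ∩ φ ⁻¹' U) := by
  intro q hq
  have h0 : ContMDiffAt (𝓡 4) (𝓡 4).tangent ∞ (fun y => (⟨y, Y y⟩ : TangentBundle (𝓡 4) E4))
      (φ q) :=
    contMDiffAt_vectorSpace_iff_contDiffAt.2 (hY.contDiffAt (hU.mem_nhds hq.2))
  have hmd := mdifferentiable_of_mem_maximalAtlas hφ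
  have hinv : ∀ z ∈ φ.source, (mfderiv (𝓡 4) (𝓡 4) φ z) ∘L
      (mfderiv (𝓡 4) (𝓡 4) φ.symm (φ z)) = .id ℝ _ ∧ (mfderiv (𝓡 4) (𝓡 4) φ.symm (φ z)) ∘L
      (mfderiv (𝓡 4) (𝓡 4) φ z) = .id ℝ _ := fun z hz => by
    have h := hmd.comp_symm_deriv (φ.map_source hz)
    rw [φ.left_inv hz] at h
    exact ⟨h, hmd.symm_comp_deriv hz⟩
  have h2 := h0.mpullback_vectorField_preimage (n := ∞)
    (contMDiffAt_of_mem_maximalAtlas hφ hq.1) (.of_inverse (hinv q hq.1).1 (hinv q hq.1).2)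
    (by simp)
  refine (h2.congr_of_eventuallyEq ?_).contMDiffWithinAt
  filter_upwards [φ.open_source.mem_nhds hq.1] with z hz
  refine congrArg (fun w => (⟨z, w⟩ : TangentBundle (𝓡 4) M)) ?_
  exact (congrArg (fun L => L (Y (φ z)))
    (ContinuousLinearMap.inverse_eq (hinv z hz).1 (hinv z hz).2)).symm

end Soliton

/-! ### From the charts of the atlas to all charts of the maximal atlas. -/

namespace Soliton

variable {M : Type*} [TopologicalSpace M] [ChartedSpace E4 M] [IsManifold (𝓡 4) ∞ M]
  {φ ψ : OpenPartialHomeomorph M E4}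

theorem contDiffOn_fieldInChart {X : VField M} (hX : SmoothOn X univ)
    (hφ : φ ∈ IsManifold.maximalAtlas (𝓡 4) ∞ M) : ContDiffOn ℝ ∞ (fieldInChart X φ) φ.target := by
  simpa using hX.fieldInChart isOpen_univ hφ

/-- The Lie derivative of the metric is a tensor on the manifold. -/
theorem bilin_lieDerivMetric_transition (g : PseudoMetric M) {X : VField M}
    (hX : SmoothOn X univ) (hφ : φ ∈ IsManifold.maximalAtlas (𝓡 4) ∞ M)
    (hψ : ψ ∈ IsManifold.maximalAtlas (𝓡 4) ∞ M) {y : E4} (hy : y ∈ (φ.symm.trans ψ).source)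
    (u v : E4) :
    Coord.bilin (Matrix.of fun i j =>
      Coord.lieDerivMetric (g.inChart φ) (fieldInChart X φ) i j y) u v =
    Coord.bilin (Matrix.of fun i j =>
      Coord.lieDerivMetric (g.inChart ψ) (fieldInChart X ψ) i j (φ.symm.trans ψ y))
      (fderiv ℝ (φ.symm.trans ψ) y u) (fderiv ℝ (φ.symm.trans ψ) y v) :=
  (isChange_transition g.form hφ hψ).bilin_lieDerivMetric
    ((g.isMetricOn hψ).mono (by simp [mfld_simps]))
    ((contDiffOn_fieldInChart hX hφ).mono (by simp [mfld_simps]))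
    ((contDiffOn_fieldInChart hX hψ).mono (by simp [mfld_simps]))
    (fun x hx => fieldInChart_transition X hφ hψ hx) hy u v

theorem IsKilling.lieDerivMetric_eq_zero {g : PseudoMetric M} {ξ : VField M} (h : IsKilling g ξ)
    (hφ : φ ∈ IsManifold.maximalAtlas (𝓡 4) ∞ M) {y : E4} (hy : y ∈ φ.target) (i j : Fin 4) :
    Coord.lieDerivMetric (g.inChart φ) (fieldInChart ξ φ) i j y = 0 := by
  obtain ⟨ψ, hψa, hψ, hyψ⟩ := exists_atlas_transition (M := M) hy
  have h1 := bilin_lieDerivMetric_transition g h.1 hφ hψ hyψ (EuclideanSpace.single i 1)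
    (EuclideanSpace.single j 1)
  rw [Coord.bilin_single, Coord.bilin_apply] at h1
  refine h1.trans (Finset.sum_eq_zero fun k _ => Finset.sum_eq_zero fun l _ => ?_)
  have hz := (φ.symm.trans ψ).map_source hyψ
  rw [Matrix.of_apply, h.2 ψ hψa _ (by simp only [mfld_simps] at hz; exact hz.1), zero_mul]

/-- The equation is postulated only in charts of the atlas, while the adapted charts constructed
below need not belong to it. All three terms are tensors, so a transition map carries the equation
over. -/
theorem IsRicciSoliton.eq_inChart {g : PseudoMetric M} {X : VField M} {Λ : ℝ}
    (h : IsRicciSoliton g X Λ) (hφ : φ ∈ IsManifold.maximalAtlas (𝓡 4) ∞ M) {y : E4}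
    (hy : y ∈ φ.target) (u v : E4) :
    Coord.bilin (Matrix.of fun i j => Coord.ricci (g.inChart φ) i j y) u v
      + (1 / 2) * Coord.bilin (Matrix.of fun i j =>
          Coord.lieDerivMetric (g.inChart φ) (fieldInChart X φ) i j y) u v
      = Λ * Coord.bilin (g.inChart φ y) u v := by
  obtain ⟨ψ, hψa, hψ, hyψ⟩ := exists_atlas_transition (M := M) hy
  have hc := isChange_transition g.form hφ hψ
  rw [bilin_lieDerivMetric_transition g h.1 hφ hψ hyψ]
  have h1 := hc.bilin_ricci ((g.isMetricOn hψ).mono (by simp [mfld_simps])) hyψ u v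
  have h2 := hc.bilin_pull hyψ u v
  have hz : φ.symm.trans ψ y ∈ ψ.target := by
    have := (φ.symm.trans ψ).map_source hyψ
    simp only [mfld_simps] at this ⊢
    exact this.1
  simp only [PseudoMetric.inChart]
  rw [h1, h2]
  simp only [Coord.bilin_apply, Finset.mul_sum, ← Finset.sum_add_distrib, Matrix.of_apply]
  refine Finset.sum_congr rfl fun i _ => Finset.sum_congr rfl fun j _ => ?_
  have h3 := h.2 ψ hψa _ hz i j
  simp only [PseudoMetric.inChart] at h3
  linear_combination ((fderiv ℝ (φ.symm.trans ψ) y u) i * (fderiv ℝ (φ.symm.trans ψ) y v) j) * h3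

/-! ## New charts from old ones -/

theorem trans_mem_maximalAtlas (hφ : φ ∈ IsManifold.maximalAtlas (𝓡 4) ∞ M)
    {χ : OpenPartialHomeomorph E4 E4} (h : ContDiffOn ℝ ∞ χ χ.source)
    (h' : ContDiffOn ℝ ∞ χ.symm χ.target) : φ.trans χ ∈ IsManifold.maximalAtlas (𝓡 4) ∞ M := by
  have hmem : ∀ {e : OpenPartialHomeomorph E4 E4}, ContDiffOn ℝ ∞ e e.source →
      ContDiffOn ℝ ∞ e.symm e.target → e ∈ contDiffGroupoid ∞ (𝓡 4) := fun {e} h1 h2 => by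
    rw [contDiffGroupoid, mem_groupoid_of_pregroupoid]
    simpa [contDiffPregroupoid, mfld_simps] using And.intro h1 h2
  have hχ := hmem h h'
  rw [IsManifold.mem_maximalAtlas_iff, mem_maximalAtlas_iff]
  intro e he
  have h1 := IsManifold.compatible_of_mem_maximalAtlas hφ (IsManifold.subset_maximalAtlas he)
  have h2 := IsManifold.compatible_of_mem_maximalAtlas (IsManifold.subset_maximalAtlas he) hφ
  constructor
  · rw [OpenPartialHomeomorph.trans_symm_eq_symm_trans_symm, OpenPartialHomeomorph.trans_assoc]
    exact (contDiffGroupoid ∞ (𝓡 4)).trans ((contDiffGroupoid ∞ (𝓡 4)).symm hχ) h1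
  · rw [← OpenPartialHomeomorph.trans_assoc]
    exact (contDiffGroupoid ∞ (𝓡 4)).trans h2 hχ

theorem fieldInChart_trans (X : VField M) (hφ : φ ∈ IsManifold.maximalAtlas (𝓡 4) ∞ M)
    {χ : OpenPartialHomeomorph E4 E4} (h : ContDiffOn ℝ ∞ χ χ.source)
    (h' : ContDiffOn ℝ ∞ χ.symm χ.target) {x : E4} (hx : x ∈ φ.target ∩ χ.source) :
    fieldInChart X (φ.trans χ) (χ x) = fderiv ℝ χ x (fieldInChart X φ x) := by
  have hx2 : x ∈ (φ.symm.trans (φ.trans χ)).source := by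
    simp only [mfld_simps]
    exact ⟨hx.1, φ.map_target hx.1, by rw [φ.right_inv hx.1]; exact hx.2⟩
  have h1 := fieldInChart_transition X hφ (trans_mem_maximalAtlas hφ h h') hx2
  have h2 : (φ.symm.trans (φ.trans χ)) =ᶠ[𝓝 x] χ := by
    filter_upwards [φ.open_target.mem_nhds hx.1] with z hz
    simp [φ.right_inv hz]
  rwa [h2.fderiv_eq, h2.eq_of_nhds] at h1

theorem bilin_inChart_trans (g : PseudoMetric M) (hφ : φ ∈ IsManifold.maximalAtlas (𝓡 4) ∞ M)
    {χ : OpenPartialHomeomorph E4 E4} (h : ContDiffOn ℝ ∞ χ χ.source)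
    (h' : ContDiffOn ℝ ∞ χ.symm χ.target) {x : E4} (hx : x ∈ φ.target ∩ χ.source) (u v : E4) :
    Coord.bilin (g.inChart (φ.trans χ) (χ x)) (fderiv ℝ χ x u) (fderiv ℝ χ x v) =
      Coord.bilin (g.inChart φ x) u v := by
  have hx2 : x ∈ (φ.symm.trans (φ.trans χ)).source := by
    simp only [mfld_simps]
    exact ⟨hx.1, φ.map_target hx.1, by rw [φ.right_inv hx.1]; exact hx.2⟩
  have h1 := (isChange_transition g.form hφ (trans_mem_maximalAtlas hφ h h')).bilin_pull hx2 u v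
  have h2 : (φ.symm.trans (φ.trans χ)) =ᶠ[𝓝 x] χ := by
    filter_upwards [φ.open_target.mem_nhds hx.1] with z hz
    simp [φ.right_inv hz]
  rw [h2.fderiv_eq, h2.eq_of_nhds] at h1
  exact h1.symm

end Soliton

namespace Soliton

/-! ## Null frames -/

/-- A frame `E₀, E₁, E₂, E₃` of the metric `G`, invariant under translations along the last two
coordinates, with `E₀, E₁` pseudo-orthonormal, `E₂, E₃` null and tangent to the leaves. -/
structure IsNullFrameOn (G : E4 → Matrix (Fin 4) (Fin 4) ℝ) (U : Set E4) (ε : ℝ)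
    (E : Fin 4 → E4 → E4) (h f r₁ r₂ l : E4 → ℝ) : Prop where
  isOpen : IsOpen U
  metric : Coord.IsMetricOn G U
  eps : ε * ε = 1
  smooth_E : ∀ a, ContDiffOn ℝ ∞ (E a) U
  smooth_h : ContDiffOn ℝ ∞ h U
  smooth_f : ContDiffOn ℝ ∞ f U
  smooth_r₁ : ContDiffOn ℝ ∞ r₁ U
  smooth_r₂ : ContDiffOn ℝ ∞ r₂ U
  smooth_l : ContDiffOn ℝ ∞ l U
  h_ne : ∀ y ∈ U, h y ≠ 0
  E₂ : E 2 = fun y => EuclideanSpace.single 2 1 - f y • EuclideanSpace.single 3 1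
  E₃ : E 3 = fun y => (h y)⁻¹ • EuclideanSpace.single 3 1
  inv_E₀ : ∀ y ∈ U, fderiv ℝ (E 0) y (EuclideanSpace.single 2 1) = 0 ∧
    fderiv ℝ (E 0) y (EuclideanSpace.single 3 1) = 0
  inv_E₁ : ∀ y ∈ U, fderiv ℝ (E 1) y (EuclideanSpace.single 2 1) = 0 ∧
    fderiv ℝ (E 1) y (EuclideanSpace.single 3 1) = 0
  inv_h : ∀ y ∈ U, fderiv ℝ h y (EuclideanSpace.single 2 1) = 0 ∧
    fderiv ℝ h y (EuclideanSpace.single 3 1) = 0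
  inv_f : ∀ y ∈ U, fderiv ℝ f y (EuclideanSpace.single 2 1) = 0 ∧
    fderiv ℝ f y (EuclideanSpace.single 3 1) = 0
  inv_r₁ : ∀ y ∈ U, fderiv ℝ r₁ y (EuclideanSpace.single 2 1) = 0 ∧
    fderiv ℝ r₁ y (EuclideanSpace.single 3 1) = 0
  inv_r₂ : ∀ y ∈ U, fderiv ℝ r₂ y (EuclideanSpace.single 2 1) = 0 ∧
    fderiv ℝ r₂ y (EuclideanSpace.single 3 1) = 0
  inv_l : ∀ y ∈ U, fderiv ℝ l y (EuclideanSpace.single 2 1) = 0 ∧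
    fderiv ℝ l y (EuclideanSpace.single 3 1) = 0
  inner : ∀ y ∈ U, ∀ a b, Coord.bilin (G y) (E a y) (E b y) =
    (!![1, 0, 0, 0; 0, ε, 0, 0; 0, 0, 0, 1; 0, 0, 1, 0] : Matrix (Fin 4) (Fin 4) ℝ) a b
  bracket : ∀ y ∈ U, VectorField.lieBracket ℝ (E 0) (E 1) y =
    r₁ y • E 0 y + r₂ y • E 1 y + l y • E 2 y

/-- The connection coefficients of a null frame. -/
def nullConnection (ε : ℝ) (r₁ r₂ l m₁ m₂ n₁ n₂ : E4 → ℝ) (a b c : Fin 4) : E4 → ℝ :=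
  (![![![0, (-ε) • r₁, 0, 0], ![r₁, 0, (1 / 2 : ℝ) • l, 0], ![0, 0, (-1 / 2 : ℝ) • n₁, 0],
      ![0, (-ε / 2) • l, 0, (1 / 2 : ℝ) • n₁]],
    ![![0, (-1 : ℝ) • r₂, (-1 / 2 : ℝ) • l, 0], ![ε • r₂, 0, 0, 0],
      ![0, 0, (-1 / 2 : ℝ) • n₂, 0], ![(1 / 2 : ℝ) • l, 0, 0, (1 / 2 : ℝ) • n₂]],
    ![![0, 0, (-1 / 2 : ℝ) • n₁, (-1 : ℝ) • m₁], ![0, 0, (-1 / 2 : ℝ) • n₂, (-1 : ℝ) • m₂],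
      ![m₁, ε • m₂, 0, 0], ![(1 / 2 : ℝ) • n₁, (ε / 2) • n₂, 0, 0]],
    ![![0, (-ε / 2) • l, 0, (-1 / 2 : ℝ) • n₁], ![(1 / 2 : ℝ) • l, 0, 0, (-1 / 2 : ℝ) • n₂],
      ![(1 / 2 : ℝ) • n₁, (ε / 2) • n₂, 0, 0], ![0, 0, 0, 0]]] :
    Fin 4 → Fin 4 → Fin 4 → E4 → ℝ) a b c

theorem contDiffOn_nullConnection {ε : ℝ} {r₁ r₂ l m₁ m₂ n₁ n₂ : E4 → ℝ} {U : Set E4}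
    (h1 : ContDiffOn ℝ ∞ r₁ U) (h2 : ContDiffOn ℝ ∞ r₂ U) (h3 : ContDiffOn ℝ ∞ l U)
    (h4 : ContDiffOn ℝ ∞ m₁ U) (h5 : ContDiffOn ℝ ∞ m₂ U) (h6 : ContDiffOn ℝ ∞ n₁ U)
    (h7 : ContDiffOn ℝ ∞ n₂ U) (a b c : Fin 4) :
    ContDiffOn ℝ ∞ (nullConnection ε r₁ r₂ l m₁ m₂ n₁ n₂ a b c) U := by
  have h0 : ContDiffOn ℝ ∞ (0 : E4 → ℝ) U := contDiffOn_const
  have hs : ∀ (t : ℝ) (k : E4 → ℝ), ContDiffOn ℝ ∞ k U → ContDiffOn ℝ ∞ (t • k) U :=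
    fun t k hk => contDiffOn_const.smul hk
  fin_cases a <;> fin_cases b <;> fin_cases c <;>
    first
    | exact h0 | exact h1 | exact h4 | exact h5
    | exact hs _ _ h1 | exact hs _ _ h2 | exact hs _ _ h3 | exact hs _ _ h4 | exact hs _ _ h5
    | exact hs _ _ h6 | exact hs _ _ h7

theorem linearIndependent_of_inner {A : Matrix (Fin 4) (Fin 4) ℝ} {ε : ℝ} (hε : ε * ε = 1)
    {e : Fin 4 → E4} (he : ∀ a b, Coord.bilin A (e a) (e b) =
      (!![1, 0, 0, 0; 0, ε, 0, 0; 0, 0, 0, 1; 0, 0, 1, 0] : Matrix (Fin 4) (Fin 4) ℝ) a b) :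
    LinearIndependent ℝ e := by
  rw [Fintype.linearIndependent_iff]
  intro c hc
  have h1 : ∀ b, ∑ a, c a * (!![1, 0, 0, 0; 0, ε, 0, 0; 0, 0, 0, 1; 0, 0, 1, 0] :
      Matrix (Fin 4) (Fin 4) ℝ) a b = 0 := fun b => by
    have h2 := congrArg (fun v => Coord.bilin A v (e b)) hc
    simpa only [map_sum, map_smul, _root_.sum_apply, _root_.smul_apply, smul_eq_mul, map_zero,
      _root_.zero_apply, he] using h2
  have hε' : ε ≠ 0 := fun h0 => by simp [h0] at hε
  have h0 := h1 0
  have h1' := h1 1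
  have h2 := h1 2
  have h3 := h1 3
  simp [Fin.sum_univ_four] at h0 h1' h2 h3
  intro a
  fin_cases a
  · exact h0
  · exact h1'.resolve_right hε'
  · exact h3
  · exact h2

namespace IsNullFrameOn

variable {G : E4 → Matrix (Fin 4) (Fin 4) ℝ} {U : Set E4} {ε : ℝ} {E : Fin 4 → E4 → E4}
  {h f r₁ r₂ l : E4 → ℝ}

theorem differentiableAt (H : IsNullFrameOn G U ε E h f r₁ r₂ l) {y : E4} (hy : y ∈ U) :
    (∀ a, DifferentiableAt ℝ (E a) y) ∧ DifferentiableAt ℝ h y ∧ DifferentiableAt ℝ f y ∧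
      DifferentiableAt ℝ r₁ y ∧ DifferentiableAt ℝ r₂ y ∧ DifferentiableAt ℝ l y := by
  have hU := H.isOpen.mem_nhds hy
  exact ⟨fun a => ((H.smooth_E a).differentiableOn (by simp)).differentiableAt hU,
    (H.smooth_h.differentiableOn (by simp)).differentiableAt hU,
    (H.smooth_f.differentiableOn (by simp)).differentiableAt hU,
    (H.smooth_r₁.differentiableOn (by simp)).differentiableAt hU,
    (H.smooth_r₂.differentiableOn (by simp)).differentiableAt hU,
    (H.smooth_l.differentiableOn (by simp)).differentiableAt hU⟩

theorem linearIndependent (H : IsNullFrameOn G U ε E h f r₁ r₂ l) {y : E4} (hy : y ∈ U) :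
    LinearIndependent ℝ fun a => E a y :=
  linearIndependent_of_inner H.eps (H.inner y hy)

/-- The derivative of an invariant function along `E₂` and `E₃` vanishes. -/
theorem fderiv_vertical (H : IsNullFrameOn G U ε E h f r₁ r₂ l) {F : Type*}
    [NormedAddCommGroup F] [NormedSpace ℝ F] {k : E4 → F} {y : E4}
    (hk : fderiv ℝ k y (EuclideanSpace.single 2 1) = 0 ∧
      fderiv ℝ k y (EuclideanSpace.single 3 1) = 0) :
    fderiv ℝ k y (E 2 y) = 0 ∧ fderiv ℝ k y (E 3 y) = 0 := by
  rw [H.E₂, H.E₃]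
  simp [hk.1, hk.2]

theorem fderiv_E₂ (H : IsNullFrameOn G U ε E h f r₁ r₂ l) {y : E4} (hy : y ∈ U) (v : E4) :
    fderiv ℝ (E 2) y v = (-(h y) * fderiv ℝ f y v) • E 3 y := by
  have h1 : HasFDerivAt (E 2) (0 - (fderiv ℝ f y).smulRight
      (EuclideanSpace.single 3 1 : E4)) y := by
    rw [H.E₂]
    exact (hasFDerivAt_const _ _).sub ((H.differentiableAt hy).2.2.1.hasFDerivAt.smul_const _)
  rw [h1.fderiv, H.E₃]
  have := H.h_ne y hy
  simp only [zero_sub, _root_.neg_apply, ContinuousLinearMap.smulRight_apply, smul_smul]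
  rw [← neg_smul]
  congr 1
  field_simp

theorem fderiv_E₃ (H : IsNullFrameOn G U ε E h f r₁ r₂ l) {y : E4} (hy : y ∈ U) (v : E4) :
    fderiv ℝ (E 3) y v = (-(fderiv ℝ h y v) / h y) • E 3 y := by
  have h0 := H.h_ne y hy
  have h1 : HasFDerivAt (E 3) ((-(h y ^ 2)⁻¹ • fderiv ℝ h y).smulRight
      (EuclideanSpace.single 3 1 : E4)) y := by
    rw [H.E₃]
    exact ((hasDerivAt_inv h0).comp_hasFDerivAt y
      (H.differentiableAt hy).2.1.hasFDerivAt).smul_const _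
  rw [h1.fderiv, H.E₃]
  simp only [ContinuousLinearMap.smulRight_apply, smul_smul, _root_.smul_apply, smul_eq_mul]
  congr 1
  field_simp

/-- The frame fields are invariant along the leaves, so only the derivatives of the coefficients `f`
and `h⁻¹` contribute. The coefficients of `E 3` in the first four brackets are `m₁, m₂, n₁, n₂` of
`nullConnection`, in this order. -/
theorem brackets (H : IsNullFrameOn G U ε E h f r₁ r₂ l) {y : E4} (hy : y ∈ U) :
    VectorField.lieBracket ℝ (E 0) (E 2) y = (-(h y) * fderiv ℝ f y (E 0 y)) • E 3 y ∧
    VectorField.lieBracket ℝ (E 1) (E 2) y = (-(h y) * fderiv ℝ f y (E 1 y)) • E 3 y ∧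
    VectorField.lieBracket ℝ (E 0) (E 3) y = (-(fderiv ℝ h y (E 0 y)) / h y) • E 3 y ∧
    VectorField.lieBracket ℝ (E 1) (E 3) y = (-(fderiv ℝ h y (E 1 y)) / h y) • E 3 y ∧
    VectorField.lieBracket ℝ (E 2) (E 3) y = 0 := by
  have h0 := H.fderiv_vertical (H.inv_E₀ y hy)
  have h1 := H.fderiv_vertical (H.inv_E₁ y hy)
  have h2 := H.fderiv_vertical (H.inv_f y hy)
  have h3 := H.fderiv_vertical (H.inv_h y hy)
  simp only [VectorField.lieBracket, H.fderiv_E₂ hy, H.fderiv_E₃ hy, h0.1, h0.2, h1.1, h1.2,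
    h2.2, h3.1]
  simp

/-- The inner products are constant, so the Koszul formula gives the connection coefficients in
terms of `r₁, r₂, l` and of the brackets above. That is the table `nullConnection`, and only its
torsion and metric equations need checking. -/
theorem isFrameOn (H : IsNullFrameOn G U ε E h f r₁ r₂ l) :
    Coord.IsFrameOn G E (nullConnection ε r₁ r₂ l (fun y => -(h y) * fderiv ℝ f y (E 0 y))
      (fun y => -(h y) * fderiv ℝ f y (E 1 y)) (fun y => -(fderiv ℝ h y (E 0 y)) / h y)
      (fun y => -(fderiv ℝ h y (E 1 y)) / h y)) U where
  smooth := H.smooth_E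
  indep y hy := H.linearIndependent hy
  smooth_coeff := by
    have hm : ∀ i : Fin 4, ContDiffOn ℝ ∞ (fun y => -(h y) * fderiv ℝ f y (E i y)) U := fun i =>
      H.smooth_h.neg.mul ((H.smooth_f.fderiv_of_isOpen H.isOpen (by simp)).clm_apply (H.smooth_E i))
    have hn : ∀ i : Fin 4, ContDiffOn ℝ ∞ (fun y => -(fderiv ℝ h y (E i y)) / h y) U := fun i =>
      ((H.smooth_h.fderiv_of_isOpen H.isOpen (by simp)).clm_apply (H.smooth_E i)).neg.div
        H.smooth_h H.h_ne
    exact contDiffOn_nullConnection H.smooth_r₁ H.smooth_r₂ H.smooth_l (hm 0) (hm 1) (hn 0) (hn 1)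
  torsion y hy a b := by
    obtain ⟨b02, b12, b03, b13, b23⟩ := H.brackets hy
    have b01 := H.bracket y hy
    have hs : ∀ V W : E4 → E4, VectorField.lieBracket ℝ V W y =
        -VectorField.lieBracket ℝ W V y := fun V W => by
      simp [VectorField.lieBracket]
    fin_cases a <;> fin_cases b <;>
      simp [Fin.sum_univ_four, nullConnection, b01, b02, b03, b12, b13, b23] <;>
      first
      | module
      | (rw [hs]; simp [b01, b02, b03, b12, b13, b23]; done)
      | (rw [hs]; simp [b01, b03, b13]; module)
  metric y hy a b c := by
    have h1 : fderiv ℝ (fun x => Coord.bilin (G x) (E a x) (E b x)) y = 0 := by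
      refine HasFDerivAt.fderiv ((hasFDerivAt_const ((!![1, 0, 0, 0; 0, ε, 0, 0; 0, 0, 0, 1;
        0, 0, 1, 0] : Matrix (Fin 4) (Fin 4) ℝ) a b) y).congr_of_eventuallyEq ?_)
      filter_upwards [H.isOpen.mem_nhds hy] with x hx using H.inner x hx a b
    rw [h1, _root_.zero_apply]
    simp only [H.inner y hy]
    have he := mul_self_eq_one_iff.1 H.eps
    fin_cases a <;> fin_cases b <;> fin_cases c <;>
      simp [Fin.sum_univ_four, nullConnection] <;>
      first | ring1 | (rcases he with he | he <;> rw [he] <;> ring1)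

end IsNullFrameOn

end Soliton

/-! ### Ricci curvature of a null frame. -/

namespace Soliton

namespace IsNullFrameOn

variable {G : E4 → Matrix (Fin 4) (Fin 4) ℝ} {U : Set E4} {ε : ℝ} {E : Fin 4 → E4 → E4}
  {h f r₁ r₂ l : E4 → ℝ}

/-- By symmetry of second derivatives, the derivative of an invariant function along an invariant
field is invariant. It makes the connection coefficients of the frame constant along the leaves. -/
theorem inv_fderiv (H : IsNullFrameOn G U ε E h f r₁ r₂ l) {k : E4 → ℝ}
    (hk : ContDiffOn ℝ ∞ k U) {v : E4} (hv : ∀ y ∈ U, fderiv ℝ k y v = 0) {V : E4 → E4}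
    (hV : ContDiffOn ℝ ∞ V U) {y : E4} (hy : y ∈ U) (hVv : fderiv ℝ V y v = 0) :
    fderiv ℝ (fun x => fderiv ℝ k x (V x)) y v = 0 := by
  have hU := H.isOpen.mem_nhds hy
  have h1 : HasFDerivAt (fderiv ℝ k) (fderiv ℝ (fderiv ℝ k) y) y :=
    (((hk.fderiv_of_isOpen H.isOpen (m := ∞) (by simp)).differentiableOn
      (by simp)).differentiableAt hU).hasFDerivAt
  have h2 := h1.clm_apply ((hV.differentiableOn (by simp)).differentiableAt hU).hasFDerivAt
  have h0 : ∀ᶠ z in 𝓝 y, HasFDerivAt k (fderiv ℝ k z) z := by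
    filter_upwards [hU] with z hz
    exact ((hk.differentiableOn (by simp)).differentiableAt (H.isOpen.mem_nhds hz)).hasFDerivAt
  have h3 : fderiv ℝ (fderiv ℝ k) y v (V y) = fderiv ℝ (fderiv ℝ k) y (V y) v :=
    second_derivative_symmetric_of_eventually h0 h1 _ _
  have h4 : HasFDerivAt (fun x => fderiv ℝ k x v) (0 : E4 →L[ℝ] ℝ) y := by
    refine (hasFDerivAt_const (0 : ℝ) y).congr_of_eventuallyEq ?_
    filter_upwards [hU] with z hz using hv z hz
  have h5 := (h1.clm_apply (hasFDerivAt_const (v : E4) y)).unique h4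
  have h6 := congrArg (fun L => L (V y)) h5
  simp at h6
  rw [h2.fderiv]
  simp [hVv, h3, h6]

/-- Some components of the Ricci tensor in a frame with connection coefficients of the shape
`nullConnection`. -/
theorem _root_.Soliton.bilin_ricci_nullConnection {m₁ m₂ n₁ n₂ : E4 → ℝ}
    (HF : Coord.IsFrameOn G E (nullConnection ε r₁ r₂ l m₁ m₂ n₁ n₂) U)
    (hG : Coord.IsMetricOn G U) (hU : IsOpen U) {y : E4} (hy : y ∈ U) (hε : ε * ε = 1)
    (hl : DifferentiableAt ℝ l y) (hr₂ : DifferentiableAt ℝ r₂ y) (hm₁ : DifferentiableAt ℝ m₁ y)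
    (hm₂ : DifferentiableAt ℝ m₂ y) (hn₁ : DifferentiableAt ℝ n₁ y) (hn₂ : DifferentiableAt ℝ n₂ y)
    (v1 : fderiv ℝ r₁ y (E 2 y) = 0 ∧ fderiv ℝ r₁ y (E 3 y) = 0)
    (v2 : fderiv ℝ r₂ y (E 2 y) = 0 ∧ fderiv ℝ r₂ y (E 3 y) = 0)
    (v4 : fderiv ℝ m₁ y (E 2 y) = 0 ∧ fderiv ℝ m₁ y (E 3 y) = 0)
    (v5 : fderiv ℝ m₂ y (E 2 y) = 0 ∧ fderiv ℝ m₂ y (E 3 y) = 0)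
    (v6 : fderiv ℝ n₁ y (E 2 y) = 0 ∧ fderiv ℝ n₁ y (E 3 y) = 0)
    (v7 : fderiv ℝ n₂ y (E 2 y) = 0 ∧ fderiv ℝ n₂ y (E 3 y) = 0) :
    let R := fun a b => Coord.bilin (Matrix.of fun i j => Coord.ricci G i j y) (E a y) (E b y)
    R 0 2 = ε / 2 * l y * m₂ y ∧ R 1 2 = -(1 / 2) * l y * m₁ y ∧
    R 0 3 = -(ε / 2) * fderiv ℝ l y (E 1 y) + ε * l y * n₂ y ∧
    R 1 3 = 1 / 2 * fderiv ℝ l y (E 0 y) - l y * n₁ y ∧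
    R 3 3 = ε / 2 * l y ^ 2 := by
  have hR := fun a b => HF.ricci_eq hG hU hy a b
  have d2 := fun t : ℝ => fderiv_const_smul hr₂ t
  have d3 := fun t : ℝ => fderiv_const_smul hl t
  have d4 := fun t : ℝ => fderiv_const_smul hm₁ t
  have d5 := fun t : ℝ => fderiv_const_smul hm₂ t
  have d6 := fun t : ℝ => fderiv_const_smul hn₁ t
  have d7 := fun t : ℝ => fderiv_const_smul hn₂ t
  have he := mul_self_eq_one_iff.1 hε
  refine ⟨?_, ?_, ?_, ?_, ?_⟩ <;> dsimp only <;> rw [hR] <;>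
    simp [Fin.sum_univ_four, nullConnection, fderiv_neg, d3, d6, d7, v1.1, v1.2,
      v2.1, v2.2, v4.2, v5.2, v6.1, v6.2, v7.1, v7.2] <;>
    first | ring1 | (rcases he with he | he <;> rw [he] <;> ring1)

/-- The Ricci tensor in a frame with connection coefficients of the shape `nullConnection`, where
the leaves are totally geodesic up to the curvature vector. -/
theorem _root_.Soliton.bilin_ricci_nullConnection_const {m₁ m₂ n₁ n₂ : E4 → ℝ}
    (HF : Coord.IsFrameOn G E (nullConnection ε r₁ r₂ l m₁ m₂ n₁ n₂) U)
    (hG : Coord.IsMetricOn G U) (hU : IsOpen U) {y : E4} (hy : y ∈ U) (hε : ε * ε = 1)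
    (hl : DifferentiableAt ℝ l y) (hr₁ : DifferentiableAt ℝ r₁ y) (hr₂ : DifferentiableAt ℝ r₂ y)
    (hm₁ : DifferentiableAt ℝ m₁ y)
    (hm₂ : DifferentiableAt ℝ m₂ y) (hn₁ : DifferentiableAt ℝ n₁ y) (hn₂ : DifferentiableAt ℝ n₂ y)
    (v1 : fderiv ℝ r₁ y (E 2 y) = 0 ∧ fderiv ℝ r₁ y (E 3 y) = 0)
    (v2 : fderiv ℝ r₂ y (E 2 y) = 0 ∧ fderiv ℝ r₂ y (E 3 y) = 0)
    (v3 : fderiv ℝ l y = 0) (v4 : m₁ y = 0 ∧ fderiv ℝ m₁ y = 0)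
    (v5 : m₂ y = 0 ∧ fderiv ℝ m₂ y = 0) (v6 : n₁ y = 0 ∧ fderiv ℝ n₁ y = 0)
    (v7 : n₂ y = 0 ∧ fderiv ℝ n₂ y = 0) (a b : Fin 4) :
    Coord.bilin (Matrix.of fun i j => Coord.ricci G i j y) (E a y) (E b y) =
    (let K := fderiv ℝ r₂ y (E 0 y) - ε * fderiv ℝ r₁ y (E 1 y) - ε * r₁ y ^ 2 - r₂ y ^ 2
    !![K, 0, 0, 0; 0, ε * K, 0, 0; 0, 0, 0, 0; 0, 0, 0, ε / 2 * l y ^ 2] :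
      Matrix (Fin 4) (Fin 4) ℝ) a b := by
  have d1 := fun t : ℝ => fderiv_const_smul hr₁ t
  have d2 := fun t : ℝ => fderiv_const_smul hr₂ t
  have d3 := fun t : ℝ => fderiv_const_smul hl t
  have d4 := fun t : ℝ => fderiv_const_smul hm₁ t
  have d5 := fun t : ℝ => fderiv_const_smul hm₂ t
  have d6 := fun t : ℝ => fderiv_const_smul hn₁ t
  have d7 := fun t : ℝ => fderiv_const_smul hn₂ t
  have he := mul_self_eq_one_iff.1 hε
  rw [HF.ricci_eq hG hU hy a b]
  fin_cases a <;> fin_cases b <;>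
    simp [Fin.sum_univ_four, nullConnection, fderiv_neg, d1, d2, d3, d5, d6, d7, v1.1, v1.2,
      v2.1, v2.2, v3, v4.1, v4.2, v5.1, v5.2, v6.1, v6.2, v7.1, v7.2] <;>
    first | ring1 | (rcases he with he | he <;> rw [he] <;> ring1)

/-- Components of the Ricci tensor in a null frame. -/
theorem bilin_ricci (H : IsNullFrameOn G U ε E h f r₁ r₂ l) {y : E4} (hy : y ∈ U) :
    Coord.bilin (Matrix.of fun i j => Coord.ricci G i j y) (E 0 y) (E 2 y) =
       ε / 2 * l y * (-(h y) * fderiv ℝ f y (E 1 y)) ∧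
    Coord.bilin (Matrix.of fun i j => Coord.ricci G i j y) (E 1 y) (E 2 y) =
       -(1 / 2) * l y * (-(h y) * fderiv ℝ f y (E 0 y)) ∧
    Coord.bilin (Matrix.of fun i j => Coord.ricci G i j y) (E 0 y) (E 3 y) =
       -(ε / 2) * fderiv ℝ l y (E 1 y) + ε * l y * (-(fderiv ℝ h y (E 1 y)) / h y) ∧
    Coord.bilin (Matrix.of fun i j => Coord.ricci G i j y) (E 1 y) (E 3 y) =
       1 / 2 * fderiv ℝ l y (E 0 y) - l y * (-(fderiv ℝ h y (E 0 y)) / h y) ∧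
    Coord.bilin (Matrix.of fun i j => Coord.ricci G i j y) (E 3 y) (E 3 y) =
       ε / 2 * l y ^ 2 := by
  obtain ⟨hE, hh, hf, hr1, hr2, hl⟩ := H.differentiableAt hy
  have hU := H.isOpen.mem_nhds hy
  have dD : ∀ k : E4 → ℝ, ContDiffOn ℝ ∞ k U → ∀ i,
      DifferentiableAt ℝ (fun x => fderiv ℝ k x (E i x)) y := fun k hk i =>
    (((hk.fderiv_of_isOpen H.isOpen (m := ∞) (by simp)).differentiableOn
      (by simp)).differentiableAt hU).clm_apply (hE i)
  have inv : ∀ i : Fin 4, (i = 0 ∨ i = 1) → ∀ k : E4 → ℝ, ContDiffOn ℝ ∞ k U →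
      (∀ x ∈ U, fderiv ℝ k x (EuclideanSpace.single 2 1) = 0 ∧
        fderiv ℝ k x (EuclideanSpace.single 3 1) = 0) →
      fderiv ℝ (fun x => fderiv ℝ k x (E i x)) y (EuclideanSpace.single 2 1) = 0 ∧
      fderiv ℝ (fun x => fderiv ℝ k x (E i x)) y (EuclideanSpace.single 3 1) = 0 := by
    intro i hi k hk hkv
    have hEi : fderiv ℝ (E i) y (EuclideanSpace.single 2 1) = 0 ∧
        fderiv ℝ (E i) y (EuclideanSpace.single 3 1) = 0 := by
      rcases hi with rfl | rfl
      · exact H.inv_E₀ y hy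
      · exact H.inv_E₁ y hy
    exact ⟨H.inv_fderiv hk (fun x hx => (hkv x hx).1) (H.smooth_E i) hy hEi.1,
      H.inv_fderiv hk (fun x hx => (hkv x hx).2) (H.smooth_E i) hy hEi.2⟩
  have hm : ∀ i : Fin 4, (i = 0 ∨ i = 1) →
      DifferentiableAt ℝ (fun x => -(h x) * fderiv ℝ f x (E i x)) y ∧
      fderiv ℝ (fun x => -(h x) * fderiv ℝ f x (E i x)) y (E 2 y) = 0 ∧
      fderiv ℝ (fun x => -(h x) * fderiv ℝ f x (E i x)) y (E 3 y) = 0 := fun i hi => by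
    have h1 := hh.hasFDerivAt.neg.mul (dD f H.smooth_f i).hasFDerivAt
    have h2 := inv i hi f H.smooth_f H.inv_f
    refine ⟨h1.differentiableAt, H.fderiv_vertical ?_⟩
    have h3 : fderiv ℝ (fun x => -(h x) * fderiv ℝ f x (E i x)) y = _ := h1.fderiv
    rw [h3]
    simp [h2.1, h2.2, (H.inv_h y hy).1, (H.inv_h y hy).2]
  have hn : ∀ i : Fin 4, (i = 0 ∨ i = 1) →
      DifferentiableAt ℝ (fun x => -(fderiv ℝ h x (E i x)) / h x) y ∧
      fderiv ℝ (fun x => -(fderiv ℝ h x (E i x)) / h x) y (E 2 y) = 0 ∧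
      fderiv ℝ (fun x => -(fderiv ℝ h x (E i x)) / h x) y (E 3 y) = 0 := fun i hi => by
    have h1 := (dD h H.smooth_h i).hasFDerivAt.neg.mul
      ((hasDerivAt_inv (H.h_ne y hy)).comp_hasFDerivAt y hh.hasFDerivAt)
    have h2 := inv i hi h H.smooth_h H.inv_h
    have h4 : (fun x => -(fderiv ℝ h x (E i x)) / h x) =
      (-fun x => fderiv ℝ h x (E i x)) * (Inv.inv ∘ h) := funext fun x => div_eq_mul_inv _ _
    rw [h4]
    refine ⟨h1.differentiableAt, H.fderiv_vertical ?_⟩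
    rw [h1.fderiv]
    simp [h2.1, h2.2, (H.inv_h y hy).1, (H.inv_h y hy).2]
  exact bilin_ricci_nullConnection H.isFrameOn H.metric H.isOpen hy H.eps hl hr2
    (hm 0 (.inl rfl)).1 (hm 1 (.inr rfl)).1 (hn 0 (.inl rfl)).1 (hn 1 (.inr rfl)).1
    (H.fderiv_vertical (H.inv_r₁ y hy)) (H.fderiv_vertical (H.inv_r₂ y hy))
    (hm 0 (.inl rfl)).2 (hm 1 (.inr rfl)).2
    (hn 0 (.inl rfl)).2 (hn 1 (.inr rfl)).2

/-- The Ricci tensor in a null frame with constant coefficients on the leaves. -/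
theorem bilin_ricci_const (H : IsNullFrameOn G U ε E h f r₁ r₂ l)
    (hh : ∀ y ∈ U, fderiv ℝ h y = 0) (hf : ∀ y ∈ U, fderiv ℝ f y = 0)
    (hl : ∀ y ∈ U, fderiv ℝ l y = 0) {y : E4} (hy : y ∈ U) (a b : Fin 4) :
    Coord.bilin (Matrix.of fun i j => Coord.ricci G i j y) (E a y) (E b y) =
    (!![fderiv ℝ r₂ y (E 0 y) - ε * fderiv ℝ r₁ y (E 1 y) - ε * r₁ y ^ 2 - r₂ y ^ 2, 0, 0, 0;
      0, ε * (fderiv ℝ r₂ y (E 0 y) - ε * fderiv ℝ r₁ y (E 1 y) - ε * r₁ y ^ 2 - r₂ y ^ 2), 0, 0;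
      0, 0, 0, 0; 0, 0, 0, ε / 2 * l y ^ 2] : Matrix (Fin 4) (Fin 4) ℝ) a b := by
  obtain ⟨-, -, -, hr1, hr2, hl'⟩ := H.differentiableAt hy
  have key : ∀ k : E4 → ℝ, (∀ x ∈ U, k x = 0) →
      DifferentiableAt ℝ k y ∧ k y = 0 ∧ fderiv ℝ k y = 0 := fun k hk => by
    have h1 : HasFDerivAt k (0 : E4 →L[ℝ] ℝ) y :=
      (hasFDerivAt_const (0 : ℝ) y).congr_of_eventuallyEq
        (by filter_upwards [H.isOpen.mem_nhds hy] with x hx using hk x hx)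
    exact ⟨h1.differentiableAt, hk y hy, h1.fderiv⟩
  have hm : ∀ i, ∀ x ∈ U, -(h x) * fderiv ℝ f x (E i x) = 0 := fun i x hx => by simp [hf x hx]
  have hn : ∀ i, ∀ x ∈ U, -(fderiv ℝ h x (E i x)) / h x = 0 := fun i x hx => by simp [hh x hx]
  exact bilin_ricci_nullConnection_const H.isFrameOn H.metric H.isOpen hy H.eps hl' hr1 hr2
    (key _ (hm 0)).1 (key _ (hm 1)).1 (key _ (hn 0)).1 (key _ (hn 1)).1
    (H.fderiv_vertical (H.inv_r₁ y hy)) (H.fderiv_vertical (H.inv_r₂ y hy)) (hl y hy)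
    (key _ (hm 0)).2 (key _ (hm 1)).2 (key _ (hn 0)).2 (key _ (hn 1)).2 a b

end IsNullFrameOn

end Soliton

/-! ### The soliton equation in a null frame. -/

namespace Soliton

theorem eq_zero_of_apply_frame {F : Type*} [NormedAddCommGroup F] [NormedSpace ℝ F]
    {e : Fin 4 → E4} (he : LinearIndependent ℝ e) {L : E4 →L[ℝ] F} (h : ∀ a, L (e a) = 0) :
    L = 0 := by
  let b := basisOfLinearIndependentOfCardEqFinrank he (by simp)
  refine ContinuousLinearMap.coe_injective (b.ext fun i => ?_)
  simp [b, h]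

namespace IsNullFrameOn

variable {G : E4 → Matrix (Fin 4) (Fin 4) ℝ} {U : Set E4} {ε : ℝ} {E : Fin 4 → E4 → E4}
  {h f r₁ r₂ l : E4 → ℝ} {X : E4 → E4}

theorem eq_smul_add_smul {y : E4} (H : IsNullFrameOn G U ε E h f r₁ r₂ l) (hy : y ∈ U) {v : E4}
    (h0 : v 0 = 0) (h1 : v 1 = 0) : v = v 2 • E 2 y + (h y * (f y * v 2 + v 3)) • E 3 y := by
  have := H.h_ne y hy
  rw [H.E₂, H.E₃]
  refine PiLp.ext fun k => ?_
  fin_cases k <;> simp [h0, h1]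
  field_simp
  ring

theorem fderiv_of_vertical (H : IsNullFrameOn G U ε E h f r₁ r₂ l) {y : E4} (hy : y ∈ U) {v : E4}
    (h0 : v 0 = 0) (h1 : v 1 = 0) {F : Type*} [NormedAddCommGroup F] [NormedSpace ℝ F]
    {k : E4 → F} (hk : fderiv ℝ k y (EuclideanSpace.single 2 1) = 0 ∧
      fderiv ℝ k y (EuclideanSpace.single 3 1) = 0) : fderiv ℝ k y v = 0 := by
  rw [H.eq_smul_add_smul hy h0 h1, map_add, map_smul, map_smul, (H.fderiv_vertical hk).1,
    (H.fderiv_vertical hk).2, smul_zero, smul_zero, add_zero]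

theorem fderiv_apply_eq_zero (hU : IsOpen U) {i : Fin 4} (hX : ContDiffOn ℝ ∞ X U)
    (h0 : ∀ y ∈ U, X y i = 0) {y : E4} (hy : y ∈ U) (v : E4) : fderiv ℝ X y v i = 0 := by
  have h1 := (EuclideanSpace.proj i : E4 →L[ℝ] ℝ).hasFDerivAt.comp y
    ((hX.differentiableOn (by simp)).differentiableAt (hU.mem_nhds hy)).hasFDerivAt
  have h2 : HasFDerivAt ((EuclideanSpace.proj i : E4 →L[ℝ] ℝ) ∘ X) (0 : E4 →L[ℝ] ℝ) y :=
    (hasFDerivAt_const (0 : ℝ) y).congr_of_eventuallyEq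
      (by filter_upwards [hU.mem_nhds hy] with z hz using h0 z hz)
  exact congrArg (fun L => L v) (h1.unique h2)

/-- The Lie derivative of the metric along a field that is tangent to the leaves and commutes
with `E₀, E₁, E₂`. -/
theorem bilin_lieDerivMetric (H : IsNullFrameOn G U ε E h f r₁ r₂ l) (hX : ContDiffOn ℝ ∞ X U)
    (hX0 : ∀ y ∈ U, X y 0 = 0) (hX1 : ∀ y ∈ U, X y 1 = 0) {y : E4} (hy : y ∈ U)
    (hE : ∀ a, a ≠ 3 → fderiv ℝ X y (E a y) = 0) (a b : Fin 4) :
    Coord.bilin (Matrix.of fun i j => Coord.lieDerivMetric G X i j y) (E a y) (E b y) =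
    (!![0, 0, 0, 0; 0, 0, 0, 0;
      0, 0, 0, f y * fderiv ℝ X y (EuclideanSpace.single 3 1) 2
        + fderiv ℝ X y (EuclideanSpace.single 3 1) 3;
      0, 0, f y * fderiv ℝ X y (EuclideanSpace.single 3 1) 2
        + fderiv ℝ X y (EuclideanSpace.single 3 1) 3,
      2 * fderiv ℝ X y (EuclideanSpace.single 3 1) 2 / h y] : Matrix (Fin 4) (Fin 4) ℝ) a b := by
  have hU := H.isOpen.mem_nhds hy
  have hh := H.h_ne y hy
  have dX := (hX.differentiableOn (by simp)).differentiableAt hU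
  have hE' := (H.differentiableAt hy).1
  set D := fderiv ℝ X y (EuclideanSpace.single 3 1) with hD
  have hDX := H.eq_smul_add_smul hy (fderiv_apply_eq_zero H.isOpen hX hX0 hy
    (EuclideanSpace.single 3 1)) (fderiv_apply_eq_zero H.isOpen hX hX1 hy _)
  rw [← hD] at hDX
  have v : ∀ k : E4 → ℝ, fderiv ℝ k y (EuclideanSpace.single 2 1) = 0 ∧
      fderiv ℝ k y (EuclideanSpace.single 3 1) = 0 → fderiv ℝ k y (X y) = 0 := fun k hk =>
    H.fderiv_of_vertical hy (hX0 y hy) (hX1 y hy) hk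
  -- The coefficients of the frame are constant along the vertical field `X`, so `[X, E a]` reduces
  -- to `-DX (E a)`. By hypothesis this survives only for `a = 3`.
  have b0 : VectorField.lieBracket ℝ X (E 0) y = 0 := by
    rw [VectorField.lieBracket, H.fderiv_of_vertical hy (hX0 y hy) (hX1 y hy) (H.inv_E₀ y hy),
      hE 0 (by decide), sub_zero]
  have b1 : VectorField.lieBracket ℝ X (E 1) y = 0 := by
    rw [VectorField.lieBracket, H.fderiv_of_vertical hy (hX0 y hy) (hX1 y hy) (H.inv_E₁ y hy),
      hE 1 (by decide), sub_zero]
  have b2 : VectorField.lieBracket ℝ X (E 2) y = 0 := by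
    rw [VectorField.lieBracket, H.fderiv_E₂ hy, v f (H.inv_f y hy), hE 2 (by decide)]
    simp
  have b3 : VectorField.lieBracket ℝ X (E 3) y =
      (-(D 2) / h y) • E 2 y + (-(f y * D 2 + D 3)) • E 3 y := by
    have h3 : fderiv ℝ X y (E 3 y) = (h y)⁻¹ • D := by rw [H.E₃, map_smul]
    rw [VectorField.lieBracket, H.fderiv_E₃ hy, v h (H.inv_h y hy), h3, hDX]
    simp only [neg_zero, zero_div, zero_smul, zero_sub, smul_add, smul_smul, neg_add, ← neg_smul]
    congr 2
    · rw [← hDX]; field_simp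
    · rw [← hDX]; field_simp; ring
  have hc : fderiv ℝ (fun x => Coord.bilin (G x) (E a x) (E b x)) y = 0 := by
    refine HasFDerivAt.fderiv ((hasFDerivAt_const ((!![1, 0, 0, 0; 0, ε, 0, 0; 0, 0, 0, 1;
      0, 0, 1, 0] : Matrix (Fin 4) (Fin 4) ℝ) a b) y).congr_of_eventuallyEq ?_)
    filter_upwards [hU] with x hx using H.inner x hx a b
  rw [Coord.bilin_lieDerivMetric (H.metric.differentiableAt H.isOpen hy) dX (hE' a) (hE' b), hc,
    _root_.zero_apply]
  have hi := H.inner y hy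
  fin_cases a <;> fin_cases b <;> simp [b0, b1, b2, b3, hi]
  ring

/-- A field that commutes with `E₀` and `E₁` commutes with `[E₀, E₁]`, too. -/
theorem fderiv_E₂_eq_zero (H : IsNullFrameOn G U ε E h f r₁ r₂ l) (hX : ContDiffOn ℝ ∞ X U)
    (hl : ∀ y ∈ U, l y ≠ 0) (hE : ∀ y ∈ U, ∀ a, a = 0 ∨ a = 1 → fderiv ℝ X y (E a y) = 0)
    {y : E4} (hy : y ∈ U) : fderiv ℝ X y (E 2 y) = 0 := by
  have hU := H.isOpen.mem_nhds hy
  have h1 : HasFDerivAt (fderiv ℝ X) (fderiv ℝ (fderiv ℝ X) y) y :=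
    (((hX.fderiv_of_isOpen H.isOpen (m := ∞) (by simp)).differentiableOn
      (by simp)).differentiableAt hU).hasFDerivAt
  have h0 : ∀ᶠ z in 𝓝 y, HasFDerivAt X (fderiv ℝ X z) z := by
    filter_upwards [hU] with z hz
    exact ((hX.differentiableOn (by simp)).differentiableAt (H.isOpen.mem_nhds hz)).hasFDerivAt
  have h3 : ∀ u v, fderiv ℝ (fderiv ℝ X) y u v = fderiv ℝ (fderiv ℝ X) y v u :=
    second_derivative_symmetric_of_eventually h0 h1
  have h4 : ∀ a, a = 0 ∨ a = 1 → ∀ w, fderiv ℝ (fderiv ℝ X) y w (E a y) +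
      fderiv ℝ X y (fderiv ℝ (E a) y w) = 0 := by
    intro a ha w
    have h5 : HasFDerivAt (fun x => fderiv ℝ X x (E a x)) (0 : E4 →L[ℝ] E4) y := by
      refine (hasFDerivAt_const (0 : E4) y).congr_of_eventuallyEq ?_
      filter_upwards [hU] with z hz using hE z hz a ha
    have h6 := (h1.clm_apply ((H.differentiableAt hy).1 a).hasFDerivAt).unique h5
    have h7 := congrArg (fun L => L w) h6
    simpa [add_comm] using h7
  -- Differentiating `DX (E 1) = 0` along `E 0` and `DX (E 0) = 0` along `E 1` and subtracting
  -- cancels the second derivatives of `X` and leaves `DX [E 0, E 1] = 0`. Since `l ≠ 0`, the `E 2`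
  -- component of the bracket gives the claim.
  have h5 : fderiv ℝ X y (VectorField.lieBracket ℝ (E 0) (E 1) y) = 0 := by
    have h6 := h4 1 (.inr rfl) (E 0 y)
    have h7 := h4 0 (.inl rfl) (E 1 y)
    rw [h3] at h6
    rw [VectorField.lieBracket, map_sub, ← add_right_inj (fderiv ℝ (fderiv ℝ X) y (E 1 y) (E 0 y)),
      ← add_sub_assoc, h6, zero_sub, add_zero]
    exact (eq_neg_of_add_eq_zero_left h7).symm
  rw [H.bracket y hy, map_add, map_add, map_smul, map_smul, map_smul, hE y hy 0 (.inl rfl),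
    hE y hy 1 (.inr rfl)] at h5
  simpa [hl y hy] using h5

/-- The consequences of the soliton equation for a soliton field that is tangent to the leaves
and commutes with `E₀` and `E₁`. -/
theorem soliton (H : IsNullFrameOn G U ε E h f r₁ r₂ l) (hX : ContDiffOn ℝ ∞ X U)
    (hX0 : ∀ y ∈ U, X y 0 = 0) (hX1 : ∀ y ∈ U, X y 1 = 0) (hl : ∀ y ∈ U, l y ≠ 0)
    (hE : ∀ y ∈ U, ∀ a, a = 0 ∨ a = 1 → fderiv ℝ X y (E a y) = 0) {Λ : ℝ}
    (hS : ∀ y ∈ U, ∀ u v, Coord.bilin (Matrix.of fun i j => Coord.ricci G i j y) u v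
      + (1 / 2) * Coord.bilin (Matrix.of fun i j => Coord.lieDerivMetric G X i j y) u v
      = Λ * Coord.bilin (G y) u v) :
    ∀ y ∈ U, fderiv ℝ h y = 0 ∧ fderiv ℝ f y = 0 ∧ fderiv ℝ l y = 0 ∧
      fderiv ℝ r₂ y (E 0 y) - ε * fderiv ℝ r₁ y (E 1 y) - ε * r₁ y ^ 2 - r₂ y ^ 2 = Λ ∧
      fderiv ℝ X y (EuclideanSpace.single 3 1) 2 = -(ε / 2) * (h y * l y ^ 2) ∧
      f y * fderiv ℝ X y (EuclideanSpace.single 3 1) 2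
        + fderiv ℝ X y (EuclideanSpace.single 3 1) 3 = 2 * Λ := by
  have hε : ε ≠ 0 := fun h0 => by simpa [h0] using H.eps
  have hE' : ∀ y ∈ U, ∀ a, a ≠ 3 → fderiv ℝ X y (E a y) = 0 := fun y hy a ha => by
    have h2 := H.fderiv_E₂_eq_zero hX hl hE hy
    fin_cases a
    · exact hE y hy 0 (.inl rfl)
    · exact hE y hy 1 (.inr rfl)
    · exact h2
    · exact absurd rfl ha
  have hL := fun y hy => H.bilin_lieDerivMetric hX hX0 hX1 (y := y) hy (hE' y hy)
  have hR := fun y hy => H.bilin_ricci (y := y) hy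
  have hS' : ∀ y ∈ U, ∀ a b, _ := fun y hy a b => hS y hy (E a y) (E b y)
  -- Entry `(3,3)`: here `g(E₃, E₃) = 0`, so the Lie derivative balances the Ricci term `(ε / 2)
  -- l²`.
  have hD : ∀ y ∈ U, fderiv ℝ X y (EuclideanSpace.single 3 1) 2 =
      -(ε / 2) * (h y * l y ^ 2) := fun y hy => by
    have h1 := hS' y hy 3 3
    have := H.h_ne y hy
    rw [hL y hy, H.inner y hy, (hR y hy).2.2.2.2] at h1
    simp at h1
    field_simp at h1 ⊢
    linear_combination h1
  -- Entries `(0,2)` and `(1,2)`: metric and Lie derivative vanish there, and the Ricci terms are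
  -- nonzero multiples of the derivatives of `f` along `E 1` and `E 0`.
  have hff : ∀ y ∈ U, fderiv ℝ f y = 0 := fun y hy => by
    have h1 := hS' y hy 0 2
    have h2 := hS' y hy 1 2
    have h3 := hl y hy
    have h4 := H.h_ne y hy
    rw [hL y hy, H.inner y hy, (hR y hy).1] at h1
    rw [hL y hy, H.inner y hy, (hR y hy).2.1] at h2
    simp [hε, h3, h4] at h1 h2
    have h5 := H.fderiv_vertical (H.inv_f y hy)
    refine eq_zero_of_apply_frame (H.linearIndependent hy) fun a => ?_
    fin_cases a
    exacts [h2, h1, h5.1, h5.2]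
  -- Entries `(0,3)` and `(1,3)`: the product `h² l` has vanishing horizontal derivatives.
  have hDl : ∀ y ∈ U, ∀ a : Fin 4, a = 0 ∨ a = 1 →
      h y * fderiv ℝ l y (E a y) = -2 * l y * fderiv ℝ h y (E a y) := by
    rintro y hy a ha
    have h1 := hS' y hy 0 3
    have h2 := hS' y hy 1 3
    have h4 := H.h_ne y hy
    rw [hL y hy, H.inner y hy, (hR y hy).2.2.1] at h1
    rw [hL y hy, H.inner y hy, (hR y hy).2.2.2.1] at h2
    simp at h1 h2
    rcases ha with rfl | rfl
    · field_simp at h2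
      linear_combination h2
    · field_simp at h1
      have h5 : ε * (h y * fderiv ℝ l y (E 1 y) + 2 * l y * fderiv ℝ h y (E 1 y)) = 0 := by
        linear_combination -h1
      linear_combination (mul_eq_zero.1 h5).resolve_left hε
  -- The derivative of `X` along `∂_{z₂}` is itself constant along `E 0` and `E 1`, because these do
  -- not depend on `z₂`. By `hD` so is `h l²`. The logarithmic derivatives of `h² l` and `h l²` are
  -- independent combinations of those of `h` and `l`, so the latter vanish.
  have hDh : ∀ y ∈ U, ∀ a : Fin 4, a = 0 ∨ a = 1 → fderiv ℝ h y (E a y) = 0 := by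
    intro y hy a ha
    have hU := H.isOpen.mem_nhds hy
    obtain ⟨dE, dh, -, -, -, dl⟩ := H.differentiableAt hy
    have h1 : HasFDerivAt (fderiv ℝ X) (fderiv ℝ (fderiv ℝ X) y) y :=
      (((hX.fderiv_of_isOpen H.isOpen (m := ∞) (by simp)).differentiableOn
        (by simp)).differentiableAt hU).hasFDerivAt
    have h0 : ∀ᶠ z in 𝓝 y, HasFDerivAt X (fderiv ℝ X z) z := by
      filter_upwards [hU] with z hz
      exact ((hX.differentiableOn (by simp)).differentiableAt (H.isOpen.mem_nhds hz)).hasFDerivAt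
    have h2 : fderiv ℝ (fderiv ℝ X) y (E a y) (EuclideanSpace.single 3 1) = 0 := by
      rw [second_derivative_symmetric_of_eventually h0 h1]
      have h5 : HasFDerivAt (fun x => fderiv ℝ X x (E a x)) (0 : E4 →L[ℝ] E4) y := by
        refine (hasFDerivAt_const (0 : E4) y).congr_of_eventuallyEq ?_
        filter_upwards [hU] with z hz using hE z hz a ha
      have h6 := (h1.clm_apply (dE a).hasFDerivAt).unique h5
      have h7 := congrArg (fun L => L (EuclideanSpace.single 3 1)) h6
      have h8 : fderiv ℝ (E a) y (EuclideanSpace.single 3 1) = 0 := by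
        rcases ha with rfl | rfl
        exacts [(H.inv_E₀ y hy).2, (H.inv_E₁ y hy).2]
      simpa [h8] using h7
    have h3 : HasFDerivAt (fun z => fderiv ℝ X z (EuclideanSpace.single 3 1) 2) _ y :=
      (EuclideanSpace.proj 2 : E4 →L[ℝ] ℝ).hasFDerivAt.comp y
        (h1.clm_apply (hasFDerivAt_const (EuclideanSpace.single 3 1 : E4) y))
    have h4 : HasFDerivAt (fun z => -(ε / 2) * (h z * l z ^ 2)) _ y :=
      (dh.hasFDerivAt.mul (dl.hasFDerivAt.pow 2)).const_mul _
    have h5 := h3.unique (h4.congr_of_eventuallyEq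
      (by filter_upwards [hU] with z hz using hD z hz))
    have h6 := congrArg (fun L => L (E a y)) h5
    simp only [ContinuousLinearMap.comp_apply, _root_.add_apply, _root_.smul_apply, smul_eq_mul,
      ContinuousLinearMap.flip_apply, h2, _root_.zero_apply, map_zero, add_zero] at h6
    have h7 := hDl y hy a ha
    have h8 : l y ^ 2 * fderiv ℝ h y (E a y) + 2 * h y * l y * fderiv ℝ l y (E a y) = 0 := by
      refine (mul_eq_zero.1 ?_).resolve_left hε
      simp only [nsmul_eq_mul, Nat.add_one_sub_one, pow_one, Nat.cast_ofNat] at h6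
      linear_combination 2 * h6
    -- The coefficients eliminate the derivative of `l` from `h7` and `h8`.
    have h9 : l y ^ 2 * fderiv ℝ h y (E a y) = 0 := by
      linear_combination (-1 / 3 : ℝ) * h8 + (2 / 3 : ℝ) * l y * h7
    exact (mul_eq_zero.1 h9).resolve_left (pow_ne_zero 2 (hl y hy))
  have hhf : ∀ y ∈ U, fderiv ℝ h y = 0 := fun y hy => by
    have h5 := H.fderiv_vertical (H.inv_h y hy)
    refine eq_zero_of_apply_frame (H.linearIndependent hy) fun a => ?_
    fin_cases a
    exacts [hDh y hy 0 (.inl rfl), hDh y hy 1 (.inr rfl), h5.1, h5.2]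
  have hlf : ∀ y ∈ U, fderiv ℝ l y = 0 := fun y hy => by
    have h5 := H.fderiv_vertical (H.inv_l y hy)
    have h6 : ∀ a : Fin 4, a = 0 ∨ a = 1 → fderiv ℝ l y (E a y) = 0 := fun a ha => by
      have h7 := hDl y hy a ha
      rw [hDh y hy a ha, mul_zero] at h7
      exact (mul_eq_zero.1 h7).resolve_left (H.h_ne y hy)
    refine eq_zero_of_apply_frame (H.linearIndependent hy) fun a => ?_
    fin_cases a
    exacts [h6 0 (.inl rfl), h6 1 (.inr rfl), h5.1, h5.2]
  intro y hy
  refine ⟨hhf y hy, hff y hy, hlf y hy, ?_, hD y hy, ?_⟩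
  -- Entry `(0,0)` is the Gauss curvature of the orbit metric; entry `(2,3)`, where the Ricci tensor
  -- vanishes, gives the last identity.
  · have h1 := hS' y hy 0 0
    rw [hL y hy, H.inner y hy, H.bilin_ricci_const hhf hff hlf hy] at h1
    simpa using h1
  · have h1 := hS' y hy 2 3
    rw [hL y hy, H.inner y hy, H.bilin_ricci_const hhf hff hlf hy] at h1
    simp at h1
    linear_combination 2 * h1

/-- The soliton equation, from its consequences. -/
theorem soliton_of_eq (H : IsNullFrameOn G U ε E h f r₁ r₂ l) (hX : ContDiffOn ℝ ∞ X U)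
    (hX0 : ∀ y ∈ U, X y 0 = 0) (hX1 : ∀ y ∈ U, X y 1 = 0)
    (hE : ∀ y ∈ U, ∀ a, a ≠ 3 → fderiv ℝ X y (E a y) = 0) {Λ : ℝ}
    (hh : ∀ y ∈ U, fderiv ℝ h y = 0) (hf : ∀ y ∈ U, fderiv ℝ f y = 0)
    (hl : ∀ y ∈ U, fderiv ℝ l y = 0)
    (hK : ∀ y ∈ U,
      fderiv ℝ r₂ y (E 0 y) - ε * fderiv ℝ r₁ y (E 1 y) - ε * r₁ y ^ 2 - r₂ y ^ 2 = Λ)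
    (hD : ∀ y ∈ U, fderiv ℝ X y (EuclideanSpace.single 3 1) 2 = -(ε / 2) * (h y * l y ^ 2))
    (hD' : ∀ y ∈ U, f y * fderiv ℝ X y (EuclideanSpace.single 3 1) 2
        + fderiv ℝ X y (EuclideanSpace.single 3 1) 3 = 2 * Λ) :
    ∀ y ∈ U, ∀ u v, Coord.bilin (Matrix.of fun i j => Coord.ricci G i j y) u v
      + (1 / 2) * Coord.bilin (Matrix.of fun i j => Coord.lieDerivMetric G X i j y) u v
      = Λ * Coord.bilin (G y) u v := by
  intro y hy u v
  have key : Coord.bilin (Matrix.of fun i j => Coord.ricci G i j y)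
      + (1 / 2 : ℝ) • Coord.bilin (Matrix.of fun i j => Coord.lieDerivMetric G X i j y)
      = Λ • Coord.bilin (G y) := by
    refine Coord.bilin_ext (H.linearIndependent hy) fun a b => ?_
    simp only [_root_.add_apply, _root_.smul_apply, smul_eq_mul]
    rw [H.bilin_lieDerivMetric hX hX0 hX1 hy (hE y hy), H.inner y hy,
      H.bilin_ricci_const hh hf hl hy, hK y hy, hD' y hy, hD y hy]
    have := H.h_ne y hy
    fin_cases a <;> fin_cases b <;> simp
    all_goals field_simp
    ring
  exact congrArg (fun B => B u v) key

end IsNullFrameOn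

end Soliton

namespace Soliton

/-! ## The normal form in coordinates -/

/-- The projection `projT`, as a continuous linear map. -/
def projTL : E4 →L[ℝ] E2 :=
  ((PiLp.continuousLinearEquiv 2 ℝ fun _ : Fin 2 => ℝ).symm : (Fin 2 → ℝ) →L[ℝ] E2).comp
    (ContinuousLinearMap.pi ![EuclideanSpace.proj 0, EuclideanSpace.proj 1])

theorem projTL_apply (y : E4) : projTL y = projT y := by
  refine PiLp.ext fun k => ?_
  fin_cases k <;> simp [projTL, projT]

theorem projT_single : projT (EuclideanSpace.single 0 1) = EuclideanSpace.single 0 1 ∧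
    projT (EuclideanSpace.single 1 1) = EuclideanSpace.single 1 1 ∧
    projT (EuclideanSpace.single 2 1) = 0 ∧ projT (EuclideanSpace.single 3 1) = 0 := by
  refine ⟨?_, ?_, ?_, ?_⟩ <;> refine PiLp.ext fun k => ?_ <;> fin_cases k <;> simp [projT]

theorem isOpen_image_projT {U : Set E4} (hU : IsOpen U) : IsOpen (projT '' U) := by
  have h1 : projT = projTL := funext fun y => (projTL_apply y).symm
  rw [h1]
  refine projTL.isOpenMap (fun t => ⟨!₂[t 0, t 1, 0, 0], ?_⟩) U hU
  rw [projTL_apply]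
  refine PiLp.ext fun k => ?_
  fin_cases k <;> simp [projT]

theorem contDiffOn_comp_projT {F : Type*} [NormedAddCommGroup F] [NormedSpace ℝ F] {U : Set E4}
    {f : E2 → F} (hf : ContDiffOn ℝ ∞ f (projT '' U)) :
    ContDiffOn ℝ ∞ (fun y => f (projT y)) U := by
  have h := hf.comp (projTL.contDiff.contDiffOn (s := U))
    fun y hy => ⟨y, hy, (projTL_apply y).symm⟩
  exact h.congr fun y _ => by simp [projTL_apply]

theorem hasFDerivAt_comp_projT {F : Type*} [NormedAddCommGroup F] [NormedSpace ℝ F]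
    {f : E2 → F} {y : E4} (hf : DifferentiableAt ℝ f (projT y)) :
    HasFDerivAt (fun y => f (projT y)) ((fderiv ℝ f (projT y)).comp projTL) y := by
  have h1 : HasFDerivAt f (fderiv ℝ f (projT y)) (projTL y) := by
    rw [projTL_apply]; exact hf.hasFDerivAt
  refine (h1.comp y projTL.hasFDerivAt).congr_of_eventuallyEq (.of_forall fun z => ?_)
  simp [projTL_apply]

namespace IsLiouvillePair

variable {Λ ε : ℝ} {D : Set E2} {P F : E2 → ℝ}

theorem differentiableAt (L : IsLiouvillePair Λ ε D P F) (hD : IsOpen D) {t : E2} (ht : t ∈ D) :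
    DifferentiableAt ℝ P t ∧ DifferentiableAt ℝ F t ∧ ∀ i, DifferentiableAt ℝ (Coord.pd i P) t :=
  ⟨(L.smooth_P.differentiableOn (by simp)).differentiableAt (hD.mem_nhds ht),
    (L.smooth_F.differentiableOn (by simp)).differentiableAt (hD.mem_nhds ht),
    fun i => ((Coord.contDiffOn_pd hD L.smooth_P i).differentiableOn
      (by simp)).differentiableAt (hD.mem_nhds ht)⟩

theorem mono (L : IsLiouvillePair Λ ε D P F) {D' : Set E2} (h : D' ⊆ D) :
    IsLiouvillePair Λ ε D' P F :=
  ⟨L.smooth_P.mono h, L.smooth_F.mono h, fun t ht => L.antiderivative t (h ht),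
    fun t ht => L.liouville t (h ht)⟩

end IsLiouvillePair

/-- The orthonormal frame of `e^{-2P} (dt₁² + ε dt₂²)`. -/
def conformalFrame (P : E2 → ℝ) (a : Fin 2) (t : E2) : E2 :=
  Real.exp (P t) • EuclideanSpace.single a 1

theorem isMetricOn_conformalMetric {ε : ℝ} {D : Set E2} {P : E2 → ℝ} (hε : ε * ε = 1)
    (hP : ContDiffOn ℝ ∞ P D) : Coord.IsMetricOn (conformalMetric ε P) D where
  smooth i j := by
    have h1 : ContDiffOn ℝ ∞ (fun t => Real.exp (-2 * P t)) D :=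
      (contDiffOn_const.mul hP).exp
    have h2 : ContDiffOn ℝ ∞ (fun t => ε * Real.exp (-2 * P t)) D := contDiffOn_const.mul h1
    have h3 : ContDiffOn ℝ ∞ (fun _ : E2 => (0 : ℝ)) D := contDiffOn_const
    fin_cases i <;> fin_cases j
    exacts [h1, h3, h3, h2]
  symm t _ i j := by fin_cases i <;> fin_cases j <;> simp [conformalMetric]
  det t _ := by
    have hε' : ε ≠ 0 := fun h0 => by simp [h0] at hε
    rw [isUnit_iff_ne_zero, conformalMetric, Matrix.det_fin_two_of]
    have := Real.exp_ne_zero (-2 * P t)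
    simp [hε']

theorem hasFDerivAt_exp_smul {E : Type*} [NormedAddCommGroup E] [NormedSpace ℝ E] {P : E → ℝ}
    {t : E} (hP : DifferentiableAt ℝ P t) {F : Type*} [NormedAddCommGroup F] [NormedSpace ℝ F]
    (v : F) : HasFDerivAt (fun x => Real.exp (P x) • v)
      ((Real.exp (P t) • fderiv ℝ P t).smulRight v) t :=
  hP.hasFDerivAt.exp.smul_const v

/-- The coefficients are read off from the brackets of `e^P ∂_i`. Checking the two frame equations
replaces the computation of Christoffel symbols. -/
theorem isFrameOn_conformalFrame {ε : ℝ} {D : Set E2} (hD : IsOpen D) {P : E2 → ℝ}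
    (hε : ε * ε = 1) (hP : ContDiffOn ℝ ∞ P D) :
    Coord.IsFrameOn (conformalMetric ε P) (conformalFrame P)
      (fun a b c t => (![![![0, ε * (Real.exp (P t) * Coord.pd 1 P t)],
          ![-(Real.exp (P t) * Coord.pd 1 P t), 0]],
        ![![0, -(Real.exp (P t) * Coord.pd 0 P t)],
          ![ε * (Real.exp (P t) * Coord.pd 0 P t), 0]]] : Fin 2 → Fin 2 → Fin 2 → ℝ) a b c) D where
  smooth a := hP.exp.smul contDiffOn_const
  indep t _ := by
    have h1 := Coord.linearIndependent_single (n := 2)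
    exact h1.units_smul fun _ => Units.mk0 (Real.exp (P t)) (Real.exp_ne_zero _)
  smooth_coeff a b c := by
    have h0 : ContDiffOn ℝ ∞ (fun _ : E2 => (0 : ℝ)) D := contDiffOn_const
    have h1 := fun i => hP.exp.mul (Coord.contDiffOn_pd hD hP i)
    have h2 := fun i => (h1 i).neg
    have h3 := fun i => contDiffOn_const (c := ε).mul (h1 i)
    fin_cases a <;> fin_cases b <;> fin_cases c
    exacts [h0, h3 1, h2 1, h0, h0, h2 0, h3 0, h0]
  torsion t ht a b := by
    have dP := (hP.differentiableOn (by simp)).differentiableAt (hD.mem_nhds ht)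
    have h1 : ∀ a, fderiv ℝ (conformalFrame P a) t = _ := fun a =>
      (hasFDerivAt_exp_smul dP (EuclideanSpace.single a 1 : E2)).fderiv
    simp only [VectorField.lieBracket, h1]
    fin_cases a <;> fin_cases b <;>
      simp [conformalFrame, Fin.sum_univ_two, Coord.pd, smul_smul] <;> module
  metric t ht a b c := by
    have dP := (hP.differentiableOn (by simp)).differentiableAt (hD.mem_nhds ht)
    have h0 : ∀ x a b, Coord.bilin (conformalMetric ε P x) (conformalFrame P a x)
        (conformalFrame P b x) = (!![1, 0; 0, ε] : Matrix (Fin 2) (Fin 2) ℝ) a b := fun x a b => by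
      have he : Real.exp (P x) * (Real.exp (P x) * Real.exp (-(2 * P x))) = 1 := by
        rw [← Real.exp_add, ← Real.exp_add, ← Real.exp_zero]
        congr 1
        ring
      simp only [conformalFrame, map_smul, _root_.smul_apply, smul_eq_mul, Coord.bilin_single]
      fin_cases a <;> fin_cases b <;> simp [conformalMetric]
      · exact he
      · linear_combination ε * he
    simp only [h0, fderiv_fun_const, Pi.zero_apply, _root_.zero_apply]
    fin_cases a <;> fin_cases b <;> fin_cases c <;> simp [Fin.sum_univ_two] <;>
      rcases mul_self_eq_one_iff.1 hε with h | h <;> simp [h]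

theorem gaussCurvature_conformalMetric {Λ ε : ℝ} {D : Set E2} (hD : IsOpen D) {P F : E2 → ℝ}
    (hε : ε * ε = 1) (L : IsLiouvillePair Λ ε D P F) {t : E2} (ht : t ∈ D) :
    Coord.gaussCurvature (conformalMetric ε P) t = Λ := by
  obtain ⟨dP, -, dd⟩ := L.differentiableAt hD ht
  have h1 := (isFrameOn_conformalFrame hD hε L.smooth_P).ricci_eq
    (isMetricOn_conformalMetric hε L.smooth_P) hD ht 1 1
  have hd : ∀ i j, fderiv ℝ (fun x => Real.exp (P x) * Coord.pd i P x) t (conformalFrame P j t) =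
      Real.exp (P t) ^ 2 * (Coord.pd j (Coord.pd i P) t + Coord.pd i P t * Coord.pd j P t) := by
    intro i j
    have h : HasFDerivAt (fun x => Real.exp (P x) * Coord.pd i P x) _ t :=
      dP.hasFDerivAt.exp.mul (dd i).hasFDerivAt
    rw [h.fderiv]
    simp only [conformalFrame, _root_.add_apply, _root_.smul_apply, map_smul, smul_eq_mul]
    change Real.exp (P t) * (Real.exp (P t) * Coord.pd j (Coord.pd i P) t +
      Coord.pd i P t * (Real.exp (P t) * Coord.pd j P t)) = _
    ring
  have dm : ∀ i, DifferentiableAt ℝ (fun x => Real.exp (P x) * Coord.pd i P x) t := fun i =>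
    dP.exp.mul (dd i)
  have hd'' : ∀ i j, fderiv ℝ (fun x => ε * (Real.exp (P x) * Coord.pd i P x)) t
      (conformalFrame P j t) = ε * (Real.exp (P t) ^ 2 *
        (Coord.pd j (Coord.pd i P) t + Coord.pd i P t * Coord.pd j P t)) := fun i j => by
    rw [fderiv_const_mul (dm i), _root_.smul_apply, hd, smul_eq_mul]
  have he : Real.exp (P t) * Real.exp (P t) * Real.exp (-2 * P t) = 1 := by
    rw [← Real.exp_add, ← Real.exp_add, ← Real.exp_zero]
    congr 1
    ring
  have hL := L.liouville t ht
  have h2 : Real.exp (P t) ^ 2 * Coord.ricci (conformalMetric ε P) 1 1 t = ε * Λ := by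
    have h3 : Coord.bilin (Matrix.of fun k j => Coord.ricci (conformalMetric ε P) k j t)
        (conformalFrame P 1 t) (conformalFrame P 1 t) =
        Real.exp (P t) ^ 2 * Coord.ricci (conformalMetric ε P) 1 1 t := by
      simp only [conformalFrame, map_smul, _root_.smul_apply, smul_eq_mul, Coord.bilin_single,
        Matrix.of_apply]
      ring
    rw [← h3, h1]
    simp [Fin.sum_univ_two, hd, hd'']
    linear_combination ε * Real.exp (P t) ^ 2 * hL + ε * Λ * he -
      Real.exp (P t) ^ 2 * Coord.pd 1 (Coord.pd 1 P) t * hε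
  -- In two dimensions `Ric₁₁` consists of the single component `R⁰₁₀₁`, because `R¹₁₁₁ = 0`; up to
  -- a conformal factor this is the Gauss curvature.
  have h3 : Coord.gaussCurvature (conformalMetric ε P) t = ε * Real.exp (P t) ^ 2 *
      Coord.ricci (conformalMetric ε P) 1 1 t := by
    have h4 : Coord.riemann (conformalMetric ε P) 1 1 1 1 t = 0 := by simp [Coord.riemann]
    have h5 := Real.exp_ne_zero (-2 * P t)
    have h6 : (conformalMetric ε P t).det = Real.exp (-2 * P t) * (ε * Real.exp (-2 * P t)) := by
      simp [conformalMetric, Matrix.det_fin_two_of]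
    have h7 : ε ≠ 0 := fun h0 => by simp [h0] at hε
    rw [Coord.gaussCurvature, h6, Coord.ricci, Fin.sum_univ_two, Fin.sum_univ_two, h4,
      div_eq_iff (by positivity)]
    simp only [conformalMetric, Matrix.of_apply, Matrix.cons_val_zero, Matrix.cons_val_one,
      Matrix.cons_val_fin_one, zero_mul, add_zero]
    linear_combination (-(Real.exp (-2 * P t) * Coord.riemann (conformalMetric ε P) 0 1 0 1 t)) *
      (ε * ε * he + hε)
  rw [h3]
  linear_combination ε * h2 + Λ * hε

end Soliton

/-! ### The metric and the soliton field of the normal form. -/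

namespace Soliton

theorem orbitMetric_normalMetric (ε c : ℝ) (P F : E2 → ℝ) (y : E4) :
    orbitMetric (normalMetric ε c P F y) = conformalMetric ε P (projT y) := by
  have ht : (normalMetric ε c P F y).submatrix tIdx tIdx =
      !![Real.exp (-2 * P (projT y)), 0; 0, ε * Real.exp (-2 * P (projT y))] := by
    ext i j
    fin_cases i <;> fin_cases j <;> rfl
  have htz : (normalMetric ε c P F y).submatrix tIdx zIdx =
      !![-c * F (projT y), F (projT y); 0, 0] := by
    ext i j
    fin_cases i <;> fin_cases j <;> rfl
  have hzt : (normalMetric ε c P F y).submatrix zIdx tIdx =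
      !![-c * F (projT y), 0; F (projT y), 0] := by
    ext i j
    fin_cases i <;> fin_cases j <;> rfl
  have hz : (normalMetric ε c P F y).submatrix zIdx zIdx = !![-2 * c, 1; 1, 0] := by
    ext i j
    fin_cases i <;> fin_cases j <;> rfl
  have h1 : (!![-2 * c, 1; 1, 0] : Matrix (Fin 2) (Fin 2) ℝ)⁻¹ = !![0, 1; 1, 2 * c] := by
    refine Matrix.inv_eq_left_inv ?_
    ext i j
    fin_cases i <;> fin_cases j <;> simp
  rw [orbitMetric, ht, htz, hzt, hz, h1]
  ext i j
  fin_cases i <;> fin_cases j <;> simp [conformalMetric]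
  ring

theorem det_normalMetric (ε c : ℝ) (P F : E2 → ℝ) (y : E4) :
    (normalMetric ε c P F y).det = -(ε * Real.exp (-2 * P (projT y)) ^ 2) := by
  simp [normalMetric, Matrix.det_succ_row_zero, Fin.sum_univ_succ, Fin.succAbove]
  ring

theorem isMetricOn_normalMetric {ε : ℝ} (c : ℝ) {U : Set E4} {P F : E2 → ℝ} (hε : ε * ε = 1)
    (hP : ContDiffOn ℝ ∞ P (projT '' U)) (hF : ContDiffOn ℝ ∞ F (projT '' U)) :
    Coord.IsMetricOn (normalMetric ε c P F) U where
  smooth i j := by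
    have hP' := contDiffOn_comp_projT hP
    have hF' := contDiffOn_comp_projT hF
    have h1 : ContDiffOn ℝ ∞ (fun y => Real.exp (-2 * P (projT y))) U :=
      (contDiffOn_const.mul hP').exp
    have h2 : ContDiffOn ℝ ∞ (fun y => ε * Real.exp (-2 * P (projT y))) U :=
      contDiffOn_const.mul h1
    have h3 : ContDiffOn ℝ ∞ (fun y => -c * F (projT y)) U := contDiffOn_const.mul hF'
    have h0 : ∀ k : ℝ, ContDiffOn ℝ ∞ (fun _ : E4 => k) U := fun _ => contDiffOn_const
    fin_cases i <;> fin_cases j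
    exacts [h1, h0 _, h3, hF', h0 _, h2, h0 _, h0 _, h3, h0 _, h0 _, h0 _, hF', h0 _, h0 _, h0 _]
  symm y _ i j := by fin_cases i <;> fin_cases j <;> simp [normalMetric]
  det y _ := by
    have hε' : ε ≠ 0 := fun h0 => by simp [h0] at hε
    rw [isUnit_iff_ne_zero, det_normalMetric]
    have := Real.exp_ne_zero (-2 * P (projT y))
    simp [hε']

/-- The frame of `Ξ^⊥` in the coordinates of the normal form. -/
def normalHorizontal (c : ℝ) (P F : E2 → ℝ) : Fin 2 → E2 → E4 :=
  ![fun t => Real.exp (P t) • (EuclideanSpace.single 0 1 -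
      F t • (EuclideanSpace.single 2 1 + c • EuclideanSpace.single 3 1)),
    fun t => Real.exp (P t) • EuclideanSpace.single 1 1]

/-- A null frame of the normal form. -/
def normalFrame (c : ℝ) (P F : E2 → ℝ) : Fin 4 → E4 → E4 :=
  ![fun y => normalHorizontal c P F 0 (projT y), fun y => normalHorizontal c P F 1 (projT y),
    fun _ => EuclideanSpace.single 2 1 - (-c) • EuclideanSpace.single 3 1,
    fun _ => (1 : ℝ)⁻¹ • EuclideanSpace.single 3 1]

theorem fderiv_comp_projT_vertical {F : Type*} [NormedAddCommGroup F] [NormedSpace ℝ F]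
    {f : E2 → F} {y : E4} (hf : DifferentiableAt ℝ f (projT y)) :
    fderiv ℝ (fun y => f (projT y)) y (EuclideanSpace.single 2 1) = 0 ∧
    fderiv ℝ (fun y => f (projT y)) y (EuclideanSpace.single 3 1) = 0 := by
  rw [(hasFDerivAt_comp_projT hf).fderiv]
  simp [projTL_apply, projT_single]

theorem hasFDerivAt_normalHorizontal {c : ℝ} {P F : E2 → ℝ} {t : E2}
    (hP : DifferentiableAt ℝ P t) (hF : DifferentiableAt ℝ F t) :
    (∀ w, fderiv ℝ (normalHorizontal c P F 0) t w =
      fderiv ℝ P t w • normalHorizontal c P F 0 t - (Real.exp (P t) * fderiv ℝ F t w) •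
        (EuclideanSpace.single 2 1 + c • EuclideanSpace.single 3 1 : E4)) ∧
    ∀ w, fderiv ℝ (normalHorizontal c P F 1) t w =
      fderiv ℝ P t w • normalHorizontal c P F 1 t := by
  constructor <;> intro w
  · have h : HasFDerivAt (fun t => Real.exp (P t) • ((EuclideanSpace.single 0 1 : E4) -
      F t • (EuclideanSpace.single 2 1 + c • EuclideanSpace.single 3 1))) _ t :=
      hP.hasFDerivAt.exp.smul ((hF.hasFDerivAt.smul_const _).const_sub _)
    change fderiv ℝ (fun t => Real.exp (P t) • ((EuclideanSpace.single 0 1 : E4) -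
      F t • (EuclideanSpace.single 2 1 + c • EuclideanSpace.single 3 1))) t w = _
    rw [h.fderiv]
    simp [normalHorizontal]
    module
  · have h : HasFDerivAt (fun t => Real.exp (P t) • (EuclideanSpace.single 1 1 : E4)) _ t :=
      hP.hasFDerivAt.exp.smul_const _
    change fderiv ℝ (fun t => Real.exp (P t) • (EuclideanSpace.single 1 1 : E4)) t w = _
    rw [h.fderiv]
    simp [normalHorizontal]
    module

theorem projT_normalHorizontal (c : ℝ) (P F : E2 → ℝ) (a : Fin 2) (t : E2) :
    projT (normalHorizontal c P F a t) = Real.exp (P t) • EuclideanSpace.single a 1 := by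
  refine PiLp.ext fun k => ?_
  fin_cases a <;> fin_cases k <;> simp [normalHorizontal, projT]

/-- The normal form has `h = l = 1` and `f = -c`. The vertical part of `[E₀, E₁]` is `e^{2P} F_{,t₂}
(∂_{z₁} + c ∂_{z₂})`, so the condition on `F` is what gives `l = 1`. -/
theorem isNullFrameOn_normalFrame {Λ ε c : ℝ} {U : Set E4} {P F : E2 → ℝ} (hU : IsOpen U)
    (hε : ε * ε = 1) (L : IsLiouvillePair Λ ε (projT '' U) P F) :
    IsNullFrameOn (normalMetric ε c P F) U ε (normalFrame c P F) (fun _ => 1) (fun _ => -c)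
      (fun y => -(Real.exp (P (projT y)) * Coord.pd 1 P (projT y)))
      (fun y => Real.exp (P (projT y)) * Coord.pd 0 P (projT y)) (fun _ => 1) := by
  have hD := isOpen_image_projT hU
  have hs : ∀ i, ContDiffOn ℝ ∞ (fun t => Real.exp (P t) * Coord.pd i P t) (projT '' U) :=
    fun i => L.smooth_P.exp.mul (Coord.contDiffOn_pd hD L.smooth_P i)
  have hE : ∀ a, ContDiffOn ℝ ∞ (normalHorizontal c P F a) (projT '' U) := by
    intro a
    fin_cases a
    · exact L.smooth_P.exp.smul (contDiffOn_const.sub (L.smooth_F.smul contDiffOn_const))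
    · exact L.smooth_P.exp.smul contDiffOn_const
  have hd : ∀ {K : Type} [NormedAddCommGroup K] [NormedSpace ℝ K] {k : E2 → K},
      ContDiffOn ℝ ∞ k (projT '' U) → ∀ y ∈ U, DifferentiableAt ℝ k (projT y) :=
    fun hk y hy => (hk.differentiableOn (by simp)).differentiableAt
      (hD.mem_nhds (mem_image_of_mem _ hy))
  refine ⟨hU, isMetricOn_normalMetric c hε L.smooth_P L.smooth_F, hε, fun a => ?_,
    contDiffOn_const, contDiffOn_const, contDiffOn_comp_projT (hs 1).neg,
    contDiffOn_comp_projT (hs 0), contDiffOn_const, fun _ _ => one_ne_zero, rfl, rfl,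
    fun y hy => fderiv_comp_projT_vertical (hd (hE 0) y hy),
    fun y hy => fderiv_comp_projT_vertical (hd (hE 1) y hy), by simp, by simp,
    fun y hy => fderiv_comp_projT_vertical (hd (hs 1).neg y hy),
    fun y hy => fderiv_comp_projT_vertical (hd (hs 0) y hy), by simp, fun y hy a b => ?_,
    fun y hy => ?_⟩
  · fin_cases a
    exacts [contDiffOn_comp_projT (hE 0), contDiffOn_comp_projT (hE 1), contDiffOn_const,
      contDiffOn_const]
  · have he : Real.exp (P (projT y)) * Real.exp (P (projT y)) * Real.exp (-2 * P (projT y)) = 1 := by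
      rw [← Real.exp_add, ← Real.exp_add, ← Real.exp_zero]
      congr 1
      ring
    rw [neg_mul] at he
    simp only [Coord.bilin_apply]
    fin_cases a <;> fin_cases b <;>
      simp [normalFrame, normalHorizontal, normalMetric, Fin.sum_univ_four]
    all_goals first | ring1 | linear_combination he | linear_combination ε * he
  · obtain ⟨dP, dF, -⟩ := L.differentiableAt hD (mem_image_of_mem _ hy)
    obtain ⟨e0, e1⟩ := hasFDerivAt_normalHorizontal (c := c) dP dF
    have h1 := L.antiderivative _ (mem_image_of_mem _ hy)
    have he : Real.exp (P (projT y)) * Real.exp (P (projT y)) * Real.exp (-2 * P (projT y)) = 1 := by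
      rw [← Real.exp_add, ← Real.exp_add, ← Real.exp_zero]
      congr 1
      ring
    change fderiv ℝ (fun y => normalHorizontal c P F 1 (projT y)) y
      (normalHorizontal c P F 0 (projT y)) - fderiv ℝ (fun y => normalHorizontal c P F 0 (projT y)) y
      (normalHorizontal c P F 1 (projT y)) =
      _ • normalHorizontal c P F 0 (projT y) + _ • normalHorizontal c P F 1 (projT y) +
      (1 : ℝ) • ((EuclideanSpace.single 2 1 : E4) - (-c) • EuclideanSpace.single 3 1)
    rw [(hasFDerivAt_comp_projT (hd (hE 1) y hy)).fderiv,
      (hasFDerivAt_comp_projT (hd (hE 0) y hy)).fderiv, ContinuousLinearMap.comp_apply,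
      ContinuousLinearMap.comp_apply, projTL_apply, projTL_apply, projT_normalHorizontal,
      projT_normalHorizontal, e0, e1, map_smul, map_smul, map_smul]
    change (_ • Coord.pd 0 P (projT y)) • _ - ((_ • Coord.pd 1 P (projT y)) • _ -
      (_ * (_ • Coord.pd 1 F (projT y))) • _) = _
    rw [h1, smul_eq_mul, smul_eq_mul, smul_eq_mul, ← mul_assoc, he]
    module

/-- The linear part of the soliton field. -/
def normalFieldL (Λ ε c : ℝ) : E4 →L[ℝ] E4 :=
  LinearMap.toContinuousLinearMap
    { toFun := normalField Λ ε c 0 0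
      map_add' := fun x y => by
        refine PiLp.ext fun k => ?_
        fin_cases k <;> simp [normalField] <;> ring
      map_smul' := fun a x => by
        refine PiLp.ext fun k => ?_
        fin_cases k <;> simp [normalField] <;> ring }

theorem normalFieldL_apply (Λ ε c : ℝ) (y : E4) :
    normalFieldL Λ ε c y = normalField Λ ε c 0 0 y := rfl

theorem normalField_eq (Λ ε c a₁ a₂ : ℝ) : normalField Λ ε c a₁ a₂ = fun y =>
    normalFieldL Λ ε c y + normalField Λ ε c a₁ a₂ 0 := by
  refine funext fun y => PiLp.ext fun k => ?_
  fin_cases k <;> simp [normalFieldL_apply, normalField]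

theorem contDiff_normalField (Λ ε c a₁ a₂ : ℝ) : ContDiff ℝ ∞ (normalField Λ ε c a₁ a₂) := by
  rw [normalField_eq]
  exact (normalFieldL Λ ε c).contDiff.add contDiff_const

theorem fderiv_normalField (Λ ε c a₁ a₂ : ℝ) (y : E4) :
    fderiv ℝ (normalField Λ ε c a₁ a₂) y = normalFieldL Λ ε c := by
  rw [normalField_eq]
  exact ((normalFieldL Λ ε c).hasFDerivAt.add_const _).fderiv

/-- The Liouville equation, rewritten as the curvature condition on `r₁ = -e^P P_{,t₂}` and `r₂ =
e^P P_{,t₁}` that `soliton_of_eq` requires. -/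
theorem gaussCurvature_frame {Λ ε : ℝ} {D : Set E2} {P F : E2 → ℝ} (hD : IsOpen D)
    (L : IsLiouvillePair Λ ε D P F) {t : E2} (ht : t ∈ D) :
    fderiv ℝ (fun t => Real.exp (P t) * Coord.pd 0 P t) t
        (Real.exp (P t) • EuclideanSpace.single 0 1) -
      ε * fderiv ℝ (fun t => -(Real.exp (P t) * Coord.pd 1 P t)) t
        (Real.exp (P t) • EuclideanSpace.single 1 1) -
      ε * (-(Real.exp (P t) * Coord.pd 1 P t)) ^ 2 - (Real.exp (P t) * Coord.pd 0 P t) ^ 2 = Λ := by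
  obtain ⟨dP, -, dd⟩ := L.differentiableAt hD ht
  have he : Real.exp (P t) * Real.exp (P t) * Real.exp (-2 * P t) = 1 := by
    rw [← Real.exp_add, ← Real.exp_add, ← Real.exp_zero]
    congr 1
    ring
  have hd : ∀ i, fderiv ℝ (fun x => Real.exp (P x) * Coord.pd i P x) t
      (Real.exp (P t) • EuclideanSpace.single i 1) =
      Real.exp (P t) ^ 2 * (Coord.pd i (Coord.pd i P) t + Coord.pd i P t * Coord.pd i P t) := by
    intro i
    have h : HasFDerivAt (fun x => Real.exp (P x) * Coord.pd i P x) _ t :=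
      dP.hasFDerivAt.exp.mul (dd i).hasFDerivAt
    rw [h.fderiv]
    simp only [_root_.add_apply, _root_.smul_apply, map_smul, smul_eq_mul]
    change Real.exp (P t) * (Real.exp (P t) * Coord.pd i (Coord.pd i P) t +
      Coord.pd i P t * (Real.exp (P t) * Coord.pd i P t)) = _
    ring
  rw [fderiv_fun_neg, _root_.neg_apply, hd, hd]
  linear_combination Real.exp (P t) ^ 2 * L.liouville t ht + Λ * he

/-- The normal form satisfies the soliton equation. -/
theorem soliton_normalMetric {Λ ε c : ℝ} (a₁ a₂ : ℝ) {U : Set E4} {P F : E2 → ℝ} (hU : IsOpen U)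
    (hε : ε * ε = 1) (L : IsLiouvillePair Λ ε (projT '' U) P F) :
    ∀ y ∈ U, ∀ i j, Coord.ricci (normalMetric ε c P F) i j y + (1 / 2) *
      Coord.lieDerivMetric (normalMetric ε c P F) (normalField Λ ε c a₁ a₂) i j y =
      Λ * normalMetric ε c P F y i j := by
  have hD := isOpen_image_projT hU
  have hs : ∀ i, ∀ y ∈ U,
      DifferentiableAt ℝ (fun t => Real.exp (P t) * Coord.pd i P t) (projT y) := fun i y hy =>
    ((L.smooth_P.exp.mul (Coord.contDiffOn_pd hD L.smooth_P i)).differentiableOn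
      (by simp)).differentiableAt (hD.mem_nhds (mem_image_of_mem _ hy))
  -- The linear part of the soliton field is a function of `z₂ - c z₁`, whose differential vanishes
  -- on the first three frame fields.
  have h := (isNullFrameOn_normalFrame (c := c) hU hε L).soliton_of_eq
    (contDiff_normalField Λ ε c a₁ a₂).contDiffOn (fun _ _ => rfl) (fun _ _ => rfl) (Λ := Λ)
    (fun y _ a ha => by
      rw [fderiv_normalField, normalFieldL_apply]
      refine PiLp.ext fun k => ?_
      fin_cases a
      · fin_cases k <;> simp [normalField, normalFrame, normalHorizontal] <;> ring
      · fin_cases k <;> simp [normalField, normalFrame, normalHorizontal]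
      · fin_cases k <;> simp [normalField, normalFrame, normalHorizontal]
        all_goals ring
      · exact absurd rfl ha)
    (by simp) (by simp) (by simp)
    (fun y hy => by
      have h1 := gaussCurvature_frame hD L (mem_image_of_mem _ hy)
      rw [(hasFDerivAt_comp_projT (hs 0 y hy)).fderiv,
        (hasFDerivAt_comp_projT (hs 1 y hy).fun_neg).fderiv, ContinuousLinearMap.comp_apply,
        ContinuousLinearMap.comp_apply, projTL_apply, projTL_apply]
      change fderiv ℝ _ _ (projT (normalHorizontal c P F 0 _)) - ε * fderiv ℝ _ _
        (projT (normalHorizontal c P F 1 _)) - _ - _ = _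
      rw [projT_normalHorizontal, projT_normalHorizontal]
      exact h1)
    (fun y _ => by
      rw [fderiv_normalField, normalFieldL_apply]
      simp [normalField]
      try ring)
    (fun y _ => by
      rw [fderiv_normalField, normalFieldL_apply]
      simp [normalField]
      try ring)
  intro y hy i j
  have h1 := h y hy (EuclideanSpace.single i 1) (EuclideanSpace.single j 1)
  simpa only [Coord.bilin_single, Matrix.of_apply] using h1

end Soliton

/-! ## Locality -/

namespace Coord

variable {n : ℕ} {G G' : EuclideanSpace ℝ (Fin n) → Matrix (Fin n) (Fin n) ℝ}
  {x : EuclideanSpace ℝ (Fin n)}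

theorem pd_congr {f f' : EuclideanSpace ℝ (Fin n) → ℝ} (h : f =ᶠ[𝓝 x] f') (i : Fin n) :
    pd i f x = pd i f' x := by
  rw [pd, pd, h.fderiv_eq]

theorem christoffel_congr (h : G =ᶠ[𝓝 x] G') (k i j : Fin n) :
    christoffel G k i j =ᶠ[𝓝 x] christoffel G' k i j := by
  filter_upwards [eventually_eventually_nhds.2 h] with y hy
  have h1 : ∀ a b, (fun z => G z a b) =ᶠ[𝓝 y] fun z => G' z a b := fun a b =>
    hy.mono fun z hz => congrFun (congrFun hz a) b
  simp only [christoffel, hy.self_of_nhds, fun c a b => pd_congr (h1 a b) c]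

theorem ricci_congr (h : G =ᶠ[𝓝 x] G') (i j : Fin n) : ricci G i j x = ricci G' i j x := by
  simp only [ricci, riemann, fun c k a b => pd_congr (christoffel_congr h k a b) c,
    fun k a b => (christoffel_congr h k a b).self_of_nhds]

theorem lieDerivMetric_congr (h : G =ᶠ[𝓝 x] G')
    {X X' : EuclideanSpace ℝ (Fin n) → EuclideanSpace ℝ (Fin n)} (hX : X =ᶠ[𝓝 x] X')
    (i j : Fin n) : lieDerivMetric G X i j x = lieDerivMetric G' X' i j x := by
  have h1 : ∀ a b, (fun z => G z a b) =ᶠ[𝓝 x] fun z => G' z a b := fun a b =>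
    h.mono fun z hz => congrFun (congrFun hz a) b
  have h2 : ∀ a, (fun z => X z a) =ᶠ[𝓝 x] fun z => X' z a := fun a =>
    hX.mono fun z hz => congrArg (fun w : EuclideanSpace ℝ (Fin n) => w a) hz
  simp only [lieDerivMetric, h.self_of_nhds, hX.self_of_nhds, fun c a b => pd_congr (h1 a b) c,
    fun c a => pd_congr (h2 a) c]

end Coord

namespace Soliton

variable {M : Type*} [TopologicalSpace M] [ChartedSpace E4 M] {φ : OpenPartialHomeomorph M E4}

/-! ## Adapted charts -/

theorem form_eq_bilin (g : ∀ p : M, LinearMap.BilinForm ℝ (TangentSpace (𝓡 4) p))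
    (hφ : φ ∈ IsManifold.maximalAtlas (𝓡 4) ∞ M) {y : E4} (hy : y ∈ φ.target)
    (v w : TangentSpace (𝓡 4) (φ.symm y)) : g (φ.symm y) v w =
      Coord.bilin (formInChart g φ y) (comps φ (φ.symm y) v) (comps φ (φ.symm y) w) := by
  rw [bilin_formInChart, vecOf_comps hφ hy, vecOf_comps hφ hy]

variable {ξ₁ ξ₂ : VField M}

theorem mem_leafSpace_span_pair (p : M) (v : TangentSpace (𝓡 4) p) :
    v ∈ leafSpace (Submodule.span ℝ {ξ₁, ξ₂}) p ↔ ∃ a b : ℝ, a • ξ₁ p + b • ξ₂ p = v := by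
  rw [leafSpace, Submodule.map_span, image_pair, Submodule.mem_span_pair]
  rfl

theorem eq_vertical {v : E4} (h0 : v 0 = 0) (h1 : v 1 = 0) :
    v = v 2 • EuclideanSpace.single 2 1 + v 3 • EuclideanSpace.single 3 1 := by
  refine PiLp.ext fun k => ?_
  fin_cases k <;> simp [h0, h1]

theorem mem_leafSpace_iff (hφ : φ ∈ IsManifold.maximalAtlas (𝓡 4) ∞ M) {y : E4}
    (hy : y ∈ φ.target) (h₁ : fieldInChart ξ₁ φ y = EuclideanSpace.single 2 1)
    (h₂ : fieldInChart ξ₂ φ y = EuclideanSpace.single 3 1) (v : TangentSpace (𝓡 4) (φ.symm y)) :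
    v ∈ leafSpace (Submodule.span ℝ {ξ₁, ξ₂}) (φ.symm y) ↔
      comps φ (φ.symm y) v 0 = 0 ∧ comps φ (φ.symm y) v 1 = 0 := by
  rw [mem_leafSpace_span_pair]
  rw [fieldInChart_eq] at h₁ h₂
  constructor
  · rintro ⟨a, b, rfl⟩
    rw [map_add, map_smul, map_smul, h₁, h₂]
    simp
  · rintro ⟨h0, h1⟩
    refine ⟨comps φ (φ.symm y) v 2, comps φ (φ.symm y) v 3,
      comps_injective hφ (φ.map_target hy) ?_⟩
    rw [map_add, map_smul, map_smul, h₁, h₂]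
    exact (eq_vertical h0 h1).symm

theorem mem_horizontalSpace_iff (g : PseudoMetric M)
    (hφ : φ ∈ IsManifold.maximalAtlas (𝓡 4) ∞ M) {y : E4}
    (hy : y ∈ φ.target) (h₁ : fieldInChart ξ₁ φ y = EuclideanSpace.single 2 1)
    (h₂ : fieldInChart ξ₂ φ y = EuclideanSpace.single 3 1) (v : TangentSpace (𝓡 4) (φ.symm y)) :
    v ∈ horizontalSpace g (Submodule.span ℝ {ξ₁, ξ₂}) (φ.symm y) ↔
      Coord.bilin (g.inChart φ y) (EuclideanSpace.single 2 1) (comps φ (φ.symm y) v) = 0 ∧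
      Coord.bilin (g.inChart φ y) (EuclideanSpace.single 3 1) (comps φ (φ.symm y) v) = 0 := by
  rw [horizontalSpace, LinearMap.BilinForm.mem_orthogonal_iff]
  rw [fieldInChart_eq] at h₁ h₂
  constructor
  · intro h
    have k1 := h (ξ₁ _) ((mem_leafSpace_span_pair _ _).2 ⟨1, 0, by simp⟩)
    have k2 := h (ξ₂ _) ((mem_leafSpace_span_pair _ _).2 ⟨0, 1, by simp⟩)
    rw [form_eq_bilin g.form hφ hy] at k1 k2
    rw [h₁] at k1
    rw [h₂] at k2
    exact ⟨k1, k2⟩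
  · rintro ⟨k1, k2⟩ w hw
    obtain ⟨a, b, rfl⟩ := (mem_leafSpace_span_pair _ _).1 hw
    rw [form_eq_bilin g.form hφ hy, map_add, map_smul, map_smul,
      h₁, h₂, map_add, map_smul, map_smul, _root_.add_apply, _root_.smul_apply,
      _root_.smul_apply]
    change a • Coord.bilin (g.inChart φ y) _ _ + b • Coord.bilin (g.inChart φ y) _ _ = 0
    rw [k1, k2, smul_zero, smul_zero, add_zero]

/-! ## Metrics on manifolds with a single chart -/

/-- The metric with components `G` on a manifold with the single chart `φ`. -/
def PseudoMetric.ofChart (hφ : φ ∈ IsManifold.maximalAtlas (𝓡 4) ∞ M) (hs : φ.source = univ)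
    (ha : ∀ χ ∈ atlas E4 M, χ = φ) (G : E4 → Matrix (Fin 4) (Fin 4) ℝ)
    (hG : Coord.IsMetricOn G φ.target) : PseudoMetric M where
  form p := LinearMap.mk₂ ℝ (fun v w => Coord.bilin (G (φ p)) (comps φ p v) (comps φ p w))
    (by simp) (by simp) (by simp) (by simp)
  symm p v w := Coord.bilin_symm (hG.symm _ (φ.map_source (hs ▸ mem_univ p))) _ _
  nondegenerate p v h := by
    have hp : p ∈ φ.source := hs ▸ mem_univ p
    obtain ⟨y, hy, rfl⟩ : ∃ y ∈ φ.target, φ.symm y = p := ⟨φ p, φ.map_source hp, φ.left_inv hp⟩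
    refine comps_injective hφ hp ?_
    rw [map_zero]
    refine Coord.bilin_nondegenerate (hG.det _ (φ.map_source hp)) fun w => ?_
    have h1 := h (vecOf φ y w)
    simp only [LinearMap.mk₂_apply] at h1
    rwa [comps_vecOf hφ hy] at h1
  smooth χ hχ i j := by
    rw [ha χ hχ]
    refine (hG.smooth i j).congr fun y hy => ?_
    change Coord.bilin (G (φ (φ.symm y))) (comps φ _ (vecOf φ y _)) (comps φ _ (vecOf φ y _)) = _
    rw [comps_vecOf hφ hy, comps_vecOf hφ hy, φ.right_inv hy, Coord.bilin_single]

theorem PseudoMetric.inChart_ofChart (hφ : φ ∈ IsManifold.maximalAtlas (𝓡 4) ∞ M)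
    (hs : φ.source = univ) (ha : ∀ χ ∈ atlas E4 M, χ = φ) (G : E4 → Matrix (Fin 4) (Fin 4) ℝ)
    (hG : Coord.IsMetricOn G φ.target) {y : E4} (hy : y ∈ φ.target) :
    (PseudoMetric.ofChart hφ hs ha G hG).inChart φ y = G y := by
  ext i j
  change Coord.bilin (G (φ (φ.symm y))) (comps φ _ (vecOf φ y _)) (comps φ _ (vecOf φ y _)) = _
  rw [comps_vecOf hφ hy, comps_vecOf hφ hy, φ.right_inv hy, Coord.bilin_single]

/-- The fields with constant components along `∂_{z₁}, ∂_{z₂}`. -/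
def verticalAlgebra (φ : OpenPartialHomeomorph M E4) : Submodule ℝ (VField M) :=
  Submodule.span ℝ {fieldOf φ fun _ => EuclideanSpace.single 2 1,
    fieldOf φ fun _ => EuclideanSpace.single 3 1}

theorem mem_verticalAlgebra {ξ : VField M} (h : ξ ∈ verticalAlgebra φ) :
    ∃ a b : ℝ, ξ = fieldOf φ fun _ =>
      a • EuclideanSpace.single 2 1 + b • EuclideanSpace.single 3 1 := by
  obtain ⟨a, b, rfl⟩ := Submodule.mem_span_pair.1 h
  refine ⟨a, b, funext fun p => ?_⟩
  change a • (mfderiv (𝓡 4) (𝓡 4) φ.symm (φ p)) (EuclideanSpace.single 2 (1 : ℝ) : E4) +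
    b • (mfderiv (𝓡 4) (𝓡 4) φ.symm (φ p)) (EuclideanSpace.single 3 (1 : ℝ) : E4) =
    (mfderiv (𝓡 4) (𝓡 4) φ.symm (φ p)) (a • EuclideanSpace.single 2 (1 : ℝ) +
      b • EuclideanSpace.single 3 (1 : ℝ) : E4)
  exact ((map_add _ _ _).trans (congrArg₂ _ (map_smul _ _ _) (map_smul _ _ _))).symm

theorem linearIndependent_vertical {y : E4}
    (h₁ : fieldInChart ξ₁ φ y = EuclideanSpace.single 2 1)
    (h₂ : fieldInChart ξ₂ φ y = EuclideanSpace.single 3 1) :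
    LinearIndependent ℝ ![ξ₁ (φ.symm y), ξ₂ (φ.symm y)] := by
  rw [LinearIndependent.pair_iff]
  intro a b hab
  have h := congrArg (comps φ (φ.symm y)) hab
  rw [fieldInChart_eq] at h₁ h₂
  rw [map_add, map_smul, map_smul, h₁, h₂, map_zero] at h
  have h2 := congrArg (fun w : E4 => w 2) h
  have h3 := congrArg (fun w : E4 => w 3) h
  simpa using And.intro h2 h3

theorem finrank_leafSpace {y : E4}
    (h₁ : fieldInChart ξ₁ φ y = EuclideanSpace.single 2 1)
    (h₂ : fieldInChart ξ₂ φ y = EuclideanSpace.single 3 1) :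
    Module.finrank ℝ (leafSpace (Submodule.span ℝ {ξ₁, ξ₂}) (φ.symm y)) = 2 := by
  have h := finrank_span_eq_card (linearIndependent_vertical h₁ h₂)
  rw [leafSpace, Submodule.map_span, image_pair]
  rw [Matrix.range_cons_cons_empty] at h
  exact h

variable [IsManifold (𝓡 4) ∞ M]

theorem smoothOn_fieldOf_univ (hφ : φ ∈ IsManifold.maximalAtlas (𝓡 4) ∞ M)
    (hs : φ.source = univ) {Y : E4 → E4} (hY : ContDiff ℝ ∞ Y) :
    SmoothOn (fieldOf φ Y) univ := by
  have h := smoothOn_fieldOf hφ isOpen_univ hY.contDiffOn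
  rwa [hs, preimage_univ, inter_univ] at h

omit [IsManifold (𝓡 4) ∞ M] in
theorem fieldInChart_fieldOf_eventuallyEq (hφ : φ ∈ IsManifold.maximalAtlas (𝓡 4) ∞ M)
    (Y : E4 → E4) {y : E4} (hy : y ∈ φ.target) : fieldInChart (fieldOf φ Y) φ =ᶠ[𝓝 y] Y :=
  mem_of_superset (φ.open_target.mem_nhds hy) fun _ hz => fieldInChart_fieldOf hφ Y hz

/-- For a field with constant components the Lie derivative of the metric is just the derivative of
its components, and brackets of such fields vanish. -/
theorem isAbelianKillingAlgebra_verticalAlgebra [Nonempty M]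
    (hφ : φ ∈ IsManifold.maximalAtlas (𝓡 4) ∞ M)
    (hs : φ.source = univ) (ha : ∀ χ ∈ atlas E4 M, χ = φ) (g : PseudoMetric M)
    (hG : ∀ y ∈ φ.target, ∀ i j, Coord.pd 2 (fun z => g.inChart φ z i j) y = 0 ∧
      Coord.pd 3 (fun z => g.inChart φ z i j) y = 0) :
    IsAbelianKillingAlgebra g (verticalAlgebra φ) where
  finrank_eq := by
    obtain ⟨p⟩ := ‹Nonempty M›
    have hp : p ∈ φ.source := hs ▸ mem_univ p
    have h1 := linearIndependent_vertical
      (fieldInChart_fieldOf hφ (fun _ => EuclideanSpace.single 2 1) (φ.map_source hp))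
      (fieldInChart_fieldOf hφ (fun _ => EuclideanSpace.single 3 1) (φ.map_source hp))
    have h2 : LinearIndependent ℝ ![fieldOf φ fun _ => EuclideanSpace.single 2 1,
        fieldOf φ fun _ => EuclideanSpace.single 3 1] := by
      rw [LinearIndependent.pair_iff] at h1 ⊢
      exact fun a b hab => h1 a b (congrFun hab _)
    have h3 := finrank_span_eq_card h2
    rw [Matrix.range_cons_cons_empty] at h3
    exact h3
  killing ξ hξ := by
    obtain ⟨a, b, rfl⟩ := mem_verticalAlgebra hξ
    refine ⟨smoothOn_fieldOf_univ hφ hs contDiff_const, fun χ hχ y hy i j => ?_⟩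
    rw [ha χ hχ] at hy ⊢
    rw [Coord.lieDerivMetric_congr EventuallyEq.rfl (fieldInChart_fieldOf_eventuallyEq hφ _ hy)]
    have h0 : ∀ i k, Coord.pd i (fun _ : E4 => (a • EuclideanSpace.single 2 (1 : ℝ) +
        b • EuclideanSpace.single 3 (1 : ℝ) : E4) k) y = 0 := fun i k => by
      simp [Coord.pd]
    simp only [Coord.lieDerivMetric, h0, mul_zero, add_zero]
    rw [Fin.sum_univ_four]
    simp [hG y hy i j]
  abelian ξ hξ η hη p := by
    have hp : p ∈ φ.source := hs ▸ mem_univ p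
    obtain ⟨y, hy, rfl⟩ : ∃ y ∈ φ.target, φ.symm y = p := ⟨φ p, φ.map_source hp, φ.left_inv hp⟩
    obtain ⟨a, b, rfl⟩ := mem_verticalAlgebra hξ
    obtain ⟨a', b', rfl⟩ := mem_verticalAlgebra hη
    refine comps_injective hφ hp ?_
    rw [← fieldInChart_eq, fieldInChart_mlieBracket
      (smoothOn_fieldOf_univ hφ hs contDiff_const) (smoothOn_fieldOf_univ hφ hs contDiff_const)
      isOpen_univ hφ hy (mem_univ _),
      (fieldInChart_fieldOf_eventuallyEq hφ _ hy).lieBracket_vectorField_eq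
      (fieldInChart_fieldOf_eventuallyEq hφ _ hy), map_zero]
    simp [VectorField.lieBracket]

end Soliton

namespace Soliton

variable {M : Type*} [TopologicalSpace M] [ChartedSpace E4 M] [IsManifold (𝓡 4) ∞ M]
  {φ : OpenPartialHomeomorph M E4}

/-! ## The normal form satisfies the hypotheses of the first case -/

/-- A horizontal vector is determined by its components along `t₁, t₂`: the horizontal lift of
`∂_{t₁}` is `∂_{t₁} - F (∂_{z₁} + c ∂_{z₂})`, and `∂_{t₂}` is its own lift. -/
theorem horizontal_normalMetric (ε c : ℝ) (P F : E2 → ℝ) (y u : E4) :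
    (Coord.bilin (normalMetric ε c P F y) (EuclideanSpace.single 2 1) u = 0 ∧
      Coord.bilin (normalMetric ε c P F y) (EuclideanSpace.single 3 1) u = 0) ↔
    u 2 = -(F (projT y) * u 0) ∧ u 3 = -(c * (F (projT y) * u 0)) := by
  simp only [Coord.bilin_apply, Fin.sum_univ_four]
  simp [normalMetric]
  constructor <;> rintro ⟨h1, h2⟩
  · exact ⟨by linear_combination h2, by linear_combination h1 + 2 * c * h2⟩
  · exact ⟨by linear_combination h2 - 2 * c * h1, by linear_combination h1⟩

theorem hasFDerivAt_coord {Y : E4 → E4} {y : E4} (hY : DifferentiableAt ℝ Y y) (k : Fin 4) :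
    HasFDerivAt (fun z => Y z k) ((EuclideanSpace.proj k).comp (fderiv ℝ Y y)) y :=
  (EuclideanSpace.proj k : E4 →L[ℝ] ℝ).hasFDerivAt.comp y hY.hasFDerivAt

theorem fderiv_apply_coord {Y : E4 → E4} {y : E4} (hY : DifferentiableAt ℝ Y y) (k : Fin 4)
    (v : E4) : fderiv ℝ Y y v k = fderiv ℝ (fun z => Y z k) y v := by
  rw [(hasFDerivAt_coord hY k).fderiv]
  rfl

/-- The derivative of a component of a horizontal vector field of the normal form. -/
theorem fderiv_horizontal {F : E2 → ℝ} {Y : E4 → E4} {y : E4} (hY : DifferentiableAt ℝ Y y)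
    (hF : DifferentiableAt ℝ F (projT y)) {k : Fin 4} {c : ℝ}
    (h : ∀ᶠ z in 𝓝 y, Y z k = -(c * (F (projT z) * Y z 0))) (v : E4) :
    fderiv ℝ Y y v k = -(c * (fderiv ℝ F (projT y) (projT v) * Y y 0
      + F (projT y) * fderiv ℝ Y y v 0)) := by
  have h1 : HasFDerivAt (fun z => F (projT z) * Y z 0) _ y :=
    (hasFDerivAt_comp_projT hF).mul (hasFDerivAt_coord hY 0)
  have h2 : HasFDerivAt (fun z => -(c * (F (projT z) * Y z 0))) _ y := (h1.const_mul c).fun_neg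
  rw [fderiv_apply_coord hY, Filter.EventuallyEq.fderiv_eq h, h2.fderiv]
  simp [projTL_apply]
  ring

theorem fderiv_projT (F : E2 → ℝ) (t : E2) (v : E4) :
    fderiv ℝ F t (projT v) = v 0 * Coord.pd 0 F t + v 1 * Coord.pd 1 F t := by
  rw [Coord.fderiv_apply_eq_sum_pd, Fin.sum_univ_two]
  rfl

variable {ξ₁ ξ₂ : VField M} {g : PseudoMetric M} {ε c : ℝ} {P F : E2 → ℝ}

omit [IsManifold (𝓡 4) ∞ M] in
theorem mem_horizontalSpace_iff_of_normal
    (hφ : φ ∈ IsManifold.maximalAtlas (𝓡 4) ∞ M) {y : E4}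
    (hy : y ∈ φ.target) (h₁ : fieldInChart ξ₁ φ y = EuclideanSpace.single 2 1)
    (h₂ : fieldInChart ξ₂ φ y = EuclideanSpace.single 3 1)
    (hg : g.inChart φ y = normalMetric ε c P F y) (v : TangentSpace (𝓡 4) (φ.symm y)) :
    v ∈ horizontalSpace g (Submodule.span ℝ {ξ₁, ξ₂}) (φ.symm y) ↔
      comps φ (φ.symm y) v 2 = -(F (projT y) * comps φ (φ.symm y) v 0) ∧
      comps φ (φ.symm y) v 3 = -(c * (F (projT y) * comps φ (φ.symm y) v 0)) := by
  rw [mem_horizontalSpace_iff g hφ hy h₁ h₂, hg, horizontal_normalMetric]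

theorem horizontal_inChart
    (hφ : φ ∈ IsManifold.maximalAtlas (𝓡 4) ∞ M)
    (h₁ : ∀ y ∈ φ.target, fieldInChart ξ₁ φ y = EuclideanSpace.single 2 1)
    (h₂ : ∀ y ∈ φ.target, fieldInChart ξ₂ φ y = EuclideanSpace.single 3 1)
    (hg : ∀ y ∈ φ.target, g.inChart φ y = normalMetric ε c P F y)
    {Y : VField M} {V : Set M} (hV : IsOpen V) (hY : SmoothOn Y V)
    (hYh : IsHorizontalOn g (Submodule.span ℝ {ξ₁, ξ₂}) Y V) {y : E4} (hy : y ∈ φ.target)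
    (hyV : φ.symm y ∈ V) :
    DifferentiableAt ℝ (fieldInChart Y φ) y ∧
    ∀ᶠ z in 𝓝 y, fieldInChart Y φ z 2 = -(1 * (F (projT z) * fieldInChart Y φ z 0)) ∧
      fieldInChart Y φ z 3 = -(c * (F (projT z) * fieldInChart Y φ z 0)) := by
  have hn : φ.target ∩ φ.symm ⁻¹' V ∈ 𝓝 y := (φ.isOpen_inter_preimage_symm hV).mem_nhds ⟨hy, hyV⟩
  refine ⟨((hY.fieldInChart hV hφ).contDiffAt hn).differentiableAt (by simp), ?_⟩
  filter_upwards [hn] with z hz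
  rw [one_mul]
  exact (mem_horizontalSpace_iff_of_normal hφ hz.1 (h₁ z hz.1) (h₂ z hz.1) (hg z hz.1) _).1
    (hYh _ hz.2)

/-- The curvature vector of the normal form. -/
theorem comps_curvatureVector {Λ : ℝ} (hε : ε * ε = 1)
    (hφ : φ ∈ IsManifold.maximalAtlas (𝓡 4) ∞ M)
    (h₁ : ∀ y ∈ φ.target, fieldInChart ξ₁ φ y = EuclideanSpace.single 2 1)
    (h₂ : ∀ y ∈ φ.target, fieldInChart ξ₂ φ y = EuclideanSpace.single 3 1)
    (hg : ∀ y ∈ φ.target, g.inChart φ y = normalMetric ε c P F y)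
    (L : IsLiouvillePair Λ ε (projT '' φ.target) P F) {y : E4} (hy : y ∈ φ.target)
    {C : TangentSpace (𝓡 4) (φ.symm y)}
    (hC : IsCurvatureVector g (Submodule.span ℝ {ξ₁, ξ₂}) (φ.symm y) C) :
    ∃ k : ℝ, k ≠ 0 ∧ comps φ (φ.symm y) C =
      k • (EuclideanSpace.single 2 1 + c • EuclideanSpace.single 3 1) := by
  obtain ⟨V, Y₁, Y₂, w, hV, hyV, hY₁, hY₂, hh₁, hh₂, hi, hw, hb, rfl⟩ := hC
  have dF := (L.differentiableAt (isOpen_image_projT φ.open_target) (mem_image_of_mem _ hy)).2.1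
  obtain ⟨d1, e1⟩ := horizontal_inChart hφ h₁ h₂ hg hV hY₁ hh₁ hy hyV
  obtain ⟨d2, e2⟩ := horizontal_inChart hφ h₁ h₂ hg hV hY₂ hh₂ hy hyV
  rw [mem_horizontalSpace_iff_of_normal hφ hy (h₁ y hy) (h₂ y hy) (hg y hy), map_sub,
    ← fieldInChart_eq, fieldInChart_mlieBracket hY₁ hY₂ hV hφ hy hyV] at hb
  rw [mem_leafSpace_iff hφ hy (h₁ y hy) (h₂ y hy)] at hw
  have hF1 := L.antiderivative _ (mem_image_of_mem _ hy)
  have q1 := e1.self_of_nhds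
  have q2 := e2.self_of_nhds
  have A2 := fderiv_horizontal d2 dF (e2.mono fun _ h => h.1) (fieldInChart Y₁ φ y)
  have A3 := fderiv_horizontal d2 dF (e2.mono fun _ h => h.2) (fieldInChart Y₁ φ y)
  have B2 := fderiv_horizontal d1 dF (e1.mono fun _ h => h.1) (fieldInChart Y₂ φ y)
  have B3 := fderiv_horizontal d1 dF (e1.mono fun _ h => h.2) (fieldInChart Y₂ φ y)
  rw [fderiv_projT, hF1] at A2 A3 B2 B3
  simp only [VectorField.lieBracket, PiLp.sub_apply] at hb
  have hgram : ∀ Y Z : VField M, g.form (φ.symm y) (Y (φ.symm y)) (Z (φ.symm y)) =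
      Coord.bilin (normalMetric ε c P F y) (fieldInChart Y φ y) (fieldInChart Z φ y) :=
    fun Y Z => by
      rw [form_eq_bilin g.form hφ hy, ← hg y hy]
      rfl
  have hi' : ∀ a b : ℝ, a • fieldInChart Y₁ φ y + b • fieldInChart Y₂ φ y = 0 →
      a = 0 ∧ b = 0 := by
    intro a b hab
    have h1 := LinearIndependent.pair_iff.1 (hi _ hyV) a b
    apply h1
    refine comps_injective hφ (φ.map_target hy) ?_
    rw [map_add, map_smul, map_smul, map_zero]
    exact hab
  rw [hgram, hgram, hgram, hgram, map_smul]
  generalize fieldInChart Y₁ φ y = u at *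
  generalize fieldInChart Y₂ φ y = v at *
  -- Horizontal vectors are determined by their first two components, so the minor of an independent
  -- pair cannot vanish.
  have hΔ : u 0 * v 1 - u 1 * v 0 ≠ 0 := by
    intro h0
    have k1 := hi' (v 0) (-u 0) (by
      refine PiLp.ext fun k => ?_
      fin_cases k <;> simp [q1, q2]
      · ring
      · linear_combination -h0
      · ring
      · ring)
    have k2 := hi' (v 1) (-u 1) (by
      refine PiLp.ext fun k => ?_
      fin_cases k <;> simp [q1, q2]
      · linear_combination h0
      · ring
      · linear_combination (-F (projT y)) * h0
      · linear_combination (-c * F (projT y)) * h0)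
    have hu : u = 0 := by
      refine PiLp.ext fun k => ?_
      fin_cases k
      · simpa using k1.2
      · simpa using k2.2
      · simp [q1, neg_eq_zero.1 k1.2]
      · simp [q1, neg_eq_zero.1 k1.2]
    have := (hi' 1 0 (by simp [hu])).1
    exact one_ne_zero this
  have hdet : Coord.bilin (normalMetric ε c P F y) u u * Coord.bilin (normalMetric ε c P F y) v v -
      Coord.bilin (normalMetric ε c P F y) u v * Coord.bilin (normalMetric ε c P F y) v u =
      ε * (Real.exp (-2 * P (projT y)) * (u 0 * v 1 - u 1 * v 0)) ^ 2 := by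
    simp only [Coord.bilin_apply, Fin.sum_univ_four, q1, q2]
    simp only [normalMetric, Matrix.of_apply, Matrix.cons_val]
    ring
  have hk : Coord.bilin (normalMetric ε c P F y) u u * Coord.bilin (normalMetric ε c P F y) v v -
      Coord.bilin (normalMetric ε c P F y) u v * Coord.bilin (normalMetric ε c P F y) v u ≠ 0 := by
    rw [hdet]
    have hε' : ε ≠ 0 := fun h0 => by simp [h0] at hε
    have := Real.exp_ne_zero (-2 * P (projT y))
    positivity
  -- The vertical part of the bracket is `F_{,t₂}` times the minor times `∂_{z₁} + c ∂_{z₂}`, and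
  -- `F_{,t₂} = e^{-2P}`; the remaining factor is the normalization by the Gram determinant.
  refine ⟨_ * (Real.exp (-2 * P (projT y)) * (u 0 * v 1 - u 1 * v 0)),
    mul_ne_zero (inv_ne_zero (Real.sqrt_ne_zero'.2 (abs_pos.2 hk)))
      (mul_ne_zero (Real.exp_ne_zero _) hΔ), ?_⟩
  rw [mul_smul]
  congr 1
  rw [eq_vertical hw.1 hw.2, smul_add, smul_smul]
  congr 2
  · rw [hw.1] at hb
    linear_combination -hb.1 + A2 - B2
  · rw [hw.1] at hb
    linear_combination -hb.2 + A3 - B3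

/-- For horizontal `Y` the bracket is `DY (X) - DX (Y)`. The second term vanishes because `DX`
factors through `z₂ - c z₁` and `Y 3 = c * Y 2`. The first is horizontal because `X` is vertical, so
that `F` does not change along it. -/
theorem isSymmetryOfHorizontal_of_normal {Λ a₁ a₂ : ℝ} {X : VField M}
    (hφ : φ ∈ IsManifold.maximalAtlas (𝓡 4) ∞ M) (hs : φ.source = univ)
    (h₁ : ∀ y ∈ φ.target, fieldInChart ξ₁ φ y = EuclideanSpace.single 2 1)
    (h₂ : ∀ y ∈ φ.target, fieldInChart ξ₂ φ y = EuclideanSpace.single 3 1)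
    (hg : ∀ y ∈ φ.target, g.inChart φ y = normalMetric ε c P F y)
    (hX : SmoothOn X univ)
    (hX' : ∀ y ∈ φ.target, fieldInChart X φ y = normalField Λ ε c a₁ a₂ y)
    (L : IsLiouvillePair Λ ε (projT '' φ.target) P F) :
    IsSymmetryOfHorizontal g (Submodule.span ℝ {ξ₁, ξ₂}) X := by
  intro V Y hV hY hYh p hpV
  have hp : p ∈ φ.source := hs ▸ mem_univ p
  obtain ⟨y, hy, rfl⟩ : ∃ y ∈ φ.target, φ.symm y = p := ⟨φ p, φ.map_source hp, φ.left_inv hp⟩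
  have dF := (L.differentiableAt (isOpen_image_projT φ.open_target) (mem_image_of_mem _ hy)).2.1
  obtain ⟨d, e⟩ := horizontal_inChart hφ h₁ h₂ hg hV hY hYh hy hpV
  have e1 : fieldInChart X φ =ᶠ[𝓝 y] normalField Λ ε c a₁ a₂ :=
    mem_of_superset (φ.open_target.mem_nhds hy) hX'
  rw [mem_horizontalSpace_iff_of_normal hφ hy (h₁ y hy) (h₂ y hy) (hg y hy), ← fieldInChart_eq,
    fieldInChart_mlieBracket (hX.mono (subset_univ V)) hY hV hφ hy hpV,
    e1.lieBracket_vectorField_eq EventuallyEq.rfl, VectorField.lieBracket, fderiv_normalField,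
    normalFieldL_apply]
  have A2 := fderiv_horizontal d dF (e.mono fun _ h => h.1) (normalField Λ ε c a₁ a₂ y)
  have A3 := fderiv_horizontal d dF (e.mono fun _ h => h.2) (normalField Λ ε c a₁ a₂ y)
  have hz : projT (normalField Λ ε c a₁ a₂ y) = 0 := by
    refine PiLp.ext fun k => ?_
    fin_cases k <;> simp [projT, normalField]
  rw [hz, map_zero, zero_mul, zero_add] at A2 A3
  have q := e.self_of_nhds
  simp only [PiLp.sub_apply, A2, A3]
  simp [normalField, q]
  constructor <;> ring

/-- The normal form, on a manifold covered by the chart, satisfies the hypotheses of the first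
case. -/
theorem isCaseI_of_normal [Nonempty M] {Λ a₁ a₂ : ℝ} (hε : ε = 1 ∨ ε = -1)
    (hφ : φ ∈ IsManifold.maximalAtlas (𝓡 4) ∞ M) (hs : φ.source = univ)
    (ha : ∀ χ ∈ atlas E4 M, χ = φ) (L : IsLiouvillePair Λ ε (projT '' φ.target) P F)
    (hg : ∀ y ∈ φ.target, g.inChart φ y = normalMetric ε c P F y) :
    IsCaseI g (verticalAlgebra φ) (fieldOf φ (normalField Λ ε c a₁ a₂)) Λ := by
  have hε' : ε * ε = 1 := by rcases hε with h | h <;> simp [h]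
  have h₁ := fun y hy => fieldInChart_fieldOf hφ (fun _ => EuclideanSpace.single 2 1) (y := y) hy
  have h₂ := fun y hy => fieldInChart_fieldOf hφ (fun _ => EuclideanSpace.single 3 1) (y := y) hy
  have hX := fun y hy => fieldInChart_fieldOf hφ (normalField Λ ε c a₁ a₂) (y := y) hy
  have hXs := smoothOn_fieldOf_univ hφ hs (contDiff_normalField Λ ε c a₁ a₂)
  have hg' : ∀ y ∈ φ.target, g.inChart φ =ᶠ[𝓝 y] normalMetric ε c P F := fun y hy =>
    mem_of_superset (φ.open_target.mem_nhds hy) hg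
  have hp : ∀ p : M, ∃ y ∈ φ.target, φ.symm y = p := fun p =>
    ⟨φ p, φ.map_source (hs ▸ mem_univ p), φ.left_inv (hs ▸ mem_univ p)⟩
  have hD := isOpen_image_projT φ.open_target
  have hz : ∀ y, ∀ u : E4, (∀ w : E4, w 0 = 0 → w 1 = 0 →
      Coord.bilin (normalMetric ε c P F y) u w = 0) → u 0 = 0 → u 1 = 0 → u = 0 := by
    intro y u hu h0 h1
    have k2 := hu (EuclideanSpace.single 3 1) (by simp) (by simp)
    have k3 := hu (EuclideanSpace.single 2 1) (by simp) (by simp)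
    simp [Coord.bilin_apply, Fin.sum_univ_four, normalMetric, h0] at k2 k3
    rw [k2] at k3
    refine PiLp.ext fun k => ?_
    fin_cases k
    exacts [h0, h1, k2, by simpa using k3]
  -- The curvature vector is a nonzero multiple of `∂_{z₁} + c ∂_{z₂}`, which is null and not
  -- proportional to `∂_{z₂}`. All conditions on the curvature vector follow from this.
  have hcv : ∀ p C, IsCurvatureVector g (verticalAlgebra φ) p C → ∃ k : ℝ, k ≠ 0 ∧
      comps φ p C = k • (EuclideanSpace.single 2 1 + c • EuclideanSpace.single 3 1) := by
    intro p C hC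
    obtain ⟨y, hy, rfl⟩ := hp p
    exact comps_curvatureVector hε' hφ h₁ h₂ hg L hy hC
  refine ⟨⟨hXs, fun χ hχ y hy i j => ?_⟩,
    isAbelianKillingAlgebra_verticalAlgebra hφ hs ha g fun y hy i j => ?_, fun p => ?_,
    fun p C hC h0 => ?_, fun p => ?_, fun p C hC => ?_, fun p => ?_,
    isSymmetryOfHorizontal_of_normal hφ hs h₁ h₂ hg hXs hX L,
    ⟨fieldOf φ fun _ => EuclideanSpace.single 3 1, ⟨?_, ?_, ?_⟩, fun p C hC h0 => ?_⟩⟩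
  · rw [ha χ hχ] at hy ⊢
    rw [Coord.ricci_congr (hg' y hy), Coord.lieDerivMetric_congr (hg' y hy)
      (fieldInChart_fieldOf_eventuallyEq hφ _ hy), hg y hy]
    exact soliton_normalMetric a₁ a₂ φ.open_target hε' L y hy i j
  · have h1 : (fun z => g.inChart φ z i j) =ᶠ[𝓝 y] fun z => normalMetric ε c P F z i j :=
      (hg' y hy).mono fun z hz => congrFun (congrFun hz i) j
    rw [Coord.pd_congr h1, Coord.pd_congr h1, Coord.pd, Coord.pd]
    obtain ⟨dP, dF, -⟩ := L.differentiableAt hD (mem_image_of_mem _ hy)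
    have e1 := fderiv_comp_projT_vertical (y := y)
      (f := fun t => Real.exp (-2 * P t)) (dP.const_mul _).exp
    have e2 := fderiv_comp_projT_vertical (y := y)
      (f := fun t => ε * Real.exp (-2 * P t)) ((dP.const_mul _).exp.const_mul _)
    have e3 := fderiv_comp_projT_vertical (y := y) (f := fun t => -c * F t) (dF.const_mul _)
    have e4 := fderiv_comp_projT_vertical (y := y) (f := F) dF
    have e0 : ∀ k : ℝ, fderiv ℝ (fun _ : E4 => k) y (EuclideanSpace.single 2 1) = 0 ∧
      fderiv ℝ (fun _ : E4 => k) y (EuclideanSpace.single 3 1) = 0 := fun k => by simp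
    fin_cases i <;> fin_cases j
    exacts [e1, e0 _, e3, e4, e0 _, e2, e0 _, e0 _, e3, e0 _, e0 _, e0 _, e4, e0 _, e0 _, e0 _]
  · obtain ⟨y, hy, rfl⟩ := hp p
    refine ⟨finrank_leafSpace (h₁ y hy) (h₂ y hy), fun v hv hw => ?_⟩
    refine comps_injective hφ (φ.map_target hy) ?_
    rw [map_zero]
    rw [verticalAlgebra, mem_leafSpace_iff hφ hy (h₁ y hy) (h₂ y hy)] at hv
    refine hz y _ (fun w h0 h1 => ?_) hv.1 hv.2
    have := hw (vecOf φ y w) (by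
      rw [verticalAlgebra, mem_leafSpace_iff hφ hy (h₁ y hy) (h₂ y hy), comps_vecOf hφ hy]
      exact ⟨h0, h1⟩)
    rw [form_eq_bilin g.form hφ hy, comps_vecOf hφ hy] at this
    rwa [← hg y hy]
  · obtain ⟨k, hk, hC'⟩ := hcv p C hC
    rw [h0, map_zero] at hC'
    have := congrArg (fun w : E4 => w 2) hC'
    simp [hk.symm] at this
  · obtain ⟨y, hy, rfl⟩ := hp p
    refine ⟨vecOf φ y (EuclideanSpace.single 0 1 - F (projT y) • EuclideanSpace.single 2 1 -
      (c * F (projT y)) • EuclideanSpace.single 3 1), ?_, ?_⟩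
    · rw [verticalAlgebra, mem_horizontalSpace_iff_of_normal hφ hy (h₁ y hy) (h₂ y hy) (hg y hy),
        comps_vecOf hφ hy]
      simp
    · rw [form_eq_bilin g.form hφ hy, comps_vecOf hφ hy]
      change 0 < Coord.bilin (g.inChart φ y) _ _
      rw [hg y hy]
      simp [Coord.bilin_apply, Fin.sum_univ_four, normalMetric]
      linarith [Real.exp_pos (-(2 * P (projT y)))]
  · obtain ⟨k, hk, hC'⟩ := hcv p C hC
    obtain ⟨y, hy, rfl⟩ := hp p
    rw [form_eq_bilin g.form hφ hy, hC']
    change Coord.bilin (g.inChart φ y) _ _ = 0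
    rw [hg y hy]
    simp [Coord.bilin_apply, Fin.sum_univ_four, normalMetric]
    ring
  · obtain ⟨y, hy, rfl⟩ := hp p
    rw [verticalAlgebra, mem_leafSpace_iff hφ hy (h₁ y hy) (h₂ y hy), ← fieldInChart_eq, hX y hy]
    exact ⟨rfl, rfl⟩
  · exact Submodule.subset_span (mem_insert_of_mem _ rfl)
  · intro h0
    obtain ⟨p⟩ := ‹Nonempty M›
    obtain ⟨y, hy, rfl⟩ := hp p
    have h := h₂ y hy
    rw [h0, fieldInChart_eq, Pi.zero_apply, map_zero] at h
    have := congrArg (fun w : E4 => w 3) h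
    simp at this
  · intro p
    obtain ⟨y, hy, rfl⟩ := hp p
    have h := h₂ y hy
    rw [fieldInChart_eq] at h
    rw [form_eq_bilin g.form hφ hy, h, Coord.bilin_single]
    change g.inChart φ y 3 3 = 0
    rw [hg y hy]
    rfl
  · obtain ⟨k, hk, hC'⟩ := hcv p C hC
    obtain ⟨y, hy, rfl⟩ := hp p
    obtain ⟨a, rfl⟩ := Submodule.mem_span_singleton.1 h0
    have h := h₂ y hy
    rw [fieldInChart_eq] at h
    rw [map_smul, h] at hC'
    have := congrArg (fun w : E4 => w 2) hC'
    simp [hk.symm] at this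

omit [IsManifold (𝓡 4) ∞ M] in
theorem hasNormalForm_of_normal {Λ a₁ a₂ : ℝ} (hε : ε = 1 ∨ ε = -1)
    (hφ : φ ∈ IsManifold.maximalAtlas (𝓡 4) ∞ M)
    (L : IsLiouvillePair Λ ε (projT '' φ.target) P F)
    (hg : ∀ y ∈ φ.target, g.inChart φ y = normalMetric ε c P F y) :
    HasNormalForm g (verticalAlgebra φ) (fieldOf φ (normalField Λ ε c a₁ a₂)) φ Λ ε c a₁ a₂ P F where
  adapted := ⟨_, _, rfl, fun y hy => ⟨fieldInChart_fieldOf hφ _ hy, fieldInChart_fieldOf hφ _ hy⟩⟩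
  functions := L
  metric := hg
  field y hy := fieldInChart_fieldOf hφ _ hy
  orbit y hy := by rw [hg y hy, orbitMetric_normalMetric]
  curvature t ht := gaussCurvature_conformalMetric (isOpen_image_projT φ.open_target)
    (by rcases hε with h | h <;> simp [h]) L ht

/-- The inclusion of an open subset of `E4`, as a chart. -/
theorem exists_chart_opens (U : TopologicalSpace.Opens E4) (hU : (U : Set E4).Nonempty) :
    ∃ φ ∈ IsManifold.maximalAtlas (𝓡 4) ∞ U, φ.source = univ ∧ φ.target = (U : Set E4) ∧
      (∀ x : U, φ x = (x : E4)) ∧ ∀ χ ∈ atlas E4 U, χ = φ := by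
  have hne : Nonempty U := hU.to_subtype
  refine ⟨(OpenPartialHomeomorph.refl E4).subtypeRestr hne, ?_, ?_, ?_, fun x => rfl, ?_⟩
  · apply IsManifold.subset_maximalAtlas
    obtain ⟨x⟩ := hne
    exact mem_iUnion.2 ⟨x, rfl⟩
  · simp
  · ext z
    simp [OpenPartialHomeomorph.subtypeRestr]
  · intro χ hχ
    obtain ⟨x, hx⟩ := mem_iUnion.1 hχ
    exact hx

theorem exists_normal_soliton (U : TopologicalSpace.Opens E4) (Λ ε c a₁ a₂ : ℝ) (P F : E2 → ℝ)
    (hU : (U : Set E4).Nonempty) (hε : ε = 1 ∨ ε = -1)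
    (L : IsLiouvillePair Λ ε (projT '' (U : Set E4)) P F) :
    ∃ (g : PseudoMetric U) (𝒢 : Submodule ℝ (VField U)) (X : VField U), IsCaseI g 𝒢 X Λ ∧
      ∃ φ ∈ IsManifold.maximalAtlas (𝓡 4) ∞ U, φ.source = univ ∧ φ.target = (U : Set E4) ∧
        (∀ x : U, φ x = (x : E4)) ∧ HasNormalForm g 𝒢 X φ Λ ε c a₁ a₂ P F := by
  obtain ⟨φ, hφ, hs, ht, he, ha⟩ := exists_chart_opens U hU
  have : Nonempty U := hU.to_subtype
  rw [← ht] at L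
  have hε' : ε * ε = 1 := by rcases hε with h | h <;> simp [h]
  have hG := isMetricOn_normalMetric c hε' L.smooth_P L.smooth_F
  have hg := fun y hy => PseudoMetric.inChart_ofChart hφ hs ha _ hG (y := y) hy
  exact ⟨PseudoMetric.ofChart hφ hs ha _ hG, _, _, isCaseI_of_normal hε hφ hs ha L hg, φ, hφ, hs,
    ht, he, hasNormalForm_of_normal hε hφ L hg⟩

end Soliton

namespace Soliton

/-! ## Explicit solutions of the Liouville equation -/

/-- The solution `C` of `C C'' - C'² = Λ`. -/
def liouvilleProfile (Λ x : ℝ) : ℝ := Real.exp x + Λ / 4 * Real.exp (-x)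

theorem hasDerivAt_liouvilleProfile (Λ x : ℝ) :
    HasDerivAt (liouvilleProfile Λ) (liouvilleProfile (-Λ) x) x := by
  have h1 := (Real.hasDerivAt_exp x).add
    (((Real.hasDerivAt_exp (-x)).comp x (hasDerivAt_neg x)).const_mul (Λ / 4))
  exact h1.congr_deriv (by rw [liouvilleProfile]; ring)

theorem contDiff_liouvilleProfile (Λ : ℝ) : ContDiff ℝ ∞ (liouvilleProfile Λ) :=
  Real.contDiff_exp.add (contDiff_const.mul (Real.contDiff_exp.comp contDiff_neg))

theorem pd_comp_zero {f : ℝ → ℝ} {f' : ℝ} {t : E2} (hf : HasDerivAt f f' (t 0)) :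
    Coord.pd 0 (fun t : E2 => f (t 0)) t = f' ∧ Coord.pd 1 (fun t : E2 => f (t 0)) t = 0 := by
  have h1 : HasFDerivAt (fun t : E2 => f (t 0)) (f' • (EuclideanSpace.proj 0 : E2 →L[ℝ] ℝ)) t :=
    hf.comp_hasFDerivAt t (EuclideanSpace.proj 0 : E2 →L[ℝ] ℝ).hasFDerivAt
  rw [Coord.pd, Coord.pd, h1.fderiv]
  simp

/-- For `P = log C(t₁)` one has `P'' = (C C'' - C'²) / C² = Λ e^{-2P}`. The derivative of the
profile for `Λ` is the one for `-Λ`, which gives `C C'' - C'² = Λ`. Nothing depends on `t₂`, so the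
sign `ε` plays no role and `F = t₂ e^{-2P}` is an antiderivative. -/
theorem isLiouvillePair_profile (Λ ε : ℝ) :
    IsLiouvillePair Λ ε {t : E2 | 0 < liouvilleProfile Λ (t 0)}
      (fun t => Real.log (liouvilleProfile Λ (t 0)))
      (fun t => t 1 * (liouvilleProfile Λ (t 0) ^ 2)⁻¹) := by
  have h0 : ContDiff ℝ ∞ fun t : E2 => t 0 := (EuclideanSpace.proj 0 : E2 →L[ℝ] ℝ).contDiff
  have h1 : ContDiff ℝ ∞ fun t : E2 => t 1 := (EuclideanSpace.proj 1 : E2 →L[ℝ] ℝ).contDiff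
  have hC : ContDiff ℝ ∞ fun t : E2 => liouvilleProfile Λ (t 0) :=
    (contDiff_liouvilleProfile Λ).comp h0
  have hopen : IsOpen {t : E2 | 0 < liouvilleProfile Λ (t 0)} :=
    isOpen_lt continuous_const hC.continuous
  have he : ∀ x, 0 < liouvilleProfile Λ x →
      Real.exp (-2 * Real.log (liouvilleProfile Λ x)) = (liouvilleProfile Λ x ^ 2)⁻¹ := by
    intro x hx
    rw [neg_mul, Real.exp_neg, two_mul, Real.exp_add, Real.exp_log hx, sq]
  have hP : ∀ t ∈ {t : E2 | 0 < liouvilleProfile Λ (t 0)},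
      Coord.pd 0 (fun t : E2 => Real.log (liouvilleProfile Λ (t 0))) t =
        liouvilleProfile (-Λ) (t 0) / liouvilleProfile Λ (t 0) ∧
      Coord.pd 1 (fun t : E2 => Real.log (liouvilleProfile Λ (t 0))) t = 0 := fun t ht =>
    pd_comp_zero (f := fun x => Real.log (liouvilleProfile Λ x))
      ((hasDerivAt_liouvilleProfile Λ (t 0)).log (ne_of_gt ht))
  refine ⟨hC.contDiffOn.log fun t ht => ne_of_gt ht, h1.contDiffOn.mul
    ((hC.pow 2).contDiffOn.inv fun t ht => pow_ne_zero 2 (ne_of_gt ht)), fun t ht => ?_,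
    fun t ht => ?_⟩
  · rw [he _ ht]
    have d1 := ((EuclideanSpace.proj 1 : E2 →L[ℝ] ℝ).hasFDerivAt (x := t))
    have d0 : DifferentiableAt ℝ (fun t : E2 => (liouvilleProfile Λ (t 0) ^ 2)⁻¹) t :=
      ((hC.pow 2).differentiable (by simp)).differentiableAt.inv (pow_ne_zero 2 (ne_of_gt ht))
    have d2 : HasFDerivAt (fun t : E2 => t 1 * (liouvilleProfile Λ (t 0) ^ 2)⁻¹) _ t :=
      d1.mul d0.hasFDerivAt
    have e := (pd_comp_zero (f := fun x => (liouvilleProfile Λ x ^ 2)⁻¹) (t := t)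
      (((hasDerivAt_liouvilleProfile Λ (t 0)).pow 2).inv (pow_ne_zero 2 (ne_of_gt ht)))).2
    rw [Coord.pd] at e
    rw [Coord.pd, d2.fderiv]
    simp [e]
  · have e0 : Coord.pd 0 (fun t : E2 => Real.log (liouvilleProfile Λ (t 0))) =ᶠ[𝓝 t]
        fun t => liouvilleProfile (-Λ) (t 0) / liouvilleProfile Λ (t 0) :=
      mem_of_superset (hopen.mem_nhds ht) fun s hs => (hP s hs).1
    have e1 : Coord.pd 1 (fun t : E2 => Real.log (liouvilleProfile Λ (t 0))) =ᶠ[𝓝 t]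
        fun _ => 0 :=
      mem_of_superset (hopen.mem_nhds ht) fun s hs => (hP s hs).2
    have hne : liouvilleProfile Λ (t 0) ≠ 0 := ne_of_gt ht
    have hm := hasDerivAt_liouvilleProfile (-Λ) (t 0)
    rw [neg_neg] at hm
    rw [Coord.pd_congr e0, Coord.pd_congr e1, he _ ht,
      (pd_comp_zero (f := fun x => liouvilleProfile (-Λ) x / liouvilleProfile Λ x) (t := t)
      (hm.div (hasDerivAt_liouvilleProfile Λ (t 0)) hne)).1]
    have hx : Real.exp (t 0) * Real.exp (-t 0) = 1 := by rw [← Real.exp_add]; simp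
    have hw : liouvilleProfile Λ (t 0) * liouvilleProfile Λ (t 0) -
        liouvilleProfile (-Λ) (t 0) * liouvilleProfile (-Λ) (t 0) = Λ := by
      simp only [liouvilleProfile]
      linear_combination Λ * hx
    rw [hw]
    simp [Coord.pd, div_eq_mul_inv]

theorem exists_liouvillePair (Λ ε : ℝ) : ∃ (U : TopologicalSpace.Opens E4) (P F : E2 → ℝ),
    (U : Set E4).Nonempty ∧ IsLiouvillePair Λ ε (projT '' (U : Set E4)) P F := by
  have hopen : IsOpen {y : E4 | 0 < liouvilleProfile Λ (y 0)} :=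
    isOpen_lt continuous_const ((contDiff_liouvilleProfile Λ).continuous.comp
      (EuclideanSpace.proj 0 : E4 →L[ℝ] ℝ).continuous)
  -- At `t₁ = |Λ|` the profile is positive: its first term is at least `1 + |Λ|`, its second at
  -- least `-|Λ| / 4`.
  refine ⟨⟨_, hopen⟩, _, _, ⟨EuclideanSpace.single 0 |Λ|, ?_⟩,
    (isLiouvillePair_profile Λ ε).mono ?_⟩
  · have h1 := Real.add_one_le_exp |Λ|
    have h2 : Real.exp (-|Λ|) ≤ 1 := Real.exp_le_one_iff.2 (by simp)
    have h3 := Real.exp_pos (-|Λ|)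
    have h4 := neg_abs_le Λ
    have h5 := abs_nonneg Λ
    change 0 < liouvilleProfile Λ ((EuclideanSpace.single 0 |Λ| : E4) 0)
    simp only [liouvilleProfile, PiLp.single_apply, if_true]
    nlinarith
  · rintro _ ⟨y, hy, rfl⟩
    exact hy

end Soliton

namespace Soliton

variable {M : Type*} [TopologicalSpace M] [ChartedSpace E4 M] [IsManifold (𝓡 4) ∞ M]
  {φ : OpenPartialHomeomorph M E4}

/-! ## Charts from parametrizations -/

/-- A local diffeomorphism `Φ` into the domain of a chart `φ` is the inverse of a chart. -/
theorem exists_chart_of_param (g : PseudoMetric M) (hφ : φ ∈ IsManifold.maximalAtlas (𝓡 4) ∞ M)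
    {Φ : E4 → E4} {U W : Set E4} (hU : IsOpen U) (hW : IsOpen W) (hΦ : ContDiffOn ℝ ∞ Φ U)
    (h0 : 0 ∈ U) (hW0 : Φ 0 ∈ W) {p : M} (hp : p ∈ φ.source) (hp0 : Φ 0 = φ p)
    (hinj : Function.Injective (fderiv ℝ Φ 0)) :
    ∃ φ' ∈ IsManifold.maximalAtlas (𝓡 4) ∞ M, p ∈ φ'.source ∧ φ' p = 0 ∧
      ∃ r > 0, φ'.target = Metric.ball 0 r ∧ ∀ y ∈ Metric.ball (0 : E4) r,
        y ∈ U ∧ Φ y ∈ φ.target ∧ Φ y ∈ W ∧ Function.Injective (fderiv ℝ Φ y) ∧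
        (∀ X : VField M, fderiv ℝ Φ y (fieldInChart X φ' y) = fieldInChart X φ (Φ y)) ∧
        ∀ u v, Coord.bilin (g.inChart φ' y) u v =
          Coord.bilin (g.inChart φ (Φ y)) (fderiv ℝ Φ y u) (fderiv ℝ Φ y v) := by
  have hU' : IsOpen (U ∩ Φ ⁻¹' (φ.target ∩ W)) :=
    hΦ.continuousOn.isOpen_inter_preimage hU (φ.open_target.inter hW)
  have h0' : (0 : E4) ∈ U ∩ Φ ⁻¹' (φ.target ∩ W) := ⟨h0, by rw [hp0]; exact φ.map_source hp, hW0⟩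
  have hd : HasFDerivAt Φ (fderiv ℝ Φ 0) 0 :=
    ((hΦ.differentiableOn (by simp)).differentiableAt (hU.mem_nhds h0)).hasFDerivAt
  obtain ⟨e, he0, heU, heΦ, hes, hes'⟩ := SmoothFlow.exists_smooth_local_inverse hU' h0'
    (hΦ.mono inter_subset_left)
    (LinearEquiv.ofInjectiveEndo (fderiv ℝ Φ 0 : E4 →ₗ[ℝ] E4) hinj).toContinuousLinearEquiv
    (hd.congr_fderiv (ContinuousLinearMap.ext fun _ => rfl))
  -- The chart is made to have a ball about zero as its target; convexity and stability under
  -- `projH` are needed later.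
  obtain ⟨r, hr, hball⟩ := Metric.isOpen_iff.1 e.open_source 0 he0
  have hesrc : (e.restr (Metric.ball 0 r)).source = Metric.ball 0 r := by
    rw [e.restr_source' _ Metric.isOpen_ball, inter_eq_right.2 hball]
  have hcoe : ((e.restr (Metric.ball 0 r)) : E4 → E4) = Φ := funext fun y => heΦ y
  have hs1 : ContDiffOn ℝ ∞ (e.restr (Metric.ball 0 r)) (e.restr (Metric.ball 0 r)).source := by
    rw [hesrc]; exact hes.mono hball
  have hs2 : ContDiffOn ℝ ∞ (e.restr (Metric.ball 0 r)).symm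
      (e.restr (Metric.ball 0 r)).target :=
    hes'.mono inter_subset_left
  generalize e.restr (Metric.ball 0 r) = e' at *
  have hmaps : ∀ y ∈ Metric.ball (0 : E4) r, Φ y ∈ φ.target ∩ e'.symm.source := fun y hy =>
    ⟨(heU (hball hy)).2.1, by rw [← hcoe]; exact e'.map_source (hesrc ▸ hy)⟩
  have hinv : ∀ y ∈ Metric.ball (0 : E4) r, e'.symm (Φ y) = y := fun y hy => by
    rw [← hcoe]; exact e'.left_inv (hesrc ▸ hy)
  have h1 : ContDiffOn ℝ ∞ e'.symm.symm e'.symm.target := by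
    rw [OpenPartialHomeomorph.symm_symm, OpenPartialHomeomorph.symm_target]; exact hs1
  have hmem0 : (0 : E4) ∈ Metric.ball (0 : E4) r := Metric.mem_ball_self hr
  refine ⟨φ.trans e'.symm, trans_mem_maximalAtlas hφ hs2 h1, ?_, ?_, r, hr, ?_, fun y hy => ?_⟩
  · rw [OpenPartialHomeomorph.trans_source]
    refine ⟨hp, ?_⟩
    rw [mem_preimage, ← hp0]
    exact (hmaps 0 hmem0).2
  · rw [OpenPartialHomeomorph.coe_trans, Function.comp_apply, ← hp0]
    exact hinv 0 hmem0
  · rw [OpenPartialHomeomorph.trans_target, OpenPartialHomeomorph.symm_target, hesrc,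
      OpenPartialHomeomorph.symm_symm, hcoe]
    exact inter_eq_left.2 fun y hy => (hmaps y hy).1
  · have k1 : ∀ v, fderiv ℝ Φ y (fderiv ℝ e'.symm (Φ y) v) = v := fun v => by
      have := Coord.fderiv_symm_comp_fderiv hs2 h1 (hmaps y hy).2 v
      rwa [hinv y hy, OpenPartialHomeomorph.symm_symm, hcoe] at this
    have k2 : ∀ v, fderiv ℝ e'.symm (Φ y) (fderiv ℝ Φ y v) = v := fun v => by
      have := Coord.fderiv_comp_fderiv_symm hs2 h1 (hmaps y hy).2 v
      rwa [hinv y hy, OpenPartialHomeomorph.symm_symm, hcoe] at this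
    refine ⟨(heU (hball hy)).1, (hmaps y hy).1, (heU (hball hy)).2.2,
      Function.LeftInverse.injective k2, fun X => ?_, fun u v => ?_⟩
    · have := fieldInChart_trans X hφ hs2 h1 (hmaps y hy)
      rw [hinv y hy] at this
      rw [this, k1]
    · have := bilin_inChart_trans g hφ hs2 h1 (hmaps y hy) (fderiv ℝ Φ y u) (fderiv ℝ Φ y v)
      rwa [hinv y hy, k2, k2] at this

/-! ## Adapted charts -/

theorem IsAbelianKillingAlgebra.exists_basis {g : PseudoMetric M} {𝒢 : Submodule ℝ (VField M)}
    (h : IsAbelianKillingAlgebra g 𝒢) {η : VField M} (hη : η ∈ 𝒢) (hη0 : η ≠ 0) :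
    ∃ ξ ∈ 𝒢, 𝒢 = Submodule.span ℝ {ξ, η} := by
  have hfin : FiniteDimensional ℝ 𝒢 := .of_finrank_pos (by rw [h.finrank_eq]; norm_num)
  obtain ⟨ξ, hξ, hξ'⟩ : ∃ ξ ∈ 𝒢, ξ ∉ Submodule.span ℝ {η} := by
    by_contra! hcon
    have h1 := Submodule.finrank_mono (R := ℝ) (s := 𝒢) (t := Submodule.span ℝ {η}) hcon
    have h2 := finrank_span_singleton (K := ℝ) hη0
    rw [h.finrank_eq, h2] at h1
    omega
  refine ⟨ξ, hξ, (Submodule.eq_of_le_of_finrank_eq ?_ ?_).symm⟩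
  · rw [Submodule.span_le]
    rintro _ (rfl | rfl)
    exacts [hξ, hη]
  · have h2 : LinearIndependent ℝ ![ξ, η] := by
      rw [LinearIndependent.pair_symm_iff, LinearIndependent.pair_iff' hη0]
      intro a ha
      exact hξ' (Submodule.mem_span_singleton.2 ⟨a, ha⟩)
    have h3 := finrank_span_eq_card h2
    rw [Matrix.range_cons_cons_empty] at h3
    rw [h3, h.finrank_eq, Fintype.card_fin]

omit [IsManifold (𝓡 4) ∞ M] in
theorem linearIndependent_of_leaf {ξ η : VField M} {p : M}
    (h : Module.finrank ℝ (leafSpace (Submodule.span ℝ {ξ, η}) p) = 2) :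
    LinearIndependent ℝ ![ξ p, η p] := by
  rw [leafSpace, Submodule.map_span, image_pair] at h
  rw [linearIndependent_iff_card_eq_finrank_span, Matrix.range_cons_cons_empty, Fintype.card_fin]
  exact h.symm

theorem exists_complement {v ξ η : E4} (h : LinearIndependent ℝ ![ξ, η])
    (hv : v ∉ Submodule.span ℝ {ξ, η}) : ∃ w, LinearIndependent ℝ ![v, w, ξ, η] := by
  have h3 : LinearIndependent ℝ ![v, ξ, η] := by
    refine linearIndependent_finCons.2 ⟨h, ?_⟩
    rwa [Matrix.range_cons_cons_empty]
  obtain ⟨w, hw⟩ : ∃ w, w ∉ Submodule.span ℝ (range ![v, ξ, η]) := by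
    by_contra! hcon
    have h1 := finrank_span_eq_card h3
    rw [Submodule.eq_top_iff'.2 hcon, finrank_top] at h1
    simp at h1
  refine ⟨w, ?_⟩
  have h4 : LinearIndependent ℝ ![w, v, ξ, η] := linearIndependent_finCons.2 ⟨h3, hw⟩
  have h5 := h4.comp (Equiv.swap (0 : Fin 4) 1) (Equiv.injective _)
  convert h5 using 1
  funext k
  fin_cases k <;> rfl

/-- Around every point there is a chart adapted to `𝒢`, with `∂_{z₂}` null. -/
theorem exists_adapted_chart {g : PseudoMetric M} {𝒢 : Submodule ℝ (VField M)} {X : VField M}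
    {Λ : ℝ} (H : IsCaseI g 𝒢 X Λ) {η : VField M} (hη : IsNullElement g 𝒢 η) (p : M) :
    ∃ φ ∈ IsManifold.maximalAtlas (𝓡 4) ∞ M, p ∈ φ.source ∧ φ p = 0 ∧ ∃ r > 0,
      φ.target = Metric.ball 0 r ∧ ∃ ξ : VField M, 𝒢 = Submodule.span ℝ {ξ, η} ∧
        (∀ y ∈ φ.target, fieldInChart ξ φ y = EuclideanSpace.single 2 1 ∧
          fieldInChart η φ y = EuclideanSpace.single 3 1) ∧
        0 < g.inChart φ 0 0 0 ∧ g.inChart φ 0 0 2 = 0 ∧ g.inChart φ 0 0 3 = 0 := by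
  obtain ⟨ξ, hξ, h𝒢⟩ := H.killingAlgebra.exists_basis hη.1 hη.2.1
  obtain ⟨φ, hφ, hp⟩ : ∃ φ ∈ IsManifold.maximalAtlas (𝓡 4) ∞ M, p ∈ φ.source :=
    ⟨chartAt E4 p, IsManifold.chart_mem_maximalAtlas _, mem_chart_source _ _⟩
  obtain ⟨y₀, hy₀, rfl⟩ : ∃ y ∈ φ.target, φ.symm y = p := ⟨φ p, φ.map_source hp, φ.left_inv hp⟩
  have sξ := (H.killingAlgebra.killing ξ hξ).1
  have sη := (H.killingAlgebra.killing η hη.1).1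
  have cξ := contDiffOn_fieldInChart sξ hφ
  have cη := contDiffOn_fieldInChart sη hφ
  -- Flowing along the commuting fields `ξ` and `η` straightens both at once.
  obtain ⟨δ, hδ, Ψ, hΨ, hΨU, hΨ0, hΨd⟩ := SmoothFlow.exists_commuting_flow φ.open_target cξ cη
    (fun y hy => by
      have h1 := fieldInChart_mlieBracket sξ sη isOpen_univ hφ hy (mem_univ _)
      rw [fieldInChart_eq, H.killingAlgebra.abelian ξ hξ η hη.1, map_zero] at h1
      exact (sub_eq_zero.1 h1.symm)) hy₀
  have hli : LinearIndependent ℝ ![fieldInChart ξ φ y₀, fieldInChart η φ y₀] := by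
    have h1 := linearIndependent_of_leaf (h𝒢 ▸ (H.nonNull (φ.symm y₀)).1)
    rw [LinearIndependent.pair_iff] at h1 ⊢
    intro a b hab
    refine h1 a b (comps_injective hφ hp ?_)
    rw [map_add, map_smul, map_smul, map_zero]
    exact hab
  -- A horizontal vector of positive length at `p`. It becomes `∂_{t₁}` at the origin and starts the
  -- orthogonalization, since in signature `(1, -1)` an arbitrary choice might be null or negative.
  obtain ⟨v, hv, hpos⟩ := H.orbitMetric (φ.symm y₀)
  have hvleaf : v ∉ leafSpace 𝒢 (φ.symm y₀) := fun hvl => by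
    have h1 := (H.nonNull _).2 v hvl fun w hw => by rw [g.symm]; exact hv w hw
    rw [h1] at hpos
    simp at hpos
  obtain ⟨w, hw⟩ := exists_complement (v := comps φ _ v) hli fun hmem => hvleaf (by
    obtain ⟨a, b, hab⟩ := Submodule.mem_span_pair.1 hmem
    rw [h𝒢, mem_leafSpace_span_pair]
    refine ⟨a, b, comps_injective hφ hp ?_⟩
    rw [map_add, map_smul, map_smul]
    exact hab)
  -- The parametrization starts at `y₀ + t₁ v + t₂ w` and follows the two flows for the times `z₁,
  -- z₂`.
  obtain ⟨A, hA⟩ : ∃ A : E4 →L[ℝ] (ℝ × ℝ) × E4, ∀ y : E4,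
      A y = ((y 2, y 3), y 0 • comps φ (φ.symm y₀) v + y 1 • w) :=
    ⟨((EuclideanSpace.proj 2 : E4 →L[ℝ] ℝ).prod (EuclideanSpace.proj 3 : E4 →L[ℝ] ℝ)).prod
      ((EuclideanSpace.proj 0 : E4 →L[ℝ] ℝ).smulRight (comps φ (φ.symm y₀) v) +
        (EuclideanSpace.proj 1 : E4 →L[ℝ] ℝ).smulRight w), fun y => by simp⟩
  have hAc : ContDiff ℝ ∞ fun y => (0, y₀) + A y := contDiff_const.add A.contDiff
  have hUo : IsOpen ((fun y => (0, y₀) + A y) ⁻¹' Metric.ball ((0 : ℝ × ℝ), y₀) δ) :=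
    Metric.isOpen_ball.preimage hAc.continuous
  have hΦ : ContDiffOn ℝ ∞ (fun y => Ψ ((0, y₀) + A y))
      ((fun y => (0, y₀) + A y) ⁻¹' Metric.ball ((0 : ℝ × ℝ), y₀) δ) :=
    hΨ.comp hAc.contDiffOn fun y hy => hy
  have hΨdiff : ∀ z ∈ Metric.ball ((0 : ℝ × ℝ), y₀) δ, HasFDerivAt Ψ (fderiv ℝ Ψ z) z :=
    fun z hz => ((hΨ.differentiableOn (by simp)).differentiableAt
      (Metric.isOpen_ball.mem_nhds hz)).hasFDerivAt
  have hΦd : ∀ y, (0, y₀) + A y ∈ Metric.ball ((0 : ℝ × ℝ), y₀) δ → ∀ u,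
      fderiv ℝ (fun y => Ψ ((0, y₀) + A y)) y u = fderiv ℝ Ψ ((0, y₀) + A y) (A u) :=
    fun y hy u => by
      have h1 : HasFDerivAt (fun y => Ψ ((0, y₀) + A y)) _ y :=
        (hΨdiff _ hy).comp y (A.hasFDerivAt.const_add (0, y₀))
      rw [h1.fderiv]
      rfl
  have hmem : ((0 : ℝ × ℝ), y₀) ∈ Metric.ball ((0 : ℝ × ℝ), y₀) δ := Metric.mem_ball_self hδ
  have h00 : (0, y₀) + A 0 = ((0 : ℝ × ℝ), y₀) := by rw [map_zero, add_zero]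
  have hΨx : ∀ u : E4, fderiv ℝ Ψ (0, y₀) (0, u) = u := by
    intro u
    have h1 : HasFDerivAt (fun x : E4 => Ψ ((0 : ℝ × ℝ), x)) _ y₀ :=
      (hΨdiff _ hmem).comp y₀ (hasFDerivAt_prodMk_right (0 : ℝ × ℝ) y₀)
    have h2 : (fun x : E4 => Ψ ((0 : ℝ × ℝ), x)) =ᶠ[𝓝 y₀] id := by
      have h3 : Continuous fun x : E4 => ((0 : ℝ × ℝ), x) := by fun_prop
      filter_upwards [(Metric.isOpen_ball.preimage h3).mem_nhds hmem] with x hx using hΨ0 x hx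
    have h3 := h2.fderiv_eq (𝕜 := ℝ)
    rw [h1.fderiv, fderiv_id] at h3
    exact congrArg (fun L => L u) h3
  have hD0 : ∀ u : E4, fderiv ℝ (fun y => Ψ ((0, y₀) + A y)) 0 u =
      u 0 • comps φ (φ.symm y₀) v + u 1 • w + u 2 • fieldInChart ξ φ y₀ +
        u 3 • fieldInChart η φ y₀ := by
    intro u
    rw [hΦd 0 (by rw [h00]; exact hmem), h00, hA]
    have h1 : (((u 2, u 3), u 0 • comps φ (φ.symm y₀) v + u 1 • w) : (ℝ × ℝ) × E4) =
        u 2 • (((1 : ℝ), (0 : ℝ)), (0 : E4)) + u 3 • (((0 : ℝ), (1 : ℝ)), (0 : E4)) + (0, u 0 • comps φ (φ.symm y₀) v + u 1 • w) := by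
      simp
    rw [h1, map_add, map_add, map_smul, map_smul, hΨx, (hΨd _ hmem).1, (hΨd _ hmem).2,
      hΨ0 _ hmem]
    abel
  have hinj : Function.Injective (fderiv ℝ (fun y => Ψ ((0, y₀) + A y)) 0) := by
    refine (injective_iff_map_eq_zero _).2 fun u hu => ?_
    rw [hD0] at hu
    have h1 := Fintype.linearIndependent_iff.1 hw (fun k : Fin 4 => u k) (by
      rw [Fin.sum_univ_four]; exact hu)
    exact PiLp.ext h1
  obtain ⟨φ', hφ', hpφ', hφ'0, r, hr, ht, hb⟩ := exists_chart_of_param g hφ hUo isOpen_univ hΦ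
    (by rw [mem_preimage, h00]; exact hmem) (mem_univ _) hp
    (by rw [h00, hΨ0 _ hmem, φ.right_inv hy₀]) hinj
  refine ⟨φ', hφ', hpφ', hφ'0, r, hr, ht, ξ, h𝒢, fun y hy => ?_, ?_⟩
  · obtain ⟨hyU, -, -, hi, hf, -⟩ := hb y (ht ▸ hy)
    constructor
    · refine hi ?_
      rw [hf, hΦd y hyU, ← (hΨd _ hyU).1, hA (EuclideanSpace.single 2 1)]
      simp
    · refine hi ?_
      rw [hf, hΦd y hyU, ← (hΨd _ hyU).2, hA (EuclideanSpace.single 3 1)]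
      simp
  · obtain ⟨-, -, -, -, -, hG⟩ := hb 0 (Metric.mem_ball_self hr)
    have e0 : fderiv ℝ (fun y => Ψ ((0, y₀) + A y)) 0 (EuclideanSpace.single 0 1) =
      comps φ (φ.symm y₀) v := by rw [hD0]; simp
    have e2 : fderiv ℝ (fun y => Ψ ((0, y₀) + A y)) 0 (EuclideanSpace.single 2 1) =
      comps φ (φ.symm y₀) (ξ _) := by rw [hD0, ← fieldInChart_eq]; simp
    have e3 : fderiv ℝ (fun y => Ψ ((0, y₀) + A y)) 0 (EuclideanSpace.single 3 1) =
      comps φ (φ.symm y₀) (η _) := by rw [hD0, ← fieldInChart_eq]; simp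
    have hb' : ∀ a b, g.form (φ.symm y₀) a b = Coord.bilin (g.inChart φ y₀)
      (comps φ (φ.symm y₀) a) (comps φ (φ.symm y₀) b) := form_eq_bilin g.form hφ hy₀
    simp only [← Coord.bilin_single (g.inChart φ' 0), hG, h00, hΨ0 _ hmem, e0, e2, e3, ← hb']
    exact ⟨hpos, by rw [g.symm]; exact hv _ ⟨ξ, hξ, rfl⟩, by rw [g.symm]; exact hv _ ⟨η, hη.1, rfl⟩⟩

end Soliton

namespace Soliton

/-! ## Functions independent of the last two coordinates -/

/-- The projection onto the plane of the first two coordinates. -/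
def projH : E4 →L[ℝ] E4 :=
  (EuclideanSpace.proj 0 : E4 →L[ℝ] ℝ).smulRight (EuclideanSpace.single 0 1) +
    (EuclideanSpace.proj 1 : E4 →L[ℝ] ℝ).smulRight (EuclideanSpace.single 1 1)

theorem projH_apply (y : E4) : projH y = !₂[y 0, y 1, 0, 0] := by
  refine PiLp.ext fun k => ?_
  fin_cases k <;> simp [projH]

theorem projH_projH (y : E4) : projH (projH y) = projH y := by simp [projH_apply]

theorem projH_single : projH (EuclideanSpace.single 2 1) = 0 ∧
    projH (EuclideanSpace.single 3 1) = 0 := by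
  constructor <;> refine PiLp.ext fun k => ?_ <;> fin_cases k <;> simp [projH]

theorem norm_projH_le (y : E4) : ‖projH y‖ ≤ ‖y‖ := by
  rw [EuclideanSpace.norm_eq, EuclideanSpace.norm_eq]
  refine Real.sqrt_le_sqrt ?_
  simp only [projH_apply, Fin.sum_univ_four]
  simp
  nlinarith [sq_nonneg (y 2), sq_nonneg (y 3)]

theorem projH_mem_ball {r : ℝ} {y : E4} (hy : y ∈ Metric.ball (0 : E4) r) :
    projH y ∈ Metric.ball (0 : E4) r := by
  rw [mem_ball_zero_iff] at hy ⊢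
  exact (norm_projH_le y).trans_lt hy

/-- A function on a ball with vanishing derivatives along the last two coordinates. -/
theorem eq_comp_projH {k : E4 → ℝ} {r : ℝ} (hk : DifferentiableOn ℝ k (Metric.ball 0 r))
    (h2 : ∀ y ∈ Metric.ball (0 : E4) r, Coord.pd 2 k y = 0)
    (h3 : ∀ y ∈ Metric.ball (0 : E4) r, Coord.pd 3 k y = 0) {y : E4}
    (hy : y ∈ Metric.ball (0 : E4) r) : k y = k (projH y) := by
  -- The projection does not increase the norm, so the vertical segment from `projH y` to `y` stays
  -- in the ball, and `k` is constant along it.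
  have hseg : ∀ t ∈ Icc (0 : ℝ) 1, projH y + t • (y - projH y) ∈ Metric.ball (0 : E4) r :=
    fun t ht => (convex_ball (0 : E4) r).add_smul_sub_mem (projH_mem_ball hy) hy ht
  have hd : ∀ t ∈ Icc (0 : ℝ) 1, HasDerivAt (fun t : ℝ => k (projH y + t • (y - projH y))) 0 t := by
    intro t ht
    have h4 := ((hk.differentiableAt (Metric.isOpen_ball.mem_nhds (hseg t ht))).hasFDerivAt).comp_hasDerivAt
      t (((hasDerivAt_id t).smul_const (y - projH y)).const_add (projH y))
    refine h4.congr_deriv ?_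
    rw [Coord.fderiv_apply_eq_sum_pd, Fin.sum_univ_four, h2 _ (hseg t ht), h3 _ (hseg t ht)]
    simp [projH_apply]
  have h5 := constant_of_has_deriv_right_zero
    (f := fun t : ℝ => k (projH y + t • (y - projH y)))
    (fun t ht => (hd t ht).continuousAt.continuousWithinAt)
    (fun t ht => (hd t (Ico_subset_Icc_self ht)).hasDerivWithinAt) 1 (by simp)
  simpa using h5

theorem fderiv_eq_comp_projH {F : Type*} [NormedAddCommGroup F] [NormedSpace ℝ F] {k : E4 → F}
    {r : ℝ} (hk : DifferentiableOn ℝ k (Metric.ball 0 r))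
    (h : ∀ y ∈ Metric.ball (0 : E4) r, k y = k (projH y)) {y : E4}
    (hy : y ∈ Metric.ball (0 : E4) r) (v : E4) :
    fderiv ℝ k y v = fderiv ℝ k (projH y) (projH v) := by
  have h1 : HasFDerivAt (fun y => k (projH y)) _ y :=
    ((hk.differentiableAt (Metric.isOpen_ball.mem_nhds (projH_mem_ball hy))).hasFDerivAt).comp y
      projH.hasFDerivAt
  have h2 : k =ᶠ[𝓝 y] fun y => k (projH y) :=
    mem_of_superset (Metric.isOpen_ball.mem_nhds hy) h
  rw [h2.fderiv_eq, h1.fderiv]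
  rfl

theorem fderiv_vertical_of_comp_projH {F : Type*} [NormedAddCommGroup F] [NormedSpace ℝ F]
    {k : E4 → F} {r : ℝ} (hk : DifferentiableOn ℝ k (Metric.ball 0 r))
    (h : ∀ y ∈ Metric.ball (0 : E4) r, k y = k (projH y)) {y : E4}
    (hy : y ∈ Metric.ball (0 : E4) r) : fderiv ℝ k y (EuclideanSpace.single 2 1) = 0 ∧
      fderiv ℝ k y (EuclideanSpace.single 3 1) = 0 := by
  rw [fderiv_eq_comp_projH hk h hy, fderiv_eq_comp_projH hk h hy, projH_single.1, projH_single.2,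
    map_zero]
  exact ⟨rfl, rfl⟩

theorem fderiv_projH {F : Type*} [NormedAddCommGroup F] [NormedSpace ℝ F]
    {k : E4 → F} {r : ℝ} (hk : DifferentiableOn ℝ k (Metric.ball 0 r))
    (h : ∀ y ∈ Metric.ball (0 : E4) r, k y = k (projH y)) {y : E4}
    (hy : y ∈ Metric.ball (0 : E4) r) (v : E4) : fderiv ℝ k y v = fderiv ℝ k (projH y) v := by
  rw [fderiv_eq_comp_projH hk h hy, fderiv_eq_comp_projH hk h (projH_mem_ball hy) v, projH_projH]

/-! ## Orthogonalization -/

/-- The null vectors tangent to the leaf. -/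
def leafFrame₂ (A : Matrix (Fin 4) (Fin 4) ℝ) : E4 :=
  EuclideanSpace.single 2 1 - (A 2 2 / (2 * A 2 3)) • EuclideanSpace.single 3 1

/-- The null vectors tangent to the leaf. -/
def leafFrame₃ (A : Matrix (Fin 4) (Fin 4) ℝ) : E4 := (A 2 3)⁻¹ • EuclideanSpace.single 3 1

/-- The component of `u` orthogonal to the leaf. -/
def horPart (A : Matrix (Fin 4) (Fin 4) ℝ) (u : E4) : E4 :=
  u - Coord.bilin A u (leafFrame₃ A) • leafFrame₂ A - Coord.bilin A u (leafFrame₂ A) • leafFrame₃ A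

/-- The component of `horPart A ∂₁` orthogonal to `horPart A ∂₀`, up to a factor. -/
def horPart₁ (A : Matrix (Fin 4) (Fin 4) ℝ) : E4 :=
  Coord.bilin A (horPart A (EuclideanSpace.single 0 1)) (horPart A (EuclideanSpace.single 0 1)) •
      horPart A (EuclideanSpace.single 1 1) -
    Coord.bilin A (horPart A (EuclideanSpace.single 1 1)) (horPart A (EuclideanSpace.single 0 1)) •
      horPart A (EuclideanSpace.single 0 1)

theorem bilin_eq_zero_of_single {A : Matrix (Fin 4) (Fin 4) ℝ} {a : E4}
    (h : ∀ k, Coord.bilin A a (EuclideanSpace.single k 1) = 0) (v : E4) :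
    Coord.bilin A a v = 0 := by
  have hv : v = ∑ k, v k • (EuclideanSpace.single k 1 : E4) := by
    refine PiLp.ext fun k => ?_
    simp [Pi.single_apply]
  rw [hv, map_sum]
  refine Finset.sum_eq_zero fun k _ => ?_
  rw [map_smul, h k, smul_zero]

section Pointwise

variable {A : Matrix (Fin 4) (Fin 4) ℝ} (hs : ∀ i j, A i j = A j i) (h33 : A 3 3 = 0)
  (h23 : A 2 3 ≠ 0)
include hs h33 h23

theorem bilin_leafFrame : Coord.bilin A (leafFrame₂ A) (leafFrame₂ A) = 0 ∧
    Coord.bilin A (leafFrame₂ A) (leafFrame₃ A) = 1 ∧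
    Coord.bilin A (leafFrame₃ A) (leafFrame₂ A) = 1 ∧
    Coord.bilin A (leafFrame₃ A) (leafFrame₃ A) = 0 := by
  simp only [leafFrame₂, leafFrame₃, map_sub, map_smul, _root_.sub_apply, _root_.smul_apply,
    Coord.bilin_single, smul_eq_mul, h33, hs 3 2]
  refine ⟨?_, ?_, ?_, ?_⟩ <;> field_simp <;> ring

theorem bilin_horPart (u : E4) : Coord.bilin A (horPart A u) (leafFrame₂ A) = 0 ∧
    Coord.bilin A (horPart A u) (leafFrame₃ A) = 0 ∧
    Coord.bilin A (leafFrame₂ A) (horPart A u) = 0 ∧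
    Coord.bilin A (leafFrame₃ A) (horPart A u) = 0 := by
  obtain ⟨h1, h2, h3, h4⟩ := bilin_leafFrame hs h33 h23
  have k1 : Coord.bilin A (horPart A u) (leafFrame₂ A) = 0 := by
    simp [horPart, h1, h3]
  have k2 : Coord.bilin A (horPart A u) (leafFrame₃ A) = 0 := by
    simp [horPart, h2, h4]
  exact ⟨k1, k2, by rw [Coord.bilin_symm hs, k1], by rw [Coord.bilin_symm hs, k2]⟩

theorem bilin_horPart₁ : Coord.bilin A (horPart₁ A) (leafFrame₂ A) = 0 ∧
    Coord.bilin A (horPart₁ A) (leafFrame₃ A) = 0 ∧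
    Coord.bilin A (leafFrame₂ A) (horPart₁ A) = 0 ∧
    Coord.bilin A (leafFrame₃ A) (horPart₁ A) = 0 ∧
    Coord.bilin A (horPart₁ A) (horPart A (EuclideanSpace.single 0 1)) = 0 ∧
    Coord.bilin A (horPart A (EuclideanSpace.single 0 1)) (horPart₁ A) = 0 := by
  have k := bilin_horPart hs h33 h23
  have k1 : Coord.bilin A (horPart₁ A) (leafFrame₂ A) = 0 := by simp [horPart₁, (k _).1]
  have k2 : Coord.bilin A (horPart₁ A) (leafFrame₃ A) = 0 := by simp [horPart₁, (k _).2.1]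
  have k3 : Coord.bilin A (horPart₁ A) (horPart A (EuclideanSpace.single 0 1)) = 0 := by
    simp [horPart₁]
    ring
  exact ⟨k1, k2, by rw [Coord.bilin_symm hs, k1], by rw [Coord.bilin_symm hs, k2], k3,
    by rw [Coord.bilin_symm hs, k3]⟩

/-- If `horPart₁ A` were null, it would be orthogonal to the leaf and to both horizontal parts,
hence to everything, and would vanish. But its component along the coordinate `1` is the squared
length of `horPart A ∂₀`, which is not zero. -/
theorem bilin_horPart₁_ne_zero (hA : IsUnit A.det)
    (h0 : Coord.bilin A (horPart A (EuclideanSpace.single 0 1))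
      (horPart A (EuclideanSpace.single 0 1)) ≠ 0) :
    Coord.bilin A (horPart₁ A) (horPart₁ A) ≠ 0 := by
  intro h1
  obtain ⟨k2, k3, -, -, k0, -⟩ := bilin_horPart₁ hs h33 h23
  have e3 : Coord.bilin A (horPart₁ A) (EuclideanSpace.single 3 1) = 0 := by
    have h : (EuclideanSpace.single 3 1 : E4) = A 2 3 • leafFrame₃ A := by
      rw [leafFrame₃, smul_smul, mul_inv_cancel₀ h23, one_smul]
    rw [h, map_smul, k3, smul_zero]
  have e2 : Coord.bilin A (horPart₁ A) (EuclideanSpace.single 2 1) = 0 := by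
    have h : (EuclideanSpace.single 2 1 : E4) =
        leafFrame₂ A + (A 2 2 / (2 * A 2 3)) • EuclideanSpace.single 3 1 := by
      rw [leafFrame₂, sub_add_cancel]
    rw [h, map_add, map_smul, k2, e3, smul_zero, add_zero]
  have e0 : Coord.bilin A (horPart₁ A) (EuclideanSpace.single 0 1) = 0 := by
    have := k0
    rw [horPart, map_sub, map_sub, map_smul, map_smul, k2, k3] at this
    simpa using this
  have e1 : Coord.bilin A (horPart₁ A) (EuclideanSpace.single 1 1) = 0 := by
    have h2 : Coord.bilin A (horPart₁ A) (horPart A (EuclideanSpace.single 1 1)) = 0 := by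
      have h5 : ∀ w, Coord.bilin A w (horPart₁ A) =
          Coord.bilin A (horPart A (EuclideanSpace.single 0 1))
            (horPart A (EuclideanSpace.single 0 1)) *
            Coord.bilin A w (horPart A (EuclideanSpace.single 1 1)) -
          Coord.bilin A (horPart A (EuclideanSpace.single 1 1))
            (horPart A (EuclideanSpace.single 0 1)) *
            Coord.bilin A w (horPart A (EuclideanSpace.single 0 1)) := fun w => by
        simp [horPart₁]
      have h6 := h5 (horPart₁ A)
      rw [h1, k0, mul_zero, sub_zero] at h6
      exact (mul_eq_zero.1 h6.symm).resolve_left h0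
    rw [horPart, map_sub, map_sub, map_smul, map_smul, k2, k3] at h2
    simpa using h2
  have hz := Coord.bilin_nondegenerate hA (bilin_eq_zero_of_single fun k => by
    fin_cases k
    exacts [e0, e1, e2, e3])
  have c2 : leafFrame₂ A 1 = 0 := by simp [leafFrame₂]
  have c3 : leafFrame₃ A 1 = 0 := by simp [leafFrame₃]
  have ch : ∀ u, horPart A u 1 = u 1 := fun u => by simp [horPart, c2, c3]
  have c1 : horPart₁ A 1 = Coord.bilin A (horPart A (EuclideanSpace.single 0 1))
      (horPart A (EuclideanSpace.single 0 1)) := by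
    rw [horPart₁, PiLp.sub_apply, PiLp.smul_apply, PiLp.smul_apply, ch, ch]
    simp
  rw [← c1, hz] at h0
  exact h0 rfl

end Pointwise

end Soliton

/-! ### An invariant pseudo-orthonormal frame. -/

namespace Soliton

/-- A pseudo-orthonormal frame of a metric independent of the last two coordinates. -/
theorem exists_orthonormal_frame {G : E4 → Matrix (Fin 4) (Fin 4) ℝ} {r : ℝ} (hr : 0 < r)
    (hG : Coord.IsMetricOn G (Metric.ball 0 r))
    (hinv : ∀ y ∈ Metric.ball (0 : E4) r, G y = G (projH y))
    (h33 : ∀ y ∈ Metric.ball (0 : E4) r, G y 3 3 = 0)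
    (h23 : ∀ y ∈ Metric.ball (0 : E4) r, G y 2 3 ≠ 0)
    (h00 : 0 < G 0 0 0) (h02 : G 0 0 2 = 0) (h03 : G 0 0 3 = 0) :
    ∃ r' > 0, r' ≤ r ∧ ∃ ε : ℝ, (ε = 1 ∨ ε = -1) ∧ ∃ E : Fin 4 → E4 → E4,
      (∀ a, ContDiffOn ℝ ∞ (E a) (Metric.ball 0 r')) ∧
      (∀ a, ∀ y ∈ Metric.ball (0 : E4) r', E a y = E a (projH y)) ∧
      (E 2 = fun y => EuclideanSpace.single 2 1 - (G y 2 2 / (2 * G y 2 3)) •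
        EuclideanSpace.single 3 1) ∧
      (E 3 = fun y => (G y 2 3)⁻¹ • EuclideanSpace.single 3 1) ∧
      ∀ y ∈ Metric.ball (0 : E4) r', ∀ a b, Coord.bilin (G y) (E a y) (E b y) =
        (!![1, 0, 0, 0; 0, ε, 0, 0; 0, 0, 0, 1; 0, 0, 1, 0] : Matrix (Fin 4) (Fin 4) ℝ) a b := by
  have s2 : ContDiffOn ℝ ∞ (fun y => leafFrame₂ (G y)) (Metric.ball 0 r) :=
    contDiffOn_const.sub (((hG.smooth 2 2).div (contDiffOn_const.mul (hG.smooth 2 3))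
      fun y hy => mul_ne_zero two_ne_zero (h23 y hy)).smul contDiffOn_const)
  have s3 : ContDiffOn ℝ ∞ (fun y => leafFrame₃ (G y)) (Metric.ball 0 r) :=
    ((hG.smooth 2 3).inv h23).smul contDiffOn_const
  have sB : ∀ {V W : E4 → E4}, ContDiffOn ℝ ∞ V (Metric.ball 0 r) →
      ContDiffOn ℝ ∞ W (Metric.ball 0 r) →
      ContDiffOn ℝ ∞ (fun y => Coord.bilin (G y) (V y) (W y)) (Metric.ball 0 r) :=
    fun hV hW => Coord.contDiffOn_bilin hG.smooth hV hW
  have sH : ∀ u, ContDiffOn ℝ ∞ (fun y => horPart (G y) u) (Metric.ball 0 r) := fun u =>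
    (contDiffOn_const.sub ((sB contDiffOn_const s3).smul s2)).sub
      ((sB contDiffOn_const s2).smul s3)
  have s1 : ContDiffOn ℝ ∞ (fun y => horPart₁ (G y)) (Metric.ball 0 r) :=
    ((sB (sH _) (sH _)).smul (sH _)).sub ((sB (sH _) (sH _)).smul (sH _))
  have sq0 := sB (sH (EuclideanSpace.single 0 1)) (sH (EuclideanSpace.single 0 1))
  have sq1 := sB s1 s1
  have hmem : (0 : E4) ∈ Metric.ball (0 : E4) r := Metric.mem_ball_self hr
  -- At the origin `∂₀` is already horizontal, so its horizontal part keeps its positive length, and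
  -- does so nearby.
  have hH0 : horPart (G 0) (EuclideanSpace.single 0 1) = EuclideanSpace.single 0 1 := by
    simp [horPart, leafFrame₂, leafFrame₃, Coord.bilin_single, h02, h03]
  have hq0 : 0 < Coord.bilin (G 0) (horPart (G 0) (EuclideanSpace.single 0 1))
      (horPart (G 0) (EuclideanSpace.single 0 1)) := by
    have h := Coord.bilin_single (G 0) 0 0
    rw [hH0]
    linarith
  have hq1 := bilin_horPart₁_ne_zero (A := G 0) (hG.symm 0 hmem) (h33 0 hmem) (h23 0 hmem) (hG.det 0 hmem)
    hq0.ne'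
  -- The sign `ε` is that of the second horizontal vector at the origin; on a smaller ball the sign
  -- cannot change.
  obtain ⟨ε, hε, hε1⟩ : ∃ ε : ℝ, (ε = 1 ∨ ε = -1) ∧
      0 < ε * Coord.bilin (G 0) (horPart₁ (G 0)) (horPart₁ (G 0)) := by
    rcases lt_or_gt_of_ne hq1 with h | h
    · exact ⟨-1, .inr rfl, by linarith⟩
    · exact ⟨1, .inl rfl, by linarith⟩
  have c0 := (sq0.continuousOn.continuousAt (Metric.isOpen_ball.mem_nhds hmem))
  have c1 := (sq1.continuousOn.continuousAt (Metric.isOpen_ball.mem_nhds hmem))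
  obtain ⟨r', hr', hball⟩ := Metric.eventually_nhds_iff_ball.1
    (((c0.eventually (lt_mem_nhds hq0)).and
      ((continuousAt_const.mul c1).eventually (lt_mem_nhds hε1))).and
      (Metric.isOpen_ball.mem_nhds hmem))
  have hsub : Metric.ball (0 : E4) (min r r') ⊆ Metric.ball 0 r :=
    Metric.ball_subset_ball (min_le_left _ _)
  have hpos : ∀ y ∈ Metric.ball (0 : E4) (min r r'),
      0 < Coord.bilin (G y) (horPart (G y) (EuclideanSpace.single 0 1))
        (horPart (G y) (EuclideanSpace.single 0 1)) ∧
      0 < ε * Coord.bilin (G y) (horPart₁ (G y)) (horPart₁ (G y)) := fun y hy =>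
    (hball y (Metric.ball_subset_ball (min_le_right _ _) hy)).1
  refine ⟨min r r', lt_min hr hr', min_le_left _ _, ε, hε,
    ![fun y => (Real.sqrt (Coord.bilin (G y) (horPart (G y) (EuclideanSpace.single 0 1))
        (horPart (G y) (EuclideanSpace.single 0 1))))⁻¹ •
          horPart (G y) (EuclideanSpace.single 0 1),
      fun y => (Real.sqrt (ε * Coord.bilin (G y) (horPart₁ (G y)) (horPart₁ (G y))))⁻¹ •
        horPart₁ (G y), fun y => leafFrame₂ (G y), fun y => leafFrame₃ (G y)],
    fun a => ?_, fun a y hy => ?_, rfl, rfl, fun y hy a b => ?_⟩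
  · fin_cases a
    · exact (((sq0.mono hsub).sqrt fun y hy => (hpos y hy).1.ne').inv fun y hy =>
        (Real.sqrt_pos.2 (hpos y hy).1).ne').smul ((sH _).mono hsub)
    · exact (((contDiffOn_const.mul (sq1.mono hsub)).sqrt fun y hy => (hpos y hy).2.ne').inv
        fun y hy => (Real.sqrt_pos.2 (hpos y hy).2).ne').smul (s1.mono hsub)
    · exact s2.mono hsub
    · exact s3.mono hsub
  -- Every frame vector is built from the matrix `G y` alone, so the frame inherits the invariance
  -- of the metric.
  · have h := hinv y (hsub hy)
    fin_cases a
    · exact congrArg (fun A => (Real.sqrt (Coord.bilin A (horPart A (EuclideanSpace.single 0 1))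
        (horPart A (EuclideanSpace.single 0 1))))⁻¹ • horPart A (EuclideanSpace.single 0 1)) h
    · exact congrArg (fun A => (Real.sqrt (ε * Coord.bilin A (horPart₁ A) (horPart₁ A)))⁻¹ •
        horPart₁ A) h
    · exact congrArg leafFrame₂ h
    · exact congrArg leafFrame₃ h
  · have hs := hG.symm y (hsub hy)
    have k33 := h33 y (hsub hy)
    have k23 := h23 y (hsub hy)
    obtain ⟨p1, p2⟩ := hpos y hy
    obtain ⟨a1, a2, a3, a4⟩ := bilin_leafFrame hs k33 k23
    obtain ⟨b1, b2, b3, b4⟩ := bilin_horPart hs k33 k23 (EuclideanSpace.single 0 1)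
    obtain ⟨d1, d2, d3, d4, d5, d6⟩ := bilin_horPart₁ hs k33 k23
    have n0 := Real.mul_self_sqrt p1.le
    have n1 := Real.mul_self_sqrt p2.le
    have m0 := (Real.sqrt_pos.2 p1).ne'
    have m1 := (Real.sqrt_pos.2 p2).ne'
    have hε2 : ε * ε = 1 := by rcases hε with h | h <;> simp [h]
    fin_cases a <;> fin_cases b <;>
      simp only [Fin.zero_eta, Fin.mk_one, Fin.reduceFinMk, Matrix.cons_val, map_smul,
        _root_.smul_apply, a1, a2, a3, a4, b1, b2, b3, b4, d1, d2, d3, d4, d5, d6, smul_zero,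
        Matrix.of_apply]
    · generalize Real.sqrt _ = s at *
      rw [← n0, smul_eq_mul, smul_eq_mul]
      field_simp
    · generalize hs : Real.sqrt (ε * _) = s at *
      have : Coord.bilin (G y) (horPart₁ (G y)) (horPart₁ (G y)) = ε * (s * s) := by
        rw [n1, ← mul_assoc, hε2, one_mul]
      rw [this, smul_eq_mul, smul_eq_mul]
      field_simp

variable {M : Type*} [TopologicalSpace M] [ChartedSpace E4 M] [IsManifold (𝓡 4) ∞ M]

/-- For a coordinate field the Killing equation says that the metric components do not depend on
that coordinate. -/
theorem inChart_eq_comp_projH {g : PseudoMetric M} {φ : OpenPartialHomeomorph M E4} {r : ℝ}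
    (hφ : φ ∈ IsManifold.maximalAtlas (𝓡 4) ∞ M) (ht : φ.target = Metric.ball 0 r)
    {ξ η : VField M} (hξ : IsKilling g ξ) (hη : IsKilling g η)
    (h₁ : ∀ y ∈ φ.target, fieldInChart ξ φ y = EuclideanSpace.single 2 1)
    (h₂ : ∀ y ∈ φ.target, fieldInChart η φ y = EuclideanSpace.single 3 1) {y : E4}
    (hy : y ∈ φ.target) : g.inChart φ y = g.inChart φ (projH y) := by
  have key : ∀ {ζ : VField M} {k : Fin 4}, IsKilling g ζ →
      (∀ y ∈ φ.target, fieldInChart ζ φ y = EuclideanSpace.single k 1) → ∀ y ∈ φ.target, ∀ i j,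
      Coord.pd k (fun z => g.inChart φ z i j) y = 0 := by
    intro ζ k hζ hk y hy i j
    have h := hζ.lieDerivMetric_eq_zero hφ hy i j
    have h1 : fieldInChart ζ φ =ᶠ[𝓝 y] fun _ => EuclideanSpace.single k 1 :=
      mem_of_superset (φ.open_target.mem_nhds hy) hk
    rw [Coord.lieDerivMetric_congr EventuallyEq.rfl h1] at h
    have h0 : ∀ i m, Coord.pd i (fun _ : E4 => (EuclideanSpace.single k (1 : ℝ) : E4) m) y = 0 :=
      fun i m => by simp [Coord.pd]
    simp only [Coord.lieDerivMetric, h0, mul_zero, add_zero] at h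
    simpa [Pi.single_apply] using h
  ext i j
  have hd : DifferentiableOn ℝ (fun z => g.inChart φ z i j) (Metric.ball 0 r) :=
    ht ▸ ((g.isMetricOn hφ).smooth i j).differentiableOn (by simp)
  exact eq_comp_projH hd (fun y hy => key hξ h₁ y (ht ▸ hy) i j)
    (fun y hy => key hη h₂ y (ht ▸ hy) i j) (ht ▸ hy)

end Soliton

/-! ### The null frame of a soliton of the first case. -/

namespace Soliton

/-- Since `e 2` and `e 3` are null and dual to each other, the coefficient of either one is the
inner product with the other. -/
theorem eq_sum_of_inner {A : Matrix (Fin 4) (Fin 4) ℝ} (hA : IsUnit A.det) {ε : ℝ}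
    (hε : ε * ε = 1) {e : Fin 4 → E4} (he : ∀ a b, Coord.bilin A (e a) (e b) =
      (!![1, 0, 0, 0; 0, ε, 0, 0; 0, 0, 0, 1; 0, 0, 1, 0] : Matrix (Fin 4) (Fin 4) ℝ) a b)
    (w : E4) : w = Coord.bilin A w (e 0) • e 0 + (ε * Coord.bilin A w (e 1)) • e 1 +
      Coord.bilin A w (e 3) • e 2 + Coord.bilin A w (e 2) • e 3 := by
  refine sub_eq_zero.1 (Coord.eq_zero_of_bilin_frame hA (linearIndependent_of_inner hε he)
    fun a => ?_)
  simp only [map_sub, map_add, map_smul, _root_.sub_apply, _root_.add_apply, _root_.smul_apply,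
    he, smul_eq_mul]
  fin_cases a <;> simp
  linear_combination (-Coord.bilin A w (e 1)) * hε

variable {M : Type*} [TopologicalSpace M] [ChartedSpace E4 M] [IsManifold (𝓡 4) ∞ M]

omit [IsManifold (𝓡 4) ∞ M] in
theorem TangentToLeaves.inChart {X ξ η : VField M} {φ : OpenPartialHomeomorph M E4}
    (h : TangentToLeaves (Submodule.span ℝ {ξ, η}) X)
    (hφ : φ ∈ IsManifold.maximalAtlas (𝓡 4) ∞ M)
    (hf : ∀ y ∈ φ.target, fieldInChart ξ φ y = EuclideanSpace.single 2 1 ∧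
      fieldInChart η φ y = EuclideanSpace.single 3 1) {y : E4} (hy : y ∈ φ.target) :
    fieldInChart X φ y 0 = 0 ∧ fieldInChart X φ y 1 = 0 :=
  (mem_leafSpace_iff hφ hy (hf y hy).1 (hf y hy).2 _).1 (h (φ.symm y))

/-- If a field tangent to the leaves is a symmetry of the horizontal distribution, its components
in an adapted chart are constant along the invariant horizontal fields. -/
theorem fderiv_fieldInChart_eq_zero {g : PseudoMetric M} {X ξ η : VField M}
    {φ : OpenPartialHomeomorph M E4} (hX : SmoothOn X univ)
    (hT : TangentToLeaves (Submodule.span ℝ {ξ, η}) X)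
    (hS : IsSymmetryOfHorizontal g (Submodule.span ℝ {ξ, η}) X)
    (hφ : φ ∈ IsManifold.maximalAtlas (𝓡 4) ∞ M)
    (hf : ∀ y ∈ φ.target, fieldInChart ξ φ y = EuclideanSpace.single 2 1 ∧
      fieldInChart η φ y = EuclideanSpace.single 3 1) {U : Set E4} (hU : IsOpen U)
    (hUφ : U ⊆ φ.target) {Y : E4 → E4} (hY : ContDiffOn ℝ ∞ Y U)
    (hYh : ∀ y ∈ U, Coord.bilin (g.inChart φ y) (EuclideanSpace.single 2 1) (Y y) = 0 ∧
      Coord.bilin (g.inChart φ y) (EuclideanSpace.single 3 1) (Y y) = 0) {y : E4} (hy : y ∈ U)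
    (hYv : fderiv ℝ Y y (EuclideanSpace.single 2 1) = 0 ∧
      fderiv ℝ Y y (EuclideanSpace.single 3 1) = 0)
    (h33 : g.inChart φ y 3 3 = 0) (h23 : g.inChart φ y 2 3 ≠ 0) :
    fderiv ℝ (fieldInChart X φ) y (Y y) = 0 := by
  have hyφ := hUφ hy
  have hV : IsOpen (φ.source ∩ φ ⁻¹' U) := φ.isOpen_inter_preimage hU
  have hyV : φ.symm y ∈ φ.source ∩ φ ⁻¹' U :=
    ⟨φ.map_target hyφ, by rw [mem_preimage, φ.right_inv hyφ]; exact hy⟩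
  have hYs : SmoothOn (fieldOf φ Y) (φ.source ∩ φ ⁻¹' U) := smoothOn_fieldOf hφ hU hY
  have sX := contDiffOn_fieldInChart hX hφ
  have tX := fun z hz => hT.inChart hφ hf (y := z) hz
  have h1 := hS _ _ hV hYs (fun q hq => by
    obtain ⟨z, hz, rfl⟩ : ∃ z ∈ U, φ.symm z = q := ⟨φ q, hq.2, φ.left_inv hq.1⟩
    rw [mem_horizontalSpace_iff g hφ (hUφ hz) (hf z (hUφ hz)).1 (hf z (hUφ hz)).2,
      ← fieldInChart_eq, fieldInChart_fieldOf hφ _ (hUφ hz)]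
    exact hYh z hz) _ hyV
  rw [mem_horizontalSpace_iff g hφ hyφ (hf y hyφ).1 (hf y hyφ).2, ← fieldInChart_eq,
    fieldInChart_mlieBracket (hX.mono (subset_univ _)) hYs hV hφ hyφ hyV,
    EventuallyEq.rfl.lieBracket_vectorField_eq (fieldInChart_fieldOf_eventuallyEq hφ _ hyφ),
    VectorField.lieBracket, eq_vertical (tX y hyφ).1 (tX y hyφ).2, map_add, map_smul, map_smul,
    hYv.1, hYv.2, smul_zero, smul_zero, add_zero, zero_sub, map_neg, map_neg, neg_eq_zero,
    neg_eq_zero] at h1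
  -- The bracket has become `-DX (Y)`: the other term vanishes because `Y` is invariant and `X`
  -- vertical. It is horizontal by the symmetry hypothesis and vertical because the first two
  -- components of `X` vanish identically. The leaves are not null, so it is zero.
  have d0 := IsNullFrameOn.fderiv_apply_eq_zero φ.open_target sX (fun z hz => (tX z hz).1) hyφ
  have d1 := IsNullFrameOn.fderiv_apply_eq_zero φ.open_target sX (fun z hz => (tX z hz).2) hyφ
  have e := eq_vertical (d0 (Y y)) (d1 (Y y))
  obtain ⟨q2, q3⟩ := h1
  rw [e, map_add, map_smul, map_smul, Coord.bilin_single, Coord.bilin_single, h33,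
    (g.isMetricOn hφ).symm y hyφ 3 2, smul_zero, add_zero, smul_eq_mul] at q3
  have z2 := (mul_eq_zero.1 q3).resolve_right h23
  rw [e, map_add, map_smul, map_smul, Coord.bilin_single, Coord.bilin_single, z2, zero_smul,
    zero_add, smul_eq_mul] at q2
  have z3 := (mul_eq_zero.1 q2).resolve_right h23
  rw [e, z2, z3, zero_smul, zero_smul, add_zero]

/-- Around every point there is a null frame in an adapted chart. -/
theorem IsCaseI.exists_nullFrame {g : PseudoMetric M} {𝒢 : Submodule ℝ (VField M)} {X : VField M}
    {Λ : ℝ} (H : IsCaseI g 𝒢 X Λ) (p : M) :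
    ∃ φ ∈ IsManifold.maximalAtlas (𝓡 4) ∞ M, p ∈ φ.source ∧ φ p = 0 ∧
      ∃ ξ η : VField M, 𝒢 = Submodule.span ℝ {ξ, η} ∧
      (∀ y ∈ φ.target, fieldInChart ξ φ y = EuclideanSpace.single 2 1 ∧
        fieldInChart η φ y = EuclideanSpace.single 3 1) ∧
      ∃ r > 0, Metric.ball 0 r ⊆ φ.target ∧ ∃ (ε : ℝ) (E : Fin 4 → E4 → E4)
        (h f r₁ r₂ l : E4 → ℝ), (ε = 1 ∨ ε = -1) ∧
        IsNullFrameOn (g.inChart φ) (Metric.ball 0 r) ε E h f r₁ r₂ l ∧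
        (∀ a, ∀ y ∈ Metric.ball (0 : E4) r, E a y = E a (projH y)) ∧
        (∀ y ∈ Metric.ball (0 : E4) r, l y ≠ 0) ∧
        ∀ y ∈ Metric.ball (0 : E4) r, ∀ a, a = 0 ∨ a = 1 →
          fderiv ℝ (fieldInChart X φ) y (E a y) = 0 := by
  obtain ⟨η, hη, hcη⟩ := H.nullElement
  obtain ⟨φ, hφ, hp, hp0, r, hr, ht, ξ, h𝒢, hf, k00, k02, k03⟩ := exists_adapted_chart H hη p
  subst h𝒢
  have hξ𝒢 : ξ ∈ Submodule.span ℝ {ξ, η} := Submodule.subset_span (mem_insert _ _)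
  have hGm := g.isMetricOn hφ
  have hGinv : ∀ y ∈ φ.target, g.inChart φ y = g.inChart φ (projH y) := fun y hy =>
    inChart_eq_comp_projH hφ ht (H.killingAlgebra.killing ξ hξ𝒢)
      (H.killingAlgebra.killing η hη.1) (fun y hy => (hf y hy).1) (fun y hy => (hf y hy).2) hy
  have h33 : ∀ y ∈ φ.target, g.inChart φ y 3 3 = 0 := fun y hy => by
    have h1 := hη.2.2 (φ.symm y)
    rw [form_eq_bilin g.form hφ hy, ← fieldInChart_eq, (hf y hy).2, Coord.bilin_single] at h1
    exact h1
  have hleaf := fun y hy => mem_leafSpace_iff hφ hy (hf y hy).1 (hf y hy).2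
  have hhor := fun y hy => mem_horizontalSpace_iff g hφ hy (hf y hy).1 (hf y hy).2
  -- Otherwise `∂_{z₂}`, being null, would be orthogonal to the whole leaf.
  have h23 : ∀ y ∈ φ.target, g.inChart φ y 2 3 ≠ 0 := fun y hy h0 => by
    have h1 := (H.nonNull (φ.symm y)).2 (vecOf φ y (EuclideanSpace.single 3 1))
      ((hleaf y hy _).2 (by rw [comps_vecOf hφ hy]; simp)) fun w hw => by
        have hw' := (hleaf y hy _).1 hw
        rw [form_eq_bilin g.form hφ hy, comps_vecOf hφ hy, eq_vertical hw'.1 hw'.2, map_add,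
          map_smul, map_smul, Coord.bilin_single, Coord.bilin_single]
        change _ • g.inChart φ y 3 2 + _ • g.inChart φ y 3 3 = 0
        rw [h33 y hy, hGm.symm y hy, h0, smul_zero, smul_zero, add_zero]
    have h2 := comps_vecOf hφ hy (EuclideanSpace.single 3 1)
    rw [h1, map_zero] at h2
    have h3 := congrArg (fun w : E4 => w 3) h2
    simp at h3
  obtain ⟨r', hr', hrr, ε, hε, E, sE, iE, hE2, hE3, hin⟩ := exists_orthonormal_frame hr
    (ht ▸ hGm) (ht ▸ hGinv) (ht ▸ h33) (ht ▸ h23) k00 k02 k03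
  have hε2 : ε * ε = 1 := by rcases hε with h | h <;> simp [h]
  have hsub : Metric.ball 0 r' ⊆ φ.target := ht ▸ Metric.ball_subset_ball hrr
  have hGm' := hGm.mono hsub
  have hsingle : ∀ y ∈ Metric.ball (0 : E4) r', (EuclideanSpace.single 3 1 : E4) =
      g.inChart φ y 2 3 • E 3 y ∧ (EuclideanSpace.single 2 1 : E4) = E 2 y +
      (g.inChart φ y 2 2 / (2 * g.inChart φ y 2 3)) • g.inChart φ y 2 3 • E 3 y := by
    intro y hy
    have h1 : (EuclideanSpace.single 3 1 : E4) = g.inChart φ y 2 3 • E 3 y := by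
      rw [hE3, smul_smul, mul_inv_cancel₀ (h23 y (hsub hy)), one_smul]
    exact ⟨h1, by rw [← h1, hE2, sub_add_cancel]⟩
  -- horizontal vectors
  have hhor' : ∀ y ∈ Metric.ball (0 : E4) r', ∀ v : TangentSpace (𝓡 4) (φ.symm y),
      Coord.bilin (g.inChart φ y) (E 2 y) (comps φ _ v) = 0 →
      Coord.bilin (g.inChart φ y) (E 3 y) (comps φ _ v) = 0 →
      v ∈ horizontalSpace g (Submodule.span ℝ {ξ, η}) (φ.symm y) := by
    intro y hy v h2 h3
    refine (hhor y (hsub hy) v).2 ⟨?_, ?_⟩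
    · rw [(hsingle y hy).2, map_add, map_smul, map_smul, _root_.add_apply, _root_.smul_apply,
        _root_.smul_apply, h2, h3, smul_zero, smul_zero, add_zero]
    · rw [(hsingle y hy).1, map_smul, _root_.smul_apply, h3, smul_zero]
  have hV : IsOpen (φ.source ∩ φ ⁻¹' Metric.ball (0 : E4) r') :=
    φ.isOpen_inter_preimage Metric.isOpen_ball
  have hVmem : ∀ y ∈ Metric.ball (0 : E4) r', φ.symm y ∈ φ.source ∩ φ ⁻¹' Metric.ball (0 : E4) r' :=
    fun y hy => ⟨φ.map_target (hsub hy), by rw [mem_preimage, φ.right_inv (hsub hy)]; exact hy⟩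
  have hVex : ∀ q ∈ φ.source ∩ φ ⁻¹' Metric.ball (0 : E4) r', ∃ y ∈ Metric.ball (0 : E4) r',
      φ.symm y = q := fun q hq => ⟨φ q, hq.2, φ.left_inv hq.1⟩
  have hYs : ∀ a, SmoothOn (fieldOf φ (E a)) (φ.source ∩ φ ⁻¹' Metric.ball (0 : E4) r') :=
    fun a => smoothOn_fieldOf hφ Metric.isOpen_ball (sE a)
  have hYc : ∀ a, ∀ y ∈ Metric.ball (0 : E4) r', fieldInChart (fieldOf φ (E a)) φ y = E a y :=
    fun a y hy => fieldInChart_fieldOf hφ _ (hsub hy)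
  have hYe : ∀ a, ∀ y ∈ Metric.ball (0 : E4) r',
      fieldInChart (fieldOf φ (E a)) φ =ᶠ[𝓝 y] E a := fun a y hy =>
    fieldInChart_fieldOf_eventuallyEq hφ _ (hsub hy)
  have hYh : ∀ a, a = 0 ∨ a = 1 → IsHorizontalOn g (Submodule.span ℝ {ξ, η}) (fieldOf φ (E a))
      (φ.source ∩ φ ⁻¹' Metric.ball (0 : E4) r') := by
    intro a ha q hq
    obtain ⟨y, hy, rfl⟩ := hVex q hq
    refine hhor' y hy _ ?_ ?_ <;> rw [← fieldInChart_eq, hYc a y hy, hin y hy] <;>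
      rcases ha with rfl | rfl <;> rfl
  -- the bracket
  have sB : ContDiffOn ℝ ∞ (VectorField.lieBracket ℝ (E 0) (E 1)) (Metric.ball 0 r') :=
    (((sE 1).fderiv_of_isOpen Metric.isOpen_ball (m := ∞) (by simp)).clm_apply (sE 0)).sub
      (((sE 0).fderiv_of_isOpen Metric.isOpen_ball (m := ∞) (by simp)).clm_apply (sE 1))
  have dE : ∀ a, DifferentiableOn ℝ (E a) (Metric.ball 0 r') := fun a =>
    (sE a).differentiableOn (by simp)
  have iB : ∀ y ∈ Metric.ball (0 : E4) r', VectorField.lieBracket ℝ (E 0) (E 1) y =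
      VectorField.lieBracket ℝ (E 0) (E 1) (projH y) := fun y hy => by
    rw [VectorField.lieBracket, VectorField.lieBracket, fderiv_projH (dE 0) (iE 0) hy,
      fderiv_projH (dE 1) (iE 1) hy, ← iE 0 y hy, ← iE 1 y hy]
  have hBeq : ∀ y ∈ Metric.ball (0 : E4) r', _ := fun y hy =>
    eq_sum_of_inner (hGm'.det y hy) hε2 (hin y hy) (VectorField.lieBracket ℝ (E 0) (E 1) y)
  have sBE : ∀ a, ContDiffOn ℝ ∞ (fun y => Coord.bilin (g.inChart φ y)
      (VectorField.lieBracket ℝ (E 0) (E 1) y) (E a y)) (Metric.ball 0 r') := fun a =>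
    Coord.contDiffOn_bilin hGm'.smooth sB (sE a)
  have iBE : ∀ a, ∀ y ∈ Metric.ball (0 : E4) r', Coord.bilin (g.inChart φ y)
      (VectorField.lieBracket ℝ (E 0) (E 1) y) (E a y) = Coord.bilin (g.inChart φ (projH y))
      (VectorField.lieBracket ℝ (E 0) (E 1) (projH y)) (E a (projH y)) := fun a y hy => by
    rw [← hGinv y (hsub hy), ← iB y hy, ← iE a y hy]
  -- The frame `E 0, E 1` has Gram determinant `ε`, so the curvature vector is the vertical part of
  -- the bracket without any rescaling.
  have hcurv : ∀ y ∈ Metric.ball (0 : E4) r',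
      IsCurvatureVector g (Submodule.span ℝ {ξ, η}) (φ.symm y) (vecOf φ y
        (Coord.bilin (g.inChart φ y) (VectorField.lieBracket ℝ (E 0) (E 1) y) (E 3 y) • E 2 y +
          Coord.bilin (g.inChart φ y) (VectorField.lieBracket ℝ (E 0) (E 1) y) (E 2 y) •
            E 3 y)) := by
    intro y hy
    refine ⟨_, fieldOf φ (E 0), fieldOf φ (E 1), vecOf φ y
      (Coord.bilin (g.inChart φ y) (VectorField.lieBracket ℝ (E 0) (E 1) y) (E 3 y) • E 2 y +
        Coord.bilin (g.inChart φ y) (VectorField.lieBracket ℝ (E 0) (E 1) y) (E 2 y) • E 3 y), hV, hVmem y hy, hYs 0, hYs 1,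
      hYh 0 (.inl rfl), hYh 1 (.inr rfl), fun q hq => ?_, ?_, ?_, ?_⟩
    · obtain ⟨z, hz, rfl⟩ := hVex q hq
      rw [LinearIndependent.pair_iff]
      intro a b hab
      have h1 := congrArg (comps φ (φ.symm z)) hab
      rw [map_add, map_smul, map_smul, map_zero, ← fieldInChart_eq, ← fieldInChart_eq,
        hYc 0 z hz, hYc 1 z hz] at h1
      have h2 := Fintype.linearIndependent_iff.1 (linearIndependent_of_inner hε2 (hin z hz))
        ![a, b, 0, 0] (by rw [Fin.sum_univ_four]; simpa using h1)
      exact ⟨h2 0, h2 1⟩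
    · rw [hleaf y (hsub hy), comps_vecOf hφ (hsub hy), hE2, hE3]
      simp
    · have h1 : comps φ (φ.symm y) (VectorField.mlieBracket (𝓡 4) (fieldOf φ (E 0))
          (fieldOf φ (E 1)) (φ.symm y)) = VectorField.lieBracket ℝ (E 0) (E 1) y := by
        rw [← fieldInChart_eq, fieldInChart_mlieBracket (hYs 0) (hYs 1) hV hφ (hsub hy)
          (hVmem y hy), (hYe 0 y hy).lieBracket_vectorField_eq (hYe 1 y hy)]
      refine hhor' y hy _ ?_ ?_
      · rw [map_sub, h1, comps_vecOf hφ (hsub hy), map_sub, map_add, map_smul, map_smul,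
          hin y hy, hin y hy, Coord.bilin_symm (hGm'.symm y hy) (E 2 y)]
        simp
      · rw [map_sub, h1, comps_vecOf hφ (hsub hy), map_sub, map_add, map_smul, map_smul,
          hin y hy, hin y hy, Coord.bilin_symm (hGm'.symm y hy) (E 3 y)]
        simp
    · have hgr : ∀ a b, g.form (φ.symm y) (fieldOf φ (E a) (φ.symm y))
          (fieldOf φ (E b) (φ.symm y)) = Coord.bilin (g.inChart φ y) (E a y) (E b y) :=
        fun a b => by
          rw [form_eq_bilin g.form hφ (hsub hy), ← fieldInChart_eq, ← fieldInChart_eq,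
            hYc a y hy, hYc b y hy]
          rfl
      rw [hgr, hgr, hgr, hgr, hin y hy, hin y hy, hin y hy, hin y hy]
      rcases hε with h | h <;> simp [h]
  -- With `C = a E₂ + b E₃`, nullity reads `2ab = 0`. As `E₃` is proportional to `η` and `C` is not,
  -- `a ≠ 0`, and hence `b = 0`.
  have hl : ∀ y ∈ Metric.ball (0 : E4) r',
      Coord.bilin (g.inChart φ y) (VectorField.lieBracket ℝ (E 0) (E 1) y) (E 3 y) ≠ 0 ∧
      Coord.bilin (g.inChart φ y) (VectorField.lieBracket ℝ (E 0) (E 1) y) (E 2 y) = 0 := by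
    intro y hy
    have h1 := H.nullCurvature _ _ (hcurv y hy)
    have h2 := hcη _ _ (hcurv y hy)
    rw [form_eq_bilin g.form hφ (hsub hy), comps_vecOf hφ (hsub hy)] at h1
    change Coord.bilin (g.inChart φ y) _ _ = 0 at h1
    simp only [map_add, map_smul, _root_.add_apply, _root_.smul_apply, hin y hy] at h1
    have h3 : Coord.bilin (g.inChart φ y) (VectorField.lieBracket ℝ (E 0) (E 1) y) (E 3 y) ≠ 0 := by
      intro h0
      refine h2 (Submodule.mem_span_singleton.2 ⟨Coord.bilin (g.inChart φ y)
        (VectorField.lieBracket ℝ (E 0) (E 1) y) (E 2 y) * (g.inChart φ y 2 3)⁻¹,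
        comps_injective hφ (φ.map_target (hsub hy)) ?_⟩)
      rw [comps_vecOf hφ (hsub hy), map_smul, ← fieldInChart_eq, (hf y (hsub hy)).2, h0, zero_smul,
        zero_add, mul_smul, hE3]
    refine ⟨h3, ?_⟩
    simp at h1
    have h4 : ∀ a b : ℝ, a * b + b * a = 0 → a ≠ 0 → b = 0 := fun a b hab ha => by
      have : a * b = 0 := by linarith
      exact (mul_eq_zero.1 this).resolve_left ha
    exact h4 _ _ h1 h3
  have vert : ∀ {k : E4 → ℝ}, ContDiffOn ℝ ∞ k (Metric.ball 0 r') →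
      (∀ y ∈ Metric.ball (0 : E4) r', k y = k (projH y)) → ∀ y ∈ Metric.ball (0 : E4) r',
      fderiv ℝ k y (EuclideanSpace.single 2 1) = 0 ∧
        fderiv ℝ k y (EuclideanSpace.single 3 1) = 0 := fun hk hi y hy =>
    fderiv_vertical_of_comp_projH (hk.differentiableOn (by simp)) hi hy
  have sf : ContDiffOn ℝ ∞ (fun y => g.inChart φ y 2 2 / (2 * g.inChart φ y 2 3))
      (Metric.ball 0 r') := (hGm'.smooth 2 2).div (contDiffOn_const.mul (hGm'.smooth 2 3))
    fun y hy => mul_ne_zero two_ne_zero (h23 y (hsub hy))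
  -- The functions `r₁, r₂, l` are the coefficients of the bracket, that is, its inner products with
  -- `E 0`, `E 1` (times `ε`) and `E 3`.
  refine ⟨φ, hφ, hp, hp0, ξ, η, rfl, hf, r', hr', hsub, ε, E, fun y => g.inChart φ y 2 3,
    fun y => g.inChart φ y 2 2 / (2 * g.inChart φ y 2 3), _, _, _, hε,
    ⟨Metric.isOpen_ball, hGm', hε2, sE, hGm'.smooth 2 3, sf, sBE 0,
      contDiffOn_const.mul (sBE 1), sBE 3, fun y hy => h23 y (hsub hy), hE2, hE3,
      fun y hy => fderiv_vertical_of_comp_projH (dE 0) (iE 0) hy,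
      fun y hy => fderiv_vertical_of_comp_projH (dE 1) (iE 1) hy,
      vert (hGm'.smooth 2 3) fun y hy => by rw [← hGinv y (hsub hy)],
      vert sf fun y hy => by rw [← hGinv y (hsub hy)], vert (sBE 0) (iBE 0),
      vert (contDiffOn_const.mul (sBE 1)) fun y hy => congrArg (ε * ·) (iBE 1 y hy),
      vert (sBE 3) (iBE 3), hin, fun y hy => ?_⟩, iE, fun y hy => (hl y hy).1,
    fun y hy a ha => ?_⟩
  · have h1 := hBeq y hy
    rw [(hl y hy).2, zero_smul, add_zero] at h1
    exact h1
  · refine fderiv_fieldInChart_eq_zero H.soliton.1 H.tangent H.symmetry hφ hf Metric.isOpen_ball hsub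
      (sE a) (fun z hz => ?_) hy (fderiv_vertical_of_comp_projH (dE a) (iE a) hy)
      (h33 y (hsub hy)) (h23 y (hsub hy))
    rw [(hsingle z hz).2, (hsingle z hz).1]
    rcases ha with rfl | rfl <;> simp [hin z hz]

end Soliton

namespace Soliton

/-! ## Coordinates for a null frame of constant curvature -/

/-- The first vector field of the prolonged system. Its variables are a point, a function `y` with
derivatives `p, q` along the frame, and the second coordinate `s`. -/
def prolongedField₁ (Λ ε l : ℝ) (E : Fin 4 → E4 → E4) (r₁ r₂ : E4 → ℝ)
    (z : E4 × ℝ × ℝ × ℝ × ℝ) : E4 × ℝ × ℝ × ℝ × ℝ :=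
  (z.2.2.1 • E 0 z.1 + (ε * z.2.2.2.1) • E 1 z.1 +
      (ε * l * (z.2.2.1 * z.2.2.1 + ε * (z.2.2.2.1 * z.2.2.2.1)) * z.2.2.2.2) • E 2 z.1,
    z.2.2.1 * z.2.2.1 + ε * (z.2.2.2.1 * z.2.2.2.1),
    -(ε * r₁ z.1 * (z.2.2.1 * z.2.2.2.1)) - Λ * z.2.1 * z.2.2.1 -
      ε * r₂ z.1 * (z.2.2.2.1 * z.2.2.2.1),
    r₁ z.1 * (z.2.2.1 * z.2.2.1) + r₂ z.1 * (z.2.2.1 * z.2.2.2.1) - Λ * z.2.1 * z.2.2.2.1, 0)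

/-- The second vector field of the prolonged system. -/
def prolongedField₂ (Λ ε : ℝ) (E : Fin 4 → E4 → E4) (r₁ r₂ : E4 → ℝ)
    (z : E4 × ℝ × ℝ × ℝ × ℝ) : E4 × ℝ × ℝ × ℝ × ℝ :=
  ((-(ε * z.2.2.2.1)) • E 0 z.1 + (ε * z.2.2.1) • E 1 z.1, 0,
    r₁ z.1 * (z.2.2.2.1 * z.2.2.2.1) + ε * Λ * z.2.1 * z.2.2.2.1 -
      ε * r₂ z.1 * (z.2.2.1 * z.2.2.2.1),
    -(ε * r₁ z.1 * (z.2.2.1 * z.2.2.2.1)) + r₂ z.1 * (z.2.2.1 * z.2.2.1) -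
      Λ * z.2.1 * z.2.2.1, 1)

section Smooth

variable {E : Fin 4 → E4 → E4} {r₁ r₂ : E4 → ℝ} {U : Set E4} (hE : ∀ a, ContDiffOn ℝ ∞ (E a) U)
  (h₁ : ContDiffOn ℝ ∞ r₁ U) (h₂ : ContDiffOn ℝ ∞ r₂ U)
include hE h₁ h₂

theorem contDiffOn_prolongedField (Λ ε l : ℝ) :
    ContDiffOn ℝ ∞ (prolongedField₁ Λ ε l E r₁ r₂) (Prod.fst ⁻¹' U) ∧
      ContDiffOn ℝ ∞ (prolongedField₂ Λ ε E r₁ r₂) (Prod.fst ⁻¹' U) := by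
  have hx : ∀ {F : Type} [NormedAddCommGroup F] [NormedSpace ℝ F] {k : E4 → F},
      ContDiffOn ℝ ∞ k U →
      ContDiffOn ℝ ∞ (fun z : E4 × ℝ × ℝ × ℝ × ℝ => k z.1) (Prod.fst ⁻¹' U) :=
    fun hk => hk.comp contDiff_fst.contDiffOn fun z hz => hz
  have e0 := hx (hE 0)
  have e1 := hx (hE 1)
  have e2 := hx (hE 2)
  have k1 := hx h₁
  have k2 := hx h₂
  have hy : ContDiffOn ℝ ∞ (fun z : E4 × ℝ × ℝ × ℝ × ℝ => z.2.1) (Prod.fst ⁻¹' U) :=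
    (contDiff_fst.comp contDiff_snd).contDiffOn
  have hp : ContDiffOn ℝ ∞ (fun z : E4 × ℝ × ℝ × ℝ × ℝ => z.2.2.1) (Prod.fst ⁻¹' U) :=
    (contDiff_fst.comp (contDiff_snd.comp contDiff_snd)).contDiffOn
  have hq : ContDiffOn ℝ ∞ (fun z : E4 × ℝ × ℝ × ℝ × ℝ => z.2.2.2.1) (Prod.fst ⁻¹' U) :=
    (contDiff_fst.comp (contDiff_snd.comp (contDiff_snd.comp contDiff_snd))).contDiffOn
  have hs : ContDiffOn ℝ ∞ (fun z : E4 × ℝ × ℝ × ℝ × ℝ => z.2.2.2.2) (Prod.fst ⁻¹' U) :=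
    (contDiff_snd.comp (contDiff_snd.comp (contDiff_snd.comp contDiff_snd))).contDiffOn
  have hc : ∀ c : ℝ, ContDiffOn ℝ ∞ (fun _ : E4 × ℝ × ℝ × ℝ × ℝ => c) (Prod.fst ⁻¹' U) :=
    fun c => contDiffOn_const
  have hN := (hp.mul hp).add ((hc ε).mul (hq.mul hq))
  exact ⟨(((hp.smul e0).add (((hc ε).mul hq).smul e1)).add
      (((((hc ε).mul (hc l)).mul hN).mul hs).smul e2)).prodMk (hN.prodMk
      ((((((hc ε).mul k1).mul (hp.mul hq)).neg.sub (((hc Λ).mul hy).mul hp)).sub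
        (((hc ε).mul k2).mul (hq.mul hq))).prodMk
      ((((k1.mul (hp.mul hp)).add (k2.mul (hp.mul hq))).sub
        (((hc Λ).mul hy).mul hq)).prodMk (hc 0)))),
    ((((hc ε).mul hq).neg.smul e0).add (((hc ε).mul hp).smul e1)).prodMk ((hc 0).prodMk
      ((((k1.mul (hq.mul hq)).add ((((hc ε).mul (hc Λ)).mul hy).mul hq)).sub
        (((hc ε).mul k2).mul (hp.mul hq))).prodMk
      (((((((hc ε).mul k1).mul (hp.mul hq)).neg).add (k2.mul (hp.mul hp))).sub
        (((hc Λ).mul hy).mul hp)).prodMk (hc 1))))⟩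

end Smooth

section Derivative

variable {E : Fin 4 → E4 → E4} {r₁ r₂ : E4 → ℝ} {z : E4 × ℝ × ℝ × ℝ × ℝ}
  (hE : ∀ a, DifferentiableAt ℝ (E a) z.1) (h₁ : DifferentiableAt ℝ r₁ z.1)
  (h₂ : DifferentiableAt ℝ r₂ z.1)
include hE h₁ h₂

theorem fderiv_prolongedField (Λ ε l : ℝ) (x : E4) (y p q s : ℝ) :
    fderiv ℝ (prolongedField₁ Λ ε l E r₁ r₂) z (x, y, p, q, s) =
    (p • E 0 z.1 + z.2.2.1 • fderiv ℝ (E 0) z.1 x + (ε * q) • E 1 z.1 +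
      (ε * z.2.2.2.1) • fderiv ℝ (E 1) z.1 x +
      (ε * l * (2 * (z.2.2.1 * p) + ε * (2 * (z.2.2.2.1 * q))) * z.2.2.2.2 +
        ε * l * (z.2.2.1 * z.2.2.1 + ε * (z.2.2.2.1 * z.2.2.2.1)) * s) • E 2 z.1 +
      (ε * l * (z.2.2.1 * z.2.2.1 + ε * (z.2.2.2.1 * z.2.2.2.1)) * z.2.2.2.2) •
        fderiv ℝ (E 2) z.1 x,
    2 * (z.2.2.1 * p) + ε * (2 * (z.2.2.2.1 * q)),
    -(ε * fderiv ℝ r₁ z.1 x * (z.2.2.1 * z.2.2.2.1)) -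
      ε * r₁ z.1 * (p * z.2.2.2.1 + z.2.2.1 * q) - Λ * (y * z.2.2.1 + z.2.1 * p) -
      ε * fderiv ℝ r₂ z.1 x * (z.2.2.2.1 * z.2.2.2.1) - ε * r₂ z.1 * (2 * (z.2.2.2.1 * q)),
    fderiv ℝ r₁ z.1 x * (z.2.2.1 * z.2.2.1) + r₁ z.1 * (2 * (z.2.2.1 * p)) +
      fderiv ℝ r₂ z.1 x * (z.2.2.1 * z.2.2.2.1) + r₂ z.1 * (p * z.2.2.2.1 + z.2.2.1 * q) -
      Λ * (y * z.2.2.2.1 + z.2.1 * q), 0) ∧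
    fderiv ℝ (prolongedField₂ Λ ε E r₁ r₂) z (x, y, p, q, s) =
    ((-(ε * q)) • E 0 z.1 + (-(ε * z.2.2.2.1)) • fderiv ℝ (E 0) z.1 x + (ε * p) • E 1 z.1 +
      (ε * z.2.2.1) • fderiv ℝ (E 1) z.1 x, 0,
    fderiv ℝ r₁ z.1 x * (z.2.2.2.1 * z.2.2.2.1) + r₁ z.1 * (2 * (z.2.2.2.1 * q)) +
      ε * Λ * (y * z.2.2.2.1 + z.2.1 * q) - ε * fderiv ℝ r₂ z.1 x * (z.2.2.1 * z.2.2.2.1) -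
      ε * r₂ z.1 * (p * z.2.2.2.1 + z.2.2.1 * q),
    -(ε * fderiv ℝ r₁ z.1 x * (z.2.2.1 * z.2.2.2.1)) -
      ε * r₁ z.1 * (p * z.2.2.2.1 + z.2.2.1 * q) + fderiv ℝ r₂ z.1 x * (z.2.2.1 * z.2.2.1) +
      r₂ z.1 * (2 * (z.2.2.1 * p)) - Λ * (y * z.2.2.1 + z.2.1 * p), 0) := by
  have hx : ∀ {F : Type} [NormedAddCommGroup F] [NormedSpace ℝ F] {k : E4 → F},
      DifferentiableAt ℝ k z.1 →
      HasFDerivAt (fun z : E4 × ℝ × ℝ × ℝ × ℝ => k z.1)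
        ((fderiv ℝ k z.1).comp (ContinuousLinearMap.fst ℝ E4 _)) z :=
    fun hk => hk.hasFDerivAt.comp z hasFDerivAt_fst
  have e0 := hx (hE 0)
  have e1 := hx (hE 1)
  have e2 := hx (hE 2)
  have k1 := hx h₁
  have k2 := hx h₂
  have hL : ∀ L : E4 × ℝ × ℝ × ℝ × ℝ →L[ℝ] ℝ, HasFDerivAt (fun z => L z) L z :=
    fun L => L.hasFDerivAt
  have hy : HasFDerivAt (fun z : E4 × ℝ × ℝ × ℝ × ℝ => z.2.1) _ z :=
    hL ((ContinuousLinearMap.fst ℝ ℝ _).comp (ContinuousLinearMap.snd ℝ E4 _))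
  have hp : HasFDerivAt (fun z : E4 × ℝ × ℝ × ℝ × ℝ => z.2.2.1) _ z :=
    hL ((ContinuousLinearMap.fst ℝ ℝ _).comp ((ContinuousLinearMap.snd ℝ ℝ _).comp
      (ContinuousLinearMap.snd ℝ E4 _)))
  have hq : HasFDerivAt (fun z : E4 × ℝ × ℝ × ℝ × ℝ => z.2.2.2.1) _ z :=
    hL ((ContinuousLinearMap.fst ℝ ℝ ℝ).comp ((ContinuousLinearMap.snd ℝ ℝ _).comp
      ((ContinuousLinearMap.snd ℝ ℝ _).comp (ContinuousLinearMap.snd ℝ E4 _))))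
  have hs : HasFDerivAt (fun z : E4 × ℝ × ℝ × ℝ × ℝ => z.2.2.2.2) _ z :=
    hL ((ContinuousLinearMap.snd ℝ ℝ ℝ).comp ((ContinuousLinearMap.snd ℝ ℝ _).comp
      ((ContinuousLinearMap.snd ℝ ℝ _).comp (ContinuousLinearMap.snd ℝ E4 _))))
  have hc : ∀ c : ℝ, HasFDerivAt (fun _ : E4 × ℝ × ℝ × ℝ × ℝ => c)
    (0 : E4 × ℝ × ℝ × ℝ × ℝ →L[ℝ] ℝ) z := fun c => hasFDerivAt_const c z
  have hN := (hp.mul hp).add ((hq.mul hq).const_mul ε)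
  have d1 : HasFDerivAt (prolongedField₁ Λ ε l E r₁ r₂) _ z :=
    (((hp.smul e0).add ((hq.const_mul ε).smul e1)).add
      (((hN.const_mul (ε * l)).mul hs).smul e2)).prodMk (hN.prodMk
      (((((k1.const_mul ε).mul (hp.mul hq)).fun_neg.sub ((hy.const_mul Λ).mul hp)).sub
        ((k2.const_mul ε).mul (hq.mul hq))).prodMk
      ((((k1.mul (hp.mul hp)).add (k2.mul (hp.mul hq))).sub
        ((hy.const_mul Λ).mul hq)).prodMk (hc 0))))
  have d2 : HasFDerivAt (prolongedField₂ Λ ε E r₁ r₂) _ z :=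
    ((((hq.const_mul ε).fun_neg).smul e0).add ((hp.const_mul ε).smul e1)).prodMk ((hc 0).prodMk
      ((((k1.mul (hq.mul hq)).add ((hy.const_mul (ε * Λ)).mul hq)).sub
        ((k2.const_mul ε).mul (hp.mul hq))).prodMk
      ((((((k1.const_mul ε).mul (hp.mul hq)).fun_neg).add (k2.mul (hp.mul hp))).sub
        ((hy.const_mul Λ).mul hp)).prodMk (hc 1))))
  rw [d1.fderiv, d2.fderiv]
  constructor
  · refine Prod.ext ?_ (Prod.ext ?_ (Prod.ext ?_ (Prod.ext ?_ ?_)))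
    · simp
      module
    · simp
      ring
    · simp
      ring
    · simp
      ring
    · simp
  · refine Prod.ext ?_ (Prod.ext ?_ (Prod.ext ?_ (Prod.ext ?_ ?_)))
    · simp
      module
    · simp
    · simp
      ring
    · simp
      ring
    · simp

end Derivative

/-- With `p, q` read as the derivatives of `y` along `E 0, E 1`, the first field lifts the gradient
of `y`, the second the rotated gradient, and the rates of `p` and `q` express `Hess y = -Λ y g̃`.
Curvature `Λ` is the integrability condition of that system. The bracket of the plain horizontal
lifts is `ε l₀ (p² + ε q²) E₂`, and the term of the first field proportional to `s` cancels it,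
because the second field advances `s` at unit rate and keeps `p² + ε q²` fixed. -/
theorem IsNullFrameOn.fderiv_prolongedField_comm {G : E4 → Matrix (Fin 4) (Fin 4) ℝ} {U : Set E4}
    {ε Λ l₀ : ℝ} {E : Fin 4 → E4 → E4} {h f r₁ r₂ l : E4 → ℝ}
    (H : IsNullFrameOn G U ε E h f r₁ r₂ l) {z : E4 × ℝ × ℝ × ℝ × ℝ} (hz : z.1 ∈ U)
    (hf : fderiv ℝ f z.1 = 0) (hl : l z.1 = l₀)
    (hK : fderiv ℝ r₂ z.1 (E 0 z.1) - ε * fderiv ℝ r₁ z.1 (E 1 z.1) - ε * r₁ z.1 ^ 2 - r₂ z.1 ^ 2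
      = Λ) :
    fderiv ℝ (prolongedField₂ Λ ε E r₁ r₂) z (prolongedField₁ Λ ε l₀ E r₁ r₂ z) =
      fderiv ℝ (prolongedField₁ Λ ε l₀ E r₁ r₂) z (prolongedField₂ Λ ε E r₁ r₂ z) := by
  obtain ⟨dE, -, -, d1, d2, -⟩ := H.differentiableAt hz
  have hb := H.bracket _ hz
  have e2 : ∀ v, fderiv ℝ (E 2) z.1 v = 0 := fun v => by rw [H.fderiv_E₂ hz, hf]; simp
  have v0 := (H.fderiv_vertical (H.inv_E₀ _ hz)).1
  have v1 := (H.fderiv_vertical (H.inv_E₁ _ hz)).1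
  have w1 := (H.fderiv_vertical (H.inv_r₁ _ hz)).1
  have w2 := (H.fderiv_vertical (H.inv_r₂ _ hz)).1
  rw [VectorField.lieBracket_eq, hl] at hb
  -- The bracket relation and the curvature equation eliminate one mixed derivative each; what
  -- remains is algebra in `p, q, y, s`, for either sign of `ε`.
  have hb' := sub_eq_iff_eq_add.1 hb
  have hK' : fderiv ℝ r₂ z.1 (E 0 z.1) =
      Λ + ε * fderiv ℝ r₁ z.1 (E 1 z.1) + ε * r₁ z.1 ^ 2 + r₂ z.1 ^ 2 := by linarith
  conv_lhs => rw [prolongedField₁, (fderiv_prolongedField dE d1 d2 Λ ε l₀ _ _ _ _ _).2]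
  conv_rhs => rw [prolongedField₂, (fderiv_prolongedField dE d1 d2 Λ ε l₀ _ _ _ _ _).1]
  simp only [map_add, map_smul, e2, v0, v1, w1, w2, hb', hK', smul_eq_mul]
  have hε := H.eps
  rcases mul_self_eq_one_iff.1 hε with rfl | rfl
  all_goals
    refine Prod.ext ?_ (Prod.ext ?_ (Prod.ext ?_ (Prod.ext ?_ ?_)))
    · simp only
      module
    · simp only
      ring
    · simp only
      ring
    · simp only
      ring
    · simp

end Soliton

/-- Two commuting fields are, on a surface through any given point, the partial derivatives of a
parametrization of that surface. -/
theorem SmoothFlow.exists_commuting_surface {Z : Type*} [NormedAddCommGroup Z] [NormedSpace ℝ Z]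
    [FiniteDimensional ℝ Z] {U : Set Z} {X Y : Z → Z} (hU : IsOpen U) (hX : ContDiffOn ℝ ∞ X U)
    (hY : ContDiffOn ℝ ∞ Y U) (hXY : ∀ x ∈ U, fderiv ℝ Y x (X x) = fderiv ℝ X x (Y x)) {p : Z}
    (hp : p ∈ U) : ∃ δ > 0, ∃ σ : E2 → Z, ContDiffOn ℝ ∞ σ (Metric.ball 0 δ) ∧ σ 0 = p ∧
      ∀ t ∈ Metric.ball (0 : E2) δ, σ t ∈ U ∧
        fderiv ℝ σ t (EuclideanSpace.single 0 1) = X (σ t) ∧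
        fderiv ℝ σ t (EuclideanSpace.single 1 1) = Y (σ t) := by
  obtain ⟨δ, hδ, Ψ, h1, h2, h3, h4⟩ := SmoothFlow.exists_commuting_flow hU hX hY hXY hp
  let L : E2 →L[ℝ] ℝ × ℝ := (EuclideanSpace.proj 0).prod (EuclideanSpace.proj 1)
  have hι : ∀ t, HasFDerivAt (fun t => (L t, p)) (L.prod (0 : E2 →L[ℝ] Z)) t := fun t =>
    L.hasFDerivAt.prodMk (hasFDerivAt_const p t)
  have hιs : ContDiff ℝ ∞ fun t => (L t, p) := L.contDiff.prodMk contDiff_const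
  obtain ⟨δ', hδ', hsub⟩ := Metric.isOpen_iff.1 (Metric.isOpen_ball.preimage hιs.continuous)
    (0 : E2) (show (L 0, p) ∈ Metric.ball (0, p) δ by rw [map_zero]; exact Metric.mem_ball_self hδ)
  have hd : ∀ t ∈ Metric.ball (0 : E2) δ', HasFDerivAt (fun t => Ψ (L t, p))
      ((fderiv ℝ Ψ (L t, p)).comp (L.prod 0)) t := fun t ht =>
    HasFDerivAt.comp t ((h1.differentiableOn (by simp)).differentiableAt
      (Metric.isOpen_ball.mem_nhds (hsub ht))).hasFDerivAt (hι t)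
  refine ⟨δ', hδ', fun t => Ψ (L t, p), h1.comp hιs.contDiffOn hsub, ?_, fun t ht =>
    ⟨h2 _ (hsub ht), ?_, ?_⟩⟩
  · simp only [map_zero]
    exact h3 p (Metric.mem_ball_self hδ)
  · rw [(hd t ht).fderiv, ← (h4 _ (hsub ht)).1]
    simp [L]
  · rw [(hd t ht).fderiv, ← (h4 _ (hsub ht)).2]
    simp [L]

namespace Soliton

theorem eq_of_partials_eq {δ : ℝ} {k₁ k₂ : E2 → ℝ}
    (h₁ : DifferentiableOn ℝ k₁ (Metric.ball 0 δ)) (h₂ : DifferentiableOn ℝ k₂ (Metric.ball 0 δ))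
    (h0 : k₁ 0 = k₂ 0) (hd : ∀ t ∈ Metric.ball (0 : E2) δ, ∀ i,
      fderiv ℝ k₁ t (EuclideanSpace.single i 1) = fderiv ℝ k₂ t (EuclideanSpace.single i 1))
    {t : E2} (ht : t ∈ Metric.ball (0 : E2) δ) : k₁ t = k₂ t := by
  refine Metric.isOpen_ball.eqOn_of_fderiv_eq (convex_ball (0 : E2) δ).isPreconnected h₁ h₂
    (fun s hs => ContinuousLinearMap.ext fun v => ?_)
    (Metric.mem_ball_self (Metric.pos_of_mem_ball ht)) h0 ht
  have hv : v = v 0 • (EuclideanSpace.single 0 1 : E2) + v 1 • EuclideanSpace.single 1 1 := by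
    refine PiLp.ext fun k => ?_
    fin_cases k <;> simp
  rw [hv]
  simp only [map_add, map_smul, hd s hs]

/-- Local coordinates `t₁, t₂` for a null frame of constant curvature. The functions `p, q` are the
components of the coordinate fields with respect to the frame. -/
theorem IsNullFrameOn.exists_isothermal {G : E4 → Matrix (Fin 4) (Fin 4) ℝ} {r ε Λ f₀ l₀ : ℝ}
    {E : Fin 4 → E4 → E4} {h f r₁ r₂ l : E4 → ℝ} (hr : 0 < r)
    (H : IsNullFrameOn G (Metric.ball 0 r) ε E h f r₁ r₂ l)
    (hf : ∀ y ∈ Metric.ball (0 : E4) r, f y = f₀) (hl : ∀ y ∈ Metric.ball (0 : E4) r, l y = l₀)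
    (hK : ∀ y ∈ Metric.ball (0 : E4) r,
      fderiv ℝ r₂ y (E 0 y) - ε * fderiv ℝ r₁ y (E 1 y) - ε * r₁ y ^ 2 - r₂ y ^ 2 = Λ) :
    ∃ δ > 0, ∃ (x : E2 → E4) (p q P F : E2 → ℝ), ContDiffOn ℝ ∞ x (Metric.ball 0 δ) ∧ x 0 = 0 ∧
      IsLiouvillePair Λ ε (Metric.ball 0 δ) P F ∧
      ∀ t ∈ Metric.ball (0 : E2) δ, x t ∈ Metric.ball (0 : E4) r ∧
        Real.exp (-2 * P t) = p t * p t + ε * (q t * q t) ∧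
        fderiv ℝ x t (EuclideanSpace.single 0 1) =
          p t • E 0 (x t) + (ε * q t) • E 1 (x t) + (ε * l₀ * F t) • E 2 (x t) ∧
        fderiv ℝ x t (EuclideanSpace.single 1 1) =
          (-(ε * q t)) • E 0 (x t) + (ε * p t) • E 1 (x t) := by
  have hS := contDiffOn_prolongedField H.smooth_E H.smooth_r₁ H.smooth_r₂ Λ ε l₀
  have hf0 : ∀ y ∈ Metric.ball (0 : E4) r, fderiv ℝ f y = 0 := fun y hy =>
    ((hasFDerivAt_const f₀ y).congr_of_eventuallyEq
      (mem_of_superset (Metric.isOpen_ball.mem_nhds hy) hf)).fderiv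
  -- The surface starts at `y = 0`, `s = 0` with `p = 1`, `q = 0`, so that the conformal factor `N`
  -- equals one at the origin and stays positive nearby, also for `ε = -1`.
  obtain ⟨δ₁, hδ₁, σ, sσ, hσ0, hσ⟩ := SmoothFlow.exists_commuting_surface
    (Metric.isOpen_ball.preimage continuous_fst) hS.1 hS.2
    (fun z hz => H.fderiv_prolongedField_comm hz (hf0 _ hz) (hl _ hz) (hK _ hz))
    (p := ((0 : E4), (0 : ℝ), (1 : ℝ), (0 : ℝ), (0 : ℝ))) (Metric.mem_ball_self hr)
  set N : E2 → ℝ := fun t => (σ t).2.2.1 * (σ t).2.2.1 + ε * ((σ t).2.2.2.1 * (σ t).2.2.2.1)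
    with hN
  have sx := sσ.fst
  have sy := sσ.snd.fst
  have sp := sσ.snd.snd.fst
  have sq := sσ.snd.snd.snd.fst
  have ss := sσ.snd.snd.snd.snd
  have sN : ContDiffOn ℝ ∞ N (Metric.ball 0 δ₁) :=
    (sp.mul sp).add (contDiffOn_const.mul (sq.mul sq))
  obtain ⟨δ, hδ, hsub⟩ := Metric.isOpen_iff.1
    (sN.continuousOn.isOpen_inter_preimage Metric.isOpen_ball isOpen_Ioi)
    (0 : E2) (show (0 : E2) ∈ Metric.ball (0 : E2) δ₁ ∩ N ⁻¹' Ioi 0 from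
      ⟨Metric.mem_ball_self hδ₁, by simp [hN, hσ0]⟩)
  have hs1 : Metric.ball 0 δ ⊆ Metric.ball (0 : E2) δ₁ := fun t ht => (hsub ht).1
  have hpos : ∀ t ∈ Metric.ball (0 : E2) δ, 0 < N t := fun t ht => (hsub ht).2
  have hd : ∀ t ∈ Metric.ball (0 : E2) δ, HasFDerivAt σ (fderiv ℝ σ t) t := fun t ht =>
    ((sσ.differentiableOn (by simp)).differentiableAt
      (Metric.isOpen_ball.mem_nhds (hs1 ht))).hasFDerivAt
  have dx := fun t ht => (hd t ht).fst
  have dy := fun t ht => (hd t ht).snd.fst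
  have dp := fun t ht => (hd t ht).snd.snd.fst
  have dq := fun t ht => (hd t ht).snd.snd.snd.fst
  have ds := fun t ht => (hd t ht).snd.snd.snd.snd
  -- Along the gradient of `y`, the squared length `N` of the gradient changes by `-2 Λ y N`; the
  -- rotated gradient is a Killing field and preserves it.
  have dN : ∀ t ∈ Metric.ball (0 : E2) δ,
      DifferentiableAt ℝ N t ∧
      fderiv ℝ N t (EuclideanSpace.single 0 1) = -2 * Λ * (σ t).2.1 * N t ∧
      fderiv ℝ N t (EuclideanSpace.single 1 1) = 0 := fun t ht => by
    have h1 : HasFDerivAt N _ t :=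
      ((dp t ht).mul (dp t ht)).add (((dq t ht).mul (dq t ht)).const_mul ε)
    refine ⟨h1.differentiableAt, ?_, ?_⟩
    · rw [h1.fderiv]
      simp [(hσ t (hs1 ht)).2.1, prolongedField₁, hN]
      ring
    · rw [h1.fderiv]
      simp [(hσ t (hs1 ht)).2.2, prolongedField₂]
      rcases mul_self_eq_one_iff.1 H.eps with h | h <;> rw [h] <;> ring
  -- The auxiliary variable `s` is the second coordinate itself.
  have hs : ∀ t ∈ Metric.ball (0 : E2) δ, (σ t).2.2.2.2 = t 1 := fun t ht => by
    refine eq_of_partials_eq (k₂ := fun t => t 1)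
      (fun t ht => (ds t ht).differentiableAt.differentiableWithinAt)
      (EuclideanSpace.proj (1 : Fin 2) : E2 →L[ℝ] ℝ).differentiable.differentiableOn
      (by simp [hσ0]) (fun t ht i => ?_) ht
    have h1 : fderiv ℝ (fun t : E2 => t 1) t = EuclideanSpace.proj (1 : Fin 2) :=
      (EuclideanSpace.proj (1 : Fin 2) : E2 →L[ℝ] ℝ).fderiv
    rw [(ds t ht).fderiv, h1]
    fin_cases i
    · simp [(hσ t (hs1 ht)).2.1, prolongedField₁]
    · simp [(hσ t (hs1 ht)).2.2, prolongedField₂]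
  have hexp : ∀ t ∈ Metric.ball (0 : E2) δ, Real.exp (-2 * (-(1 / 2) * Real.log (N t))) = N t :=
    fun t ht => by
      rw [show -2 * (-(1 / 2) * Real.log (N t)) = Real.log (N t) by ring, Real.exp_log (hpos t ht)]
  -- With `P = -(1/2) log N` one gets `P_{,t₁} = Λ y`. Since `y_{,t₁} = N = e^{-2P}` and `P` does
  -- not depend on `t₂`, the Liouville equation follows, and `t₂ N` is an antiderivative of
  -- `e^{-2P}`.
  have dP : ∀ t ∈ Metric.ball (0 : E2) δ,
      Coord.pd 0 (fun t => -(1 / 2) * Real.log (N t)) t = Λ * (σ t).2.1 ∧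
      Coord.pd 1 (fun t => -(1 / 2) * Real.log (N t)) t = 0 := fun t ht => by
    have h1 := ((dN t ht).1.hasFDerivAt.log (hpos t ht).ne').const_mul (-(1 / 2))
    have h2 := (hpos t ht).ne'
    rw [Coord.pd, Coord.pd, h1.fderiv]
    simp only [_root_.smul_apply, (dN t ht).2.1, (dN t ht).2.2, smul_eq_mul, mul_zero, and_true]
    field_simp
  refine ⟨δ, hδ, fun t => (σ t).1, fun t => (σ t).2.2.1, fun t => (σ t).2.2.2.1,
    fun t => -(1 / 2) * Real.log (N t), fun t => t 1 * N t, sx.mono hs1, by simp [hσ0],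
    ⟨contDiffOn_const.mul ((sN.mono hs1).log fun t ht => (hpos t ht).ne'),
      (EuclideanSpace.proj (1 : Fin 2) : E2 →L[ℝ] ℝ).contDiff.contDiffOn.mul (sN.mono hs1),
      fun t ht => ?_, fun t ht => ?_⟩, fun t ht => ⟨(hσ t (hs1 ht)).1, hexp t ht, ?_, ?_⟩⟩
  · have h1 : HasFDerivAt (fun t : E2 => t 1 * N t) _ t :=
      (EuclideanSpace.proj (1 : Fin 2) : E2 →L[ℝ] ℝ).hasFDerivAt.mul (dN t ht).1.hasFDerivAt
    rw [Coord.pd, h1.fderiv, hexp t ht]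
    simp [(dN t ht).2.2]
  · have hev : ∀ {k₁ k₂ : E2 → ℝ}, (∀ t ∈ Metric.ball (0 : E2) δ, k₁ t = k₂ t) →
        fderiv ℝ k₁ t = fderiv ℝ k₂ t := fun hk =>
      Filter.EventuallyEq.fderiv_eq (mem_of_superset (Metric.isOpen_ball.mem_nhds ht) hk)
    rw [hexp t ht, Coord.pd, Coord.pd, hev fun t ht => (dP t ht).1, hev fun t ht => (dP t ht).2,
      ((dy t ht).const_mul Λ).fderiv]
    simp [(hσ t (hs1 ht)).2.1, prolongedField₁, hN]
  · rw [(dx t ht).fderiv]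
    simp only [ContinuousLinearMap.comp_apply, (hσ t (hs1 ht)).2.1, prolongedField₁,
      ContinuousLinearMap.coe_fst', hs t ht, hN]
    congr 2
    ring
  · rw [(dx t ht).fderiv]
    simp only [ContinuousLinearMap.comp_apply, (hσ t (hs1 ht)).2.2, prolongedField₂,
      ContinuousLinearMap.coe_fst']

end Soliton

/-! ### Normal coordinates for the metric. -/

namespace Soliton

/-- A null frame of constant curvature with constant functions `h, f, l` defines coordinates in
which the metric has the normal form. -/
theorem IsNullFrameOn.exists_normal_param {G : E4 → Matrix (Fin 4) (Fin 4) ℝ}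
    {r ε Λ h₀ f₀ l₀ : ℝ} {E : Fin 4 → E4 → E4} {h f r₁ r₂ l : E4 → ℝ} (hr : 0 < r)
    (H : IsNullFrameOn G (Metric.ball 0 r) ε E h f r₁ r₂ l)
    (hE : ∀ a, ∀ y ∈ Metric.ball (0 : E4) r, E a y = E a (projH y))
    (hh : ∀ y ∈ Metric.ball (0 : E4) r, h y = h₀)
    (hf : ∀ y ∈ Metric.ball (0 : E4) r, f y = f₀)
    (hl : ∀ y ∈ Metric.ball (0 : E4) r, l y = l₀) (hl₀ : l₀ ≠ 0)
    (hK : ∀ y ∈ Metric.ball (0 : E4) r,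
      fderiv ℝ r₂ y (E 0 y) - ε * fderiv ℝ r₁ y (E 1 y) - ε * r₁ y ^ 2 - r₂ y ^ 2 = Λ) :
    ∃ (U : Set E4) (Φ : E4 → E4) (μ ν c : ℝ) (P F : E2 → ℝ), IsOpen U ∧ 0 ∈ U ∧ μ ≠ 0 ∧ ν ≠ 0 ∧
      ContDiffOn ℝ ∞ Φ U ∧ Φ 0 = 0 ∧ IsLiouvillePair Λ ε (projT '' U) P F ∧
      ∀ y ∈ U, fderiv ℝ Φ y (EuclideanSpace.single 2 1) = μ • EuclideanSpace.single 2 1 ∧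
        fderiv ℝ Φ y (EuclideanSpace.single 3 1) = ν • EuclideanSpace.single 3 1 ∧
        ∀ u v, Coord.bilin (G (Φ y)) (fderiv ℝ Φ y u) (fderiv ℝ Φ y v) =
          Coord.bilin (normalMetric ε c P F y) u v := by
  obtain ⟨δ, hδ, x, p, q, P, F, sx, hx0, L, hx⟩ := H.exists_isothermal hr hf hl hK
  have hε := H.eps
  have hε0 : ε ≠ 0 := fun h0 => by simp [h0] at hε
  have hh₀ : h₀ ≠ 0 := hh 0 (Metric.mem_ball_self hr) ▸ H.h_ne 0 (Metric.mem_ball_self hr)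
  have hμ : ε * l₀ ≠ 0 := mul_ne_zero hε0 hl₀
  -- The scales of `z₁, z₂` are chosen so that the `E₂` term of `∂_{t₁}` has coefficient `μ F` and
  -- `g(∂_{z₁}, ∂_{z₂}) = μ ν h₀ = 1`. Then `g(∂_{z₁}, ∂_{z₁}) = 2 μ² f₀ h₀`, which is `-2c` for the
  -- value of `c` used below.
  set μ := ε * l₀ with hμd
  set ν := (μ * h₀)⁻¹ with hνd
  have hν : μ * ν * h₀ = 1 := by rw [hνd]; field_simp
  let A : E4 →L[ℝ] E4 := (EuclideanSpace.proj 2 : E4 →L[ℝ] ℝ).smulRight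
    (μ • (EuclideanSpace.single 2 1 : E4)) + (EuclideanSpace.proj 3 : E4 →L[ℝ] ℝ).smulRight
    (ν • (EuclideanSpace.single 3 1 : E4))
  have hA : ∀ v, A v = v 2 • μ • (EuclideanSpace.single 2 1 : E4) +
      v 3 • ν • (EuclideanSpace.single 3 1 : E4) := fun v => by simp [A]
  have hAH : ∀ v, projH (A v) = 0 := fun v => by
    rw [hA, map_add, map_smul, map_smul, map_smul, map_smul, projH_single.1, projH_single.2]
    simp
  have hopen : IsOpen (projT ⁻¹' Metric.ball (0 : E2) δ) := by
    have h1 : projT = projTL := funext fun y => (projTL_apply y).symm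
    rw [h1]
    exact Metric.isOpen_ball.preimage projTL.continuous
  have sΦ : ContDiffOn ℝ ∞ (fun y => x (projT y) + A y) (projT ⁻¹' Metric.ball (0 : E2) δ) :=
    (contDiffOn_comp_projT (sx.mono (image_preimage_subset _ _))).add A.contDiff.contDiffOn
  have hp0 : projT 0 = 0 := by rw [← projTL_apply, map_zero]
  refine ⟨projT ⁻¹' Metric.ball (0 : E2) δ ∩ (fun y => x (projT y) + A y) ⁻¹' Metric.ball 0 r,
    fun y => x (projT y) + A y, μ, ν, -(μ ^ 2 * f₀ * h₀), P, F,
    sΦ.continuousOn.isOpen_inter_preimage hopen Metric.isOpen_ball, ⟨?_, ?_⟩, hμ,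
    right_ne_zero_of_mul (left_ne_zero_of_mul (hν ▸ one_ne_zero)), sΦ.mono inter_subset_left, ?_,
    L.mono ?_, ?_⟩
  · rw [mem_preimage, hp0]
    exact Metric.mem_ball_self hδ
  · rw [mem_preimage, hp0, hx0, map_zero, add_zero]
    exact Metric.mem_ball_self hr
  · simp only [hp0, hx0, map_zero, add_zero]
  · rintro _ ⟨y, hy, rfl⟩
    exact hy.1
  intro y ⟨hy1, hy2⟩
  obtain ⟨hxr, hexp, hx1, hx2⟩ := hx _ hy1
  rw [mem_preimage] at hy2
  have hd := (hasFDerivAt_comp_projT ((sx.differentiableOn (by simp)).differentiableAt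
    (Metric.isOpen_ball.mem_nhds hy1))).fun_add A.hasFDerivAt
  -- Adding `A y` moves the point only along the leaf, and the frame does not change there.
  have hEx : ∀ a, E a (x (projT y)) = E a (x (projT y) + A y) := fun a => by
    rw [hE a _ hy2, hE a _ hxr, map_add, hAH, add_zero]
  have e2 : (EuclideanSpace.single 2 1 : E4) = E 2 (x (projT y) + A y) +
      (f₀ * h₀) • E 3 (x (projT y) + A y) := by
    rw [H.E₂, H.E₃]
    simp only [hf _ hy2, hh _ hy2, smul_smul]
    rw [mul_assoc, mul_inv_cancel₀ hh₀, mul_one, sub_add_cancel]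
  have e3 : (EuclideanSpace.single 3 1 : E4) = h₀ • E 3 (x (projT y) + A y) := by
    rw [H.E₃]
    simp only [hh _ hy2, smul_smul]
    rw [mul_inv_cancel₀ hh₀, one_smul]
  have hD : ∀ v : E4, fderiv ℝ (fun y => x (projT y) + A y) y v =
      (p (projT y) * v 0 - ε * q (projT y) * v 1) • E 0 (x (projT y) + A y) +
      (ε * q (projT y) * v 0 + ε * p (projT y) * v 1) • E 1 (x (projT y) + A y) +
      (μ * F (projT y) * v 0 + μ * v 2) • E 2 (x (projT y) + A y) +
      (μ * f₀ * h₀ * v 2 + ν * h₀ * v 3) • E 3 (x (projT y) + A y) := fun v => by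
    have h1 : projT v = v 0 • (EuclideanSpace.single 0 1 : E2) +
        v 1 • EuclideanSpace.single 1 1 := by
      refine PiLp.ext fun k => ?_
      fin_cases k <;> simp [projT]
    rw [hd.fderiv, _root_.add_apply, ContinuousLinearMap.comp_apply, projTL_apply, h1, map_add,
      map_smul, map_smul, hx1, hx2, hA, e2, e3, hEx 0, hEx 1, hEx 2]
    module
  refine ⟨?_, ?_, fun u v => ?_⟩
  · rw [hD, PiLp.single_apply, PiLp.single_apply, PiLp.single_apply, PiLp.single_apply]
    conv_rhs => rw [e2]
    simp
    module
  · rw [hD, PiLp.single_apply, PiLp.single_apply, PiLp.single_apply, PiLp.single_apply]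
    conv_rhs => rw [e3]
    simp
    module
  · rw [hD, hD]
    simp only [map_add, map_smul, _root_.add_apply, _root_.smul_apply, H.inner _ hy2,
      Coord.bilin_apply, normalMetric, hexp]
    simp [Fin.sum_univ_four]
    rcases mul_self_eq_one_iff.1 hε with h1 | h1 <;> simp only [h1] <;>
    linear_combination ((F (projT y)) * (u 0 * v 3 + u 3 * v 0) + u 2 * v 3 + u 3 * v 2) * hν

end Soliton

/-! ### The normal form of the solitons of the first case. -/

namespace Soliton

variable {M : Type*} [TopologicalSpace M] [ChartedSpace E4 M] [IsManifold (𝓡 4) ∞ M]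

omit [IsManifold (𝓡 4) ∞ M] in
theorem fieldInChart_smul (a : ℝ) (ξ : VField M) (φ : OpenPartialHomeomorph M E4) (y : E4) :
    fieldInChart (a • ξ) φ y = a • fieldInChart ξ φ y := by
  rw [fieldInChart_eq, fieldInChart_eq, Pi.smul_apply, map_smul]

omit [IsManifold (𝓡 4) ∞ M] in
theorem span_smul_pair {a b : ℝ} (ha : a ≠ 0) (hb : b ≠ 0) (ξ η : VField M) :
    Submodule.span ℝ {a • ξ, b • η} = Submodule.span ℝ {ξ, η} := by
  refine le_antisymm (Submodule.span_le.2 ?_) (Submodule.span_le.2 ?_)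
  · rintro _ (rfl | rfl)
    · exact Submodule.mem_span_pair.2 ⟨a, 0, by simp⟩
    · exact Submodule.mem_span_pair.2 ⟨0, b, by simp⟩
  · rintro _ (rfl | rfl)
    · exact Submodule.mem_span_pair.2 ⟨a⁻¹, 0, by simp [smul_smul, inv_mul_cancel₀ ha]⟩
    · exact Submodule.mem_span_pair.2 ⟨0, b⁻¹, by simp [smul_smul, inv_mul_cancel₀ hb]⟩

/-- Around every point there are adapted coordinates in which the metric has the normal form. -/
theorem IsCaseI.exists_normal_chart {g : PseudoMetric M} {𝒢 : Submodule ℝ (VField M)}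
    {X : VField M} {Λ : ℝ} (H : IsCaseI g 𝒢 X Λ) (p : M) :
    ∃ φ ∈ IsManifold.maximalAtlas (𝓡 4) ∞ M, p ∈ φ.source ∧ (∃ r > 0, φ.target = Metric.ball 0 r) ∧
      ∃ ξ η : VField M, 𝒢 = Submodule.span ℝ {ξ, η} ∧
      (∀ y ∈ φ.target, fieldInChart ξ φ y = EuclideanSpace.single 2 1 ∧
        fieldInChart η φ y = EuclideanSpace.single 3 1) ∧
      ∃ (ε c : ℝ) (P F : E2 → ℝ), (ε = 1 ∨ ε = -1) ∧
        IsLiouvillePair Λ ε (projT '' φ.target) P F ∧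
        ∀ y ∈ φ.target, g.inChart φ y = normalMetric ε c P F y := by
  obtain ⟨φ, hφ, hp, hp0, ξ, η, rfl, hf, r, hr, hsub, ε, E, h, f, r₁, r₂, l, hε, N, iE, hl, hX⟩ :=
    H.exists_nullFrame p
  have hS := N.soliton ((contDiffOn_fieldInChart H.soliton.1 hφ).mono hsub)
    (fun y hy => (H.tangent.inChart hφ hf (hsub hy)).1)
    (fun y hy => (H.tangent.inChart hφ hf (hsub hy)).2) hl hX
    (fun y hy u v => H.soliton.eq_inChart hφ (hsub hy) u v)
  have h0 : (0 : E4) ∈ Metric.ball (0 : E4) r := Metric.mem_ball_self hr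
  have hconst : ∀ {k : E4 → ℝ}, ContDiffOn ℝ ∞ k (Metric.ball 0 r) →
      (∀ y ∈ Metric.ball (0 : E4) r, fderiv ℝ k y = 0) →
      ∀ y ∈ Metric.ball (0 : E4) r, k y = k 0 := fun hk hd y hy =>
    Metric.isOpen_ball.is_const_of_fderiv_eq_zero (convex_ball (0 : E4) r).isPreconnected
      (hk.differentiableOn (by simp)) (fun z hz => hd z hz) hy h0
  obtain ⟨U, Φ, μ, ν, c, P, F, hU, hU0, hμ, hν, sΦ, hΦ0, L, hΦ⟩ := N.exists_normal_param hr iE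
    (hconst N.smooth_h fun y hy => (hS y hy).1) (hconst N.smooth_f fun y hy => (hS y hy).2.1)
    (hconst N.smooth_l fun y hy => (hS y hy).2.2.1) (hl 0 h0) fun y hy => (hS y hy).2.2.2.1
  -- The pull-back of the metric by `Φ` is the nondegenerate normal metric, so no vector can be
  -- annihilated.
  have hinj : Function.Injective (fderiv ℝ Φ 0) := by
    refine (injective_iff_map_eq_zero _).2 fun u hu => Coord.bilin_nondegenerate
      ((isMetricOn_normalMetric c N.eps L.smooth_P L.smooth_F).det 0 hU0) fun v => ?_
    rw [← (hΦ 0 hU0).2.2, hu, map_zero, _root_.zero_apply]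
  obtain ⟨φ', hφ', hp', -, r', hr', ht, hb⟩ := exists_chart_of_param g hφ hU isOpen_univ sΦ hU0
    (mem_univ _) hp (hΦ0.trans hp0.symm) hinj
  refine ⟨φ', hφ', hp', ⟨r', hr', ht⟩, μ • ξ, ν • η, (span_smul_pair hμ hν ξ η).symm,
    fun y hy => ?_, ε, c, P, F, hε, L.mono (image_mono fun y hy => (hb y (ht ▸ hy)).1),
    fun y hy => ?_⟩
  · obtain ⟨hyU, hyφ, -, hi, hX', -⟩ := hb y (ht ▸ hy)
    refine ⟨hi ?_, hi ?_⟩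
    · rw [hX', fieldInChart_smul, (hf _ hyφ).1, (hΦ y hyU).1]
    · rw [hX', fieldInChart_smul, (hf _ hyφ).2, (hΦ y hyU).2.1]
  · obtain ⟨hyU, -, -, -, -, hG⟩ := hb y (ht ▸ hy)
    ext i j
    rw [← Coord.bilin_single (g.inChart φ' y), hG, (hΦ y hyU).2.2, Coord.bilin_single]

/-- In normal coordinates the soliton field has the normal form. -/
theorem IsCaseI.exists_normalField {g : PseudoMetric M} {X ξ η : VField M}
    {Λ : ℝ} (H : IsCaseI g (Submodule.span ℝ {ξ, η}) X Λ) {φ : OpenPartialHomeomorph M E4}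
    (hφ : φ ∈ IsManifold.maximalAtlas (𝓡 4) ∞ M) {r : ℝ} (hr : 0 < r)
    (ht : φ.target = Metric.ball 0 r)
    (hf : ∀ y ∈ φ.target, fieldInChart ξ φ y = EuclideanSpace.single 2 1 ∧
      fieldInChart η φ y = EuclideanSpace.single 3 1) {ε c : ℝ} {P F : E2 → ℝ} (hε : ε * ε = 1)
    (L : IsLiouvillePair Λ ε (projT '' φ.target) P F)
    (hg : ∀ y ∈ φ.target, g.inChart φ y = normalMetric ε c P F y) :
    ∃ a₁ a₂ : ℝ, ∀ y ∈ φ.target, fieldInChart X φ y = normalField Λ ε c a₁ a₂ y := by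
  have N₀ := isNullFrameOn_normalFrame (c := c) φ.open_target hε L
  -- The frame of the normal form is now a null frame for the metric in the chart, so the soliton
  -- equation can be evaluated again, with `h = l = 1` and `f = -c`.
  have N := { N₀ with
    metric := g.isMetricOn hφ
    inner := fun y hy a b => by rw [hg y hy, N₀.inner y hy] }
  have sX := contDiffOn_fieldInChart H.soliton.1 hφ
  have tX := fun y hy => H.tangent.inChart hφ hf (y := y) hy
  have hE : ∀ y ∈ φ.target, ∀ a, a = 0 ∨ a = 1 →
      fderiv ℝ (fieldInChart X φ) y (normalFrame c P F a y) = 0 := fun y hy a ha => by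
    refine fderiv_fieldInChart_eq_zero H.soliton.1 H.tangent H.symmetry hφ hf φ.open_target
      Subset.rfl (N₀.smooth_E a) (fun z hz => ?_) hy ?_ ?_ ?_
    · rw [hg z hz]
      rcases ha with rfl | rfl <;>
        simp [Coord.bilin_apply, normalFrame, normalHorizontal, normalMetric, Fin.sum_univ_four]
      ring
    · rcases ha with rfl | rfl
      exacts [N₀.inv_E₀ y hy, N₀.inv_E₁ y hy]
    · rw [hg y hy]
      rfl
    · rw [hg y hy]
      exact one_ne_zero
  have hS := N.soliton sX (fun y hy => (tX y hy).1) (fun y hy => (tX y hy).2)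
    (fun _ _ => one_ne_zero) hE (fun y hy u v => H.soliton.eq_inChart hφ hy u v)
  have hD : ∀ y ∈ φ.target, fderiv ℝ (fieldInChart X φ) y = normalFieldL Λ ε c := by
    intro y hy
    obtain ⟨-, -, -, -, k2, k3⟩ := hS y hy
    have e0 := hE y hy 0 (.inl rfl)
    have e1 := hE y hy 1 (.inr rfl)
    have e2 := N.fderiv_E₂_eq_zero sX (fun _ _ => one_ne_zero) hE hy
    have d0 := IsNullFrameOn.fderiv_apply_eq_zero φ.open_target sX (fun z hz => (tX z hz).1) hy
    have d1 := IsNullFrameOn.fderiv_apply_eq_zero φ.open_target sX (fun z hz => (tX z hz).2) hy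
    have hexp := Real.exp_ne_zero (P (projT y))
    simp only [normalFrame, normalHorizontal, Matrix.cons_val, map_smul, map_sub, map_add,
      smul_eq_zero, hexp, false_or] at e0 e1 e2
    have e2' := sub_eq_zero.1 e2
    rw [e2', neg_smul, neg_add_cancel, smul_zero, sub_zero] at e0
    refine ContinuousLinearMap.ext fun v => ?_
    have hv : v = v 0 • (EuclideanSpace.single 0 1 : E4) + v 1 • EuclideanSpace.single 1 1 +
        v 2 • EuclideanSpace.single 2 1 + v 3 • EuclideanSpace.single 3 1 := by
      refine PiLp.ext fun k => ?_
      fin_cases k <;> simp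
    -- The derivative of `X` vanishes on `∂_{t₁}`, `∂_{t₂}` and `∂_{z₁} + c ∂_{z₂}`, so it is
    -- determined by its value on `∂_{z₂}`, which the soliton equation supplies.
    have hv' : fderiv ℝ (fieldInChart X φ) y v =
        (v 3 - c * v 2) • fderiv ℝ (fieldInChart X φ) y (EuclideanSpace.single 3 1) := by
      conv_lhs => rw [hv]
      rw [map_add, map_add, map_add, map_smul, map_smul, map_smul, map_smul, e0, e1, e2']
      module
    rw [hv', normalFieldL_apply]
    refine PiLp.ext fun k => ?_
    fin_cases k
    · simp [d0, normalField]
    · simp [d1, normalField]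
    · simp [k2, normalField]
      ring
    · have k3' : fderiv ℝ (fieldInChart X φ) y (EuclideanSpace.single 3 1) 3 =
          2 * Λ - ε * c / 2 := by linear_combination k3 + c * k2
      simp [k3', normalField]
      ring
  have h0 : (0 : E4) ∈ φ.target := ht ▸ Metric.mem_ball_self hr
  -- The field has a constant derivative on a ball; `a₁, a₂` are its vertical components at the
  -- origin.
  refine ⟨fieldInChart X φ 0 2, fieldInChart X φ 0 3, fun y hy => ?_⟩
  refine φ.open_target.eqOn_of_fderiv_eq (ht ▸ (convex_ball (0 : E4) r).isPreconnected)
    (sX.differentiableOn (by simp))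
    ((contDiff_normalField Λ ε c _ _).differentiable (by simp)).differentiableOn
    (fun z hz => by rw [hD z hz, fderiv_normalField]) h0 ?_ hy
  refine PiLp.ext fun k => ?_
  fin_cases k <;> simp [normalField, tX 0 h0]

theorem IsCaseI.exists_hasNormalForm {g : PseudoMetric M} {𝒢 : Submodule ℝ (VField M)}
    {X : VField M} {Λ : ℝ} (H : IsCaseI g 𝒢 X Λ) (p : M) :
    ∃ φ ∈ IsManifold.maximalAtlas (𝓡 4) ∞ M, p ∈ φ.source ∧
      ∃ (ε c a₁ a₂ : ℝ) (P F : E2 → ℝ), (ε = 1 ∨ ε = -1) ∧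
        HasNormalForm g 𝒢 X φ Λ ε c a₁ a₂ P F := by
  obtain ⟨φ, hφ, hp, ⟨r, hr, ht⟩, ξ, η, rfl, hf, ε, c, P, F, hε, L, hg⟩ := H.exists_normal_chart p
  have hε' : ε * ε = 1 := by rcases hε with h | h <;> simp [h]
  obtain ⟨a₁, a₂, hX⟩ := H.exists_normalField hφ hr ht hf hε' L hg
  exact ⟨φ, hφ, hp, ε, c, a₁, a₂, P, F, hε, ⟨ξ, η, rfl, hf⟩, L, hg, hX,
    fun y hy => by rw [hg y hy, orbitMetric_normalMetric],
    fun t ht => gaussCurvature_conformalMetric (isOpen_image_projT φ.open_target) hε' L ht⟩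

end Soliton

end

theorem mainTheorem1 :
    -- every soliton of the first case is locally of the normal form
    (∀ (M : Type*) [TopologicalSpace M] [ChartedSpace E4 M] [IsManifold (𝓡 4) ∞ M]
      (g : Soliton.PseudoMetric M) (𝒢 : Submodule ℝ (Soliton.VField M)) (X : Soliton.VField M)
      (Λ : ℝ), Soliton.IsCaseI g 𝒢 X Λ →
      ∀ p : M, ∃ φ ∈ IsManifold.maximalAtlas (𝓡 4) ∞ M, p ∈ φ.source ∧
        ∃ (ε c a₁ a₂ : ℝ) (P F : E2 → ℝ), (ε = 1 ∨ ε = -1) ∧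
          Soliton.HasNormalForm g 𝒢 X φ Λ ε c a₁ a₂ P F) ∧
    -- the constants and the solution of the Liouville equation are arbitrary
    (∀ (U : TopologicalSpace.Opens E4) (Λ ε c a₁ a₂ : ℝ) (P F : E2 → ℝ),
      (U : Set E4).Nonempty → (ε = 1 ∨ ε = -1) →
      Soliton.IsLiouvillePair Λ ε (Soliton.projT '' (U : Set E4)) P F →
      ∃ (g : Soliton.PseudoMetric U) (𝒢 : Submodule ℝ (Soliton.VField U)) (X : Soliton.VField U),
        Soliton.IsCaseI g 𝒢 X Λ ∧
        ∃ φ ∈ IsManifold.maximalAtlas (𝓡 4) ∞ U,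
          φ.source = Set.univ ∧ φ.target = (U : Set E4) ∧ (∀ x : U, φ x = (x : E4)) ∧
          Soliton.HasNormalForm g 𝒢 X φ Λ ε c a₁ a₂ P F) ∧
    -- every value of `Λ` (negative, zero or positive) and every sign `ε` occurs
    (∀ Λ ε : ℝ, (ε = 1 ∨ ε = -1) →
      ∃ (U : TopologicalSpace.Opens E4) (g : Soliton.PseudoMetric U)
        (𝒢 : Submodule ℝ (Soliton.VField U)) (X : Soliton.VField U)
        (φ : OpenPartialHomeomorph U E4) (c a₁ a₂ : ℝ) (P F : E2 → ℝ),
        (U : Set E4).Nonempty ∧ Soliton.IsCaseI g 𝒢 X Λ ∧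
        φ ∈ IsManifold.maximalAtlas (𝓡 4) ∞ U ∧ φ.source = Set.univ ∧
        Soliton.HasNormalForm g 𝒢 X φ Λ ε c a₁ a₂ P F) := by
  refine ⟨fun M _ _ _ g 𝒢 X Λ H p => H.exists_hasNormalForm p,
    fun U Λ ε c a₁ a₂ P F hU hε L => Soliton.exists_normal_soliton U Λ ε c a₁ a₂ P F hU hε L,
    fun Λ ε hε => ?_⟩
  obtain ⟨U, P, F, hU, L⟩ := Soliton.exists_liouvillePair Λ ε
  obtain ⟨g, 𝒢, X, H, φ, hφ, hs, -, -, hn⟩ :=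
    Soliton.exists_normal_soliton U Λ ε 0 0 0 P F hU hε L
  exact ⟨U, g, 𝒢, X, φ, 0, 0, 0, P, F, hU, H, hφ, hs, hn⟩
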